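/- **Setting.** Let $d\in\{2,3\}$, $T>0$, $\nu>0$, $\lambda\ge 0$. Let $\Omega$ be either the flat torus $\mathcal T^d=([-1,1]|_{\{-1,1\}})^d$ (periodic case; then $\partial\Omega=\emptyset$, $\overline\Omega=\Omega$) or a bounded domain in $\mathbb R^d$ (Dirichlet case). Let $p\in C[0,\infty)\cap C^\infty(0,\infty)$ satisfy $p'(\varrho)>0$ for $\varrho>0$ and $\liminf_{\varrho\to\infty}p'(\varrho)>0$, and let $P\in C[0,\infty)$ be a pressure potential, differentiable on $(0,\infty)$ with $P'(\varrho)\varrho-P(\varrho)=p(\varrho)$, such that $p\le a(1+P)$ on $[0,\infty)$ for some $a>0$. Let $F(c)=(c+1)^2$ for $c\le-1$, $F(c)=\frac14(c^2-1)^2$ for $-1\le c\le 1$, $F(c)=(c-1)^2$ for $c>1$, let $W(c)=F(c)-c^2$, and let $\mathbb S(A)=\nu\,(A+A^t-\frac2d\,\mathrm{tr}A\,\mathbb I)+\lambda\,\mathrm{tr}A\,\mathbb I$. For a vector field $v$, $(\nabla_x v)_{ij}=\partial_jv_i$. **Dissipative weak solutions.** Let the initial data $\varrho_0\ge0$, $(\varrho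 u)_0$, $c_0$ have finite energy: $P(\varrho_0)\in L^1(\Omega)$, $(\varrho u)_0=0$ a.e. where $\varrho_0=0$, $|(\varrho u)_0|^2/\varrho_0\in L^1(\Omega)$ (with $0/0=0$), $c_0\in W^{1,2}(\Omega)$. A trio $(\varrho,u,c)$ is a dissipative weak solution of the Navier--Stokes--Allen--Cahn system with these data if $\varrho\ge0$ a.e. in $(0,T)\times\Omega$; $\sqrt\varrho u\in L^\infty(0,T;L^2)$, $P(\varrho)\in L^\infty(0,T;L^1)$, $u\in L^2(0,T;W^{1,2})$, $c\in L^\infty(0,T;W^{1,2})\cap L^2(0,T;W^{2,2})$, and in the Dirichlet case $u(t)\in W^{1,2}_0$, $c(t)\in W^{1,2}_0$ for a.a. $t$; and if, with $\mu=\Delta_xc-F'(c)$, there are $\mathfrak R\in L^\infty(0,T;\mathcal M(\Omega;\mathbb R^{d\times d}_{\rm sym}))$ and $\mathfrak E\in L^\infty(0,T;\mathcal M^+(\overline\Omega))$ such that * for all $\varphi\in C^1_c([0,T)\times\overline\Omega)$: $\int_0^T\!\int_\Omega[\varrho\,\partial_t\varphi+\varrho u\cdot\nabla_x\varphi]\,dx\,dt=-\int_\Omega\varrho_0\varphi(0,\cdot)\,dx$;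 * for all $\phi\in C^1_c([0,T)\times\Omega;\mathbb R^d)$: $\int_0^T\!\int_\Omega[\varrho u\cdot\partial_t\phi+\varrho u\otimes u:\nabla_x\phi+p(\varrho)\,\mathrm{div}_x\phi]\,dx\,dt=\int_0^T\!\int_\Omega[\mathbb S(\nabla_xu):\nabla_x\phi+\mu\nabla_xc\cdot\phi]\,dx\,dt-\int_\Omega(\varrho u)_0\cdot\phi(0,\cdot)\,dx+\int_0^T\!\int_\Omega\nabla_x\phi:d\mathfrak R(t)\,dt$; * for all $\varphi\in C^1_c([0,T)\times\Omega)$: $\int_0^T\!\int_\Omega[c\,\partial_t\varphi-u\cdot\nabla_xc\,\varphi]\,dx\,dt=-\int_0^T\!\int_\Omega\mu\varphi\,dx\,dt-\int_\Omega c_0\varphi(0,\cdot)\,dx$; * for a.a. $\tau\in(0,T)$: $\int_\Omega[\frac12\varrho|u|^2+\frac12|\nabla_xc|^2+P(\varrho)+F(c)](\tau)\,dx+\int_0^\tau\!\int_\Omega[\mathbb S(\nabla_xu):\nabla_xu+\mu^2]\,dx\,dt+\int_{\overline\Omega}d\mathfrak E(\tau)\le\int_\Omega\big[\frac12\frac{|(\varrho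 u)_0|^2}{\varrho_0}+\frac12|\nabla_xc_0|^2+P(\varrho_0)+F(c_0)\big]dx$; * there is $\Lambda>0$ such that $\Lambda\,\mathfrak E(\tau)\,\mathbb I\pm\mathfrak R(\tau)\ge0$ on $\Omega$ for a.a. $\tau\in(0,T)$, i.e. $\int_\Omega\phi\,\xi\otimes\xi:d(\Lambda\mathfrak E(\tau)\mathbb I\pm\mathfrak R(\tau))\ge0$ for all $0\le\phi\in C_c(\Omega)$, $\xi\in\mathbb R^d$. **Theorem (relative energy inequality).** Let $(\varrho,u,c)$ be a dissipative weak solution with defect measures $\mathfrak R$, $\mathfrak E$. Let $R\in C^1([0,T]\times\overline\Omega)$ with $R>0$ on $[0,T]\times\overline\Omega$, let $U\in C^1([0,T]\times\overline\Omega;\mathbb R^d)$, and let $C,\nabla_xC,\Delta_xC\in C^1([0,T]\times\overline\Omega)$; in the Dirichlet case let moreover $U|_{\partial\Omega}=0$ and $C|_{\partial\Omega}=0$. (Here $C^1([0,T]\times\overline\Omega)$ means $C^1$ with derivatives that extend continuously to $[0,T]\times\overline\Omega$.) Define the relative energy $$\mathcal E(\varrho,u,c\,|\,R,U,C)=\int_\Omega\Big[\tfrac12\varrho|u-U|^2+(c-C)^2+\tfrac12|\nabla_xc-\nabla_xC|^2+P(\varrho)-P'(R)(\varrho-R)-P(R)\Big]dx,$$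 evaluated at $t=0$ with $\varrho_0$, $u_0=(\varrho u)_0/\varrho_0$ (zero where $\varrho_0=0$), $c_0$. Then all the integrals below converge, and for a.a. $\tau\in(0,T)$ $$\begin{aligned} &\big[\mathcal E(\varrho,u,c\,|\,R,U,C)\big]_{t=0}^{t=\tau}+\int_0^\tau\!\!\int_\Omega\big[\mathbb S(\nabla_xu-\nabla_xU):(\nabla_xu-\nabla_xU)+\mu^2\big]dx\,dt+\int_{\overline\Omega}d\mathfrak E(\tau)\\ &\le-\int_0^\tau\!\!\int_\Omega\mu(\Delta_xc-\mu-2c)\,dx\,dt-\int_0^\tau\!\!\int_\Omega(\mathrm{div}_xu-\mathrm{div}_xU)W(c)\,dx\,dt\\ &\quad+\int_0^\tau\!\!\int_\Omega\varrho(U-u)\cdot\partial_tU\,dx\,dt+\int_0^\tau\!\!\int_\Omega(R-\varrho)\,\partial_tP'(R)\,dx\,dt-\int_0^\tau\!\!\int_\Omega\varrho u\cdot\nabla_xP'(R)\,dx\,dt\\ &\quad+\int_0^\tau\!\!\int_\Omega\varrho\,\textstyle\sum_{i,j}(U-u)_i\,u_j\,\partial_jU_i\,dx\,dt-\int_0^\tau\!\!\int_\Omega(p(\varrho)-c^2)\,\mathrm{div}_xU\,dx\,dt\\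 &\quad-\int_0^\tau\!\!\int_\Omega\big(\nabla_xc\otimes\nabla_xc-\tfrac12|\nabla_xc|^2\mathbb I\big):\nabla_xU\,dx\,dt+\int_0^\tau\!\!\int_\Omega\nabla_xU:d\mathfrak R(t)\,dt\\ &\quad+\int_0^\tau\!\!\int_\Omega(\mu-u\cdot\nabla_xc)(\Delta_xC-2C)\,dx\,dt+\int_0^\tau\!\!\int_\Omega(c-C)\,(\partial_t\Delta_xC-2\,\partial_tC)\,dx\,dt\\ &\quad-\int_0^\tau\!\!\int_\Omega\mathbb S(\nabla_xU):(\nabla_xu-\nabla_xU)\,dx\,dt . \end{aligned}$$ -/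

import Mathlib

open MeasureTheory Set Filter Topology
open scoped ContDiff ENNReal

noncomputable section

namespace NSAC

/-- The physical space `ℝ^d` with its Euclidean structure. -/
abbrev Space (d : ℕ) := EuclideanSpace ℝ (Fin d)

/-- Real `d × d` matrices; the gradient of a vector field `v` is the matrix `(∂_j v_i)_{ij}`. -/
abbrev Mat (d : ℕ) := Matrix (Fin d) (Fin d) ℝ

/-! ### The physical domain and its boundary conditions -/

/-- The physical domain together with the boundary conditions: either the flat torus
`([-1,1]|_{-1,1})^d` (periodic boundary conditions), or a domain `Ω ⊆ ℝ^d` (homogeneous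
Dirichlet conditions). Functions on the torus are represented by functions on the half-open
cube `[-1,1)^d` and continuous or smooth functions on the torus by functions on `ℝ^d` that are
2-periodic in every coordinate. -/
inductive FluidDomain (d : ℕ) where
  | torus : FluidDomain d
  | dirichlet (Ω : Set (Space d)) : FluidDomain d

namespace FluidDomain

variable {d : ℕ}

/-- In the Dirichlet case, `Ω` is a bounded domain (open, connected, non-empty). -/
def IsAdmissible : FluidDomain d → Prop
  | torus => True
  | dirichlet Ω => IsOpen Ω ∧ IsConnected Ω ∧ Bornology.IsBounded Ω

/-- The set over which one integrates: the half-open cube, or `Ω`. -/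
def cell : FluidDomain d → Set (Space d)
  | torus => {x | ∀ i, x i ∈ Ico (-1 : ℝ) 1}
  | dirichlet Ω => Ω

/-- A set of representatives of the closure of the physical domain (the torus is compact). -/
def closedCell : FluidDomain d → Set (Space d)
  | torus => {x | ∀ i, x i ∈ Ico (-1 : ℝ) 1}
  | dirichlet Ω => closure Ω

/-- The open set on which smooth functions live: all of `ℝ^d` for (periodic) functions on the
torus, `Ω` in the Dirichlet case. -/
def space : FluidDomain d → Set (Space d)
  | torus => univ
  | dirichlet Ω => Ω

/-- The boundary of the physical domain (the torus has none). -/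
def bdry : FluidDomain d → Set (Space d)
  | torus => ∅
  | dirichlet Ω => frontier Ω

/-- On the torus, functions are 2-periodic in every coordinate. -/
def PeriodicOn {X : Type*} : FluidDomain d → (Space d → X) → Prop
  | torus, f => ∀ x i, f (x + EuclideanSpace.single i 2) = f x
  | dirichlet _, _ => True

/-- Vanishing outside a compact subset of the physical domain (no condition on the torus). -/
def CompactSupp : FluidDomain d → (Space d → ℝ) → Prop
  | torus, _ => True
  | dirichlet Ω, φ => HasCompactSupport φ ∧ tsupport φ ⊆ Ω

/-- Smooth test functions: `C_c^∞(Ω)`, respectively `C^∞` of the torus. -/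
def SmoothTest (D : FluidDomain d) (φ : Space d → ℝ) : Prop :=
  ContDiff ℝ ∞ φ ∧ D.PeriodicOn φ ∧ D.CompactSupp φ

/-- Continuous test functions: `C_c(Ω)`, respectively `C` of the torus. -/
def ContTest (D : FluidDomain d) (φ : Space d → ℝ) : Prop :=
  Continuous φ ∧ D.PeriodicOn φ ∧ D.CompactSupp φ

/-- `f ∈ C^1([0,T] × closure Ω)`: `f` is continuous up to the boundary, it is differentiable in
time and in space, and its derivatives extend continuously to `[0,T] × closure Ω`. On the torus
`f` is moreover periodic in space. -/
def IsC1 (D : FluidDomain d) (T : ℝ) {X : Type*} [NormedAddCommGroup X] [NormedSpace ℝ X]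
    (f : ℝ → Space d → X) : Prop :=
  (∀ t ∈ Icc 0 T, D.PeriodicOn (f t)) ∧
  ContinuousOn (fun z : ℝ × Space d => f z.1 z.2) (Icc 0 T ×ˢ closure D.space) ∧
  ∃ (ft : ℝ → Space d → X) (fx : ℝ → Space d → (Space d →L[ℝ] X)),
    ContinuousOn (fun z : ℝ × Space d => ft z.1 z.2) (Icc 0 T ×ˢ closure D.space) ∧
    ContinuousOn (fun z : ℝ × Space d => fx z.1 z.2) (Icc 0 T ×ˢ closure D.space) ∧
    ∀ t ∈ Icc 0 T, ∀ x ∈ D.space,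
      HasDerivWithinAt (fun s => f s x) (ft t x) (Icc 0 T) t ∧ HasFDerivAt (f t) (fx t x) x

/-- `f`, defined on `[0,T] × Ω`, belongs to `C^1([0,T] × closure Ω)` (after extension by
continuity to the boundary). -/
def ExtendsToC1 (D : FluidDomain d) (T : ℝ) {X : Type*} [NormedAddCommGroup X] [NormedSpace ℝ X]
    (f : ℝ → Space d → X) : Prop :=
  ∃ g : ℝ → Space d → X, D.IsC1 T g ∧ ∀ t ∈ Icc 0 T, ∀ x ∈ D.space, g t x = f t x

/-- `φ ∈ C^1_c([0,T) × closure Ω)`. -/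
def IsTestClosed (D : FluidDomain d) (T : ℝ) {X : Type*} [NormedAddCommGroup X]
    [NormedSpace ℝ X] (φ : ℝ → Space d → X) : Prop :=
  D.IsC1 T φ ∧ ∃ t₀ < T, ∀ t ∈ Icc 0 T, t₀ ≤ t → ∀ x ∈ closure D.space, φ t x = 0

/-- `φ ∈ C^1_c([0,T) × Ω)`; on the torus this is the same as `IsTestClosed`. -/
def IsTest (D : FluidDomain d) (T : ℝ) {X : Type*} [NormedAddCommGroup X]
    [NormedSpace ℝ X] (φ : ℝ → Space d → X) : Prop :=
  D.IsTestClosed T φ ∧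
  ∀ Ω, D = dirichlet Ω →
    ∃ K ⊆ Ω, IsCompact K ∧ ∀ t ∈ Icc 0 T, ∀ x ∈ closure Ω \ K, φ t x = 0

/-! ### Weak derivatives and function spaces -/

/-- `g` is the weak partial derivative `∂_i f` on the physical domain. -/
def IsWeakPartial (D : FluidDomain d) (i : Fin d) (f g : Space d → ℝ) : Prop :=
  ∀ φ : Space d → ℝ, D.SmoothTest φ →
    ∫ x in D.cell, f x * fderiv ℝ φ x (EuclideanSpace.single i 1) = - ∫ x in D.cell, g x * φ x

/-- `f`, with weak gradient `g`, lies in `W^{1,2}_0`, the closure of the smooth test functions in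
`W^{1,2}`. -/
def IsW012 (D : FluidDomain d) (f : Space d → ℝ) (g : Fin d → Space d → ℝ) : Prop :=
  ∀ ε : ℝ≥0∞, 0 < ε → ∃ φ : Space d → ℝ, D.SmoothTest φ ∧
    eLpNorm (fun x => f x - φ x) 2 (volume.restrict D.cell) < ε ∧
    ∀ i, eLpNorm (fun x => g i x - fderiv ℝ φ x (EuclideanSpace.single i 1)) 2
      (volume.restrict D.cell) < ε

/-- `f ∈ L^q(0,T; L^r(Ω))`. -/
def MemLL (D : FluidDomain d) (T : ℝ) (q r : ℝ≥0∞) {X : Type*} [NormedAddCommGroup X]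
    (f : ℝ → Space d → X) : Prop :=
  AEStronglyMeasurable (fun z : ℝ × Space d => f z.1 z.2) (volume.restrict (Ioo 0 T ×ˢ D.cell)) ∧
  (∀ᵐ t ∂(volume.restrict (Ioo 0 T)), MemLp (f t) r (volume.restrict D.cell)) ∧
  MemLp (fun t => (eLpNorm (f t) r (volume.restrict D.cell)).toReal) q (volume.restrict (Ioo 0 T))

end FluidDomain

/-! ### Constitutive relations -/

/-- `p` is an admissible pressure law and `P` is a pressure potential associated with it. -/
structure IsPressureLaw (p P : ℝ → ℝ) : Prop where
  continuousOn : ContinuousOn p (Ici 0)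
  smooth : ContDiffOn ℝ ∞ p (Ioi 0)
  deriv_pos : ∀ r, 0 < r → 0 < deriv p r
  liminf_pos : 0 < liminf (fun r => ((deriv p r : ℝ) : EReal)) atTop
  potential_continuousOn : ContinuousOn P (Ici 0)
  potential_differentiableAt : ∀ r, 0 < r → DifferentiableAt ℝ P r
  potential_eq : ∀ r, 0 < r → deriv P r * r - P r = p r
  le_potential : ∃ a : ℝ, 0 < a ∧ ∀ r, 0 ≤ r → p r ≤ a * (1 + P r)

/-- The Ginzburg--Landau potential `F`. -/
def glF (c : ℝ) : ℝ :=
  if c ≤ -1 then (c + 1) ^ 2 else if c ≤ 1 then (c ^ 2 - 1) ^ 2 / 4 else (c - 1) ^ 2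

/-- `W(c) = F(c) - c^2`. -/
def glW (c : ℝ) : ℝ := glF c - c ^ 2

variable {d : ℕ}

/-- The product `A : B` of matrices. -/
def ddot (A B : Mat d) : ℝ := ∑ i, ∑ j, A i j * B i j

/-- The tensor product `a ⊗ b` of vectors. -/
def otimes (a b : Space d) : Mat d := Matrix.of fun i j => a i * b j

/-- The viscous stress `𝕊(A) = ν (A + Aᵗ - (2/d) tr A 𝕀) + λ tr A 𝕀`. -/
def stress (ν lam : ℝ) (A : Mat d) : Mat d :=
  ν • (A + A.transpose - (2 / (d : ℝ) * A.trace) • (1 : Mat d)) + (lam * A.trace) • (1 : Mat d)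

/-- `∇c ⊗ ∇c - (1/2) |∇c|^2 𝕀` as a function of `a = ∇c`. -/
def korteweg (a : Space d) : Mat d := otimes a a - (‖a‖ ^ 2 / 2) • (1 : Mat d)

/-- The classical gradient `(∂_j V_i)_{ij}` of a vector field. -/
def jac (V : Space d → Space d) (x : Space d) : Mat d :=
  Matrix.of fun i j => fderiv ℝ V x (EuclideanSpace.single j 1) i

/-- The integral `∫ M : d𝓡` of a matrix-valued function against a matrix-valued measure. -/
def matIntegral (M : Space d → Mat d) (𝓡 : Fin d → Fin d → SignedMeasure (Space d)) : ℝ :=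
  ∑ i, ∑ j, ∫ᵛ x, M x i j ∂•(𝓡 i j)

/-! ### Dissipative weak solutions -/

/-- Initial data `ρ_0`, `m_0 = (ρu)_0`, `c_0`, and the weak gradient of `c_0`. -/
structure InitialData (d : ℕ) where
  ρ : Space d → ℝ
  m : Space d → Space d
  c : Space d → ℝ
  Dc : Space d → Space d

/-- The initial data have finite energy. The kinetic energy density `|m_0|^2 / ρ_0` is understood
to be `0` where `ρ_0 = 0`, `m_0 = 0` and `+∞` where `ρ_0 = 0`, `m_0 ≠ 0`. -/
structure InitialData.FiniteEnergy (I : InitialData d) (D : FluidDomain d) (P : ℝ → ℝ) :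
    Prop where
  ρ_meas : AEStronglyMeasurable I.ρ (volume.restrict D.cell)
  ρ_nonneg : ∀ᵐ x ∂(volume.restrict D.cell), 0 ≤ I.ρ x
  m_meas : AEStronglyMeasurable I.m (volume.restrict D.cell)
  m_vacuum : ∀ᵐ x ∂(volume.restrict D.cell), I.ρ x = 0 → I.m x = 0
  kinetic : IntegrableOn (fun x => ‖I.m x‖ ^ 2 / I.ρ x) D.cell
  internal : IntegrableOn (fun x => P (I.ρ x)) D.cell
  c_mem : MemLp I.c 2 (volume.restrict D.cell)
  Dc_mem : MemLp I.Dc 2 (volume.restrict D.cell)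
  Dc_weak : ∀ i, D.IsWeakPartial i I.c (fun x => I.Dc x i)

/-- The initial velocity `m_0 / ρ_0` (zero on the vacuum set). -/
def InitialData.u (I : InitialData d) (x : Space d) : Space d := (I.ρ x)⁻¹ • I.m x

/-- The unknowns: density, velocity and concentration difference, the weak derivatives
`∇u`, `∇c`, `∇²c` (which are determined by `u` and `c` up to null sets), and the two defect
measures. -/
structure Flow (d : ℕ) where
  ρ : ℝ → Space d → ℝ
  u : ℝ → Space d → Space d
  c : ℝ → Space d → ℝ
  Du : ℝ → Space d → Mat d
  Dc : ℝ → Space d → Space d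
  D2c : ℝ → Space d → Mat d
  𝓔 : ℝ → Measure (Space d)
  𝓡 : ℝ → Fin d → Fin d → SignedMeasure (Space d)

/-- `Δc`. -/
def Flow.lapc (s : Flow d) (t : ℝ) (x : Space d) : ℝ := (s.D2c t x).trace

/-- `div u`. -/
def Flow.divu (s : Flow d) (t : ℝ) (x : Space d) : ℝ := (s.Du t x).trace

/-- `μ = Δc - F'(c)`. -/
def Flow.μ (s : Flow d) (t : ℝ) (x : Space d) : ℝ := s.lapc t x - deriv glF (s.c t x)

/-- Dissipative weak solutions on `(0,T) × Ω`. -/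
structure IsDissipativeWeakSolution (D : FluidDomain d) (T ν lam : ℝ) (p P : ℝ → ℝ)
    (I : InitialData d) (s : Flow d) : Prop where
  -- regularity
  ρ_meas : AEStronglyMeasurable (fun z : ℝ × Space d => s.ρ z.1 z.2)
    (volume.restrict (Ioo 0 T ×ˢ D.cell))
  ρ_nonneg : ∀ᵐ z : ℝ × Space d ∂(volume.restrict (Ioo 0 T ×ˢ D.cell)), 0 ≤ s.ρ z.1 z.2
  momentum_mem : D.MemLL T ∞ 2 (fun t x => Real.sqrt (s.ρ t x) • s.u t x)
  potential_mem : D.MemLL T ∞ 1 (fun t x => P (s.ρ t x))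
  u_mem : D.MemLL T 2 2 s.u
  Du_mem : ∀ i j, D.MemLL T 2 2 (fun t x => s.Du t x i j)
  Du_weak : ∀ᵐ t ∂(volume.restrict (Ioo 0 T)), ∀ i j,
    D.IsWeakPartial j (fun x => s.u t x i) (fun x => s.Du t x i j)
  c_mem : D.MemLL T ∞ 2 s.c
  Dc_mem : D.MemLL T ∞ 2 s.Dc
  Dc_weak : ∀ᵐ t ∂(volume.restrict (Ioo 0 T)), ∀ i,
    D.IsWeakPartial i (s.c t) (fun x => s.Dc t x i)
  D2c_mem : ∀ i j, D.MemLL T 2 2 (fun t x => s.D2c t x i j)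
  D2c_weak : ∀ᵐ t ∂(volume.restrict (Ioo 0 T)), ∀ i j,
    D.IsWeakPartial j (fun x => s.Dc t x i) (fun x => s.D2c t x i j)
  -- Dirichlet boundary conditions
  u_dirichlet : ∀ Ω, D = .dirichlet Ω → ∀ᵐ t ∂(volume.restrict (Ioo 0 T)), ∀ i,
    D.IsW012 (fun x => s.u t x i) (fun j x => s.Du t x i j)
  c_dirichlet : ∀ Ω, D = .dirichlet Ω → ∀ᵐ t ∂(volume.restrict (Ioo 0 T)),
    D.IsW012 (s.c t) (fun i x => s.Dc t x i)
  -- the energy defect is in `L^∞(0,T; 𝓜⁺(closure Ω))`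
  𝓔_bdd : ∃ M : ℝ, ∀ᵐ t ∂(volume.restrict (Ioo 0 T)), s.𝓔 t univ ≤ ENNReal.ofReal M
  𝓔_supp : ∀ᵐ t ∂(volume.restrict (Ioo 0 T)), s.𝓔 t D.closedCellᶜ = 0
  𝓔_meas : ∀ φ : Space d → ℝ, Continuous φ → D.PeriodicOn φ →
    AEMeasurable (fun t => ∫ x in D.closedCell, φ x ∂(s.𝓔 t)) (volume.restrict (Ioo 0 T))
  -- the momentum defect is in `L^∞(0,T; 𝓜(Ω; ℝ^{d×d}_sym))`
  𝓡_bdd : ∃ M : ℝ, ∀ᵐ t ∂(volume.restrict (Ioo 0 T)), ∀ i j,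
    (s.𝓡 t i j).variation univ ≤ ENNReal.ofReal M
  𝓡_supp : ∀ᵐ t ∂(volume.restrict (Ioo 0 T)), ∀ i j, (s.𝓡 t i j).variation D.cellᶜ = 0
  𝓡_symm : ∀ᵐ t ∂(volume.restrict (Ioo 0 T)), ∀ i j, s.𝓡 t i j = s.𝓡 t j i
  𝓡_meas : ∀ φ : Space d → ℝ, D.ContTest φ → ∀ i j,
    AEMeasurable (fun t => ∫ᵛ x, φ x ∂•(s.𝓡 t i j)) (volume.restrict (Ioo 0 T))
  -- equation of continuity
  continuity : ∀ φ : ℝ → Space d → ℝ, D.IsTestClosed T φ →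
    ∫ t in (0)..T, ∫ x in D.cell,
        (s.ρ t x * deriv (fun r => φ r x) t + s.ρ t x * inner ℝ (s.u t x) (gradient (φ t) x))
      = - ∫ x in D.cell, I.ρ x * φ 0 x
  -- momentum equation
  momentum : ∀ φ : ℝ → Space d → Space d, D.IsTest T φ →
    ∫ t in (0)..T, ∫ x in D.cell,
        (s.ρ t x * inner ℝ (s.u t x) (deriv (fun r => φ r x) t)
          + ddot (s.ρ t x • otimes (s.u t x) (s.u t x)) (jac (φ t) x)
          + p (s.ρ t x) * (jac (φ t) x).trace)
      = (∫ t in (0)..T, ∫ x in D.cell,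
          (ddot (stress ν lam (s.Du t x)) (jac (φ t) x)
            + s.μ t x * inner ℝ (s.Dc t x) (φ t x)))
        - (∫ x in D.cell, inner ℝ (I.m x) (φ 0 x))
        + ∫ t in (0)..T, matIntegral (jac (φ t)) (s.𝓡 t)
  -- Allen--Cahn equation
  allenCahn : ∀ φ : ℝ → Space d → ℝ, D.IsTest T φ →
    ∫ t in (0)..T, ∫ x in D.cell,
        (s.c t x * deriv (fun r => φ r x) t - inner ℝ (s.u t x) (s.Dc t x) * φ t x)
      = - (∫ t in (0)..T, ∫ x in D.cell, s.μ t x * φ t x) - ∫ x in D.cell, I.c x * φ 0 x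
  -- energy balance
  energy : ∀ᵐ τ ∂(volume.restrict (Ioo 0 T)),
    (∫ x in D.cell, (s.ρ τ x * ‖s.u τ x‖ ^ 2 / 2 + ‖s.Dc τ x‖ ^ 2 / 2 + P (s.ρ τ x)
        + glF (s.c τ x)))
      + (∫ t in (0)..τ, ∫ x in D.cell,
          (ddot (stress ν lam (s.Du t x)) (s.Du t x) + s.μ t x ^ 2))
      + (s.𝓔 τ).real D.closedCell
    ≤ ∫ x in D.cell, (‖I.m x‖ ^ 2 / I.ρ x / 2 + ‖I.Dc x‖ ^ 2 / 2 + P (I.ρ x) + glF (I.c x))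
  -- compatibility of the defects: `Λ 𝓔 𝕀 ± 𝓡 ≥ 0`
  compatibility : ∃ Λ : ℝ, 0 < Λ ∧ ∀ᵐ τ ∂(volume.restrict (Ioo 0 T)),
    ∀ φ : Space d → ℝ, D.ContTest φ → (∀ x, 0 ≤ φ x) → ∀ ξ : Space d,
      0 ≤ Λ * ‖ξ‖ ^ 2 * (∫ x in D.cell, φ x ∂(s.𝓔 τ))
        + matIntegral (fun x => φ x • otimes ξ ξ) (s.𝓡 τ) ∧
      0 ≤ Λ * ‖ξ‖ ^ 2 * (∫ x in D.cell, φ x ∂(s.𝓔 τ))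
        - matIntegral (fun x => φ x • otimes ξ ξ) (s.𝓡 τ)

/-! ### Relative energy -/

/-- The density of the relative energy, as a function of the values `ρ, u, c, ∇c` and
`R, U, C, ∇C`. -/
def relDensity (P : ℝ → ℝ) (ρ : ℝ) (u : Space d) (c : ℝ) (Dc : Space d)
    (R : ℝ) (U : Space d) (C : ℝ) (DC : Space d) : ℝ :=
  ρ * ‖u - U‖ ^ 2 / 2 + (c - C) ^ 2 + ‖Dc - DC‖ ^ 2 / 2 + (P ρ - deriv P R * (ρ - R) - P R)

/-- The density of `𝓔(ρ, u, c | R, U, C)` at a positive time `t`. -/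
def relDensityAt (P : ℝ → ℝ) (s : Flow d) (R : ℝ → Space d → ℝ) (U : ℝ → Space d → Space d)
    (C : ℝ → Space d → ℝ) (t : ℝ) (x : Space d) : ℝ :=
  relDensity P (s.ρ t x) (s.u t x) (s.c t x) (s.Dc t x)
    (R t x) (U t x) (C t x) (gradient (C t) x)

/-- The density of `𝓔(ρ, u, c | R, U, C)` at the initial time, computed from the initial data. -/
def relDensityInit (P : ℝ → ℝ) (I : InitialData d) (R : ℝ → Space d → ℝ)
    (U : ℝ → Space d → Space d) (C : ℝ → Space d → ℝ) (x : Space d) : ℝ :=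
  relDensity P (I.ρ x) (I.u x) (I.c x) (I.Dc x) (R 0 x) (U 0 x) (C 0 x) (gradient (C 0) x)

/-- The dissipation on the left-hand side:
`𝕊(∇u - ∇U) : (∇u - ∇U) + μ²`. -/
def dissipation (ν lam : ℝ) (s : Flow d) (U : ℝ → Space d → Space d)
    (t : ℝ) (x : Space d) : ℝ :=
  ddot (stress ν lam (s.Du t x - jac (U t) x)) (s.Du t x - jac (U t) x) + s.μ t x ^ 2

/-- The integrands (with their signs) on the right-hand side of the relative energy inequality,
except for the one that contains the defect measure. -/
def remainder (ν lam : ℝ) (p P : ℝ → ℝ) (s : Flow d) (R : ℝ → Space d → ℝ)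
    (U : ℝ → Space d → Space d) (C : ℝ → Space d → ℝ) (t : ℝ) (x : Space d) : Fin 11 → ℝ :=
  ![- (s.μ t x * (s.lapc t x - s.μ t x - 2 * s.c t x)),
    - ((s.divu t x - (jac (U t) x).trace) * glW (s.c t x)),
    s.ρ t x * inner ℝ (U t x - s.u t x) (deriv (fun r => U r x) t),
    (R t x - s.ρ t x) * deriv (fun r => deriv P (R r x)) t,
    - (s.ρ t x * inner ℝ (s.u t x) (gradient (fun y => deriv P (R t y)) x)),
    s.ρ t x * ddot (otimes (U t x - s.u t x) (s.u t x)) (jac (U t) x),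
    - ((p (s.ρ t x) - s.c t x ^ 2) * (jac (U t) x).trace),
    - ddot (korteweg (s.Dc t x)) (jac (U t) x),
    (s.μ t x - inner ℝ (s.u t x) (s.Dc t x)) * (Laplacian.laplacian (C t) x - 2 * C t x),
    (s.c t x - C t x) *
      (deriv (fun r => Laplacian.laplacian (C r) x) t - 2 * deriv (fun r => C r x) t),
    - ddot (stress ν lam (jac (U t) x)) (s.Du t x - jac (U t) x)]

end NSAC

end

noncomputable section

namespace NSAC

/-! ### Functions of time -/

/-! The relative energy is the energy plus terms that the equations control. Since `F(c) = W(c) +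
c²` and `P'(R)R - P(R) = p(R)`, and since Green's formula gives `∫ ∇c·∇C = -∫ c ΔC` and `∫ |∇C|² =
-∫ C ΔC`, the relative energy at time `τ` equals `[energy] - ∫ W(c) - ∫ ρu·U + ∫ ρ(|U|²/2 - P'(R)) -
∫ c(2C - ΔC) + ∫ (p(R) + C² - CΔC/2)` (`IsState.integral_relDensity_gradient`). The increments of
these six terms between `0` and `τ` come from the energy inequality, the renormalized Allen–Cahn
equation (`ae_integral_glW_eq`), the momentum equation tested with `U` (`ae_momentum`), the
continuity equation tested with `|U|²/2 - P'(R)` (`ae_continuity`), the Allen–Cahn equation tested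
with `2C - ΔC` (`ae_allenCahn`), and the fundamental theorem of calculus. The energy balance is the
only inequality among them.

The resulting integrands agree with those of the assertion up to four expressions whose integral
over `Ω` vanishes at almost every time (`sum_remainder_sub_dissipation`): `W(c) div u + W'(c) u·∇c`,
`(∇c⊗∇c - |∇c|²/2 𝕀):∇U + Δc ∇c·U`, `F(c) div U + F'(c) ∇c·U`, and `∂ₜC ΔC - C ∂ₜΔC`.

The analysis lies in justifying these manipulations at low regularity and without any regularity of
`∂Ω`.

Boundary. The test functions of the momentum equation have compact support, while `U` only vanishes
on `∂Ω`. Cutoffs `η n` with `|∇η n| ≤ n + 1`, constant at distance more than `3/(n+1)` from the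
complement, are used; as `|U|` is at most a constant times the distance to the complement, `∇(η n
U)` is bounded uniformly in `n` and is eventually equal to `∇U` at every interior point
(`IsCutoff.norm_pd_mul_le`). Dominated convergence then removes the cutoff, against the defect
measures as well. The Allen–Cahn equation contains no spatial derivative of its test function, so
there no boundary condition is needed.

Density. Cut-off `W^{1,2}` functions are `L²` limits, with their gradients, of test functions; they
are mollified on a periodic box by powers of `∏ (1 + cos(π(x_i - y_i)/L))` (`IsBoxWeak.exists_seq`,
`IsSobolev.isW012_cutoff`). All product and chain rules are limits of classical ones.

Renormalization. The source `μ - u·∇c` is only known to be integrable. The weak equation makes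
`c(·,x)` absolutely continuous in time for almost every `x`, and the chain rule for the Lipschitz
function `W` becomes one-dimensional (`ae_primitive_c`, `comp_primitive_eq`).

Initial time. No boundary condition is imposed on `c₀`. It is inherited from `c(t_k) → c₀` in `L¹`
along times at which `c(t_k)` lies in `W₀^{1,2}` with uniformly bounded gradient
(`integral_mul_pd_init`). -/

theorem _root_.AbsolutelyContinuousOnInterval.lipschitz_comp {f G : ℝ → ℝ} {a b : ℝ}
    {K : NNReal} (hf : AbsolutelyContinuousOnInterval f a b) (hG : LipschitzWith K G) :
    AbsolutelyContinuousOnInterval (fun x => G (f x)) a b := by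
  rw [absolutelyContinuousOnInterval_iff] at hf ⊢
  intro ε hε
  -- `K + 1` instead of `K`, which may vanish.
  obtain ⟨δ, hδ, h⟩ := hf (ε / (K + 1)) (by positivity)
  refine ⟨δ, hδ, fun E hE hE' => ?_⟩
  have h1 := h E hE hE'
  have hK : (0 : ℝ) < K + 1 := by positivity
  rw [lt_div_iff₀ hK] at h1
  refine lt_of_le_of_lt ?_ h1
  rw [Finset.sum_mul]
  refine Finset.sum_le_sum fun i _ => ?_
  refine (hG.dist_le_mul _ _).trans ?_
  nlinarith [dist_nonneg (x := f (E.2 i).1) (y := f (E.2 i).2)]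

/-- Chain rule for a differentiable Lipschitz function of a primitive. -/
theorem comp_primitive_eq {G g : ℝ → ℝ} {K : NNReal} (hG : LipschitzWith K G)
    (hG' : Differentiable ℝ G) (a τ : ℝ) (hg : IntervalIntegrable g volume 0 τ) :
    G (a + ∫ t in (0)..τ, g t)
      = G a + ∫ t in (0)..τ, deriv G (a + ∫ r in (0)..t, g r) * g t := by
  have hH : AbsolutelyContinuousOnInterval (fun t => a + ∫ r in (0)..t, g r) 0 τ :=
    ((LipschitzWith.const a).lipschitzOnWith (s := uIcc 0 τ)).absolutelyContinuousOnInterval.add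
      (hg.absolutelyContinuousOnInterval_intervalIntegral (c := 0) (by simp))
  have h1 := (hH.lipschitz_comp hG).integral_deriv_eq_sub
  simp only [intervalIntegral.integral_same, add_zero] at h1
  rw [eq_comm, ← eq_sub_iff_add_eq', ← h1]
  refine intervalIntegral.integral_congr_ae ?_
  filter_upwards [hg.ae_hasDerivAt_integral] with t ht ht'
  have h2 := (ht (uIoc_subset_uIcc ht') 0 (by simp)).const_add a
  exact ((hG' _).hasDerivAt.comp t h2).deriv.symm

/-- Continuity of the primitive extends the vanishing from rational to all endpoints, and Lebesgue
differentiation concludes. Rational endpoints suffice so that, when `f` depends on a parameter, only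
countably many exceptional null sets of parameters have to be discarded. -/
theorem ae_eq_zero_of_primitive_eq_zero {f : ℝ → ℝ} {T : ℝ} (hT : 0 < T)
    (hf : IntervalIntegrable f volume 0 T)
    (h : ∀ q : ℚ, (q : ℝ) ∈ Ioo 0 T → ∫ t in (0)..(q : ℝ), f t = 0) :
    ∀ᵐ t ∂(volume.restrict (Ioo 0 T)), f t = 0 := by
  have hc := (hf.absolutelyContinuousOnInterval_intervalIntegral (c := 0) (by simp)).continuousOn
  rw [uIcc_of_le hT.le] at hc
  have hz : ∀ x ∈ Ioo 0 T, ∫ t in (0)..x, f t = 0 := by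
    have hd : Ioo 0 T ⊆ closure (Ioo 0 T ∩ range ((↑) : ℚ → ℝ)) :=
      (Rat.denseRange_cast (𝕜 := ℝ)).open_subset_closure_inter isOpen_Ioo
    intro x hx
    have hcx : ContinuousAt (fun x => ∫ t in (0)..x, f t) x :=
      hc.continuousAt (Icc_mem_nhds hx.1 hx.2)
    have h0 : (fun x => ∫ t in (0)..x, f t) x ∈ closure ({0} : Set ℝ) := by
      refine ((hcx.continuousWithinAt (s := Ioo 0 T ∩ range ((↑) : ℚ → ℝ))).mem_closure
        (hd hx)) ?_
      rintro y ⟨hy, q, rfl⟩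
      exact h q hy
    simpa using h0
  rw [ae_restrict_iff' measurableSet_Ioo]
  filter_upwards [hf.ae_hasDerivAt_integral] with t ht ht'
  have h1 := ht (by rw [uIcc_of_le hT.le]; exact Ioo_subset_Icc_self ht') 0 (by simp)
  refine h1.unique ((hasDerivAt_const t (0 : ℝ)).congr_of_eventuallyEq ?_)
  filter_upwards [Ioo_mem_nhds ht'.1 ht'.2] with x hx using hz x hx

/-- A smooth function of time that vanishes near `T`. -/
def TimeTest (T : ℝ) (ψ : ℝ → ℝ) : Prop := ContDiff ℝ ∞ ψ ∧ ∃ t₀ < T, ∀ t, t₀ ≤ t → ψ t = 0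

/-- The integrated form of `A' = B`, `A(0) = a₀`. -/
theorem ae_eq_primitive_of_weak {T : ℝ} (hT : 0 < T) {A B : ℝ → ℝ} {a₀ : ℝ}
    (hA : IntegrableOn A (Ioo 0 T)) (hB : IntegrableOn B (Ioo 0 T))
    (h : ∀ ψ, TimeTest T ψ →
      ∫ t in (0)..T, (deriv ψ t * A t + ψ t * B t) = - (ψ 0 * a₀)) :
    ∀ᵐ τ ∂(volume.restrict (Ioo 0 T)), A τ = a₀ + ∫ t in (0)..τ, B t := by
  have hA' : IntervalIntegrable A volume 0 T := by
    rw [intervalIntegrable_iff_integrableOn_Ioo_of_le hT.le]; exact hA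
  have hB' : IntervalIntegrable B volume 0 T := by
    rw [intervalIntegrable_iff_integrableOn_Ioo_of_le hT.le]; exact hB
  set H : ℝ → ℝ := fun τ => a₀ + ∫ t in (0)..τ, B t with hHdef
  have hH : AbsolutelyContinuousOnInterval H 0 T :=
    ((LipschitzWith.const a₀).lipschitzOnWith (s := uIcc 0 T)).absolutelyContinuousOnInterval.add
      (hB'.absolutelyContinuousOnInterval_intervalIntegral (c := 0) (by simp))
  have hHi : IntervalIntegrable H volume 0 T := hH.continuousOn.intervalIntegrable
  have hHd : ∀ᵐ t, t ∈ uIoc 0 T → deriv H t = B t := by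
    filter_upwards [hB'.ae_hasDerivAt_integral] with t ht ht'
    exact ((ht (uIoc_subset_uIcc ht') 0 (by simp)).const_add a₀).deriv
  have key : ∀ χ : ℝ → ℝ, ContDiff ℝ ∞ χ → HasCompactSupport χ → tsupport χ ⊆ Ioo 0 T →
      ∫ t, χ t • (A t - H t) ∂volume = 0 := by
    intro χ hχ hχc hχs
    -- The last point of the support, which lies before `T` by compactness. Beyond the midpoint `(t₀
    -- + T) / 2` the function `χ` vanishes, and so does its primitive from `T`.
    obtain ⟨t₀, ht₀T, ht₀⟩ : ∃ t₀ < T, ∀ t, t₀ ≤ t → t ∉ tsupport χ ∨ t = t₀ := by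
      rcases (tsupport χ).eq_empty_or_nonempty with he | hne
      · exact ⟨0, hT, fun t _ => Or.inl (by simp [he])⟩
      · refine ⟨sSup (tsupport χ), (hχs (hχc.isCompact.sSup_mem hne)).2, fun t ht => ?_⟩
        by_cases htm : t ∈ tsupport χ
        · exact Or.inr (le_antisymm (le_csSup hχc.isCompact.bddAbove htm) ht)
        · exact Or.inl htm
    have hχ0 : ∀ t, (t₀ + T) / 2 ≤ t → χ t = 0 := fun t ht =>
      image_eq_zero_of_notMem_tsupport
        ((ht₀ t (by linarith)).resolve_right (by intro h; linarith))
    -- The primitive that vanishes at `T` is an admissible test function. Integrating `∫ ψ B = ∫ ψ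
    -- H'` by parts produces `-ψ(0) a₀ - ∫ χ H`; the boundary term at `0` cancels the initial datum
    -- of the hypothesis, and `∫ χ (A - H) = 0` remains.
    set ψ : ℝ → ℝ := fun t => ∫ r in T..t, χ r with hψ
    have hψd : ∀ t, HasDerivAt ψ (χ t) t := fun t =>
      intervalIntegral.integral_hasDerivAt_right (hχ.continuous.intervalIntegrable _ _)
        (hχ.continuous.stronglyMeasurableAtFilter _ _) hχ.continuous.continuousAt
    have hψ' : deriv ψ = χ := funext fun t => (hψd t).deriv
    have hψs : ContDiff ℝ ∞ ψ := by
      rw [contDiff_infty_iff_deriv]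
      exact ⟨fun t => (hψd t).differentiableAt, hψ' ▸ hχ⟩
    have hψ0 : ∀ t, (t₀ + T) / 2 ≤ t → ψ t = 0 := by
      intro t ht
      rw [hψ]
      refine (intervalIntegral.integral_congr (g := fun _ => (0 : ℝ)) fun r hr => ?_).trans
        intervalIntegral.integral_zero
      refine hχ0 r ?_
      rcases uIcc_subset_uIcc_union_uIcc (a := T) (b := T) (c := t) hr with h | h
      · rw [uIcc_self] at h; rw [h]; linarith
      · refine le_trans ?_ h.1
        exact le_min (by linarith) ht
    have h1 := h ψ ⟨hψs, (t₀ + T) / 2, by linarith, hψ0⟩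
    rw [hψ'] at h1
    have hψac : AbsolutelyContinuousOnInterval ψ 0 T :=
      ((hψs.of_le (by exact_mod_cast le_top : (1 : WithTop ℕ∞) ≤ ((⊤ : ℕ∞) : WithTop ℕ∞))).contDiffOn
        (s := uIcc 0 T)).absolutelyContinuousOnInterval
    have h2 := hψac.integral_mul_deriv_eq_deriv_mul hH
    rw [hψ', hψ0 T (by linarith)] at h2
    have hH0 : H 0 = a₀ := by simp [hHdef]
    rw [hH0] at h2
    have h3 : ∫ t in (0)..T, ψ t * deriv H t = ∫ t in (0)..T, ψ t * B t := by
      refine intervalIntegral.integral_congr_ae ?_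
      filter_upwards [hHd] with t ht ht'
      rw [ht ht']
    have hχA := hA'.continuousOn_mul (hχ.continuous.continuousOn (s := uIcc 0 T))
    have hχH := hHi.continuousOn_mul (hχ.continuous.continuousOn (s := uIcc 0 T))
    have hψB := hB'.continuousOn_mul (hψs.continuous.continuousOn (s := uIcc 0 T))
    rw [intervalIntegral.integral_add hχA hψB] at h1
    have h4 : ∫ t in (0)..T, χ t * (A t - H t) = 0 := by
      simp_rw [mul_sub]
      rw [intervalIntegral.integral_sub hχA hχH]
      linarith
    rw [intervalIntegral.integral_of_le hT.le, integral_Ioc_eq_integral_Ioo] at h4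
    rw [← h4, eq_comm]
    refine setIntegral_eq_integral_of_forall_compl_eq_zero fun t ht => ?_
    rw [image_eq_zero_of_notMem_tsupport (fun h => ht (hχs h)), zero_mul]
  have hloc : LocallyIntegrableOn (fun t => A t - H t) (Ioo 0 T) volume := by
    refine IntegrableOn.locallyIntegrableOn (hA.sub ?_)
    exact (intervalIntegrable_iff_integrableOn_Ioo_of_le hT.le).1 hHi
  have h5 := isOpen_Ioo.ae_eq_zero_of_integral_contDiff_smul_eq_zero hloc key
  rw [ae_restrict_iff' measurableSet_Ioo]
  filter_upwards [h5] with t ht ht'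
  linarith [ht ht']

variable {d : ℕ}

/-- The classical partial derivative. -/
abbrev pd (i : Fin d) (φ : Space d → ℝ) (x : Space d) : ℝ :=
  fderiv ℝ φ x (EuclideanSpace.single i 1)

/-! ### Square integrable functions -/

theorem eLpNorm_two_eq {α : Type*} [MeasurableSpace α] {μ : Measure α} {u : α → ℝ}
    (hu : MemLp u 2 μ) : eLpNorm u 2 μ = ENNReal.ofReal (√(∫ x, u x ^ 2 ∂μ)) := by
  rw [hu.eLpNorm_eq_integral_rpow_norm (by simp) (by simp), Real.sqrt_eq_rpow]
  simp

theorem tendsto_eLpNorm_two_of_dominated {α : Type*} [MeasurableSpace α] {μ : Measure α}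
    {u : ℕ → α → ℝ} {v h : α → ℝ} (hh : MemLp h 2 μ)
    (hu : ∀ n, AEStronglyMeasurable (u n) μ) (hv : AEStronglyMeasurable v μ)
    (hM : ∀ n, ∀ᵐ x ∂μ, ‖u n x‖ ≤ h x) (hvM : ∀ᵐ x ∂μ, ‖v x‖ ≤ h x)
    (hlim : ∀ᵐ x ∂μ, Tendsto (fun n => u n x) atTop (𝓝 (v x))) :
    Tendsto (fun n => eLpNorm (fun x => u n x - v x) 2 μ) atTop (𝓝 0) := by
  have hmem : ∀ n, MemLp (fun x => u n x - v x) 2 μ := fun n =>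
    (hh.mono' (hu n) (hM n)).sub (hh.mono' hv hvM)
  simp_rw [fun n => eLpNorm_two_eq (hmem n)]
  have h0 : Tendsto (fun n => ∫ x, (u n x - v x) ^ 2 ∂μ) atTop (𝓝 (∫ x, (0 : ℝ) ∂μ)) := by
    refine tendsto_integral_of_dominated_convergence (fun x => (2 * h x) ^ 2)
      (fun n => ((hu n).sub hv).pow 2) (hh.const_mul 2).integrable_sq (fun n => ?_) ?_
    · filter_upwards [hM n, hvM] with x h1 h2
      rw [norm_pow]
      gcongr
      exact (norm_sub_le _ _).trans (by linarith)
    · filter_upwards [hlim] with x hx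
      simpa using (hx.sub_const (v x)).pow 2
  have h1 := (ENNReal.tendsto_ofReal ((Real.continuous_sqrt.tendsto _).comp h0))
  simpa using h1

/-- Joint continuity of the inner product of `L²`. All passages to the limit in integrals of
products of smooth approximations rest on it. -/
theorem tendsto_integral_mul_of_L2 {α : Type*} [MeasurableSpace α] {μ : Measure α}
    {u v : ℕ → α → ℝ} {f g : α → ℝ} (hu : ∀ n, MemLp (u n) 2 μ) (hv : ∀ n, MemLp (v n) 2 μ)
    (hf : MemLp f 2 μ) (hg : MemLp g 2 μ)
    (huf : Tendsto (fun n => eLpNorm (fun x => f x - u n x) 2 μ) atTop (𝓝 0))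
    (hvg : Tendsto (fun n => eLpNorm (fun x => g x - v n x) 2 μ) atTop (𝓝 0)) :
    Tendsto (fun n => ∫ x, u n x * v n x ∂μ) atTop (𝓝 (∫ x, f x * g x ∂μ)) := by
  have key : ∀ {a b : α → ℝ} (ha : MemLp a 2 μ) (hb : MemLp b 2 μ),
      ∫ x, a x * b x ∂μ = inner ℝ (ha.toLp a) (hb.toLp b) := by
    intro a b ha hb
    rw [L2.inner_def]
    refine integral_congr_ae ?_
    filter_upwards [ha.coeFn_toLp, hb.coeFn_toLp] with x h1 h2
    rw [h1, h2]; simp [mul_comm]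
  have conv : ∀ {w : ℕ → α → ℝ} {h : α → ℝ} (hw : ∀ n, MemLp (w n) 2 μ) (hh : MemLp h 2 μ),
      Tendsto (fun n => eLpNorm (fun x => h x - w n x) 2 μ) atTop (𝓝 0) →
      Tendsto (fun n => (hw n).toLp (w n)) atTop (𝓝 (hh.toLp h)) := by
    intro w h hw hh H
    rw [Lp.tendsto_Lp_iff_tendsto_eLpNorm'' _ hw]
    refine H.congr fun n => ?_
    rw [← eLpNorm_neg]
    congr 1
    ext x; simp
  simp_rw [fun n => key (hu n) (hv n)]
  rw [key hf hg]
  exact (conv hu hf huf).inner (conv hv hg hvg)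

/-! ### Boxes and periodic functions -/

/-- The half-open box `[-L,L)^d`. -/
def box (L : ℝ) : Set (Space d) := {x | ∀ i, x i ∈ Ico (-L) L}

/-- The closed box `[-L,L]^d`. -/
def cbox (L : ℝ) : Set (Space d) := {x | ∀ i, x i ∈ Icc (-L) L}

/-- Smooth functions that are `2L`-periodic in every coordinate. -/
def SmoothPeriodic (L : ℝ) (φ : Space d → ℝ) : Prop :=
  ContDiff ℝ ∞ φ ∧ ∀ x i, φ (x + EuclideanSpace.single i (2 * L)) = φ x

theorem box_eq_preimage (L : ℝ) :
    (box L : Set (Space d)) = WithLp.ofLp ⁻¹' (univ.pi fun _ => Ico (-L) L) := by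
  ext x; simp [box]

theorem cbox_eq_preimage (L : ℝ) :
    (cbox L : Set (Space d)) = WithLp.ofLp ⁻¹' (univ.pi fun _ => Icc (-L) L) := by
  ext x; exact ⟨fun h i _ => h i, fun h i => h i (mem_univ i)⟩

theorem box_subset_cbox (L : ℝ) : (box L : Set (Space d)) ⊆ cbox L :=
  fun _ hx i => Ico_subset_Icc_self (hx i)

theorem isCompact_cbox (L : ℝ) : IsCompact (cbox L : Set (Space d)) := by
  rw [cbox_eq_preimage]
  exact (EuclideanSpace.equiv (Fin d) ℝ).toHomeomorph.isCompact_preimage.2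
    (isCompact_univ_pi fun _ => isCompact_Icc)

theorem measurableSet_box (L : ℝ) : MeasurableSet (box L : Set (Space d)) := by
  rw [box_eq_preimage]
  exact (PiLp.volume_preserving_ofLp (Fin d)).measurable
    (MeasurableSet.univ_pi fun _ => measurableSet_Ico)

theorem box_ae_eq_cbox (L : ℝ) : (box L : Set (Space d)) =ᵐ[volume] cbox L := by
  rw [box_eq_preimage, cbox_eq_preimage, pi_univ_Icc]
  exact (PiLp.volume_preserving_ofLp (Fin d)).quasiMeasurePreserving.preimage_ae_eq
    Measure.univ_pi_Ico_ae_eq_Icc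

theorem volume_box_lt_top (L : ℝ) : volume (box L : Set (Space d)) < ⊤ :=
  (measure_mono (box_subset_cbox L)).trans_lt (isCompact_cbox L).measure_lt_top

instance isFiniteMeasure_box (L : ℝ) : IsFiniteMeasure (volume.restrict (box L : Set (Space d))) :=
  ⟨by simpa using volume_box_lt_top L⟩

theorem isOpen_obox (L : ℝ) : IsOpen {x : Space d | ∀ i, x i ∈ Ioo (-L) L} := by
  simp only [ofPred_forall]
  exact isOpen_iInter_of_finite fun i => isOpen_Ioo.preimage (by fun_prop)

theorem ae_mem_obox (L : ℝ) :
    ∀ᵐ x ∂(volume.restrict (box L : Set (Space d))), ∀ i, x i ∈ Ioo (-L) L := by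
  have h : (box L : Set (Space d)) =ᵐ[volume]
      (WithLp.ofLp ⁻¹' (univ.pi fun _ => Ioo (-L) L) : Set (Space d)) := by
    rw [box_eq_preimage]
    exact (PiLp.volume_preserving_ofLp (Fin d)).quasiMeasurePreserving.preimage_ae_eq
      (Measure.univ_pi_Ico_ae_eq_Icc.trans Measure.univ_pi_Ioo_ae_eq_Icc.symm)
  rw [Measure.restrict_congr_set h, ae_restrict_iff' ]
  · exact Eventually.of_forall fun x hx i => hx i (mem_univ i)
  · exact (PiLp.volume_preserving_ofLp (Fin d)).measurable
      (MeasurableSet.univ_pi fun _ => measurableSet_Ioo)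

theorem integrableOn_box_of_continuous {L : ℝ} {f : Space d → ℝ} (hf : Continuous f) :
    IntegrableOn f (box L) :=
  (hf.continuousOn.integrableOn_compact (isCompact_cbox L)).mono_set (box_subset_cbox L)

theorem exists_bound_box {f : Space d → ℝ} (L : ℝ) (hf : Continuous f) :
    ∃ M, ∀ x ∈ box L, ‖f x‖ ≤ M := by
  obtain ⟨M, hM⟩ := (isCompact_cbox L).exists_bound_of_continuousOn hf.continuousOn
  exact ⟨M, fun x hx => hM x (box_subset_cbox L hx)⟩

/-- The integral of a partial derivative of a periodic function vanishes. -/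
theorem integral_box_pd_eq_zero {L : ℝ} (hL : 0 ≤ L) {ψ : Space d → ℝ} (hψ : ContDiff ℝ 1 ψ)
    (hper : ∀ x i, ψ (x + EuclideanSpace.single i (2 * L)) = ψ x) (i : Fin d) :
    ∫ x in box L, pd i ψ x = 0 := by
  obtain ⟨n, rfl⟩ : ∃ n, d = n + 1 := ⟨d - 1, by have := i.pos; omega⟩
  have hcont : Continuous (pd i ψ) := (hψ.continuous_fderiv one_ne_zero).clm_apply continuous_const
  rw [setIntegral_congr_set (box_ae_eq_cbox L), cbox_eq_preimage]
  have hmp := PiLp.volume_preserving_toLp (Fin (n + 1))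
  have hemb : MeasurableEmbedding (@WithLp.toLp 2 (Fin (n + 1) → ℝ)) :=
    (MeasurableEquiv.toLp 2 (Fin (n + 1) → ℝ)).measurableEmbedding
  rw [← hmp.setIntegral_preimage_emb hemb]
  have hset : (@WithLp.toLp 2 (Fin (n + 1) → ℝ)) ⁻¹'
      (WithLp.ofLp ⁻¹' (univ.pi fun _ => Icc (-L) L)) = Icc (fun _ => -L) (fun _ => L) := by
    rw [← pi_univ_Icc]; rfl
  rw [hset]
  set e := (EuclideanSpace.equiv (Fin (n + 1)) ℝ).symm with he
  have hderiv : ∀ x, HasFDerivAt (fun z : Fin (n + 1) → ℝ => ψ (e z))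
      ((fderiv ℝ ψ (e x)).comp (e : (Fin (n + 1) → ℝ) →L[ℝ] Space (n + 1))) x := fun x =>
    ((hψ.differentiable one_ne_zero _).hasFDerivAt).comp x e.hasFDerivAt
  have hcψ : Continuous fun z : Fin (n + 1) → ℝ => ψ (e z) := hψ.continuous.comp e.continuous
  have hsingle : ∀ j, e (Pi.single j 1) = EuclideanSpace.single j 1 := fun j => rfl
  -- The divergence theorem for the field whose only nonzero component is `ψ`, in direction `i`.
  have key := integral_divergence_of_hasFDerivAt_off_countable' (n := n)
    (fun _ => -L) (fun _ => L) (fun _ => by linarith)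
    (fun j z => if j = i then ψ (e z) else 0)
    (fun j x => if j = i then (fderiv ℝ ψ (e x)).comp
      (e : (Fin (n + 1) → ℝ) →L[ℝ] Space (n + 1)) else 0) ∅ countable_empty
    (fun j => by
      by_cases hj : j = i
      · simpa [hj] using hcψ.continuousOn
      · simpa [hj] using continuousOn_const)
    (fun x _ j => by
      by_cases hj : j = i
      · simpa [hj] using hderiv x
      · simpa [hj] using hasFDerivAt_const (0 : ℝ) x)
    (by
      refine ContinuousOn.integrableOn_compact isCompact_Icc (Continuous.continuousOn ?_)
      refine continuous_finsetSum _ fun j _ => ?_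
      by_cases hj : j = i
      · simp only [hj, if_true, ContinuousLinearMap.comp_apply]
        exact hcont.comp e.continuous
      · simpa [hj] using continuous_const)
  have hl : ∀ x : Fin (n + 1) → ℝ, (∑ j, (if j = i then (fderiv ℝ ψ (e x)).comp
      (e : (Fin (n + 1) → ℝ) →L[ℝ] Space (n + 1)) else 0) (Pi.single j 1))
      = pd i ψ (WithLp.toLp 2 x) := by
    intro x
    rw [Finset.sum_eq_single i]
    · simp only [if_true]; rfl
    · intro j _ hj; simp [hj]
    · simp
  simp_rw [hl] at key
  rw [key]
  refine Finset.sum_eq_zero fun j _ => ?_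
  by_cases hj : j = i
  · subst hj
    simp only [if_true]
    rw [sub_eq_zero]
    refine setIntegral_congr_fun measurableSet_Icc fun x _ => ?_
    -- Opposite faces differ by one period, so their contributions cancel.
    have : e (j.insertNth L x) = e (j.insertNth (-L) x) + EuclideanSpace.single j (2 * L) := by
      ext k
      refine Fin.succAboveCases j ?_ (fun k => ?_) k
      · simp [e]; ring
      · simp [e]
    show ψ (e (j.insertNth L x)) = ψ (e (j.insertNth (-L) x))
    rw [this, hper]
  · simp [hj]

/-! ### Mollification on a box by a periodic kernel -/

/-- A kernel of the form `∑ a_j(x) b_j(y)` with smooth periodic factors. -/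
def IsSeparated (L : ℝ) (K : Space d → Space d → ℝ) : Prop :=
  ∃ (ι : Type) (_ : Fintype ι) (a b : ι → Space d → ℝ),
    (∀ j, SmoothPeriodic L (a j)) ∧ (∀ j, SmoothPeriodic L (b j)) ∧
    ∀ x y, K x y = ∑ j, a j x * b j y

theorem SmoothPeriodic.mul {L : ℝ} {a b : Space d → ℝ} (ha : SmoothPeriodic L a)
    (hb : SmoothPeriodic L b) : SmoothPeriodic L fun x => a x * b x :=
  ⟨ha.1.mul hb.1, fun x i => by simp only [ha.2, hb.2]⟩

theorem SmoothPeriodic.const (L c : ℝ) : SmoothPeriodic L (fun _ : Space d => c) :=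
  ⟨contDiff_const, fun _ _ => rfl⟩

theorem SmoothPeriodic.sum {L : ℝ} {ι : Type} {s : Finset ι} {a : ι → Space d → ℝ}
    (ha : ∀ j, SmoothPeriodic L (a j)) : SmoothPeriodic L fun x => ∑ j ∈ s, a j x :=
  ⟨ContDiff.sum fun j _ => (ha j).1, fun x i => Finset.sum_congr rfl fun j _ => (ha j).2 x i⟩

theorem IsSeparated.mul {L : ℝ} {K K' : Space d → Space d → ℝ} (h : IsSeparated L K)
    (h' : IsSeparated L K') : IsSeparated L fun x y => K x y * K' x y := by
  obtain ⟨ι, _, a, b, ha, hb, hK⟩ := h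
  obtain ⟨κ, _, a', b', ha', hb', hK'⟩ := h'
  refine ⟨ι × κ, inferInstance, fun j x => a j.1 x * a' j.2 x, fun j y => b j.1 y * b' j.2 y,
    fun j => (ha _).mul (ha' _), fun j => (hb _).mul (hb' _), fun x y => ?_⟩
  simp only [hK, hK']
  rw [Finset.sum_mul_sum, ← Finset.univ_product_univ, Finset.sum_product]
  refine Finset.sum_congr rfl fun i _ => Finset.sum_congr rfl fun j _ => ?_
  ring

theorem IsSeparated.const (L c : ℝ) : IsSeparated L (fun _ _ : Space d => c) :=
  ⟨Unit, inferInstance, fun _ _ => c, fun _ _ => 1, fun _ => .const L c, fun _ => .const L 1,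
    fun _ _ => by simp⟩

theorem IsSeparated.pow {L : ℝ} {K : Space d → Space d → ℝ} (h : IsSeparated L K) (n : ℕ) :
    IsSeparated L fun x y => K x y ^ n := by
  induction n with
  | zero => simpa using IsSeparated.const L 1
  | succ n ih => simpa only [pow_succ] using ih.mul h

theorem IsSeparated.prod {L : ℝ} {ι : Type} (s : Finset ι) {K : ι → Space d → Space d → ℝ}
    (h : ∀ j, IsSeparated L (K j)) : IsSeparated L fun x y => ∏ j ∈ s, K j x y := by
  classical
  induction s using Finset.induction_on with
  | empty => simpa using IsSeparated.const L 1
  | insert j s hj ih =>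
    simp only [Finset.prod_insert hj]
    exact (h j).mul ih

/-- An unnormalized periodic kernel that peaks on the diagonal. -/
def cosKernel (L : ℝ) (x y : Space d) : ℝ := ∏ i, (1 + Real.cos (Real.pi * (x i - y i) / L))

/-- The addition formula `cos (a - b) = cos a cos b + sin a sin b` writes each factor as a sum of
three separated products, and separated kernels are closed under multiplication. -/
theorem isSeparated_cosKernel {L : ℝ} (hL : 0 < L) :
    IsSeparated L (cosKernel L : Space d → Space d → ℝ) := by
  refine IsSeparated.prod _ fun i => ?_
  have hc : SmoothPeriodic L fun x : Space d => Real.cos (Real.pi * x i / L) := by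
    refine ⟨by fun_prop, fun x j => ?_⟩
    by_cases hj : i = j
    · subst hj
      have : Real.pi * (x i + 2 * L) / L = Real.pi * x i / L + 2 * Real.pi := by
        field_simp
      simp [this]
    · simp [hj]
  have hs : SmoothPeriodic L fun x : Space d => Real.sin (Real.pi * x i / L) := by
    refine ⟨by fun_prop, fun x j => ?_⟩
    by_cases hj : i = j
    · subst hj
      have : Real.pi * (x i + 2 * L) / L = Real.pi * x i / L + 2 * Real.pi := by
        field_simp
      simp [this]
    · simp [hj]
  refine ⟨Fin 3, inferInstance,
    ![fun _ => 1, fun x => Real.cos (Real.pi * x i / L), fun x => Real.sin (Real.pi * x i / L)],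
    ![fun _ => 1, fun x => Real.cos (Real.pi * x i / L), fun x => Real.sin (Real.pi * x i / L)],
    ?_, ?_, fun x y => ?_⟩
  · intro j; fin_cases j
    exacts [.const L 1, hc, hs]
  · intro j; fin_cases j
    exacts [.const L 1, hc, hs]
  · simp only [Fin.sum_univ_three, Matrix.cons_val_zero, Matrix.cons_val_one, Matrix.cons_val]
    rw [mul_sub, sub_div, Real.cos_sub]
    ring

/-- `f` has the weak gradient `g` on the torus of side length `2L`. -/
def IsBoxWeak (L : ℝ) (f : Space d → ℝ) (g : Fin d → Space d → ℝ) : Prop :=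
  ∀ i, ∀ φ : Space d → ℝ, SmoothPeriodic L φ →
    ∫ x in box L, f x * pd i φ x = - ∫ x in box L, g i x * φ x

theorem IsSeparated.smoothPeriodic_right {L : ℝ} {K : Space d → Space d → ℝ}
    (hK : IsSeparated L K) (x : Space d) : SmoothPeriodic L (K x) := by
  obtain ⟨ι, _, a, b, ha, hb, hK⟩ := hK
  rw [show K x = fun y => ∑ j, a j x * b j y from funext (hK x)]
  exact SmoothPeriodic.sum fun j => (SmoothPeriodic.const L (a j x)).mul (hb j)

theorem integrable_mul_smooth {L : ℝ} {f φ : Space d → ℝ} (hf : IntegrableOn f (box L))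
    (hφ : Continuous φ) : IntegrableOn (fun x => f x * φ x) (box L) := by
  obtain ⟨M, hM⟩ := exists_bound_box L hφ
  exact Integrable.mul_bdd (c := M) hf hφ.aestronglyMeasurable
    ((ae_restrict_iff' (measurableSet_box L)).2 (Eventually.of_forall hM))

theorem pd_sum_mul {ι : Type} [Fintype ι] {a : ι → Space d → ℝ} (ha : ∀ j, ContDiff ℝ ∞ (a j))
    (c : ι → ℝ) (i : Fin d) (x : Space d) :
    pd i (fun x => ∑ j, a j x * c j) x = ∑ j, pd i (a j) x * c j := by
  have h : HasFDerivAt (fun x => ∑ j, a j x * c j) (∑ j, c j • fderiv ℝ (a j) x) x :=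
    HasFDerivAt.fun_sum fun j _ =>
      ((ha j).differentiable (by simp) x).hasFDerivAt.mul_const (c j)
  simp only [pd]
  rw [h.fderiv]
  simp [mul_comm]

/-- Convolution with a smooth kernel of separated form. -/
theorem IsSeparated.integral_spec {L : ℝ} {K : Space d → Space d → ℝ} (hK : IsSeparated L K)
    {k : Space d → ℝ} (hk : Differentiable ℝ k) (hKk : ∀ x y, K x y = k (x - y))
    {f : Space d → ℝ} {g : Fin d → Space d → ℝ} (hf : IntegrableOn f (box L))
    (hfg : IsBoxWeak L f g) :
    SmoothPeriodic L (fun x => ∫ y in box L, f y * K x y) ∧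
    ∀ i x, pd i (fun x => ∫ y in box L, f y * K x y) x = ∫ y in box L, g i y * K x y := by
  have hKs := hK
  obtain ⟨ι, _, a, b, ha, hb, hab⟩ := hK
  have hfb : ∀ j, IntegrableOn (fun y => f y * b j y) (box L) := fun j =>
    integrable_mul_smooth hf (hb j).1.continuous
  -- A separated kernel makes the convolution a finite combination of fixed smooth functions of `x`,
  -- so no differentiation under the integral is required.
  have h1 : (fun x => ∫ y in box L, f y * K x y)
      = fun x => ∑ j, a j x * ∫ y in box L, f y * b j y := by
    ext x
    simp_rw [hab, Finset.mul_sum]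
    rw [integral_finsetSum]
    · refine Finset.sum_congr rfl fun j _ => ?_
      rw [← integral_const_mul]
      congr 1; ext y; ring
    · intro j _
      refine ((hfb j).const_mul (a j x)).congr (Eventually.of_forall fun y => ?_)
      ring
  refine ⟨?_, fun i x => ?_⟩
  · rw [h1]
    exact SmoothPeriodic.sum fun j => (ha j).mul (.const L _)
  · rw [h1, pd_sum_mul (fun j => (ha j).1)]
    -- The kernel depends on `x - y` only: a derivative in `x` is minus a derivative in `y`, and the
    -- weak formulation moves the latter onto `f`.
    have h2 : ∀ y, ∑ j, pd i (a j) x * b j y = - pd i (K x) y := by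
      intro y
      rw [← pd_sum_mul (fun j => (ha j).1) (fun j => b j y)]
      rw [show (fun x => ∑ j, a j x * b j y) = fun x => k (x - y) from
        funext fun x => by rw [← hab, hKk]]
      rw [show K x = fun y => k (x - y) from funext fun y => hKk x y]
      simp only [pd]
      have e1 : HasFDerivAt (fun x => k (x - y)) (fderiv ℝ k (x - y)) x := by
        have := (hk (x - y)).hasFDerivAt.comp x ((hasFDerivAt_id x).sub_const y)
        rw [ContinuousLinearMap.comp_id] at this
        exact this
      have e2 : HasFDerivAt (fun y => k (x - y)) (-(fderiv ℝ k (x - y))) y := by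
        have := (hk (x - y)).hasFDerivAt.comp y ((hasFDerivAt_id y).const_sub x)
        rw [ContinuousLinearMap.comp_neg, ContinuousLinearMap.comp_id] at this
        exact this
      rw [e1.fderiv, e2.fderiv]; simp
    have h3 := hfg i (K x) (hKs.smoothPeriodic_right x)
    rw [← neg_eq_iff_eq_neg] at h3
    rw [← h3, ← integral_neg]
    simp_rw [← mul_neg, ← h2, Finset.mul_sum]
    rw [integral_finsetSum]
    · refine Finset.sum_congr rfl fun j _ => ?_
      rw [← integral_const_mul]
      congr 1; ext y; ring
    · intro j _
      refine ((hfb j).const_mul (pd i (a j) x)).congr (Eventually.of_forall fun y => ?_)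
      ring

theorem isBoxWeak_one {L : ℝ} (hL : 0 ≤ L) :
    IsBoxWeak L (fun _ : Space d => (1 : ℝ)) (fun _ _ => 0) := by
  intro i φ hφ
  simpa using integral_box_pd_eq_zero hL (hφ.1.of_le (by simp)) hφ.2 i

theorem cosKernel_symm (L : ℝ) (x y : Space d) : cosKernel L x y = cosKernel L y x := by
  refine Finset.prod_congr rfl fun i _ => ?_
  rw [← Real.cos_neg]; congr 2; ring

theorem cosKernel_nonneg (L : ℝ) (x y : Space d) : 0 ≤ cosKernel L x y :=
  Finset.prod_nonneg fun i _ => by linarith [Real.neg_one_le_cos (Real.pi * (x i - y i) / L)]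

theorem cosKernel_le (L : ℝ) (x y : Space d) : cosKernel L x y ≤ 2 ^ d := by
  calc cosKernel L x y ≤ ∏ _i : Fin d, (2 : ℝ) := by
        refine Finset.prod_le_prod (fun i _ => ?_) fun i _ => ?_
        · linarith [Real.neg_one_le_cos (Real.pi * (x i - y i) / L)]
        · linarith [Real.cos_le_one (Real.pi * (x i - y i) / L)]
    _ = 2 ^ d := by simp

theorem continuous_cosKernel (L : ℝ) :
    Continuous fun z : Space d × Space d => cosKernel L z.1 z.2 := by
  unfold cosKernel; fun_prop

/-- For `x` in the open box and `y` in the closed one, `|x_i - y_i| < 2L`, so each angle lies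
strictly between `-2π` and `2π`, where the cosine equals `1` only at `0`. For `x` on a face the
opposite face would carry a second maximum. -/
theorem cosKernel_lt {L : ℝ} (hL : 0 < L) {x y : Space d} (hx : ∀ i, x i ∈ Ioo (-L) L)
    (hy : y ∈ cbox L) (hxy : y ≠ x) : cosKernel L x y < cosKernel L x x := by
  obtain ⟨i, hi⟩ : ∃ i, y i ≠ x i := by
    by_contra h; push Not at h; exact hxy (by ext i; exact h i)
  have hxx : cosKernel L x x = ∏ _i : Fin d, (2 : ℝ) := by
    simp [cosKernel]; norm_num
  rw [hxx]
  have hlt : Real.cos (Real.pi * (x i - y i) / L) < 1 := by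
    refine lt_of_le_of_ne (Real.cos_le_one _) fun h => ?_
    have hpi := Real.pi_pos
    have h2 : Real.pi * (x i - y i) / L = 0 := by
      refine (Real.cos_eq_one_iff_of_lt_of_lt ?_ ?_).1 h
      · rw [lt_div_iff₀ hL]; nlinarith [(hx i).1, (hy i).2]
      · rw [div_lt_iff₀ hL]; nlinarith [(hx i).2, (hy i).1]
    rw [div_eq_zero_iff, mul_eq_zero] at h2
    rcases h2 with (h2 | h2) | h2
    · exact hpi.ne' h2
    · exact hi (by linarith)
    · exact hL.ne' h2
  have hnn : ∀ j, 0 ≤ 1 + Real.cos (Real.pi * (x j - y j) / L) := fun j => by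
    linarith [Real.neg_one_le_cos (Real.pi * (x j - y j) / L)]
  have hle : ∀ j, 1 + Real.cos (Real.pi * (x j - y j) / L) ≤ 2 := fun j => by
    linarith [Real.cos_le_one (Real.pi * (x j - y j) / L)]
  unfold cosKernel
  rw [← Finset.mul_prod_erase _ _ (Finset.mem_univ i), ← Finset.mul_prod_erase _ _ (Finset.mem_univ i)]
  refine lt_of_le_of_lt (mul_le_mul_of_nonneg_left
    (Finset.prod_le_prod (fun j _ => hnn j) fun j _ => hle j) (hnn i)) ?_
  exact mul_lt_mul_of_pos_right (by linarith) (by positivity)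

/-- The mass of the powers of the kernel. -/
def kernelMass (L : ℝ) (d n : ℕ) : ℝ := ∫ y in box L, cosKernel L (0 : Space d) y ^ n

/-- The smoothing of the constant `1` has zero derivative because the weak gradient of `1` is zero;
hence the mass does not depend on `x`. This takes the place of translation invariance on the torus.
-/
theorem integral_cosKernel_pow {L : ℝ} (hL : 0 < L) (n : ℕ) (x : Space d) :
    ∫ y in box L, cosKernel L x y ^ n = kernelMass L d n := by
  have hk : ContDiff ℝ ∞ fun z : Space d => (∏ i, (1 + Real.cos (Real.pi * z i / L))) ^ n := by
    refine ContDiff.pow (contDiff_prod fun i _ => ?_) n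
    fun_prop
  obtain ⟨h1, h2⟩ := ((isSeparated_cosKernel (d := d) hL).pow n).integral_spec
    (hk.differentiable (by simp)) (fun x y => by simp [cosKernel])
    (integrableOn_const (volume_box_lt_top L).ne) (isBoxWeak_one hL.le)
  simp only [one_mul, zero_mul, integral_zero] at h1 h2
  refine is_const_of_fderiv_eq_zero (𝕜 := ℝ) (h1.1.differentiable (by simp)) (fun x => ?_) x 0
  refine ContinuousLinearMap.coe_injective
    ((EuclideanSpace.basisFun (Fin d) ℝ).toBasis.ext fun i => ?_)
  simpa using h2 i x

theorem kernelMass_pos {L : ℝ} (hL : 0 < L) (n : ℕ) : 0 < kernelMass L d n := by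
  have hc : Continuous fun y : Space d => cosKernel L (0 : Space d) y ^ n :=
    ((continuous_cosKernel L).comp (by fun_prop : Continuous fun y : Space d => ((0 : Space d), y))).pow n
  refine (setIntegral_pos_iff_support_of_nonneg_ae
    (Eventually.of_forall fun y => pow_nonneg (cosKernel_nonneg _ _ _) _)
    (integrableOn_box_of_continuous hc)).2 ?_
  have hU : IsOpen {x : Space d | ∀ i, x i ∈ Ioo (-L) L} := isOpen_obox L
  have hsub : Function.support (fun y : Space d => cosKernel L (0 : Space d) y ^ n)
      ∩ {x | ∀ i, x i ∈ Ioo (-L) L}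
      ⊆ Function.support (fun y => cosKernel L (0 : Space d) y ^ n) ∩ box L :=
    inter_subset_inter_right _ fun x hx i => Ioo_subset_Ico_self (hx i)
  refine lt_of_lt_of_le ?_ (measure_mono hsub)
  refine (hc.isOpen_support.inter hU).measure_pos _ ⟨0, ?_, fun i => by simp [hL]⟩
  rw [Function.mem_support]
  refine pow_ne_zero _ ?_
  simp [cosKernel]

/-- Smoothing on the box. -/
def boxSmooth (L : ℝ) (n : ℕ) (f : Space d → ℝ) (x : Space d) : ℝ :=
  ∫ y in box L, f y * (cosKernel L x y ^ n * (kernelMass L d n)⁻¹)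

theorem boxSmooth_spec {L : ℝ} (hL : 0 < L) (n : ℕ) {f : Space d → ℝ}
    {g : Fin d → Space d → ℝ} (hf : IntegrableOn f (box L)) (hfg : IsBoxWeak L f g) :
    SmoothPeriodic L (boxSmooth L n f) ∧
    ∀ i x, pd i (boxSmooth L n f) x = boxSmooth L n (g i) x := by
  have hk : ContDiff ℝ ∞ fun z : Space d =>
      (∏ i, (1 + Real.cos (Real.pi * z i / L))) ^ n * (kernelMass L d n)⁻¹ := by
    refine ContDiff.mul (ContDiff.pow (contDiff_prod fun i _ => ?_) n) contDiff_const
    fun_prop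
  exact (((isSeparated_cosKernel (d := d) hL).pow n).mul (.const L _)).integral_spec
    (hk.differentiable (by simp)) (fun x y => by simp [cosKernel]) hf hfg

/-- The smoothing operator applied to an arbitrary integrable function is smooth. -/
theorem boxSmooth_smoothPeriodic {L : ℝ} (hL : 0 < L) (n : ℕ) {f : Space d → ℝ}
    (hf : IntegrableOn f (box L)) : SmoothPeriodic L (boxSmooth L n f) := by
  obtain ⟨ι, _, a, b, ha, hb, hab⟩ :=
    ((isSeparated_cosKernel (d := d) hL).pow n).mul (.const L (kernelMass L d n)⁻¹)
  have h1 : boxSmooth L n f = fun x => ∑ j, a j x * ∫ y in box L, f y * b j y := by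
    ext x
    unfold boxSmooth
    simp_rw [hab, Finset.mul_sum]
    rw [integral_finsetSum]
    · refine Finset.sum_congr rfl fun j _ => ?_
      rw [← integral_const_mul]
      congr 1; ext y; ring
    · intro j _
      refine ((integrable_mul_smooth hf (hb j).1.continuous).const_mul (a j x)).congr
        (Eventually.of_forall fun y => ?_)
      ring
  rw [h1]
  exact SmoothPeriodic.sum fun j => (ha j).mul (.const L _)

/-- The normalized periodic kernel. -/
def boxKernel (L : ℝ) (n : ℕ) (x y : Space d) : ℝ := cosKernel L x y ^ n * (kernelMass L d n)⁻¹

theorem boxKernel_nonneg {L : ℝ} (hL : 0 < L) (n : ℕ) (x y : Space d) :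
    0 ≤ boxKernel L n x y :=
  mul_nonneg (pow_nonneg (cosKernel_nonneg _ _ _) _) (inv_nonneg.2 (kernelMass_pos hL n).le)

theorem boxKernel_symm (L : ℝ) (n : ℕ) (x y : Space d) :
    boxKernel L n x y = boxKernel L n y x := by
  rw [boxKernel, boxKernel, cosKernel_symm]

theorem continuous_boxKernel (L : ℝ) (n : ℕ) :
    Continuous fun z : Space d × Space d => boxKernel L n z.1 z.2 :=
  ((continuous_cosKernel L).pow n).mul continuous_const

theorem continuous_boxKernel_right (L : ℝ) (n : ℕ) (x : Space d) :
    Continuous (boxKernel L n x) :=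
  Continuous.uncurry_left x (continuous_boxKernel L n)

theorem norm_boxKernel_le {L : ℝ} (hL : 0 < L) (n : ℕ) (x y : Space d) :
    ‖boxKernel L n x y‖ ≤ (2 ^ d) ^ n * (kernelMass L d n)⁻¹ := by
  rw [Real.norm_of_nonneg (boxKernel_nonneg hL n x y)]
  exact mul_le_mul_of_nonneg_right
    (pow_le_pow_left₀ (cosKernel_nonneg _ _ _) (cosKernel_le _ _ _) n)
    (inv_nonneg.2 (kernelMass_pos hL n).le)

theorem integral_boxKernel {L : ℝ} (hL : 0 < L) (n : ℕ) (x : Space d) :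
    ∫ y in box L, boxKernel L n x y = 1 := by
  unfold boxKernel
  rw [integral_mul_const, integral_cosKernel_pow hL, mul_inv_cancel₀ (kernelMass_pos hL n).ne']

theorem integrable_mul_boxKernel {L : ℝ} {f : Space d → ℝ} (hf : IntegrableOn f (box L))
    (n : ℕ) (x : Space d) : IntegrableOn (fun y => f y * boxKernel L n x y) (box L) :=
  integrable_mul_smooth hf (continuous_boxKernel_right L n x)

theorem integrable_boxKernel (L : ℝ) (n : ℕ) (x : Space d) :
    IntegrableOn (fun y => boxKernel L n x y) (box L) :=
  integrableOn_box_of_continuous (continuous_boxKernel_right L n x)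

theorem norm_boxSmooth_le {L : ℝ} (hL : 0 < L) (n : ℕ) {f : Space d → ℝ} {M : ℝ}
    (hf : ∀ᵐ x ∂(volume.restrict (box L)), ‖f x‖ ≤ M) (x : Space d) : ‖boxSmooth L n f x‖ ≤ M := by
  calc ‖boxSmooth L n f x‖ ≤ ∫ y in box L, M * boxKernel L n x y := by
        refine norm_integral_le_of_norm_le ((integrable_boxKernel L n x).const_mul M) ?_
        filter_upwards [hf] with y hy
        rw [norm_mul]
        exact mul_le_mul hy (Real.norm_of_nonneg (boxKernel_nonneg hL n x y)).le (norm_nonneg _)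
          ((norm_nonneg _).trans hy)
    _ = M := by rw [integral_const_mul, integral_boxKernel hL, mul_one]

/-- Jensen's inequality for the probability density `boxKernel L n x`: the variance `∫ (f - m)² K`
about the mean `m` is nonnegative. -/
theorem boxSmooth_sq_le {L : ℝ} (hL : 0 < L) (n : ℕ) {f : Space d → ℝ}
    (hf : MemLp f 2 (volume.restrict (box L))) (x : Space d) :
    boxSmooth L n f x ^ 2 ≤ ∫ y in box L, f y ^ 2 * boxKernel L n x y := by
  have hf1 : IntegrableOn f (box L) := hf.integrable (by norm_num)
  set m := boxSmooth L n f x with hm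
  have i1 := integrable_mul_boxKernel hf.integrable_sq n x
  have i2 := integrable_mul_boxKernel hf1 n x
  have i3 := integrable_boxKernel L n x
  have h0 : 0 ≤ ∫ y in box L, (f y - m) ^ 2 * boxKernel L n x y :=
    integral_nonneg fun y => mul_nonneg (sq_nonneg _) (boxKernel_nonneg hL n x y)
  have h1 : ∫ y in box L, (f y - m) ^ 2 * boxKernel L n x y
      = (∫ y in box L, f y ^ 2 * boxKernel L n x y) - 2 * m * m + m ^ 2 := by
    have : ∀ y, (f y - m) ^ 2 * boxKernel L n x y = f y ^ 2 * boxKernel L n x y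
        - 2 * m * (f y * boxKernel L n x y) + m ^ 2 * boxKernel L n x y := fun y => by ring
    simp_rw [this]
    have e1 : IntegrableOn (fun y => 2 * m * (f y * boxKernel L n x y)) (box L) :=
      i2.const_mul (2 * m)
    have e2 : IntegrableOn (fun y => f y ^ 2 * boxKernel L n x y
        - 2 * m * (f y * boxKernel L n x y)) (box L) := i1.sub e1
    rw [integral_add e2 (i3.const_mul _), integral_sub i1 e1, integral_const_mul,
      integral_const_mul, integral_boxKernel hL, mul_one]
    rfl
  nlinarith

theorem memLp_boxSmooth {L : ℝ} (hL : 0 < L) (n : ℕ) {f : Space d → ℝ}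
    (hf : IntegrableOn f (box L)) : MemLp (boxSmooth L n f) 2 (volume.restrict (box L)) := by
  have hc := (boxSmooth_smoothPeriodic hL n hf).1.continuous
  obtain ⟨M, hM⟩ := exists_bound_box L hc
  exact MemLp.of_bound hc.aestronglyMeasurable M
    ((ae_restrict_iff' (measurableSet_box L)).2 (Eventually.of_forall hM))

/-- Integrate Jensen's inequality in `x` and exchange the integrals. By symmetry the kernel also has
mass one in its other variable. -/
theorem eLpNorm_boxSmooth_le {L : ℝ} (hL : 0 < L) (n : ℕ) {f : Space d → ℝ}
    (hf : MemLp f 2 (volume.restrict (box L))) :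
    eLpNorm (boxSmooth L n f) 2 (volume.restrict (box L))
      ≤ eLpNorm f 2 (volume.restrict (box L)) := by
  have hs := memLp_boxSmooth hL n (hf.integrable (by norm_num))
  rw [eLpNorm_two_eq hf, eLpNorm_two_eq hs]
  refine ENNReal.ofReal_le_ofReal (Real.sqrt_le_sqrt ?_)
  have hprod : Integrable (fun z : Space d × Space d => f z.2 ^ 2 * boxKernel L n z.1 z.2)
      ((volume.restrict (box L)).prod (volume.restrict (box L))) :=
    Integrable.mul_bdd (hf.integrable_sq.comp_snd _)
      (continuous_boxKernel L n).aestronglyMeasurable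
      (Eventually.of_forall fun z => norm_boxKernel_le hL n z.1 z.2)
  calc ∫ x in box L, boxSmooth L n f x ^ 2
      ≤ ∫ x in box L, ∫ y in box L, f y ^ 2 * boxKernel L n x y :=
        integral_mono hs.integrable_sq hprod.integral_prod_left fun x => boxSmooth_sq_le hL n hf x
    _ = ∫ y in box L, ∫ x in box L, f y ^ 2 * boxKernel L n x y :=
        integral_integral_swap hprod
    _ = ∫ y in box L, f y ^ 2 := by
        congr 1; ext y
        rw [integral_const_mul]
        simp_rw [boxKernel_symm L n _ y]
        rw [integral_boxKernel hL, mul_one]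

/-- Normalized powers of a nonnegative continuous function with a unique maximum concentrate at that
maximum, here the diagonal point `x`. -/
theorem tendsto_boxSmooth_of_continuous {L : ℝ} (hL : 0 < L) {h : Space d → ℝ}
    (hh : Continuous h) {x : Space d} (hx : ∀ i, x i ∈ Ioo (-L) L) :
    Tendsto (fun n => boxSmooth L n h x) atTop (𝓝 (h x)) := by
  have hsub : {x : Space d | ∀ i, x i ∈ Ioo (-L) L} ⊆ cbox L :=
    fun y hy i => Ioo_subset_Icc_self (hy i)
  have hxc : x ∈ interior (cbox L) := interior_maximal hsub (isOpen_obox L) hx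
  have hck : Continuous (cosKernel L x) := Continuous.uncurry_left x (continuous_cosKernel L)
  have h1 := tendsto_setIntegral_pow_smul_of_unique_maximum_of_isCompact_of_continuousOn
    (μ := volume) (isCompact_cbox L) (c := cosKernel L x) (x₀ := x) (g := h) hck.continuousOn
    (fun y hy hyx => cosKernel_lt hL hx hy hyx) (fun y _ => cosKernel_nonneg L x y)
    (by simp [cosKernel]) (subset_closure hxc) hh.continuousOn
  refine h1.congr fun n => ?_
  rw [← setIntegral_congr_set (box_ae_eq_cbox L), ← setIntegral_congr_set (box_ae_eq_cbox L),
    integral_cosKernel_pow hL, boxSmooth, smul_eq_mul, ← integral_const_mul]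
  congr 1; ext y; simp only [smul_eq_mul]; ring

theorem boxSmooth_sub (L : ℝ) (n : ℕ) {f g : Space d → ℝ} (hf : IntegrableOn f (box L))
    (hg : IntegrableOn g (box L)) (x : Space d) :
    boxSmooth L n (fun x => f x - g x) x = boxSmooth L n f x - boxSmooth L n g x := by
  have := integral_sub (integrable_mul_boxKernel hf n x) (integrable_mul_boxKernel hg n x)
  simp_rw [← sub_mul] at this
  exact this

/-- Density argument: the convergence holds for bounded continuous functions by dominated
convergence, and smoothing is a contraction of `L²`, so an approximation error is not enlarged. -/
theorem tendsto_boxSmooth {L : ℝ} (hL : 0 < L) {f : Space d → ℝ}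
    (hf : MemLp f 2 (volume.restrict (box L))) :
    Tendsto (fun n => eLpNorm (fun x => f x - boxSmooth L n f x) 2 (volume.restrict (box L)))
      atTop (𝓝 0) := by
  rw [ENNReal.tendsto_atTop_zero]
  intro ε hε
  have hε3 : ε / 3 ≠ 0 := by simp [hε.ne']
  obtain ⟨h, hh, hhm⟩ := hf.exists_boundedContinuous_eLpNorm_sub_le (by simp) hε3
  have hhi : IntegrableOn h (box L) := hhm.integrable (by norm_num)
  have hfi : IntegrableOn f (box L) := hf.integrable (by norm_num)
  have hfh : MemLp (fun x => f x - h x) 2 (volume.restrict (box L)) := hf.sub hhm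
  have hlim : Tendsto (fun n => eLpNorm (fun x => boxSmooth L n h x - h x) 2
      (volume.restrict (box L))) atTop (𝓝 0) := by
    refine tendsto_eLpNorm_two_of_dominated (h := fun _ => ‖h‖) (memLp_const _)
      (fun n => (memLp_boxSmooth hL n hhi).1) hhm.1
      (fun n => Eventually.of_forall fun x =>
        norm_boxSmooth_le hL n (Eventually.of_forall fun y => h.norm_coe_le_norm y) x)
      (Eventually.of_forall fun y => h.norm_coe_le_norm y) ?_
    filter_upwards [ae_mem_obox L] with x hx
    exact tendsto_boxSmooth_of_continuous hL h.continuous hx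
  obtain ⟨N, hN⟩ := ENNReal.tendsto_atTop_zero.1 hlim (ε / 3) (pos_iff_ne_zero.2 hε3)
  refine ⟨N, fun n hn => ?_⟩
  have e1 : (fun x => f x - boxSmooth L n f x) = (fun x => f x - h x)
      - (boxSmooth L n (fun x => f x - h x)) - (fun x => boxSmooth L n h x - h x) := by
    ext x
    simp only [Pi.sub_apply, boxSmooth_sub L n hfi hhi]
    ring
  have m1 := memLp_boxSmooth hL n (hfh.integrable (by norm_num))
  rw [e1]
  calc _ ≤ eLpNorm ((fun x => f x - h x) - boxSmooth L n (fun x => f x - h x)) 2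
          (volume.restrict (box L)) + eLpNorm (fun x => boxSmooth L n h x - h x) 2
          (volume.restrict (box L)) :=
        eLpNorm_sub_le (hfh.sub m1).1 ((memLp_boxSmooth hL n hhi).sub hhm).1 (by norm_num)
    _ ≤ (ε / 3 + ε / 3) + ε / 3 := by
        refine add_le_add ((eLpNorm_sub_le hfh.1 m1.1 (by norm_num)).trans (add_le_add hh ?_))
          (hN n hn)
        exact (eLpNorm_boxSmooth_le hL n hfh).trans hh
    _ = ε := ENNReal.add_thirds ε

/-- Square integrable functions with square integrable weak gradient on the torus are limits of
smooth periodic functions. -/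
theorem IsBoxWeak.exists_seq {L : ℝ} (hL : 0 < L) {f : Space d → ℝ} {g : Fin d → Space d → ℝ}
    (hfg : IsBoxWeak L f g) (hf : MemLp f 2 (volume.restrict (box L)))
    (hg : ∀ i, MemLp (g i) 2 (volume.restrict (box L))) :
    ∃ φ : ℕ → Space d → ℝ, (∀ n, SmoothPeriodic L (φ n)) ∧
      Tendsto (fun n => eLpNorm (fun x => f x - φ n x) 2 (volume.restrict (box L))) atTop (𝓝 0) ∧
      ∀ i, Tendsto (fun n => eLpNorm (fun x => g i x - pd i (φ n) x) 2
        (volume.restrict (box L))) atTop (𝓝 0) := by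
  have hfi : IntegrableOn f (box L) := hf.integrable (by norm_num)
  refine ⟨fun n => boxSmooth L n f, fun n => (boxSmooth_spec hL n hfi hfg).1,
    tendsto_boxSmooth hL hf, fun i => ?_⟩
  simp_rw [fun n => (boxSmooth_spec hL n hfi hfg).2 i]
  exact tendsto_boxSmooth hL (hg i)

/-- An integrable function orthogonal to all smooth periodic functions vanishes. -/
theorem ae_eq_zero_of_integral_smoothPeriodic {L : ℝ} (hL : 0 < L) {h : Space d → ℝ}
    (hh : IntegrableOn h (box L))
    (H : ∀ φ, SmoothPeriodic L φ → ∫ x in box L, h x * φ x = 0) :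
    ∀ᵐ x ∂(volume.restrict (box L)), h x = 0 := by
  -- A measurable version of the sign of `h`, equal to `0` where the chosen representative of `h`
  -- vanishes. Its smoothings are bounded by `1` and converge almost everywhere along a subsequence,
  -- so that `0 = ∫ h wₙ → ∫ |h|`.
  set w : Space d → ℝ := fun x => hh.1.mk h x / |hh.1.mk h x| with hw
  have hwm : Measurable w := by
    have := hh.1.stronglyMeasurable_mk.measurable
    exact this.div this.abs
  have hwb : ∀ x, ‖w x‖ ≤ 1 := by
    intro x
    simp only [hw, norm_div, Real.norm_eq_abs, abs_abs]
    exact div_self_le_one _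
  have hw2 : MemLp w 2 (volume.restrict (box L)) :=
    MemLp.of_bound hwm.aestronglyMeasurable 1 (Eventually.of_forall hwb)
  have hwi : IntegrableOn w (box L) := hw2.integrable (by norm_num)
  have hm : TendstoInMeasure (volume.restrict (box L)) (fun n => boxSmooth L n w) atTop w := by
    refine tendstoInMeasure_of_tendsto_eLpNorm (p := 2) (by simp)
      (fun n => (memLp_boxSmooth hL n hwi).1) hw2.1 ?_
    refine (tendsto_boxSmooth hL hw2).congr fun n => ?_
    rw [← eLpNorm_neg]; congr 1; ext x; simp
  obtain ⟨ns, -, hns⟩ := hm.exists_seq_tendsto_ae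
  have hlim : Tendsto (fun k => ∫ x in box L, h x * boxSmooth L (ns k) w x) atTop
      (𝓝 (∫ x in box L, h x * w x)) := by
    refine tendsto_integral_of_dominated_convergence (fun x => ‖h x‖)
      (fun k => hh.1.mul (memLp_boxSmooth hL (ns k) hwi).1) hh.norm (fun k => ?_) ?_
    · refine Eventually.of_forall fun x => ?_
      rw [norm_mul]
      exact mul_le_of_le_one_right (norm_nonneg _)
        (norm_boxSmooth_le hL _ (Eventually.of_forall hwb) x)
    · filter_upwards [hns] with x hx using hx.const_mul (h x)
  simp_rw [fun n => H _ (boxSmooth_smoothPeriodic hL n hwi)] at hlim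
  have h0 : ∫ x in box L, ‖h x‖ = 0 := by
    rw [← tendsto_nhds_unique hlim tendsto_const_nhds]
    refine integral_congr_ae ?_
    filter_upwards [hh.1.ae_eq_mk] with x hx
    simp only [hw]
    rw [← hx, Real.norm_eq_abs]
    rcases eq_or_ne (h x) 0 with h0 | h0
    · simp [h0]
    · have := abs_pos.2 h0
      field_simp
      rw [sq_abs]
  have := (integral_eq_zero_iff_of_nonneg (fun x => norm_nonneg _) hh.norm).1 h0
  filter_upwards [this] with x hx using by simpa using hx

/-! ### Cutoff functions in a bounded domain -/

/-- A smooth function approximating the indicator function of a set, at scale `1/N`. -/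
theorem exists_smooth_cutoff {F : Set (Space d)} {N : ℝ} (hN : 0 < N) :
    ∃ η : Space d → ℝ, ContDiff ℝ ∞ η ∧ (∀ x, ‖η x‖ ≤ 1) ∧ (∀ x, ‖fderiv ℝ η x‖ ≤ N) ∧
      (∀ x, 3 / N ≤ Metric.infDist x F → η x = 1) ∧
      (∀ x, Metric.infDist x F ≤ 1 / (2 * N) → η x = 0) := by
  set δ : Space d → ℝ := fun x => Metric.infDist x F with hδ
  have hδL : ∀ x y, |δ x - δ y| ≤ dist x y := fun x y => by
    have := (Metric.lipschitz_infDist_pt F).dist_le_mul x y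
    simpa [Real.dist_eq] using this
  -- A clamped multiple of the distance: `0` up to distance `1/N`, `1` from distance `2/N` on, with
  -- Lipschitz constant `N`. Mollification at radius `1/(4N)` keeps the Lipschitz constant, and the
  -- thresholds `1/(2N)` and `3/N` of the statement leave room for that radius.
  set g : Space d → ℝ := fun x => max 0 (min 1 (N * δ x - 1)) with hg
  have hgL : ∀ x y, |g x - g y| ≤ N * dist x y := by
    intro x y
    have h1 : |g x - g y| ≤ |(N * δ x - 1) - (N * δ y - 1)| := by
      refine (abs_max_sub_max_le_max _ _ _ _).trans (max_le (by simp) ?_)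
      exact (abs_min_sub_min_le_max _ _ _ _).trans (max_le (by simp) le_rfl)
    refine h1.trans ?_
    rw [show (N * δ x - 1) - (N * δ y - 1) = N * (δ x - δ y) by ring, abs_mul, abs_of_pos hN]
    exact mul_le_mul_of_nonneg_left (hδL x y) hN.le
  have hg1 : ∀ x, ‖g x‖ ≤ 1 := fun x => by
    rw [Real.norm_of_nonneg (le_max_left _ _)]
    exact max_le zero_le_one (min_le_left _ _)
  have hgc : Continuous g := by
    have : Continuous δ := Metric.continuous_infDist_pt F
    fun_prop
  let φ : ContDiffBump (0 : Space d) :=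
    ⟨1 / (8 * N), 1 / (4 * N), by positivity, by
      rw [div_lt_div_iff₀ (by positivity) (by positivity)]; linarith⟩
  have hrad : φ.rOut = 1 / (4 * N) := rfl
  set k : Space d → ℝ := φ.normed volume with hk
  have hki : Integrable k := φ.integrable_normed
  have hkg : ∀ x, Integrable fun t => k t * g (x - t) := fun x =>
    hki.mul_bdd (c := 1) (hgc.comp (continuous_const.sub continuous_id)).aestronglyMeasurable
      (Eventually.of_forall fun t => hg1 _)
  set η : Space d → ℝ := fun x => ∫ t, k t * g (x - t) with hη
  have hηconv : η = convolution k g (ContinuousLinearMap.lsmul ℝ ℝ) volume := by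
    ext x; simp [hη, convolution]
  have hconst : ∀ x c, (∀ y ∈ Metric.ball x (1 / (4 * N)), g y = c) → η x = c := by
    intro x c h
    have hx : g x = c := h x (Metric.mem_ball_self (by positivity))
    rw [hηconv, hk, φ.normed_convolution_eq_right (fun y hy => by rw [h y hy, hx]), hx]
  have hLip : LipschitzWith ⟨N, hN.le⟩ η := by
    refine LipschitzWith.of_dist_le_mul fun x y => ?_
    rw [Real.dist_eq, hη, ← integral_sub (hkg x) (hkg y), ← Real.norm_eq_abs]
    calc _ ≤ ∫ t, k t * (N * dist x y) := by
          refine norm_integral_le_of_norm_le (hki.mul_const _) (Eventually.of_forall fun t => ?_)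
          rw [← mul_sub, norm_mul, Real.norm_of_nonneg (φ.nonneg_normed t)]
          refine mul_le_mul_of_nonneg_left ?_ (φ.nonneg_normed t)
          have := hgL (x - t) (y - t)
          rwa [dist_sub_right] at this
      _ = N * dist x y := by rw [integral_mul_const, φ.integral_normed, one_mul]
  refine ⟨η, ?_, fun x => ?_, fun x => norm_fderiv_le_of_lipschitz ℝ hLip, fun x hx => ?_,
    fun x hx => ?_⟩
  · rw [hηconv]
    exact HasCompactSupport.contDiff_convolution_left (n := ⊤) _ φ.hasCompactSupport_normed
      φ.contDiff_normed hgc.locallyIntegrable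
  · calc ‖η x‖ ≤ ∫ t, k t := by
          refine norm_integral_le_of_norm_le hki (Eventually.of_forall fun t => ?_)
          rw [norm_mul, Real.norm_of_nonneg (φ.nonneg_normed t)]
          exact mul_le_of_le_one_right (φ.nonneg_normed t) (hg1 _)
      _ = 1 := φ.integral_normed
  · refine hconst x 1 fun y hy => ?_
    have h1 := (abs_le.1 (hδL y x)).1
    have h2 := (Metric.mem_ball.1 hy).le
    have h3 : 2 ≤ N * δ y := by
      have : 3 / N - 1 / (4 * N) ≤ δ y := by linarith
      have h4 : N * (3 / N - 1 / (4 * N)) ≤ N * δ y := mul_le_mul_of_nonneg_left this hN.le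
      have h5 : N * (3 / N - 1 / (4 * N)) = 3 - 1 / 4 := by field_simp
      linarith
    simp only [hg]
    rw [min_eq_left (by linarith), max_eq_right zero_le_one]
  · refine hconst x 0 fun y hy => ?_
    have h1 := (abs_le.1 (hδL y x)).2
    have h2 := (Metric.mem_ball.1 hy).le
    have h3 : N * δ y ≤ 1 := by
      have : δ y ≤ 1 / (2 * N) + 1 / (4 * N) := by linarith
      have h4 : N * δ y ≤ N * (1 / (2 * N) + 1 / (4 * N)) := mul_le_mul_of_nonneg_left this hN.le
      have h5 : N * (1 / (2 * N) + 1 / (4 * N)) = 3 / 4 := by field_simp; norm_num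
      linarith
    simp only [hg]
    exact max_eq_left ((min_le_right _ _).trans (by linarith))

/-- The ball about `x` whose radius is the distance to the complement lies in `Ω`, and a nearest
point `y` of the complement lies in its closure and on `∂Ω`. The mean value inequality on this
convex ball, extended by continuity to `y` where `V` vanishes, gives the bound. No regularity of
`∂Ω` enters. -/
theorem norm_le_mul_infDist {X : Type*} [NormedAddCommGroup X] [NormedSpace ℝ X]
    {Ω : Set (Space d)} (hΩ : IsOpen Ω) (hne : (Ωᶜ).Nonempty) {V : Space d → X} {L : ℝ}
    (hV : ∀ x ∈ Ω, DifferentiableAt ℝ V x) (hL : ∀ x ∈ Ω, ‖fderiv ℝ V x‖ ≤ L)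
    (hc : ContinuousOn V (closure Ω)) (h0 : ∀ x ∈ frontier Ω, V x = 0) {x : Space d}
    (hx : x ∈ Ω) : ‖V x‖ ≤ L * Metric.infDist x Ωᶜ := by
  set r := Metric.infDist x Ωᶜ with hr
  have hrpos : 0 < r := (hΩ.isClosed_compl.notMem_iff_infDist_pos hne).1 (by simpa using hx)
  obtain ⟨y, hy, hxy⟩ := hΩ.isClosed_compl.exists_infDist_eq_dist hne x
  have hball : Metric.ball x r ⊆ Ω := Metric.ball_infDist_compl_subset
  have hycl : y ∈ closure (Metric.ball x r) := by
    rw [closure_ball x hrpos.ne', Metric.mem_closedBall, dist_comm, ← hxy]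
  have hyc : y ∈ closure Ω := closure_mono hball hycl
  have hyf : y ∈ frontier Ω := ⟨hyc, by rwa [hΩ.interior_eq]⟩
  have hlip : ∀ z ∈ Metric.ball x r, ‖V z - V x‖ ≤ L * r := by
    intro z hz
    refine ((convex_ball x r).norm_image_sub_le_of_norm_fderiv_le
      (fun w hw => hV w (hball hw)) (fun w hw => hL w (hball hw))
      (Metric.mem_ball_self hrpos) hz).trans ?_
    refine mul_le_mul_of_nonneg_left ?_ ((norm_nonneg _).trans (hL x hx))
    rw [← dist_eq_norm]; exact (Metric.mem_ball.1 hz).le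
  have : (𝓝[Metric.ball x r] y).NeBot := mem_closure_iff_nhdsWithin_neBot.1 hycl
  have hlim : Tendsto (fun z => ‖V z - V x‖) (𝓝[Metric.ball x r] y) (𝓝 ‖V y - V x‖) :=
    (((hc y hyc).mono (hball.trans subset_closure)).tendsto.sub_const _).norm
  have := le_of_tendsto hlim (eventually_mem_nhdsWithin.mono hlip)
  rwa [h0 y hyf, zero_sub, norm_neg] at this

namespace FluidDomain

variable {D : FluidDomain d}

theorem isOpen_space (hD : D.IsAdmissible) : IsOpen D.space := by
  cases D with
  | torus => exact isOpen_univ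
  | dirichlet Ω => exact hD.1

theorem cell_subset_space : D.cell ⊆ D.space := by
  cases D with
  | torus => exact subset_univ _
  | dirichlet Ω => exact subset_rfl

theorem measurableSet_cell (hD : D.IsAdmissible) : MeasurableSet D.cell := by
  cases D with
  | torus => exact measurableSet_box 1
  | dirichlet Ω => exact hD.1.measurableSet

/-- The cell is contained in a compact subset of the closure of the space. -/
theorem exists_compact_cell (hD : D.IsAdmissible) :
    ∃ K, IsCompact K ∧ D.cell ⊆ K ∧ K ⊆ closure D.space := by
  cases D with
  | torus => exact ⟨cbox 1, isCompact_cbox 1, box_subset_cbox 1, by simp [space]⟩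
  | dirichlet Ω => exact ⟨closure Ω, hD.2.2.isCompact_closure, subset_closure, subset_rfl⟩

theorem volume_cell_lt_top (hD : D.IsAdmissible) : volume D.cell < ⊤ := by
  obtain ⟨K, hK, h, -⟩ := D.exists_compact_cell hD
  exact (measure_mono h).trans_lt hK.measure_lt_top

theorem isFiniteMeasure_cell (hD : D.IsAdmissible) : IsFiniteMeasure (volume.restrict D.cell) :=
  ⟨by simpa using D.volume_cell_lt_top hD⟩

/-- `C^1` test functions of space. -/
def C1Test (D : FluidDomain d) (φ : Space d → ℝ) : Prop :=
  ContDiff ℝ 1 φ ∧ D.PeriodicOn φ ∧ D.CompactSupp φ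

theorem SmoothTest.c1Test {φ : Space d → ℝ} (h : D.SmoothTest φ) : D.C1Test φ :=
  ⟨h.1.of_le (by simp), h.2⟩

theorem integral_pd_eq_zero {ψ : Space d → ℝ} (hψ : D.C1Test ψ) (i : Fin d) :
    ∫ x in D.cell, pd i ψ x = 0 := by
  cases D with
  | torus =>
    refine integral_box_pd_eq_zero zero_le_one hψ.1 (fun x j => ?_) i
    rw [mul_one]; exact hψ.2.1 x j
  | dirichlet Ω =>
    obtain ⟨h1, -, h2, h3⟩ := hψ
    have hc : Continuous (pd i ψ) :=
      (h1.continuous_fderiv one_ne_zero).clm_apply continuous_const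
    have hs : HasCompactSupport (pd i ψ) := h2.fderiv_apply ℝ _
    have : ∫ x in Ω, pd i ψ x = ∫ x, pd i ψ x := by
      refine setIntegral_eq_integral_of_forall_compl_eq_zero fun x hx => ?_
      have : fderiv ℝ ψ x = 0 := by
        by_contra h
        exact hx (h3 (support_fderiv_subset ℝ h))
      simp [pd, this]
    change ∫ x in Ω, pd i ψ x = 0
    rw [this]
    have := integral_mul_fderiv_eq_neg_fderiv_mul_of_integrable (μ := volume)
      (f := fun _ : Space d => (1 : ℝ)) (g := ψ) (v := EuclideanSpace.single i 1)
      (by simp) (by simpa using hc.integrable_of_hasCompactSupport hs)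
      (by simpa using h1.continuous.integrable_of_hasCompactSupport h2)
      (fun x _ => differentiableAt_const _) (fun x _ => h1.differentiable one_ne_zero x)
    simpa using this

theorem compactSupp_mul_left {φ ψ : Space d → ℝ} (h : D.CompactSupp φ) :
    D.CompactSupp fun x => φ x * ψ x := by
  cases D with
  | torus => trivial
  | dirichlet Ω => exact ⟨h.1.mul_right, tsupport_mul_subset_left.trans h.2⟩

theorem periodicOn_mul {φ ψ : Space d → ℝ} (h : D.PeriodicOn φ) (h' : D.PeriodicOn ψ) :
    D.PeriodicOn fun x => φ x * ψ x := by
  cases D with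
  | torus => intro x i; simp only [h x i, h' x i]
  | dirichlet Ω => trivial

theorem SmoothTest.mul {φ ψ : Space d → ℝ} (h : D.SmoothTest φ) (h' : ContDiff ℝ ∞ ψ)
    (hp : D.PeriodicOn ψ) : D.SmoothTest fun x => φ x * ψ x :=
  ⟨h.1.mul h', periodicOn_mul h.2.1 hp, compactSupp_mul_left h.2.2⟩

/-- The product of a smooth test function and a function that is `C^1` inside the domain. -/
theorem C1Test.mul (hD : D.IsAdmissible) {φ V : Space d → ℝ} (h : D.C1Test φ)
    (hV : ContDiffOn ℝ 1 V D.space) (hp : D.PeriodicOn V) : D.C1Test fun x => φ x * V x := by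
  refine ⟨?_, periodicOn_mul h.2.1 hp, compactSupp_mul_left h.2.2⟩
  cases D with
  | torus => exact h.1.mul (contDiffOn_univ.1 hV)
  | dirichlet Ω =>
    rw [contDiff_iff_contDiffAt]
    intro x
    by_cases hx : x ∈ tsupport φ
    · exact h.1.contDiffAt.mul (hV.contDiffAt (hD.1.mem_nhds (h.2.2.2 hx)))
    · refine (contDiffAt_const (c := (0 : ℝ))).congr_of_eventuallyEq ?_
      filter_upwards [(isClosed_tsupport φ).isOpen_compl.mem_nhds hx] with y hy
      rw [image_eq_zero_of_notMem_tsupport hy, zero_mul]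

/-- A sequence of cutoff functions. -/
structure IsCutoff (D : FluidDomain d) (η : ℕ → Space d → ℝ) : Prop where
  test : ∀ n, D.SmoothTest (η n)
  norm_le : ∀ n x, ‖η n x‖ ≤ 1
  eventually_one : ∀ K ⊆ D.space, IsCompact K → ∀ᶠ n in atTop, ∀ x ∈ K, η n =ᶠ[𝓝 x] fun _ => 1
  mul_fderiv_le : ∀ (V : Space d → ℝ) (L : ℝ), (∀ x ∈ D.space, DifferentiableAt ℝ V x) →
    (∀ x ∈ D.cell, ‖fderiv ℝ V x‖ ≤ L) → ContinuousOn V (closure D.space) →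
    (∀ x ∈ D.bdry, V x = 0) → ∀ n, ∀ x ∈ D.cell, ‖V x‖ * ‖fderiv ℝ (η n) x‖ ≤ 3 * L

/-- On the torus the constant `1` serves. In a bounded domain the cutoffs depend on the distance to
the complement at scale `1/(n+1)`. -/
theorem exists_isCutoff (hd : 0 < d) (D : FluidDomain d) (hD : D.IsAdmissible) :
    ∃ η, D.IsCutoff η := by
  cases D with
  | torus =>
    refine ⟨fun _ _ => 1, ⟨fun _ => ⟨contDiff_const, fun _ _ => rfl, trivial⟩, fun _ _ => by simp,
      fun K _ _ => Eventually.of_forall fun n x _ => EventuallyEq.rfl, ?_⟩⟩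
    intro V L _ hL _ _ n x hx
    have := (norm_nonneg _).trans (hL x hx)
    simpa using this
  | dirichlet Ω =>
    obtain ⟨hΩ, hΩc, hΩb⟩ := hD
    -- The distance to an empty complement would be `0` by convention. Positive dimension makes the
    -- whole space unbounded, which excludes this.
    have hne : (Ωᶜ).Nonempty := by
      have : Nonempty (Fin d) := ⟨⟨0, hd⟩⟩
      rw [nonempty_compl]
      rintro rfl
      exact NormedSpace.unbounded_univ ℝ (Space d) hΩb
    have hN : ∀ n : ℕ, (0 : ℝ) < n + 1 := fun n => by positivity
    choose η h1 h2 h3 h4 h5 using fun n : ℕ => exists_smooth_cutoff (F := Ωᶜ) (hN n)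
    have hcont : Continuous fun x : Space d => Metric.infDist x Ωᶜ :=
      Metric.continuous_infDist_pt Ωᶜ
    have hone : ∀ (n : ℕ) x, 3 / ((n : ℝ) + 1) < Metric.infDist x Ωᶜ → η n =ᶠ[𝓝 x] fun _ => 1 := by
      intro n x hx
      filter_upwards [hcont.continuousAt.eventually (lt_mem_nhds hx)] with y hy
      exact h4 n y hy.le
    refine ⟨η, ⟨fun n => ⟨h1 n, trivial, ?_⟩, h2, fun K hK hKc => ?_, ?_⟩⟩
    · have hsub : tsupport (η n) ⊆ {x | 1 / (2 * ((n : ℝ) + 1)) ≤ Metric.infDist x Ωᶜ} := by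
        refine closure_minimal (fun x hx => ?_) (isClosed_le continuous_const hcont)
        by_contra h
        exact hx (h5 n x (le_of_not_ge h))
      have hsub' : tsupport (η n) ⊆ Ω := fun x hx => by
        have h0 : 0 < Metric.infDist x Ωᶜ := lt_of_lt_of_le (by positivity) (hsub hx)
        simpa using (hΩ.isClosed_compl.notMem_iff_infDist_pos hne).2 h0
      exact ⟨Metric.isCompact_of_isClosed_isBounded (isClosed_tsupport _) (hΩb.subset hsub'), hsub'⟩
    · rcases K.eq_empty_or_nonempty with rfl | hKne
      · simp
      obtain ⟨x₀, hx₀, hmin⟩ := hKc.exists_isMinOn hKne hcont.continuousOn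
      have hpos : 0 < Metric.infDist x₀ Ωᶜ :=
        (hΩ.isClosed_compl.notMem_iff_infDist_pos hne).1 (by simpa [space] using hK hx₀)
      have hlim : Tendsto (fun n : ℕ => 3 / ((n : ℝ) + 1)) atTop (𝓝 0) :=
        tendsto_const_nhds.div_atTop (tendsto_atTop_add_const_right _ _ tendsto_natCast_atTop_atTop)
      filter_upwards [hlim.eventually (gt_mem_nhds hpos)] with n hn x hx
      exact hone n x (hn.trans_le (hmin hx))
    · intro V L hV hL hc h0 n x hx
      have hLnn := (norm_nonneg _).trans (hL x hx)
      by_cases hlt : 3 / ((n : ℝ) + 1) < Metric.infDist x Ωᶜ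
      · rw [(hone n x hlt).fderiv_eq]
        simp only [fderiv_fun_const, Pi.zero_apply, norm_zero, mul_zero]
        positivity
      · push Not at hlt
        -- Near the boundary `|V| ≤ 3L/(n+1)` compensates `|∇η n| ≤ n + 1`; the product does not
        -- depend on `n`.
        calc ‖V x‖ * ‖fderiv ℝ (η n) x‖ ≤ (L * (3 / ((n : ℝ) + 1))) * (n + 1) := by
              refine mul_le_mul ((norm_le_mul_infDist hΩ hne hV hL hc h0 hx).trans ?_) (h3 n x)
                (norm_nonneg _) (by positivity)
              exact mul_le_mul_of_nonneg_left hlt hLnn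
          _ = 3 * L := by field_simp

theorem IsCutoff.tendsto_one {η : ℕ → Space d → ℝ} (hη : D.IsCutoff η) {x : Space d}
    (hx : x ∈ D.space) : ∀ᶠ n in atTop, η n =ᶠ[𝓝 x] fun _ => 1 := by
  filter_upwards [hη.eventually_one {x} (by simpa using hx) isCompact_singleton] with n hn
  exact hn x rfl

end FluidDomain

/-! ### Calculus of `L²` convergence -/

/-- Convergence in `L²(μ)`. -/
def TendstoL2 {α : Type*} [MeasurableSpace α] (μ : Measure α) (u : ℕ → α → ℝ) (f : α → ℝ) : Prop :=
  Tendsto (fun n => eLpNorm (fun x => f x - u n x) 2 μ) atTop (𝓝 0)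

theorem TendstoL2.of_le {α : Type*} [MeasurableSpace α] {μ : Measure α} {u v : ℕ → α → ℝ}
    {f g : α → ℝ} (h : TendstoL2 μ u f) (M : ℝ)
    (hle : ∀ n, ∀ᵐ x ∂μ, ‖g x - v n x‖ ≤ M * ‖f x - u n x‖) : TendstoL2 μ v g := by
  have h1 : Tendsto (fun n => ENNReal.ofReal M * eLpNorm (fun x => f x - u n x) 2 μ) atTop
      (𝓝 (ENNReal.ofReal M * 0)) := ENNReal.Tendsto.const_mul h (Or.inr ENNReal.ofReal_ne_top)
  rw [mul_zero] at h1
  exact tendsto_of_tendsto_of_tendsto_of_le_of_le tendsto_const_nhds h1 (fun _ => zero_le)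
    fun n => eLpNorm_le_mul_eLpNorm_of_ae_le_mul (hle n) 2

theorem TendstoL2.add {α : Type*} [MeasurableSpace α] {μ : Measure α} {u v : ℕ → α → ℝ}
    {f g : α → ℝ} (hf : TendstoL2 μ u f) (hg : TendstoL2 μ v g)
    (hfm : ∀ n, AEStronglyMeasurable (fun x => f x - u n x) μ)
    (hgm : ∀ n, AEStronglyMeasurable (fun x => g x - v n x) μ) :
    TendstoL2 μ (fun n x => u n x + v n x) (fun x => f x + g x) := by
  have h1 := Tendsto.add hf hg
  rw [add_zero] at h1
  refine tendsto_of_tendsto_of_tendsto_of_le_of_le tendsto_const_nhds h1 (fun _ => zero_le)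
    fun n => ?_
  refine (le_of_eq ?_).trans (eLpNorm_add_le (hfm n) (hgm n) (by norm_num))
  congr 1; ext x; simp only [Pi.add_apply]; ring

theorem TendstoL2.mul_bdd {α : Type*} [MeasurableSpace α] {μ : Measure α} {u : ℕ → α → ℝ}
    {f : α → ℝ} (h : TendstoL2 μ u f) {ψ : α → ℝ} {M : ℝ} (hψ : ∀ᵐ x ∂μ, ‖ψ x‖ ≤ M) :
    TendstoL2 μ (fun n x => u n x * ψ x) fun x => f x * ψ x := by
  refine h.of_le M fun n => ?_
  filter_upwards [hψ] with x hx
  rw [← sub_mul, norm_mul, mul_comm]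
  exact mul_le_mul_of_nonneg_right hx (norm_nonneg _)

theorem TendstoL2.comp_tendsto {α : Type*} [MeasurableSpace α] {μ : Measure α} {u : ℕ → α → ℝ}
    {f : α → ℝ} (h : TendstoL2 μ u f) {ns : ℕ → ℕ} (hns : Tendsto ns atTop atTop) :
    TendstoL2 μ (fun n => u (ns n)) f :=
  Tendsto.comp (g := fun n => eLpNorm (fun x => f x - u n x) 2 μ) h hns

theorem TendstoL2.exists_seq_ae {α : Type*} [MeasurableSpace α] {μ : Measure α} {u : ℕ → α → ℝ}
    {f : α → ℝ} (h : TendstoL2 μ u f) (hu : ∀ n, AEStronglyMeasurable (u n) μ)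
    (hf : AEStronglyMeasurable f μ) :
    ∃ ns : ℕ → ℕ, StrictMono ns ∧ ∀ᵐ x ∂μ, Tendsto (fun k => u (ns k) x) atTop (𝓝 (f x)) := by
  refine (tendstoInMeasure_of_tendsto_eLpNorm (p := 2) (by simp) hu hf ?_).exists_seq_tendsto_ae
  refine h.congr fun n => ?_
  rw [← eLpNorm_neg]; congr 1; ext x; simp

theorem memLp_mul_bdd {α : Type*} [MeasurableSpace α] {μ : Measure α} {f ψ : α → ℝ} {M : ℝ}
    (hf : MemLp f 2 μ) (hψ : AEStronglyMeasurable ψ μ) (hM : ∀ᵐ x ∂μ, ‖ψ x‖ ≤ M) :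
    MemLp (fun x => f x * ψ x) 2 μ := by
  refine MemLp.of_le_mul (c := M) hf (hf.1.mul hψ) ?_
  filter_upwards [hM] with x hx
  rw [norm_mul, mul_comm]
  exact mul_le_mul_of_nonneg_right hx (norm_nonneg _)

/-! ### Sobolev functions, cutoffs and approximation by test functions -/

namespace FluidDomain

variable {D : FluidDomain d}

/-- Square integrable functions with a square integrable weak gradient. -/
structure IsSobolev (D : FluidDomain d) (f : Space d → ℝ) (g : Fin d → Space d → ℝ) : Prop where
  mem : MemLp f 2 (volume.restrict D.cell)
  grad_mem : ∀ i, MemLp (g i) 2 (volume.restrict D.cell)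
  weak : ∀ i, D.IsWeakPartial i f (g i)

theorem IsW012.exists_seq {f : Space d → ℝ} {g : Fin d → Space d → ℝ} (h : D.IsW012 f g) :
    ∃ φ : ℕ → Space d → ℝ, (∀ n, D.SmoothTest (φ n)) ∧
      TendstoL2 (volume.restrict D.cell) φ f ∧
      ∀ i, TendstoL2 (volume.restrict D.cell) (fun n => pd i (φ n)) (g i) := by
  have hpos : ∀ n : ℕ, 0 < ((n : ℝ≥0∞))⁻¹ := fun n => by simp
  choose φ h1 h2 h3 using fun n => h _ (hpos n)
  exact ⟨φ, h1,
    tendsto_of_tendsto_of_tendsto_of_le_of_le tendsto_const_nhds ENNReal.tendsto_inv_nat_nhds_zero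
      (fun _ => zero_le) fun n => (h2 n).le,
    fun i => tendsto_of_tendsto_of_tendsto_of_le_of_le tendsto_const_nhds
      ENNReal.tendsto_inv_nat_nhds_zero (fun _ => zero_le) fun n => (h3 n i).le⟩

theorem IsW012.of_seq {f : Space d → ℝ} {g : Fin d → Space d → ℝ} {φ : ℕ → Space d → ℝ}
    (h1 : ∀ n, D.SmoothTest (φ n)) (h2 : TendstoL2 (volume.restrict D.cell) φ f)
    (h3 : ∀ i, TendstoL2 (volume.restrict D.cell) (fun n => pd i (φ n)) (g i)) :
    D.IsW012 f g := by
  intro ε hε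
  have e1 := h2.eventually (gt_mem_nhds hε)
  have e2 : ∀ᶠ n in atTop, ∀ i, _ := eventually_all.2 fun i => (h3 i).eventually (gt_mem_nhds hε)
  obtain ⟨n, hn1, hn2⟩ := (e1.and e2).exists
  exact ⟨φ n, h1 n, hn1, hn2⟩

/-- Functions that are `C^1` inside the domain and bounded together with their derivatives. -/
structure BddC1 (D : FluidDomain d) (ψ : Space d → ℝ) : Prop where
  contDiffOn : ContDiffOn ℝ 1 ψ D.space
  periodic : D.PeriodicOn ψ
  bound : ∃ M, ∀ x ∈ D.cell, ‖ψ x‖ ≤ M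
  fderiv_bound : ∃ M, ∀ x ∈ D.cell, ‖fderiv ℝ ψ x‖ ≤ M

theorem norm_pd_le (i : Fin d) (ψ : Space d → ℝ) (x : Space d) : ‖pd i ψ x‖ ≤ ‖fderiv ℝ ψ x‖ := by
  simpa using (fderiv ℝ ψ x).le_opNorm (EuclideanSpace.single i 1)

theorem BddC1.pd_bound {ψ : Space d → ℝ} (h : D.BddC1 ψ) :
    ∃ M, ∀ i, ∀ x ∈ D.cell, ‖pd i ψ x‖ ≤ M := by
  obtain ⟨M, hM⟩ := h.fderiv_bound
  exact ⟨M, fun i x hx => (norm_pd_le i ψ x).trans (hM x hx)⟩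

theorem exists_bound_cell (hD : D.IsAdmissible) {X : Type*} [NormedAddCommGroup X]
    {ψ : Space d → X} (h : ContinuousOn ψ (closure D.space)) : ∃ M, ∀ x ∈ D.cell, ‖ψ x‖ ≤ M := by
  obtain ⟨K, hK, h1, h2⟩ := D.exists_compact_cell hD
  obtain ⟨M, hM⟩ := hK.exists_bound_of_continuousOn (h.mono h2)
  exact ⟨M, fun x hx => hM x (h1 hx)⟩

theorem C1Test.bddC1 (hD : D.IsAdmissible) {ψ : Space d → ℝ} (h : D.C1Test ψ) : D.BddC1 ψ :=
  ⟨h.1.contDiffOn, h.2.1, exists_bound_cell hD h.1.continuous.continuousOn,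
    exists_bound_cell hD (h.1.continuous_fderiv one_ne_zero).continuousOn⟩

theorem aesm_of_continuousOn (hD : D.IsAdmissible) {X : Type*} [NormedAddCommGroup X]
    [SecondCountableTopologyEither (Space d) X] {ψ : Space d → X} (h : ContinuousOn ψ D.space) :
    AEStronglyMeasurable ψ (volume.restrict D.cell) :=
  (h.mono cell_subset_space).aestronglyMeasurable (measurableSet_cell hD)

theorem ae_cell {P : Space d → Prop} (hD : D.IsAdmissible) (h : ∀ x ∈ D.cell, P x) :
    ∀ᵐ x ∂(volume.restrict D.cell), P x :=
  (ae_restrict_iff' (measurableSet_cell hD)).2 (Eventually.of_forall h)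

theorem BddC1.continuousOn_pd (hD : D.IsAdmissible) {ψ : Space d → ℝ} (h : D.BddC1 ψ)
    (i : Fin d) : ContinuousOn (pd i ψ) D.space :=
  (h.contDiffOn.continuousOn_fderiv_of_isOpen (isOpen_space hD) le_rfl).clm_apply
    continuousOn_const

theorem BddC1.differentiableAt (hD : D.IsAdmissible) {ψ : Space d → ℝ} (h : D.BddC1 ψ)
    {x : Space d} (hx : x ∈ D.cell) : DifferentiableAt ℝ ψ x :=
  (h.contDiffOn.differentiableOn one_ne_zero).differentiableAt
    ((isOpen_space hD).mem_nhds (cell_subset_space hx))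

theorem BddC1.memLp (hD : D.IsAdmissible) {ψ : Space d → ℝ} (h : D.BddC1 ψ) :
    MemLp ψ 2 (volume.restrict D.cell) := by
  have := isFiniteMeasure_cell hD
  obtain ⟨M, hM⟩ := h.bound
  exact MemLp.of_bound (aesm_of_continuousOn hD h.contDiffOn.continuousOn) M (ae_cell hD hM)

theorem BddC1.memLp_pd (hD : D.IsAdmissible) {ψ : Space d → ℝ} (h : D.BddC1 ψ) (i : Fin d) :
    MemLp (pd i ψ) 2 (volume.restrict D.cell) := by
  have := isFiniteMeasure_cell hD
  obtain ⟨M, hM⟩ := h.pd_bound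
  exact MemLp.of_bound (aesm_of_continuousOn hD (h.continuousOn_pd hD i)) M (ae_cell hD (hM i))

theorem pd_mul {φ ψ : Space d → ℝ} {x : Space d} (hφ : DifferentiableAt ℝ φ x)
    (hψ : DifferentiableAt ℝ ψ x) (i : Fin d) :
    pd i (fun x => φ x * ψ x) x = pd i φ x * ψ x + φ x * pd i ψ x := by
  simp only [pd]
  rw [fderiv_fun_mul hφ hψ]
  simp; ring

/-- The product `η φ` is an admissible test function even if `φ` is not compactly supported. Hence
`η f`, extended by zero, has the weak gradient `η ∇f + f ∇η` on any larger box. -/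
theorem IsSobolev.integral_cutoff (hD : D.IsAdmissible) {f : Space d → ℝ}
    {g : Fin d → Space d → ℝ} (h : D.IsSobolev f g)
    {η : Space d → ℝ} (hη : D.SmoothTest η) {φ : Space d → ℝ} (hφ : ContDiff ℝ ∞ φ)
    (hp : D.PeriodicOn φ) (i : Fin d) :
    ∫ x in D.cell, η x * f x * pd i φ x
      = - ∫ x in D.cell, (η x * g i x + pd i η x * f x) * φ x := by
  have := isFiniteMeasure_cell hD
  have hs := hη.mul hφ hp
  have h1 := h.weak i _ hs
  have hη1 := hη.c1Test.bddC1 hD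
  have hb := hs.c1Test.bddC1 hD
  obtain ⟨M, hM⟩ := exists_bound_cell hD hφ.continuous.continuousOn
  have hφm : AEStronglyMeasurable φ (volume.restrict D.cell) := hφ.continuous.aestronglyMeasurable
  have e1 : Integrable (fun x => f x * pd i (fun x => η x * φ x) x) (volume.restrict D.cell) :=
    h.mem.integrable_mul (hb.memLp_pd hD i)
  have e2 : Integrable (fun x => f x * (pd i η x * φ x)) (volume.restrict D.cell) :=
    h.mem.integrable_mul (memLp_mul_bdd (hη1.memLp_pd hD i) hφm (ae_cell hD hM))
  have e3 : Integrable (fun x => g i x * (η x * φ x)) (volume.restrict D.cell) :=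
    (h.grad_mem i).integrable_mul (hb.memLp hD)
  calc ∫ x in D.cell, η x * f x * pd i φ x
      = ∫ x in D.cell, (f x * pd i (fun x => η x * φ x) x - f x * (pd i η x * φ x)) := by
        congr 1; ext x
        rw [pd_mul (hη.1.differentiable (by simp) x) (hφ.differentiable (by simp) x)]
        ring
    _ = - ((∫ x in D.cell, g i x * (η x * φ x)) + ∫ x in D.cell, f x * (pd i η x * φ x)) := by
        rw [integral_sub e1 e2, h1]; ring
    _ = _ := by
        rw [← integral_add e3 e2]
        congr 2; ext x; ring

theorem IsSobolev.cutoff_mem (hD : D.IsAdmissible) {f : Space d → ℝ}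
    {g : Fin d → Space d → ℝ} (h : D.IsSobolev f g) {η : Space d → ℝ} (hη : D.SmoothTest η) :
    MemLp (fun x => η x * f x) 2 (volume.restrict D.cell) ∧
    ∀ i, MemLp (fun x => η x * g i x + pd i η x * f x) 2 (volume.restrict D.cell) := by
  have hη1 := hη.c1Test.bddC1 hD
  obtain ⟨M, hM⟩ := hη1.bound
  obtain ⟨M', hM'⟩ := hη1.pd_bound
  have hηm : AEStronglyMeasurable η (volume.restrict D.cell) := hη.1.continuous.aestronglyMeasurable
  refine ⟨?_, fun i => MemLp.add ?_ ?_⟩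
  · simpa only [mul_comm] using memLp_mul_bdd h.mem hηm (ae_cell hD hM)
  · simpa only [mul_comm] using memLp_mul_bdd (h.grad_mem i) hηm (ae_cell hD hM)
  · simpa only [mul_comm] using memLp_mul_bdd h.mem (hη1.memLp_pd hD i).1 (ae_cell hD (hM' i))

/-- Cut-off Sobolev functions are limits of smooth test functions. -/
theorem IsSobolev.isW012_cutoff (hd : 0 < d) (hD : D.IsAdmissible) {f : Space d → ℝ}
    {g : Fin d → Space d → ℝ} (h : D.IsSobolev f g) {η : Space d → ℝ} (hη : D.SmoothTest η) :
    D.IsW012 (fun x => η x * f x) (fun i x => η x * g i x + pd i η x * f x) := by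
  obtain ⟨m1, m2⟩ := h.cutoff_mem hD hη
  have hw := fun i φ hφ hp => h.integral_cutoff hD hη (φ := φ) hφ hp i
  cases D with
  | torus =>
    have hb : IsBoxWeak 1 (fun x => η x * f x) (fun i x => η x * g i x + pd i η x * f x) :=
      fun i φ hφ => hw i φ hφ.1 (fun x j => by simpa using hφ.2 x j)
    obtain ⟨φ, h1, h2, h3⟩ := hb.exists_seq one_pos m1 m2
    exact IsW012.of_seq (φ := φ)
      (fun n => ⟨(h1 n).1, fun x j => by simpa using (h1 n).2 x j, trivial⟩) h2 h3
  | dirichlet Ω =>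
    have hΩm : MeasurableSet Ω := hD.1.measurableSet
    obtain ⟨r, hr⟩ := hD.2.2.subset_closedBall 0
    -- The bounded domain is placed inside a half-open box; the summand `1` keeps it off the faces.
    -- The cut-off function, extended by zero, is then a periodic Sobolev function, and the periodic
    -- smoothing applies.
    set L : ℝ := |r| + 1 with hLdef
    have hL : 0 < L := by positivity
    have hsub : Ω ⊆ box L := by
      intro x hx i
      have h1 : ‖x‖ ≤ r := by simpa using hr hx
      have h2 : |x i| ≤ |r| := (PiLp.norm_apply_le x i).trans (h1.trans (le_abs_self r))
      have := abs_le.1 h2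
      exact ⟨by linarith, by linarith⟩
    have hind : ∀ u w : Space d → ℝ, ∫ x in box L, Ω.indicator u x * w x = ∫ x in Ω, u x * w x := by
      intro u w
      have : (fun x => Ω.indicator u x * w x) = Ω.indicator fun x => u x * w x := by
        ext x; by_cases hx : x ∈ Ω <;> simp [hx]
      rw [this, setIntegral_indicator hΩm, inter_eq_right.2 hsub]
    have mem : ∀ u : Space d → ℝ, MemLp u 2 (volume.restrict Ω) →
        MemLp (Ω.indicator u) 2 (volume.restrict (box L)) := fun u hu =>
      ((memLp_indicator_iff_restrict hΩm).2 hu).restrict _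
    have hb : IsBoxWeak L (Ω.indicator fun x => η x * f x)
        (fun i => Ω.indicator fun x => η x * g i x + pd i η x * f x) := by
      intro i φ hφ
      rw [hind, hind]
      exact hw i φ hφ.1 trivial
    obtain ⟨Φ, h1, h2, h3⟩ := hb.exists_seq hL (mem _ m1) (fun i => mem _ (m2 i))
    have toΩ : ∀ {u : Space d → ℝ} {v : ℕ → Space d → ℝ},
        TendstoL2 (volume.restrict (box L)) v (Ω.indicator u) →
        TendstoL2 (volume.restrict Ω) v u := by
      intro u v huv
      refine tendsto_of_tendsto_of_tendsto_of_le_of_le tendsto_const_nhds huv (fun _ => zero_le)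
        fun n => ?_
      refine (le_of_eq ?_).trans (eLpNorm_mono_measure _ (Measure.restrict_mono hsub le_rfl))
      refine eLpNorm_congr_ae ((ae_restrict_iff' hΩm).2 (Eventually.of_forall fun x hx => ?_))
      simp [hx]
    -- The smoothed functions are not supported in `Ω`. Multiplication by a cutoff `ζ` equal to `1`
    -- near the support of `η` repairs this without changing the limit, since `∇ζ` vanishes where `η
    -- f` lives.
    obtain ⟨ζs, hζs⟩ := exists_isCutoff hd (dirichlet Ω) hD
    obtain ⟨ζ, hζ, hn₀⟩ : ∃ ζ, (dirichlet Ω).SmoothTest ζ ∧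
        ∀ x ∈ tsupport η, ζ =ᶠ[𝓝 x] fun _ => 1 := by
      obtain ⟨n₀, hn₀⟩ := (hζs.eventually_one (tsupport η) hη.2.2.2 hη.2.2.1).exists
      exact ⟨ζs n₀, hζs.test n₀, hn₀⟩
    have hζ1 := hζ.c1Test.bddC1 hD
    obtain ⟨B, hB⟩ := hζ1.bound
    obtain ⟨B', hB'⟩ := hζ1.pd_bound
    have f1 : ∀ x, η x * f x * ζ x = η x * f x := by
      intro x
      by_cases hx : x ∈ tsupport η
      · rw [(hn₀ x hx).eq_of_nhds, mul_one]
      · rw [image_eq_zero_of_notMem_tsupport hx]; simp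
    have f2 : ∀ i x, η x * f x * pd i ζ x = 0 := by
      intro i x
      by_cases hx : x ∈ tsupport η
      · simp [pd, (hn₀ x hx).fderiv_eq]
      · rw [image_eq_zero_of_notMem_tsupport hx]; simp
    have f3 : ∀ i x, (η x * g i x + pd i η x * f x) * ζ x = η x * g i x + pd i η x * f x := by
      intro i x
      by_cases hx : x ∈ tsupport η
      · rw [(hn₀ x hx).eq_of_nhds, mul_one]
      · have h4 : fderiv ℝ η x = 0 := by
          by_contra h
          exact hx (support_fderiv_subset ℝ h)
        rw [image_eq_zero_of_notMem_tsupport hx]; simp [pd, h4]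
    have c1 := toΩ h2
    have c2 := fun i => toΩ (h3 i)
    refine IsW012.of_seq (φ := fun n x => ζ x * Φ n x)
      (fun n => hζ.mul (h1 n).1 trivial) ?_ fun i => ?_
    · have := c1.mul_bdd (ae_cell (D := dirichlet Ω) hD hB)
      simp only [f1] at this
      refine Tendsto.congr (fun n => ?_) this
      congr 1; ext x; ring
    · have e1 := (c2 i).mul_bdd (ae_cell (D := dirichlet Ω) hD hB)
      have e2 := c1.mul_bdd (ae_cell (D := dirichlet Ω) hD (hB' i))
      have hΦm : ∀ n, AEStronglyMeasurable (Φ n) (volume.restrict Ω) := fun n =>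
        (h1 n).1.continuous.aestronglyMeasurable
      have hΦm' : ∀ n, AEStronglyMeasurable (pd i (Φ n)) (volume.restrict Ω) := fun n =>
        (((h1 n).1.continuous_fderiv (by simp)).clm_apply continuous_const).aestronglyMeasurable
      have hζm : AEStronglyMeasurable ζ (volume.restrict Ω) := hζ.1.continuous.aestronglyMeasurable
      have e3 := e1.add e2 (fun n => ((m2 i).1.mul hζm).sub ((hΦm' n).mul hζm))
        (fun n => (m1.1.mul (hζ1.memLp_pd hD i).1).sub ((hΦm n).mul (hζ1.memLp_pd hD i).1))
      simp only [f3, f2, add_zero] at e3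
      refine Tendsto.congr (fun n => ?_) e3
      congr 1; ext x
      change _ = _ - pd i (fun x => ζ x * Φ n x) x
      rw [pd_mul (hζ.1.differentiable (by simp) x) ((h1 n).1.differentiable (by simp) x)]
      ring

/-- An integrable function orthogonal to all smooth test functions vanishes. -/
theorem ae_eq_zero_of_integral_smoothTest (hD : D.IsAdmissible) {h : Space d → ℝ}
    (hh : IntegrableOn h D.cell) (H : ∀ φ, D.SmoothTest φ → ∫ x in D.cell, h x * φ x = 0) :
    ∀ᵐ x ∂(volume.restrict D.cell), h x = 0 := by
  cases D with
  | torus =>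
    refine ae_eq_zero_of_integral_smoothPeriodic one_pos hh fun φ hφ => ?_
    exact H φ ⟨hφ.1, fun x j => by simpa using hφ.2 x j, trivial⟩
  | dirichlet Ω =>
    have := hD.1.ae_eq_zero_of_integral_contDiff_smul_eq_zero hh.locallyIntegrableOn
      (fun φ h1 h2 h3 => by
        have h4 := H φ ⟨h1, trivial, h2, h3⟩
        rw [← h4, eq_comm]
        rw [setIntegral_eq_integral_of_forall_compl_eq_zero fun x hx => ?_]
        · congr 1; ext x; rw [smul_eq_mul, mul_comm]
        · rw [image_eq_zero_of_notMem_tsupport (fun h => hx (h3 h)), mul_zero])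
    exact (ae_restrict_iff' hD.1.measurableSet).2 this

end FluidDomain

theorem integral_mul_eq_inner {α : Type*} [MeasurableSpace α] {μ : Measure α} {a b : α → ℝ}
    (ha : MemLp a 2 μ) (hb : MemLp b 2 μ) :
    ∫ x, a x * b x ∂μ = inner ℝ (ha.toLp a) (hb.toLp b) := by
  rw [L2.inner_def]
  refine integral_congr_ae ?_
  filter_upwards [ha.coeFn_toLp, hb.coeFn_toLp] with x h1 h2
  rw [h1, h2]; simp [mul_comm]

theorem integrable_mul_L2 {α : Type*} [MeasurableSpace α] {μ : Measure α} {a b : α → ℝ}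
    (ha : MemLp a 2 μ) (hb : MemLp b 2 μ) : Integrable (fun x => a x * b x) μ :=
  ha.integrable_mul hb

theorem abs_integral_mul_le {α : Type*} [MeasurableSpace α] {μ : Measure α} {a b : α → ℝ}
    (ha : MemLp a 2 μ) (hb : MemLp b 2 μ) :
    |∫ x, a x * b x ∂μ| ≤ (eLpNorm a 2 μ).toReal * (eLpNorm b 2 μ).toReal := by
  rw [integral_mul_eq_inner ha hb]
  refine (abs_real_inner_le_norm _ _).trans ?_
  rw [Lp.norm_toLp, Lp.norm_toLp]

/-! ### The potential -/

/-- Truncation to `[-1,1]`. -/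
def clip (c : ℝ) : ℝ := max (-1) (min 1 c)

/-- Values and slopes of the three branches match at `±1`, so the one-sided derivatives glue. The
truncation gives one formula for all branches and exhibits `F' - 2c` as a bounded function. -/
theorem hasDerivAt_glF (c : ℝ) : HasDerivAt glF (2 * c + (clip c ^ 3 - 3 * clip c)) c := by
  have q1 : ∀ c : ℝ, HasDerivAt (fun c : ℝ => (c + 1) ^ 2) (2 * (c + 1)) c := fun c => by
    have := ((hasDerivAt_id c).add_const (1 : ℝ)).pow 2
    exact this.congr_deriv (by simp)
  have q2 : ∀ c : ℝ, HasDerivAt (fun c : ℝ => (c ^ 2 - 1) ^ 2 / 4) (c ^ 3 - c) c := fun c => by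
    have := ((((hasDerivAt_id c).pow 2).sub_const (1 : ℝ)).pow 2).div_const 4
    refine this.congr_deriv ?_
    simp; ring
  have q3 : ∀ c : ℝ, HasDerivAt (fun c : ℝ => (c - 1) ^ 2) (2 * (c - 1)) c := fun c => by
    have := ((hasDerivAt_id c).sub_const (1 : ℝ)).pow 2
    exact this.congr_deriv (by simp)
  have f1 : ∀ y ≤ (-1 : ℝ), glF y = (y + 1) ^ 2 := fun y hy => by simp [glF, hy]
  have f2 : ∀ y, -1 ≤ y → y ≤ 1 → glF y = (y ^ 2 - 1) ^ 2 / 4 := fun y h1 h2 => by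
    rcases h1.eq_or_lt with rfl | h
    · norm_num [glF]
    · simp [glF, h2, not_le.2 h]
  have f3 : ∀ y, 1 ≤ y → glF y = (y - 1) ^ 2 := fun y h1 => by
    rcases h1.eq_or_lt with rfl | h
    · norm_num [glF]
    · have h2 : ¬ y ≤ -1 := by linarith
      simp [glF, h2, not_le.2 h]
  have glue : ∀ {a D : ℝ} {f g : ℝ → ℝ}, HasDerivAt f D a → HasDerivAt g D a →
      (∀ᶠ y in 𝓝 a, y ≤ a → glF y = f y) → (∀ᶠ y in 𝓝 a, a ≤ y → glF y = g y) →
      HasDerivAt glF D a := by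
    intro a D f g hf hg h1 h2
    have e1 : HasDerivWithinAt glF D (Iic a) a :=
      (hf.hasDerivWithinAt).congr_of_eventuallyEq
        (eventually_nhdsWithin_iff.2 h1) (h1.self_of_nhds le_rfl)
    have e2 : HasDerivWithinAt glF D (Ici a) a :=
      (hg.hasDerivWithinAt).congr_of_eventuallyEq
        (eventually_nhdsWithin_iff.2 h2) (h2.self_of_nhds le_rfl)
    have := e1.union e2
    rwa [Iic_union_Ici, hasDerivWithinAt_univ] at this
  rcases lt_trichotomy c (-1) with h | rfl | h
  · have hc : clip c = -1 := by
      simp only [clip]; rw [min_eq_right (by linarith), max_eq_left h.le]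
    rw [hc]
    refine ((q1 c).congr_deriv (by ring)).congr_of_eventuallyEq ?_
    filter_upwards [gt_mem_nhds h] with y hy using f1 y hy.le
  · have hc : clip (-1) = -1 := by norm_num [clip]
    rw [hc]
    refine glue ((q1 (-1)).congr_deriv (by norm_num)) ((q2 (-1)).congr_deriv (by norm_num))
      (Eventually.of_forall fun y hy => f1 y hy) ?_
    filter_upwards [gt_mem_nhds (show (-1 : ℝ) < 1 by norm_num)] with y hy hy' using f2 y hy' hy.le
  rcases lt_trichotomy c 1 with h' | rfl | h'
  · have hc : clip c = c := by
      simp only [clip]; rw [min_eq_right h'.le, max_eq_right h.le]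
    rw [hc]
    refine ((q2 c).congr_deriv (by ring)).congr_of_eventuallyEq ?_
    filter_upwards [gt_mem_nhds h', lt_mem_nhds h] with y hy hy' using f2 y hy'.le hy.le
  · have hc : clip 1 = 1 := by norm_num [clip]
    rw [hc]
    refine glue ((q2 1).congr_deriv (by norm_num)) ((q3 1).congr_deriv (by norm_num)) ?_
      (Eventually.of_forall fun y hy => f3 y hy)
    filter_upwards [lt_mem_nhds h] with y hy hy' using f2 y hy.le hy'
  · have hc : clip c = 1 := by
      simp only [clip]; rw [min_eq_left h'.le, max_eq_right (by norm_num)]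
    rw [hc]
    refine ((q3 c).congr_deriv (by ring)).congr_of_eventuallyEq ?_
    filter_upwards [lt_mem_nhds h'] with y hy using f3 y hy.le

theorem hasDerivAt_glW (c : ℝ) : HasDerivAt glW (clip c ^ 3 - 3 * clip c) c := by
  have h := (hasDerivAt_glF c).sub ((hasDerivAt_id c).pow 2)
  refine h.congr_deriv ?_
  simp

theorem deriv_glF (c : ℝ) : deriv glF c = 2 * c + deriv glW c := by
  rw [(hasDerivAt_glF c).deriv, (hasDerivAt_glW c).deriv]

theorem continuous_deriv_glW : Continuous (deriv glW) := by
  rw [show deriv glW = fun c => clip c ^ 3 - 3 * clip c from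
    funext fun c => (hasDerivAt_glW c).deriv]
  unfold clip; fun_prop

theorem contDiff_glW : ContDiff ℝ 1 glW :=
  contDiff_one_iff_deriv.2 ⟨fun c => (hasDerivAt_glW c).differentiableAt, continuous_deriv_glW⟩

/-- This bound is the reason for splitting off `c²`: `W` is globally Lipschitz, so its chain rule
needs no more than square integrability, whereas `F'` grows linearly. -/
theorem abs_deriv_glW_le (c : ℝ) : ‖deriv glW c‖ ≤ 2 := by
  rw [(hasDerivAt_glW c).deriv, Real.norm_eq_abs]
  have h1 : -1 ≤ clip c := le_max_left _ _
  have h2 : clip c ≤ 1 := max_le (by norm_num) (min_le_left _ _)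
  rw [abs_le]
  -- With `x = clip c`: `x³ - 3x + 2 = (1 - x)²(x + 2)` and `2 - (x³ - 3x) = (1 + x)²(2 - x)`, both
  -- nonnegative on `[-1,1]`.
  constructor
  · nlinarith [mul_nonneg (sub_nonneg.2 h2) (sub_nonneg.2 h2),
      mul_nonneg (mul_nonneg (sub_nonneg.2 h2) (sub_nonneg.2 h2)) (by linarith : 0 ≤ clip c + 2)]
  · nlinarith [mul_nonneg (mul_nonneg (by linarith : 0 ≤ 1 + clip c) (by linarith : 0 ≤ 1 + clip c))
      (by linarith : 0 ≤ 2 - clip c)]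

theorem lipschitz_glW : LipschitzWith 2 glW :=
  lipschitzWith_of_nnnorm_deriv_le (fun c => (hasDerivAt_glW c).differentiableAt) fun c => by
    have := abs_deriv_glW_le c
    exact_mod_cast this

theorem glF_eq (c : ℝ) : glF c = glW c + c ^ 2 := by simp [glW]

theorem abs_glW_le (c : ℝ) : ‖glW c‖ ≤ 1 + 2 * ‖c‖ := by
  have h := lipschitz_glW.dist_le_mul c 0
  have h0 : glW 0 = 1 / 4 := by norm_num [glW, glF]
  rw [dist_eq_norm, dist_zero_right, h0] at h
  have := norm_le_norm_sub_add (glW c) (1 / 4)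
  norm_num at h this ⊢
  linarith

/-! ### Integration by parts and product rules -/

namespace FluidDomain

variable {D : FluidDomain d}

/-- Sobolev functions that are limits of smooth test functions. -/
structure IsSobolev0 (D : FluidDomain d) (f : Space d → ℝ) (g : Fin d → Space d → ℝ) : Prop where
  mem : MemLp f 2 (volume.restrict D.cell)
  grad_mem : ∀ i, MemLp (g i) 2 (volume.restrict D.cell)
  w012 : D.IsW012 f g

theorem IsSobolev.cutoff (hd : 0 < d) (hD : D.IsAdmissible) {f : Space d → ℝ}
    {g : Fin d → Space d → ℝ} (h : D.IsSobolev f g) {η : Space d → ℝ} (hη : D.SmoothTest η) :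
    D.IsSobolev0 (fun x => η x * f x) (fun i x => η x * g i x + pd i η x * f x) :=
  ⟨(h.cutoff_mem hD hη).1, (h.cutoff_mem hD hη).2, h.isW012_cutoff hd hD hη⟩

/-- On the torus the constant `1` is a cutoff, so every Sobolev function is a limit of test
functions and a zero boundary condition is void; it is a hypothesis only in the Dirichlet case. -/
theorem IsSobolev.isSobolev0 (hd : 0 < d) (hD : D.IsAdmissible) {f : Space d → ℝ}
    {g : Fin d → Space d → ℝ} (h : D.IsSobolev f g)
    (h0 : ∀ Ω, D = dirichlet Ω → D.IsW012 f g) : D.IsSobolev0 f g := by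
  cases D with
  | torus =>
    have := h.cutoff hd hD (η := fun _ => 1) ⟨contDiff_const, fun _ _ => rfl, trivial⟩
    simpa [pd] using this
  | dirichlet Ω => exact ⟨h.mem, h.grad_mem, h0 Ω rfl⟩

/-- A test function equal to `1` where a given test function lives. -/
theorem exists_cutoff_eq_one (hd : 0 < d) (hD : D.IsAdmissible) {ψ : Space d → ℝ}
    (hψ : D.C1Test ψ) : ∃ η, D.SmoothTest η ∧ ∀ x ∈ D.cell,
      (η x = 1 ∧ ∀ i, pd i η x = 0) ∨ (ψ x = 0 ∧ ∀ i, pd i ψ x = 0) := by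
  cases D with
  | torus =>
    exact ⟨fun _ => 1, ⟨contDiff_const, fun _ _ => rfl, trivial⟩,
      fun x _ => Or.inl ⟨rfl, fun i => by simp [pd]⟩⟩
  | dirichlet Ω =>
    obtain ⟨ζ, hζ⟩ := exists_isCutoff hd (dirichlet Ω) hD
    obtain ⟨n, hn⟩ := (hζ.eventually_one (tsupport ψ) hψ.2.2.2 hψ.2.2.1).exists
    refine ⟨ζ n, hζ.test n, fun x _ => ?_⟩
    by_cases hx : x ∈ tsupport ψ
    · exact Or.inl ⟨(hn x hx).eq_of_nhds, fun i => by simp [pd, (hn x hx).fderiv_eq]⟩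
    · have h4 : fderiv ℝ ψ x = 0 := by
        by_contra h
        exact hx (support_fderiv_subset ℝ h)
      exact Or.inr ⟨image_eq_zero_of_notMem_tsupport hx, fun i => by simp [pd, h4]⟩

theorem SmoothTest.c1Test_mul (hD : D.IsAdmissible) {φ ψ : Space d → ℝ} (h : D.SmoothTest φ)
    (hψ : D.BddC1 ψ) : D.C1Test fun x => φ x * ψ x :=
  h.c1Test.mul hD hψ.contDiffOn hψ.periodic

theorem integrable_mul_bdd {f ψ : Space d → ℝ} {M : ℝ} (hD : D.IsAdmissible)
    (hf : IntegrableOn f D.cell) (hψ : AEStronglyMeasurable ψ (volume.restrict D.cell))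
    (hM : ∀ x ∈ D.cell, ‖ψ x‖ ≤ M) : IntegrableOn (fun x => f x * ψ x) D.cell :=
  Integrable.mul_bdd (c := M) hf hψ (ae_cell hD hM)

theorem C1Test.integral_mul_pd (hD : D.IsAdmissible) {φ ψ : Space d → ℝ} (h : D.C1Test φ)
    (hψ : D.BddC1 ψ) (i : Fin d) :
    ∫ x in D.cell, (pd i φ x * ψ x + φ x * pd i ψ x) = 0 := by
  rw [← integral_pd_eq_zero (h.mul hD hψ.contDiffOn hψ.periodic) i]
  refine setIntegral_congr_fun (measurableSet_cell hD) fun x hx => ?_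
  exact (pd_mul (h.1.differentiable one_ne_zero x) (hψ.differentiableAt hD hx) i).symm

/-- Integration by parts against functions that are `C^1` up to the boundary. -/
theorem IsSobolev0.integral_mul_pd (hD : D.IsAdmissible) {f : Space d → ℝ}
    {g : Fin d → Space d → ℝ} (h : D.IsSobolev0 f g) {ψ : Space d → ℝ} (hψ : D.BddC1 ψ)
    (i : Fin d) : ∫ x in D.cell, f x * pd i ψ x = - ∫ x in D.cell, g i x * ψ x := by
  obtain ⟨φ, h1, h2, h3⟩ := h.w012.exists_seq
  have hφ : ∀ n, D.BddC1 (φ n) := fun n => (h1 n).c1Test.bddC1 hD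
  have c1 := tendsto_integral_mul_of_L2 (fun n => (hφ n).memLp hD) (fun _ => hψ.memLp_pd hD i)
    h.mem (hψ.memLp_pd hD i) h2 (by simp)
  have c2 := tendsto_integral_mul_of_L2 (fun n => (hφ n).memLp_pd hD i) (fun _ => hψ.memLp hD)
    (h.grad_mem i) (hψ.memLp hD) (h3 i) (by simp)
  have c3 := c1.add c2
  refine eq_neg_of_add_eq_zero_left (tendsto_nhds_unique c3 (tendsto_const_nhds.congr fun n => ?_))
  rw [← (h1 n).c1Test.integral_mul_pd hD hψ i, integral_add, add_comm]
  · exact ((hφ n).memLp_pd hD i).integrable_mul (hψ.memLp hD)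
  · exact ((hφ n).memLp hD).integrable_mul (hψ.memLp_pd hD i)

/-- The product rule for limits of smooth test functions. -/
theorem IsSobolev0.integral_mul_mul_pd (hD : D.IsAdmissible) {f h : Space d → ℝ}
    {g k : Fin d → Space d → ℝ} (hf : D.IsSobolev0 f g) (hh : D.IsSobolev0 h k)
    {ψ : Space d → ℝ} (hψ : D.BddC1 ψ) (i : Fin d) :
    ∫ x in D.cell, f x * h x * pd i ψ x
      = - ∫ x in D.cell, (g i x * h x + f x * k i x) * ψ x := by
  -- Only `h` is approximated. For a test function `φ n`, the product `φ n ψ` is admissible in the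
  -- integration by parts for `f`, and each of the three resulting integrals pairs a fixed `L²`
  -- function with a convergent one.
  obtain ⟨φ, h1, h2, h3⟩ := hh.w012.exists_seq
  have hφ : ∀ n, D.BddC1 (φ n) := fun n => (h1 n).c1Test.bddC1 hD
  obtain ⟨M, hM⟩ := hψ.bound
  obtain ⟨M', hM'⟩ := hψ.pd_bound
  have aψ := ae_cell hD hM
  have aψ' := ae_cell hD (hM' i)
  have mψ : AEStronglyMeasurable ψ (volume.restrict D.cell) := (hψ.memLp hD).1
  have mψ' := (hψ.memLp_pd hD i).1
  have c1 := tendsto_integral_mul_of_L2 (fun _ => hf.mem)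
    (fun n => memLp_mul_bdd ((hφ n).memLp hD) mψ' aψ') hf.mem (memLp_mul_bdd hh.mem mψ' aψ')
    (by simp) (h2.mul_bdd aψ')
  have c2 := tendsto_integral_mul_of_L2 (fun _ => hf.mem)
    (fun n => memLp_mul_bdd ((hφ n).memLp_pd hD i) mψ aψ) hf.mem
    (memLp_mul_bdd (hh.grad_mem i) mψ aψ) (by simp) ((h3 i).mul_bdd aψ)
  have c3 := tendsto_integral_mul_of_L2 (fun _ => hf.grad_mem i)
    (fun n => memLp_mul_bdd ((hφ n).memLp hD) mψ aψ) (hf.grad_mem i)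
    (memLp_mul_bdd hh.mem mψ aψ) (by simp) (h2.mul_bdd aψ)
  have i1 := integrable_mul_L2 hf.mem (memLp_mul_bdd hh.mem mψ' aψ')
  have i2 := integrable_mul_L2 hf.mem (memLp_mul_bdd (hh.grad_mem i) mψ aψ)
  have i3 := integrable_mul_L2 (hf.grad_mem i) (memLp_mul_bdd hh.mem mψ aψ)
  have key := tendsto_nhds_unique ((c1.add c2).add c3)
    (tendsto_const_nhds (x := (0 : ℝ)).congr fun n => ?_)
  · rw [add_assoc] at key
    have e1 : ∫ x in D.cell, f x * h x * pd i ψ x = ∫ x in D.cell, f x * (h x * pd i ψ x) := by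
      congr 1; ext x; ring
    have e2 : ∫ x in D.cell, (g i x * h x + f x * k i x) * ψ x
        = (∫ x in D.cell, f x * (k i x * ψ x)) + ∫ x in D.cell, g i x * (h x * ψ x) := by
      rw [← integral_add i2 i3]; congr 1; ext x; ring
    rw [e1, e2]; linarith
  · have hb : D.BddC1 fun x => φ n x * ψ x := ((h1 n).c1Test_mul hD hψ).bddC1 hD
    have h4 := hf.integral_mul_pd hD hb i
    have j1 := integrable_mul_L2 hf.mem (memLp_mul_bdd ((hφ n).memLp hD) mψ' aψ')
    have j2 := integrable_mul_L2 hf.mem (memLp_mul_bdd ((hφ n).memLp_pd hD i) mψ aψ)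
    have h5 : ∫ x in D.cell, f x * pd i (fun x => φ n x * ψ x) x
        = (∫ x in D.cell, f x * (φ n x * pd i ψ x)) + ∫ x in D.cell, f x * (pd i (φ n) x * ψ x) := by
      rw [← integral_add j1 j2]
      refine setIntegral_congr_fun (measurableSet_cell hD) fun x hx => ?_
      rw [pd_mul ((h1 n).1.differentiable (by simp) x) (hψ.differentiableAt hD hx)]
      ring
    linarith

/-- Integration by parts of weakly differentiable functions against `C^1` test functions. -/
theorem IsSobolev.integral_mul_pd (hd : 0 < d) (hD : D.IsAdmissible) {f : Space d → ℝ}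
    {g : Fin d → Space d → ℝ} (h : D.IsSobolev f g) {ψ : Space d → ℝ} (hψ : D.C1Test ψ)
    (i : Fin d) : ∫ x in D.cell, f x * pd i ψ x = - ∫ x in D.cell, g i x * ψ x := by
  obtain ⟨η, hη, hη1⟩ := exists_cutoff_eq_one hd hD hψ
  have h1 := (h.cutoff hd hD hη).integral_mul_pd hD (hψ.bddC1 hD) i
  refine (setIntegral_congr_fun (measurableSet_cell hD) fun x hx => ?_).trans
    (h1.trans (congrArg Neg.neg (setIntegral_congr_fun (measurableSet_cell hD) fun x hx => ?_)))
  all_goals rcases hη1 x hx with ⟨e1, e2⟩ | ⟨e1, e2⟩ <;> simp [e1, e2]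

/-- The product rule for weakly differentiable functions. -/
theorem IsSobolev.integral_mul_mul_pd (hd : 0 < d) (hD : D.IsAdmissible) {f h : Space d → ℝ}
    {g k : Fin d → Space d → ℝ} (hf : D.IsSobolev f g) (hh : D.IsSobolev h k)
    {ψ : Space d → ℝ} (hψ : D.C1Test ψ) (i : Fin d) :
    ∫ x in D.cell, f x * h x * pd i ψ x
      = - ∫ x in D.cell, (g i x * h x + f x * k i x) * ψ x := by
  -- Without a boundary condition on the factors both are replaced by their cut-off versions; since
  -- `η = 1` and `∇η = 0` wherever `ψ` or `∇ψ` is nonzero, none of the integrals changes.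
  obtain ⟨η, hη, hη1⟩ := exists_cutoff_eq_one hd hD hψ
  have h1 := (hf.cutoff hd hD hη).integral_mul_mul_pd hD (hh.cutoff hd hD hη) (hψ.bddC1 hD) i
  refine (setIntegral_congr_fun (measurableSet_cell hD) fun x hx => ?_).trans
    (h1.trans (congrArg Neg.neg (setIntegral_congr_fun (measurableSet_cell hD) fun x hx => ?_)))
  all_goals rcases hη1 x hx with ⟨e1, e2⟩ | ⟨e1, e2⟩ <;> simp [e1, e2]

end FluidDomain

/-! ### Chain rules for the potentials and removal of cutoffs -/

namespace FluidDomain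

variable {D : FluidDomain d}

theorem bddC1_of_contDiff (hD : D.IsAdmissible) {ψ : Space d → ℝ} (h : ContDiff ℝ 1 ψ)
    (hp : D.PeriodicOn ψ) : D.BddC1 ψ :=
  ⟨h.contDiffOn, hp, exists_bound_cell hD h.continuous.continuousOn,
    exists_bound_cell hD (h.continuous_fderiv one_ne_zero).continuousOn⟩

theorem periodicOn_comp {X Y : Type*} {φ : Space d → X} (h : D.PeriodicOn φ) (G : X → Y) :
    D.PeriodicOn fun x => G (φ x) := by
  cases D with
  | torus => intro x i; simp only [h x i]
  | dirichlet Ω => trivial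

theorem aesm_glW {c : Space d → ℝ} (h : AEStronglyMeasurable c (volume.restrict D.cell)) :
    AEStronglyMeasurable (fun x => glW (c x)) (volume.restrict D.cell) :=
  contDiff_glW.continuous.comp_aestronglyMeasurable h

theorem memLp_glW (hD : D.IsAdmissible) {c : Space d → ℝ}
    (h : MemLp c 2 (volume.restrict D.cell)) :
    MemLp (fun x => glW (c x)) 2 (volume.restrict D.cell) := by
  have := isFiniteMeasure_cell hD
  refine MemLp.mono' ((memLp_const (1 : ℝ)).add (h.norm.const_mul 2)) (aesm_glW h.1) ?_
  exact Eventually.of_forall fun x => abs_glW_le _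

theorem memLp_deriv_glW_mul {c g : Space d → ℝ} (h : MemLp c 2 (volume.restrict D.cell))
    (hg : MemLp g 2 (volume.restrict D.cell)) :
    MemLp (fun x => deriv glW (c x) * g x) 2 (volume.restrict D.cell) := by
  have := memLp_mul_bdd hg (continuous_deriv_glW.comp_aestronglyMeasurable h.1)
    (Eventually.of_forall fun x => abs_deriv_glW_le (c x))
  simpa only [mul_comm] using this

/-- Chain rule for `W(c)`, tested with `C^1` functions. -/
theorem IsSobolev0.integral_glW_test (hD : D.IsAdmissible) {c : Space d → ℝ}
    {g : Fin d → Space d → ℝ} (h : D.IsSobolev0 c g) {ψ : Space d → ℝ} (hψ : D.C1Test ψ)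
    (i : Fin d) :
    ∫ x in D.cell, (glW (c x) * pd i ψ x + deriv glW (c x) * g i x * ψ x) = 0 := by
  obtain ⟨φ', h1', h2', h3'⟩ := h.w012.exists_seq
  obtain ⟨ns, hns, hae⟩ := h2'.exists_seq_ae
    (fun n => (h1' n).1.continuous.aestronglyMeasurable) h.mem.1
  obtain ⟨φ, h1, h2, h3, hae⟩ : ∃ φ : ℕ → Space d → ℝ, (∀ n, D.SmoothTest (φ n)) ∧
      TendstoL2 (volume.restrict D.cell) φ c ∧
      TendstoL2 (volume.restrict D.cell) (fun n => pd i (φ n)) (g i) ∧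
      ∀ᵐ x ∂(volume.restrict D.cell), Tendsto (fun k => φ k x) atTop (𝓝 (c x)) :=
    ⟨fun n => φ' (ns n), fun n => h1' _, h2'.comp_tendsto hns.tendsto_atTop,
      (h3' i).comp_tendsto hns.tendsto_atTop, hae⟩
  have hφ : ∀ n, D.BddC1 (φ n) := fun n => (h1 n).c1Test.bddC1 hD
  have hψb := hψ.bddC1 hD
  have mW' : ∀ {c : Space d → ℝ}, AEStronglyMeasurable c (volume.restrict D.cell) →
      AEStronglyMeasurable (fun x => deriv glW (c x)) (volume.restrict D.cell) :=
    fun h => continuous_deriv_glW.comp_aestronglyMeasurable h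
  have l1 : TendstoL2 (volume.restrict D.cell) (fun n x => glW (φ n x)) fun x => glW (c x) :=
    h2.of_le 2 fun n => Eventually.of_forall fun x => by
      have := lipschitz_glW.dist_le_mul (c x) (φ n x)
      rwa [dist_eq_norm, dist_eq_norm] at this
  -- `W'(φₙ)∂φₙ - W'(c)∂c` is split in two: `W'(φₙ)(∂φₙ - ∂c)` is small because `W'` is bounded, and
  -- `(W'(φₙ) - W'(c))∂c` tends to zero by dominated convergence. The second part is why an almost
  -- everywhere convergent subsequence was extracted.
  have l2 : TendstoL2 (volume.restrict D.cell)
      (fun n x => deriv glW (φ n x) * (pd i (φ n) x - g i x)) fun _ => 0 :=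
    h3.of_le 2 fun n => Eventually.of_forall fun x => by
      rw [zero_sub, norm_neg, norm_mul, norm_sub_rev]
      exact mul_le_mul_of_nonneg_right (abs_deriv_glW_le _) (norm_nonneg _)
  have l3 : TendstoL2 (volume.restrict D.cell)
      (fun n x => deriv glW (φ n x) * g i x) fun x => deriv glW (c x) * g i x := by
    have := tendsto_eLpNorm_two_of_dominated (μ := volume.restrict D.cell)
      (h := fun x => 2 * ‖g i x‖) (u := fun n x => deriv glW (φ n x) * g i x)
      (v := fun x => deriv glW (c x) * g i x) ((h.grad_mem i).norm.const_mul 2)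
      (fun n => (mW' ((hφ n).memLp hD).1).mul (h.grad_mem i).1)
      ((mW' h.mem.1).mul (h.grad_mem i).1) (fun n => Eventually.of_forall fun x => ?_)
      (Eventually.of_forall fun x => ?_) ?_
    · refine Tendsto.congr (fun n => ?_) this
      rw [← eLpNorm_neg]; congr 1; ext x; simp
    · rw [norm_mul]
      exact mul_le_mul_of_nonneg_right (abs_deriv_glW_le _) (norm_nonneg _)
    · rw [norm_mul]
      exact mul_le_mul_of_nonneg_right (abs_deriv_glW_le _) (norm_nonneg _)
    · filter_upwards [hae] with x hx
      exact ((continuous_deriv_glW.tendsto _).comp hx).mul_const _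
  have l4 := l2.add l3
    (fun n => aestronglyMeasurable_const.sub ((mW' ((hφ n).memLp hD).1).mul
      (((hφ n).memLp_pd hD i).1.sub (h.grad_mem i).1)))
    (fun n => ((mW' h.mem.1).mul (h.grad_mem i).1).sub
      ((mW' ((hφ n).memLp hD).1).mul (h.grad_mem i).1))
  simp only [zero_add, ← mul_add, sub_add_cancel] at l4
  have mW := memLp_glW hD h.mem
  have mWg := memLp_deriv_glW_mul h.mem (h.grad_mem i)
  have mWn := fun n => memLp_glW hD ((hφ n).memLp hD)
  have mWgn := fun n => memLp_deriv_glW_mul ((hφ n).memLp hD) ((hφ n).memLp_pd hD i)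
  have c1 := tendsto_integral_mul_of_L2 mWn (fun _ => hψb.memLp_pd hD i) mW (hψb.memLp_pd hD i)
    l1 (by simp)
  have c2 := tendsto_integral_mul_of_L2 mWgn (fun _ => hψb.memLp hD) mWg (hψb.memLp hD)
    l4 (by simp)
  rw [integral_add (integrable_mul_L2 mW (hψb.memLp_pd hD i)) (integrable_mul_L2 mWg (hψb.memLp hD))]
  refine tendsto_nhds_unique (c1.add c2) (tendsto_const_nhds.congr fun n => ?_)
  have hW : ContDiff ℝ 1 fun x => glW (φ n x) := contDiff_glW.comp (h1 n).c1Test.1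
  have hb : D.BddC1 fun x => glW (φ n x) :=
    bddC1_of_contDiff hD hW (periodicOn_comp (h1 n).2.1 glW)
  rw [← hψ.integral_mul_pd hD hb i, ← integral_add
    (integrable_mul_L2 (mWn n) (hψb.memLp_pd hD i)) (integrable_mul_L2 (mWgn n) (hψb.memLp hD))]
  congr 1; ext x
  have : pd i (fun x => glW (φ n x)) x = deriv glW (φ n x) * pd i (φ n) x := by
    have h5 := (contDiff_glW.differentiable one_ne_zero (φ n x)).hasDerivAt.comp_hasFDerivAt x
      ((h1 n).1.differentiable (by simp) x).hasFDerivAt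
    simp only [pd]
    erw [h5.fderiv]
    simp
  rw [this]; ring

/-- Chain rule for `W(c)`, tested with limits of test functions. -/
theorem IsSobolev0.integral_glW (hD : D.IsAdmissible) {c v : Space d → ℝ}
    {g w : Fin d → Space d → ℝ} (h : D.IsSobolev0 c g) (hv : D.IsSobolev0 v w) (i : Fin d) :
    ∫ x in D.cell, (glW (c x) * w i x + deriv glW (c x) * g i x * v x) = 0 := by
  obtain ⟨φ, h1, h2, h3⟩ := hv.w012.exists_seq
  have hφ : ∀ n, D.BddC1 (φ n) := fun n => (h1 n).c1Test.bddC1 hD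
  have mW := memLp_glW hD h.mem
  have mWg := memLp_deriv_glW_mul h.mem (h.grad_mem i)
  have c1 := tendsto_integral_mul_of_L2 (fun _ => mW) (fun n => (hφ n).memLp_pd hD i) mW
    (hv.grad_mem i) (by simp) (h3 i)
  have c2 := tendsto_integral_mul_of_L2 (fun _ => mWg) (fun n => (hφ n).memLp hD) mWg
    hv.mem (by simp) h2
  rw [integral_add (integrable_mul_L2 mW (hv.grad_mem i)) (integrable_mul_L2 mWg hv.mem)]
  refine tendsto_nhds_unique (c1.add c2) (tendsto_const_nhds.congr fun n => ?_)
  rw [← h.integral_glW_test hD (h1 n).c1Test i, integral_add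
    (integrable_mul_L2 mW ((hφ n).memLp_pd hD i)) (integrable_mul_L2 mWg ((hφ n).memLp hD))]

/-- Functions that are `C^1` up to the boundary and vanish there. -/
structure VanishC1 (D : FluidDomain d) (V : Space d → ℝ) : Prop extends D.BddC1 V where
  continuousOn : ContinuousOn V (closure D.space)
  zero : ∀ x ∈ D.bdry, V x = 0

/-- In `∂(ηV) = ∂η V + η ∂V` the first term is bounded by `3L`, since `V` vanishes on the boundary,
and the second by `L`. Uniformity in `n` supplies the dominating function whenever a cutoff is
removed under a derivative. -/
theorem IsCutoff.norm_pd_mul_le (hD : D.IsAdmissible) {η : ℕ → Space d → ℝ} (hη : D.IsCutoff η)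
    {V : Space d → ℝ} (hV : D.VanishC1 V) {L : ℝ} (hL : ∀ x ∈ D.cell, ‖fderiv ℝ V x‖ ≤ L)
    (i : Fin d) (n : ℕ) {x : Space d} (hx : x ∈ D.cell) :
    ‖pd i (fun x => η n x * V x) x‖ ≤ 4 * L := by
  have h1 := hη.mul_fderiv_le V L
    (fun x hx => (hV.contDiffOn.differentiableOn one_ne_zero).differentiableAt
      ((isOpen_space hD).mem_nhds hx)) hL hV.continuousOn hV.zero n x hx
  rw [pd_mul ((hη.test n).1.differentiable (by simp) x) (hV.differentiableAt hD hx)]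
  have h2 : ‖pd i (η n) x * V x‖ ≤ 3 * L := by
    rw [norm_mul, mul_comm]
    exact (mul_le_mul_of_nonneg_left (norm_pd_le i _ x) (norm_nonneg _)).trans h1
  have h3 : ‖η n x * pd i V x‖ ≤ L := by
    rw [norm_mul]
    have h4 := (norm_pd_le i V x).trans (hL x hx)
    exact (mul_le_of_le_one_left (norm_nonneg _) (hη.norm_le n x)).trans h4
  exact (norm_add_le _ _).trans (by linarith)

theorem IsCutoff.eventually_mul_eq {η : ℕ → Space d → ℝ} (hη : D.IsCutoff η)
    (V : Space d → ℝ) {x : Space d} (hx : x ∈ D.cell) :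
    ∀ᶠ n in atTop, η n x * V x = V x ∧ ∀ i, pd i (fun x => η n x * V x) x = pd i V x := by
  filter_upwards [hη.tendsto_one (cell_subset_space hx)] with n hn
  refine ⟨by rw [hn.eq_of_nhds, one_mul], fun i => ?_⟩
  have : (fun x => η n x * V x) =ᶠ[𝓝 x] V := by
    filter_upwards [hn] with y hy
    rw [hy, one_mul]
  simp only [pd]
  rw [this.fderiv_eq]

/-- First order identities extend from test functions to functions vanishing on the boundary. -/
theorem VanishC1.integral_eq_zero (hd : 0 < d) (hD : D.IsAdmissible) {a : Fin d → Space d → ℝ}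
    {b : Space d → ℝ} (ha : ∀ i, IntegrableOn (a i) D.cell) (hb : IntegrableOn b D.cell)
    (H : ∀ ψ, D.C1Test ψ → ∫ x in D.cell, (∑ i, a i x * pd i ψ x + b x * ψ x) = 0)
    {V : Space d → ℝ} (hV : D.VanishC1 V) :
    ∫ x in D.cell, (∑ i, a i x * pd i V x + b x * V x) = 0 := by
  obtain ⟨η, hη⟩ := exists_isCutoff hd D hD
  obtain ⟨L, hL⟩ : ∃ L, ∀ i n, ∀ x ∈ D.cell, ‖pd i (fun x => η n x * V x) x‖ ≤ L :=
    hV.fderiv_bound.imp' (4 * ·) fun L h i n x hx => hη.norm_pd_mul_le hD hV h i n hx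
  obtain ⟨M, hM⟩ := hV.bound
  have hψ : ∀ n, D.C1Test fun x => η n x * V x := fun n => (hη.test n).c1Test_mul hD hV.toBddC1
  have hlim : Tendsto (fun n => ∫ x in D.cell, (∑ i, a i x * pd i (fun x => η n x * V x) x
      + b x * (η n x * V x))) atTop
      (𝓝 (∫ x in D.cell, (∑ i, a i x * pd i V x + b x * V x))) := by
    refine tendsto_integral_of_dominated_convergence
      (fun x => (∑ i, ‖a i x‖ * L) + ‖b x‖ * M) (fun n => ?_) ?_ (fun n => ?_) ?_
    · have hb' := (hψ n).bddC1 hD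
      exact (Finset.aestronglyMeasurable_fun_sum _ fun i _ =>
        (ha i).1.mul (hb'.memLp_pd hD i).1).add (hb.1.mul (hb'.memLp hD).1)
    · exact (integrable_finsetSum _ fun i _ => (ha i).norm.mul_const L).add (hb.norm.mul_const M)
    · refine ae_cell hD fun x hx => (norm_add_le _ _).trans (add_le_add ?_ ?_)
      · refine (norm_sum_le _ _).trans (Finset.sum_le_sum fun i _ => ?_)
        rw [norm_mul]
        exact mul_le_mul_of_nonneg_left (hL i n x hx) (norm_nonneg _)
      · rw [norm_mul, norm_mul]
        exact mul_le_mul_of_nonneg_left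
          ((mul_le_of_le_one_left (norm_nonneg _) (hη.norm_le n x)).trans (hM x hx)) (norm_nonneg _)
    · refine ae_cell hD fun x hx => tendsto_const_nhds.congr' ?_
      filter_upwards [hη.eventually_mul_eq V hx] with n hn
      simp only [hn.1, hn.2]
  exact tendsto_nhds_unique hlim (tendsto_const_nhds.congr fun n => (H _ (hψ n)).symm)

/-- `∫ F(c) ∂_k V = - ∫ F'(c) ∂_k c V`. -/
theorem IsSobolev0.integral_glF (hd : 0 < d) (hD : D.IsAdmissible) {c : Space d → ℝ}
    {g : Fin d → Space d → ℝ} (h : D.IsSobolev0 c g) (k : Fin d)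
    {V : Space d → ℝ} (hV : D.VanishC1 V) :
    ∫ x in D.cell, (glF (c x) * pd k V x + deriv glF (c x) * g k x * V x) = 0 := by
  have := isFiniteMeasure_cell hD
  have i1 : IntegrableOn (fun x => glW (c x)) D.cell := (memLp_glW hD h.mem).integrable (by norm_num)
  have i2 : IntegrableOn (fun x => c x ^ 2) D.cell := h.mem.integrable_sq
  have i3 : IntegrableOn (fun x => deriv glW (c x) * g k x) D.cell :=
    (memLp_deriv_glW_mul h.mem (h.grad_mem k)).integrable (by norm_num)
  have i4 : IntegrableOn (fun x => c x * g k x) D.cell := integrable_mul_L2 h.mem (h.grad_mem k)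
  have i5 : IntegrableOn (fun x => glF (c x)) D.cell := by
    simp_rw [glF_eq]; exact i1.add i2
  have i6 : IntegrableOn (fun x => deriv glF (c x) * g k x) D.cell := by
    refine ((i4.const_mul 2).add i3).congr (Eventually.of_forall fun x => ?_)
    simp only [Pi.add_apply, deriv_glF]; ring
  have key := VanishC1.integral_eq_zero hd hD
    (a := fun i x => if i = k then glF (c x) else 0) (b := fun x => deriv glF (c x) * g k x)
    (fun i => by by_cases hi : i = k <;> simp [hi, i5]) i6 (fun ψ hψ => ?_) hV
  · simpa using key
  · have hψb := hψ.bddC1 hD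
    -- `F = W + c²`: the chain rule handles the Lipschitz part, and the product rule for `c · c` the
    -- quadratic one.
    have e1 := h.integral_glW_test hD hψ k
    have e2 := h.integral_mul_mul_pd hD h hψb k
    obtain ⟨M, hM⟩ := hψb.bound
    obtain ⟨M', hM'⟩ := hψb.pd_bound
    have j1 : IntegrableOn (fun x => c x * c x * pd k ψ x) D.cell := by
      have := integrable_mul_bdd hD i2 (hψb.memLp_pd hD k).1 (hM' k)
      simpa only [sq] using this
    have j2 : IntegrableOn (fun x => (g k x * c x + c x * g k x) * ψ x) D.cell := by
      refine integrable_mul_bdd hD ?_ (hψb.memLp hD).1 hM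
      refine IntegrableOn.congr_fun (i4.add i4) (fun x _ => ?_) (measurableSet_cell hD)
      simp only [Pi.add_apply]; ring
    have j3 : IntegrableOn (fun x => glW (c x) * pd k ψ x + deriv glW (c x) * g k x * ψ x) D.cell :=
      (integrable_mul_bdd hD i1 (hψb.memLp_pd hD k).1 (hM' k)).add
        (integrable_mul_bdd hD i3 (hψb.memLp hD).1 hM)
    have e3 : ∫ x in D.cell, (∑ i, (if i = k then glF (c x) else 0) * pd i ψ x
        + deriv glF (c x) * g k x * ψ x)
        = ∫ x in D.cell, ((glW (c x) * pd k ψ x + deriv glW (c x) * g k x * ψ x)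
          + (c x * c x * pd k ψ x + (g k x * c x + c x * g k x) * ψ x)) := by
      congr 1; ext x
      simp only [ite_mul, zero_mul, Finset.sum_ite_eq', Finset.mem_univ, if_true, deriv_glF, glF_eq]
      ring
    have j4 : IntegrableOn (fun x => c x * c x * pd k ψ x + (g k x * c x + c x * g k x) * ψ x)
        D.cell := j1.add j2
    rw [e3, integral_add j3 j4, e1, integral_add j1 j2, e2]
    ring

end FluidDomain

/-! ### Weak Hessians, the Korteweg identity and inherited boundary values -/

namespace FluidDomain

variable {D : FluidDomain d}

theorem periodicOn_pd {φ : Space d → ℝ} (h : D.PeriodicOn φ) (i : Fin d) :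
    D.PeriodicOn (pd i φ) := by
  cases D with
  | torus =>
    intro x j
    have h2 : (fun y => φ (y + EuclideanSpace.single j 2)) = φ := funext fun y => h y j
    have h3 := fderiv_comp_add_right (𝕜 := ℝ) (f := φ) (x := x) (EuclideanSpace.single j (2 : ℝ))
    rw [h2] at h3
    simp only [pd, ← h3]
  | dirichlet Ω => trivial

theorem SmoothTest.pd {φ : Space d → ℝ} (h : D.SmoothTest φ) (i : Fin d) :
    D.SmoothTest (pd i φ) := by
  refine ⟨(h.1.fderiv_right (m := ∞) le_rfl).clm_apply contDiff_const, periodicOn_pd h.2.1 i, ?_⟩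
  have h3 := h.2.2
  cases D with
  | torus => trivial
  | dirichlet Ω =>
    have hs : tsupport (NSAC.pd i φ) ⊆ tsupport φ :=
      closure_minimal ((Function.support_subset_iff'.2 fun x hx => by
        simp [NSAC.pd, fderiv_of_notMem_tsupport (𝕜 := ℝ) hx])) (isClosed_tsupport _)
    exact ⟨h3.1.of_isClosed_subset (isClosed_tsupport _) hs, hs.trans h3.2⟩

theorem pd_comm {φ : Space d → ℝ} (h : ContDiff ℝ ∞ φ) (i j : Fin d) :
    pd i (pd j φ) = pd j (pd i φ) := by
  ext x
  have h1 : DifferentiableAt ℝ (fderiv ℝ φ) x :=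
    ((h.fderiv_right (m := ∞) le_rfl).differentiable (by simp)) x
  have h2 : IsSymmSndFDerivAt ℝ φ x := h.contDiffAt.isSymmSndFDerivAt
    (by simp only [minSmoothness_of_isRCLikeNormedField]; exact WithTop.coe_le_coe.2 (le_top : (2 : ℕ∞) ≤ ⊤))
  have h3 : ∀ k l, pd k (pd l φ) x
      = fderiv ℝ (fderiv ℝ φ) x (EuclideanSpace.single k 1) (EuclideanSpace.single l 1) := by
    intro k l
    simp only [pd]
    rw [fderiv_clm_apply h1 (differentiableAt_const _)]
    simp
  rw [h3, h3]
  exact h2 _ _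

/-- Both entries are second distributional derivatives of `c`, and the second derivatives of a test
function commute. -/
theorem weak_hessian_symm (hD : D.IsAdmissible) {c : Space d → ℝ} {a : Fin d → Space d → ℝ}
    {H : Fin d → Fin d → Space d → ℝ} (hc : ∀ i, D.IsWeakPartial i c (a i))
    (ha : ∀ i, D.IsSobolev (a i) (H i)) (i j : Fin d) :
    ∀ᵐ x ∂(volume.restrict D.cell), H i j x = H j i x := by
  have := isFiniteMeasure_cell hD
  have hi := ((ha i).grad_mem j).integrable (by norm_num)
  have hj := ((ha j).grad_mem i).integrable (by norm_num)
  have key := ae_eq_zero_of_integral_smoothTest hD (h := fun x => H i j x - H j i x) (hi.sub hj)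
    (fun φ hφ => ?_)
  · filter_upwards [key] with x hx
    linarith
  · have e : ∀ k l, ∫ x in D.cell, H k l x * φ x = ∫ x in D.cell, c x * pd k (pd l φ) x := by
      intro k l
      have h1 := (ha k).weak l φ hφ
      have h2 := hc k (pd l φ) (hφ.pd l)
      simp only [pd] at h2 ⊢
      linarith
    have hφb := hφ.c1Test.bddC1 hD
    have m1 := integrable_mul_L2 ((ha i).grad_mem j) (hφb.memLp hD)
    have m2 := integrable_mul_L2 ((ha j).grad_mem i) (hφb.memLp hD)
    simp_rw [sub_mul]
    rw [integral_sub m1 m2, e, e, pd_comm hφ.1, sub_self]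

/-- The weak form of `div (∇c ⊗ ∇c - |∇c|²/2 𝕀) = Δc ∇c`. -/
theorem integral_korteweg (hd : 0 < d) (hD : D.IsAdmissible) {c : Space d → ℝ}
    {a : Fin d → Space d → ℝ} {H : Fin d → Fin d → Space d → ℝ}
    (hc : ∀ i, D.IsWeakPartial i c (a i)) (ha : ∀ i, D.IsSobolev (a i) (H i)) (k : Fin d)
    {V : Space d → ℝ} (hV : D.VanishC1 V) :
    ∫ x in D.cell, (∑ i, (a i x * a k x - if i = k then (∑ j, a j x ^ 2) / 2 else 0) * pd i V x
      + (∑ i, H i i x) * a k x * V x) = 0 := by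
  have := isFiniteMeasure_cell hD
  have iaa : ∀ i j, IntegrableOn (fun x => a i x * a j x) D.cell := fun i j =>
    integrable_mul_L2 (ha i).mem (ha j).mem
  have iHa : ∀ i j l, IntegrableOn (fun x => H i j x * a l x) D.cell := fun i j l =>
    integrable_mul_L2 ((ha i).grad_mem j) (ha l).mem
  have isq : IntegrableOn (fun x => (∑ j, a j x ^ 2) / 2) D.cell := by
    refine (integrable_finsetSum _ fun j _ => ?_).div_const 2
    refine (iaa j j).congr_fun (fun x _ => ?_) (measurableSet_cell hD)
    simp only [sq]
  have isub : IntegrableOn (fun x => a k x * a k x - (∑ j, a j x ^ 2) / 2) D.cell :=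
    (iaa k k).sub isq
  refine VanishC1.integral_eq_zero hd hD
    (a := fun i x => a i x * a k x - if i = k then (∑ j, a j x ^ 2) / 2 else 0)
    (b := fun x => (∑ i, H i i x) * a k x) (fun i => ?_) ?_ (fun ψ hψ => ?_) hV
  · by_cases hi : i = k
    · simpa [hi] using isub
    · simpa [hi] using iaa i k
  · simp_rw [Finset.sum_mul]
    exact integrable_finsetSum _ fun i _ => iHa i i k
  · have hψb := hψ.bddC1 hD
    obtain ⟨M, hM⟩ := hψb.bound
    obtain ⟨M', hM'⟩ := hψb.pd_bound
    have e1 := fun i => (ha i).integral_mul_mul_pd hd hD (ha k) hψ i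
    have e2 := fun j => (ha j).integral_mul_mul_pd hd hD (ha j) hψ k
    have j1 : ∀ i j l, IntegrableOn (fun x => a i x * a j x * pd l ψ x) D.cell := fun i j l =>
      integrable_mul_bdd hD (iaa i j) (hψb.memLp_pd hD l).1 (hM' l)
    have j2 : ∀ i j l, IntegrableOn (fun x => H i j x * a l x * ψ x) D.cell := fun i j l =>
      integrable_mul_bdd hD (iHa i j l) (hψb.memLp hD).1 hM
    have hsym : ∀ᵐ x ∂(volume.restrict D.cell), ∀ i j, H i j x = H j i x :=
      ae_all_iff.2 fun i => ae_all_iff.2 fun j => weak_hessian_symm hD hc ha i j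
    have e1' : ∀ i, ∫ x in D.cell, a i x * a k x * pd i ψ x
        = -(∫ x in D.cell, H i i x * a k x * ψ x) - ∫ x in D.cell, H k i x * a i x * ψ x := by
      intro i
      rw [e1, sub_eq_add_neg, ← neg_add, ← integral_add (j2 i i k) (j2 k i i)]
      congr 2; ext x; ring
    -- Symmetry of the Hessian brings `∂_k(|∇c|²)/2` into the form `∑ⱼ H k j ∂_j c`. This cancels
    -- the mixed term of `div (∇c ⊗ ∇c)` and leaves `Δc ∂_k c`.
    have e2' : ∀ j, ∫ x in D.cell, a j x * a j x * pd k ψ x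
        = - (2 * ∫ x in D.cell, H k j x * a j x * ψ x) := by
      intro j
      rw [e2, ← integral_const_mul]
      congr 1
      refine integral_congr_ae ?_
      filter_upwards [hsym] with x hx
      rw [hx j k]; ring
    have e3 : ∫ x in D.cell, (∑ i, (a i x * a k x - if i = k then (∑ j, a j x ^ 2) / 2 else 0)
        * pd i ψ x + (∑ i, H i i x) * a k x * ψ x)
        = ∫ x in D.cell, ((∑ i, (a i x * a k x * pd i ψ x - (1 / 2) * (a i x * a i x * pd k ψ x)
          + H i i x * a k x * ψ x))) := by
      congr 1; ext x
      simp only [sub_mul, ite_mul, zero_mul, Finset.sum_sub_distrib, Finset.sum_ite_eq',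
        Finset.mem_univ, if_true, Finset.sum_add_distrib, Finset.sum_mul, ← Finset.mul_sum,
        Finset.sum_div, ← sq]
      congr 2
      rw [Finset.mul_sum]
      exact Finset.sum_congr rfl fun i _ => by ring
    have j3 : ∀ i, IntegrableOn (fun x => a i x * a k x * pd i ψ x
        - (1 / 2) * (a i x * a i x * pd k ψ x)) D.cell := fun i =>
      (j1 i k i).sub ((j1 i i k).const_mul _)
    have j4 : ∀ i, IntegrableOn (fun x => a i x * a k x * pd i ψ x
        - (1 / 2) * (a i x * a i x * pd k ψ x) + H i i x * a k x * ψ x) D.cell := fun i =>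
      (j3 i).add (j2 i i k)
    rw [e3, integral_finsetSum _ fun i _ => j4 i]
    refine Finset.sum_eq_zero fun i _ => ?_
    rw [integral_add (j3 i) (j2 i i k), integral_sub (j1 i k i) ((j1 i i k).const_mul _),
      integral_const_mul, e1', e2']
    ring

/-- `∫ f ∂_i V = - ∫ ∂_i f V` for a limit `f` in `L¹` of functions in `W^{1,2}_0` that are bounded in
`W^{1,2}`. -/
theorem IsSobolev.integral_mul_pd_of_tendsto (hd : 0 < d) (hD : D.IsAdmissible)
    {f : Space d → ℝ} {g : Fin d → Space d → ℝ} (h : D.IsSobolev f g) {fk : ℕ → Space d → ℝ}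
    {gk : ℕ → Fin d → Space d → ℝ} (hk : ∀ k, D.IsSobolev0 (fk k) (gk k)) {M : ℝ}
    (hM : ∀ k i, (eLpNorm (gk k i) 2 (volume.restrict D.cell)).toReal ≤ M)
    (hlim : ∀ v : Space d → ℝ, AEStronglyMeasurable v (volume.restrict D.cell) →
      (∃ B, ∀ x ∈ D.cell, ‖v x‖ ≤ B) →
      Tendsto (fun k => ∫ x in D.cell, fk k x * v x) atTop (𝓝 (∫ x in D.cell, f x * v x)))
    {V : Space d → ℝ} (hV : D.BddC1 V) (i : Fin d) :
    ∫ x in D.cell, f x * pd i V x = - ∫ x in D.cell, g i x * V x := by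
  have := isFiniteMeasure_cell hD
  obtain ⟨η, hη⟩ := exists_isCutoff hd D hD
  obtain ⟨B, hB⟩ := hV.bound
  have hηV : ∀ m, D.C1Test fun x => η m x * V x := fun m => (hη.test m).c1Test_mul hD hV
  have hηVb : ∀ m, D.BddC1 fun x => η m x * V x := fun m => (hηV m).bddC1 hD
  set ε : ℕ → ℝ := fun m =>
    (eLpNorm (fun x => η m x * V x - V x) 2 (volume.restrict D.cell)).toReal with hε
  have hB' : ∀ m, ∀ x ∈ D.cell, ‖η m x * V x‖ ≤ |B| := fun m x hx => by
    rw [norm_mul]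
    exact (mul_le_of_le_one_left (norm_nonneg _) (hη.norm_le m x)).trans
      ((hB x hx).trans (le_abs_self _))
  have hεlim : Tendsto ε atTop (𝓝 0) := by
    have h1 := tendsto_eLpNorm_two_of_dominated (μ := volume.restrict D.cell)
      (u := fun m x => η m x * V x) (v := V) (h := fun _ => |B|) (memLp_const _)
      (fun m => ((hηVb m).memLp hD).1) (hV.memLp hD).1
      (fun m => ae_cell hD (hB' m)) (ae_cell hD fun x hx => (hB x hx).trans (le_abs_self _))
      (ae_cell hD fun x hx => tendsto_const_nhds.congr' ?_)
    · have := (ENNReal.tendsto_toReal ENNReal.zero_ne_top).comp h1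
      rwa [ENNReal.toReal_zero] at this
    · filter_upwards [hη.eventually_mul_eq V hx] with n hn
      exact hn.1.symm
  -- `V` need not vanish on the boundary, so `∇(η m V)` is not controlled. The error of inserting
  -- the cutoff is instead computed on `fk k`, where integration by parts is available up to the
  -- boundary: it equals `∫ gk (η m V - V)`, at most `M ε m` uniformly in `k`, and survives `k → ∞`.
  have est : ∀ m, |(∫ x in D.cell, f x * pd i V x) + ∫ x in D.cell, g i x * (η m x * V x)| ≤ M * ε m := by
    intro m
    have e1 := h.integral_mul_pd hd hD (hηV m) i
    have e2 : ∀ k, |(∫ x in D.cell, fk k x * pd i V x)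
        - ∫ x in D.cell, fk k x * pd i (fun x => η m x * V x) x| ≤ M * ε m := by
      intro k
      rw [(hk k).integral_mul_pd hD hV i, (hk k).integral_mul_pd hD (hηVb m) i]
      have m1 := integrable_mul_L2 ((hk k).grad_mem i) ((hηVb m).memLp hD)
      have m2 := integrable_mul_L2 ((hk k).grad_mem i) (hV.memLp hD)
      rw [neg_sub_neg, ← integral_sub m1 m2]
      have h3 := abs_integral_mul_le ((hk k).grad_mem i) (((hηVb m).memLp hD).sub (hV.memLp hD))
      simp only [← mul_sub]
      exact h3.trans (mul_le_mul_of_nonneg_right (hM k i) ENNReal.toReal_nonneg)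
    have l1 := hlim (pd i V) (hV.memLp_pd hD i).1 (hV.pd_bound.imp fun _ h => h i)
    have l2 := hlim (pd i fun x => η m x * V x) ((hηVb m).memLp_pd hD i).1
      ((hηVb m).pd_bound.imp fun _ h => h i)
    have := le_of_tendsto (l1.sub l2).abs (Eventually.of_forall e2)
    rwa [e1, sub_neg_eq_add] at this
  have l3 : Tendsto (fun m => ∫ x in D.cell, g i x * (η m x * V x)) atTop
      (𝓝 (∫ x in D.cell, g i x * V x)) := by
    refine tendsto_integral_of_dominated_convergence (fun x => ‖g i x‖ * |B|)
      (fun m => (h.grad_mem i).1.mul ((hηVb m).memLp hD).1)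
      (((h.grad_mem i).integrable (by norm_num)).norm.mul_const _)
      (fun m => ae_cell hD fun x hx => ?_) (ae_cell hD fun x hx => tendsto_const_nhds.congr' ?_)
    · rw [norm_mul]
      exact mul_le_mul_of_nonneg_left (hB' m x hx) (norm_nonneg _)
    · filter_upwards [hη.eventually_mul_eq V hx] with n hn
      rw [hn.1]
  have l4 := le_of_tendsto_of_tendsto' (l3.const_add (∫ x in D.cell, f x * pd i V x)).abs
    (hεlim.const_mul M) est
  rw [mul_zero] at l4
  have := abs_nonpos_iff.1 l4
  linarith

/-- Green's formula for classical functions. -/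
theorem VanishC1.green (hd : 0 < d) (hD : D.IsAdmissible) {g : Fin d → Space d → ℝ}
    (hg : ∀ i, D.BddC1 (g i)) {V : Space d → ℝ} (hV : D.VanishC1 V) :
    ∫ x in D.cell, (∑ i, g i x * pd i V x + (∑ i, pd i (g i) x) * V x) = 0 := by
  have := isFiniteMeasure_cell hD
  refine VanishC1.integral_eq_zero hd hD (fun i => ((hg i).memLp hD).integrable (by norm_num))
    (integrable_finsetSum _ fun i _ => ((hg i).memLp_pd hD i).integrable (by norm_num))
    (fun ψ hψ => ?_) hV
  have hψb := hψ.bddC1 hD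
  have j : ∀ i, IntegrableOn (fun x => pd i ψ x * g i x + ψ x * pd i (g i) x) D.cell := fun i =>
    (integrable_mul_L2 (hψb.memLp_pd hD i) ((hg i).memLp hD)).add
      (integrable_mul_L2 (hψb.memLp hD) ((hg i).memLp_pd hD i))
  have e : ∀ x, (∑ i, g i x * pd i ψ x + (∑ i, pd i (g i) x) * ψ x)
      = ∑ i, (pd i ψ x * g i x + ψ x * pd i (g i) x) := by
    intro x
    rw [Finset.sum_add_distrib, Finset.sum_mul]
    congr 1 <;> exact Finset.sum_congr rfl fun i _ => mul_comm _ _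
  simp_rw [e]
  rw [integral_finsetSum _ fun i _ => j i]
  exact Finset.sum_eq_zero fun i _ => hψ.integral_mul_pd hD (hg i) i

end FluidDomain

namespace FluidDomain

variable {D : FluidDomain d} {T : ℝ}

/-! ### The space-time cylinder -/

/-- Lebesgue measure on the space-time cylinder `(0,T) × Ω`. -/
abbrev cyl (D : FluidDomain d) (T : ℝ) : Measure (ℝ × Space d) :=
  volume.restrict (Ioo 0 T ×ˢ D.cell)

theorem cyl_eq_prod (D : FluidDomain d) (T : ℝ) :
    D.cyl T = (volume.restrict (Ioo 0 T)).prod (volume.restrict D.cell) := by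
  rw [cyl, Measure.volume_eq_prod, Measure.prod_restrict]

theorem measurableSet_cyl (hD : D.IsAdmissible) : MeasurableSet (Ioo 0 T ×ˢ D.cell) :=
  measurableSet_Ioo.prod (measurableSet_cell hD)

theorem ae_cyl (hD : D.IsAdmissible) {A : ℝ × Space d → Prop}
    (h : ∀ t ∈ Ioo 0 T, ∀ x ∈ D.cell, A (t, x)) : ∀ᵐ z ∂(D.cyl T), A z :=
  (ae_restrict_iff' (measurableSet_cyl hD)).2 (Eventually.of_forall fun z hz => h z.1 hz.1 z.2 hz.2)

theorem ae_ae_of_ae_cyl {A : ℝ × Space d → Prop} (h : ∀ᵐ z ∂(D.cyl T), A z) :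
    ∀ᵐ t ∂(volume.restrict (Ioo 0 T)), ∀ᵐ x ∂(volume.restrict D.cell), A (t, x) := by
  rw [cyl_eq_prod] at h
  exact Measure.ae_ae_of_ae_prod h

/-- Integrability on the space-time cylinder. -/
def IntCyl (D : FluidDomain d) (T : ℝ) (F : ℝ → Space d → ℝ) : Prop :=
  Integrable (fun z : ℝ × Space d => F z.1 z.2) (D.cyl T)

/-- The iterated integral over `(0,τ) × Ω`. -/
def iter (D : FluidDomain d) (τ : ℝ) (F : ℝ → Space d → ℝ) : ℝ :=
  ∫ t in (0)..τ, ∫ x in D.cell, F t x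

section IntCyl

variable {F G : ℝ → Space d → ℝ}

theorem IntCyl.ae_integrable (h : D.IntCyl T F) :
    ∀ᵐ t ∂(volume.restrict (Ioo 0 T)), IntegrableOn (F t) D.cell := by
  rw [IntCyl, cyl_eq_prod] at h
  exact h.prod_right_ae

theorem IntCyl.integrable_integral (h : D.IntCyl T F) :
    Integrable (fun t => ∫ x in D.cell, F t x) (volume.restrict (Ioo 0 T)) := by
  rw [IntCyl, cyl_eq_prod] at h
  exact h.integral_prod_left

theorem intervalIntegrable_of_integrable {f : ℝ → ℝ} (h : IntegrableOn f (Ioo 0 T)) {τ : ℝ}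
    (hτ : τ ∈ Icc 0 T) : IntervalIntegrable f volume 0 τ := by
  rw [intervalIntegrable_iff_integrableOn_Ioo_of_le hτ.1]
  exact h.mono_set (Ioo_subset_Ioo_right hτ.2)

theorem IntCyl.intervalIntegrable (h : D.IntCyl T F) {τ : ℝ} (hτ : τ ∈ Icc 0 T) :
    IntervalIntegrable (fun t => ∫ x in D.cell, F t x) volume 0 τ :=
  intervalIntegrable_of_integrable h.integrable_integral hτ

theorem IntCyl.congr (h : D.IntCyl T F) (hFG : ∀ᵐ z ∂(D.cyl T), F z.1 z.2 = G z.1 z.2) :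
    D.IntCyl T G := Integrable.congr h hFG

theorem IntCyl.add (hF : D.IntCyl T F) (hG : D.IntCyl T G) :
    D.IntCyl T (fun t x => F t x + G t x) := Integrable.add hF hG

theorem IntCyl.sub (hF : D.IntCyl T F) (hG : D.IntCyl T G) :
    D.IntCyl T (fun t x => F t x - G t x) := Integrable.sub hF hG

theorem IntCyl.neg (hF : D.IntCyl T F) : D.IntCyl T (fun t x => - F t x) := Integrable.neg hF

theorem IntCyl.const_mul (hF : D.IntCyl T F) (r : ℝ) : D.IntCyl T (fun t x => r * F t x) :=
  Integrable.const_mul hF r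

theorem IntCyl.sum {ι : Type*} (s : Finset ι) {F : ι → ℝ → Space d → ℝ}
    (h : ∀ i ∈ s, D.IntCyl T (F i)) : D.IntCyl T (fun t x => ∑ i ∈ s, F i t x) :=
  integrable_finsetSum s h

theorem iter_congr {τ : ℝ} (hτ : τ ∈ Icc 0 T)
    (h : ∀ᵐ t ∂(volume.restrict (Ioo 0 T)), ∫ x in D.cell, F t x = ∫ x in D.cell, G t x) :
    D.iter τ F = D.iter τ G := by
  refine intervalIntegral.integral_congr_ae_restrict ?_
  rw [uIoc_of_le hτ.1, ← restrict_Ioo_eq_restrict_Ioc]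
  exact ae_restrict_of_ae_restrict_of_subset (Ioo_subset_Ioo_right hτ.2) h

theorem iter_congr_ae {τ : ℝ} (hτ : τ ∈ Icc 0 T) (h : ∀ᵐ z ∂(D.cyl T), F z.1 z.2 = G z.1 z.2) :
    D.iter τ F = D.iter τ G := by
  refine iter_congr hτ ?_
  filter_upwards [ae_ae_of_ae_cyl h] with t ht
  exact integral_congr_ae ht

theorem iter_add {τ : ℝ} (hτ : τ ∈ Icc 0 T) (hF : D.IntCyl T F) (hG : D.IntCyl T G) :
    D.iter τ (fun t x => F t x + G t x) = D.iter τ F + D.iter τ G := by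
  rw [iter, iter, iter, ← intervalIntegral.integral_add (hF.intervalIntegrable hτ)
    (hG.intervalIntegrable hτ)]
  refine intervalIntegral.integral_congr_ae_restrict ?_
  rw [uIoc_of_le hτ.1, ← restrict_Ioo_eq_restrict_Ioc]
  refine ae_restrict_of_ae_restrict_of_subset (Ioo_subset_Ioo_right hτ.2) ?_
  filter_upwards [hF.ae_integrable, hG.ae_integrable] with t h1 h2
  exact integral_add h1 h2

theorem iter_const_mul (τ r : ℝ) (F : ℝ → Space d → ℝ) :
    D.iter τ (fun t x => r * F t x) = r * D.iter τ F := by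
  simp only [iter, integral_const_mul, intervalIntegral.integral_const_mul]

theorem iter_sub {τ : ℝ} (hτ : τ ∈ Icc 0 T) (hF : D.IntCyl T F) (hG : D.IntCyl T G) :
    D.iter τ (fun t x => F t x - G t x) = D.iter τ F - D.iter τ G := by
  have h := iter_add hτ hF (hG.const_mul (-1))
  rw [iter_const_mul] at h
  simp only [sub_eq_add_neg, neg_one_mul] at h ⊢
  exact h

theorem iter_sum {ι : Type*} (s : Finset ι) {τ : ℝ} (hτ : τ ∈ Icc 0 T)
    {F : ι → ℝ → Space d → ℝ} (h : ∀ i ∈ s, D.IntCyl T (F i)) :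
    D.iter τ (fun t x => ∑ i ∈ s, F i t x) = ∑ i ∈ s, D.iter τ (F i) := by
  classical
  induction s using Finset.induction_on with
  | empty => simp [iter]
  | insert a s ha ih =>
    have h1 := h a (Finset.mem_insert_self a s)
    have h2 : ∀ i ∈ s, D.IntCyl T (F i) := fun i hi => h i (Finset.mem_insert_of_mem hi)
    simp only [Finset.sum_insert ha]
    rw [iter_add hτ h1 (IntCyl.sum s h2), ih h2]

end IntCyl

/-! ### Lebesgue spaces of vector-valued functions -/

/-- Tonelli: with equal exponents in time and space the iterated norm is the norm on the cylinder.
-/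
theorem MemLL.memLp_cyl {X : Type*} [NormedAddCommGroup X] {f : ℝ → Space d → X} {q : ℝ≥0∞}
    (hq : q ≠ 0) (hq' : q ≠ ⊤) (h : D.MemLL T q q f) :
    MemLp (fun z : ℝ × Space d => f z.1 z.2) q (D.cyl T) := by
  refine ⟨h.1, ?_⟩
  rw [eLpNorm_lt_top_iff_lintegral_rpow_enorm_lt_top hq hq']
  have hm := h.1
  change AEStronglyMeasurable _ (D.cyl T) at hm
  rw [cyl_eq_prod] at hm ⊢
  rw [lintegral_prod _ (hm.enorm.pow_const _)]
  have h3 := (eLpNorm_lt_top_iff_lintegral_rpow_enorm_lt_top hq hq').1 h.2.2.2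
  refine lt_of_eq_of_lt (lintegral_congr_ae ?_) h3
  filter_upwards [h.2.1] with t ht
  have hq0 := ENNReal.toReal_pos hq hq'
  rw [Real.enorm_of_nonneg ENNReal.toReal_nonneg, ENNReal.ofReal_toReal ht.2.ne,
    eLpNorm_eq_lintegral_rpow_enorm_toReal hq hq', ← ENNReal.rpow_mul, one_div,
    inv_mul_cancel₀ hq0.ne', ENNReal.rpow_one]

theorem MemLL.mono_exponent {X : Type*} [NormedAddCommGroup X] [NormedSpace ℝ X]
    {f : ℝ → Space d → X} {q q' r : ℝ≥0∞} (h : D.MemLL T q r f) (hqq : q' ≤ q) :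
    D.MemLL T q' r f :=
  ⟨h.1, h.2.1, h.2.2.mono_exponent hqq⟩

theorem intCyl_mul_L2 {f g : ℝ → Space d → ℝ}
    (hf : MemLp (fun z : ℝ × Space d => f z.1 z.2) 2 (D.cyl T))
    (hg : MemLp (fun z : ℝ × Space d => g z.1 z.2) 2 (D.cyl T)) :
    D.IntCyl T fun t x => f t x * g t x := integrable_mul_L2 hf hg

theorem isFiniteMeasure_cyl (hD : D.IsAdmissible) : IsFiniteMeasure (D.cyl T) := by
  have := isFiniteMeasure_cell hD
  rw [cyl_eq_prod]; infer_instance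

/-- Bounded measurable functions on the space-time cylinder. -/
structure BddMeas (D : FluidDomain d) (T : ℝ) {X : Type*} [NormedAddCommGroup X]
    (F : ℝ → Space d → X) : Prop where
  aesm : AEStronglyMeasurable (fun z : ℝ × Space d => F z.1 z.2) (D.cyl T)
  bound : ∃ M, ∀ t ∈ Ioo 0 T, ∀ x ∈ D.cell, ‖F t x‖ ≤ M

theorem closedCyl_subset : Ioo 0 T ×ˢ D.cell ⊆ Icc 0 T ×ˢ closure D.space :=
  prod_mono Ioo_subset_Icc_self (cell_subset_space.trans subset_closure)

theorem BddMeas.of_continuousOn (hD : D.IsAdmissible) {X : Type*} [NormedAddCommGroup X]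
    {F : ℝ → Space d → X} [SecondCountableTopologyEither (ℝ × Space d) X]
    (h : ContinuousOn (fun z : ℝ × Space d => F z.1 z.2) (Icc 0 T ×ˢ closure D.space)) :
    D.BddMeas T F := by
  refine ⟨(h.mono closedCyl_subset).aestronglyMeasurable (measurableSet_cyl hD), ?_⟩
  obtain ⟨K, hK, hK1, hK2⟩ := exists_compact_cell hD
  obtain ⟨M, hM⟩ := (isCompact_Icc.prod hK).exists_bound_of_continuousOn
    (h.mono (prod_mono_right hK2))
  exact ⟨M, fun t ht x hx => hM (t, x) ⟨Ioo_subset_Icc_self ht, hK1 hx⟩⟩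

theorem BddMeas.congr (hD : D.IsAdmissible) {X : Type*} [NormedAddCommGroup X]
    {F G : ℝ → Space d → X} (h : D.BddMeas T F)
    (hFG : ∀ t ∈ Ioo 0 T, ∀ x ∈ D.cell, F t x = G t x) : D.BddMeas T G := by
  refine ⟨h.aesm.congr (ae_cyl hD hFG), ?_⟩
  obtain ⟨M, hM⟩ := h.bound
  exact ⟨M, fun t ht x hx => hFG t ht x hx ▸ hM t ht x hx⟩

theorem BddMeas.clm {X Y : Type*} [NormedAddCommGroup X] [NormedSpace ℝ X] [NormedAddCommGroup Y]
    [NormedSpace ℝ Y] {F : ℝ → Space d → X} (h : D.BddMeas T F) (L : X →L[ℝ] Y) :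
    D.BddMeas T fun t x => L (F t x) := by
  refine ⟨L.continuous.comp_aestronglyMeasurable h.aesm, ?_⟩
  obtain ⟨M, hM⟩ := h.bound
  exact ⟨‖L‖ * M, fun t ht x hx => (L.le_opNorm _).trans (by gcongr; exact hM t ht x hx)⟩

theorem BddMeas.mul {F G : ℝ → Space d → ℝ} (hF : D.BddMeas T F) (hG : D.BddMeas T G) :
    D.BddMeas T fun t x => F t x * G t x := by
  obtain ⟨M, hM⟩ := hF.bound
  obtain ⟨M', hM'⟩ := hG.bound
  refine ⟨hF.aesm.mul hG.aesm, M * M', fun t ht x hx => ?_⟩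
  rw [norm_mul]
  exact mul_le_mul (hM t ht x hx) (hM' t ht x hx) (norm_nonneg _)
    ((norm_nonneg _).trans (hM t ht x hx))

theorem BddMeas.add {X : Type*} [NormedAddCommGroup X] {F G : ℝ → Space d → X}
    (hF : D.BddMeas T F) (hG : D.BddMeas T G) : D.BddMeas T fun t x => F t x + G t x := by
  obtain ⟨M, hM⟩ := hF.bound
  obtain ⟨M', hM'⟩ := hG.bound
  exact ⟨hF.aesm.add hG.aesm, M + M', fun t ht x hx =>
    (norm_add_le _ _).trans (add_le_add (hM t ht x hx) (hM' t ht x hx))⟩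

theorem BddMeas.const {X : Type*} [NormedAddCommGroup X] (r : X) :
    D.BddMeas T fun _ _ => r := ⟨aestronglyMeasurable_const, ‖r‖, fun _ _ _ _ => le_rfl⟩

theorem BddMeas.sub {F G : ℝ → Space d → ℝ}
    (hF : D.BddMeas T F) (hG : D.BddMeas T G) : D.BddMeas T fun t x => F t x - G t x := by
  simpa only [neg_one_mul, ← sub_eq_add_neg] using hF.add ((BddMeas.const (-1)).mul hG)

theorem BddMeas.sum {ι : Type*} (s : Finset ι) {F : ι → ℝ → Space d → ℝ}
    (h : ∀ i, D.BddMeas T (F i)) : D.BddMeas T (fun t x => ∑ i ∈ s, F i t x) := by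
  classical
  induction s using Finset.induction_on with
  | empty => simpa using BddMeas.const (0 : ℝ)
  | insert a s ha ih => simpa only [Finset.sum_insert ha] using (h a).add ih

theorem IntCyl.mul_bdd (hD : D.IsAdmissible) {F G : ℝ → Space d → ℝ} (hF : D.IntCyl T F)
    (hG : D.BddMeas T G) : D.IntCyl T fun t x => F t x * G t x := by
  obtain ⟨M, hM⟩ := hG.bound
  exact Integrable.mul_bdd (c := M) hF hG.aesm (ae_cyl hD hM)

theorem BddMeas.memLp (hD : D.IsAdmissible) {F : ℝ → Space d → ℝ} (hF : D.BddMeas T F) :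
    MemLp (fun z : ℝ × Space d => F z.1 z.2) 2 (D.cyl T) := by
  have := isFiniteMeasure_cyl (T := T) hD
  obtain ⟨M, hM⟩ := hF.bound
  exact MemLp.of_bound hF.aesm M (ae_cyl hD hM)

theorem BddMeas.intCyl (hD : D.IsAdmissible) {F : ℝ → Space d → ℝ} (hF : D.BddMeas T F) :
    D.IntCyl T F := by
  have := isFiniteMeasure_cyl (T := T) hD
  exact (hF.memLp hD).integrable (by norm_num)

/-! ### Calculus in `C¹([0,T] × closure Ω)` -/

section IsC1

variable {X Y : Type*} [NormedAddCommGroup X] [NormedSpace ℝ X] [NormedAddCommGroup Y]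
  [NormedSpace ℝ Y]

/-- Smoothness on an open set `O` is assumed because `p` and `P'` are regular only on `(0,∞)`. The
values of the inner function lie in `O` up to the boundary, so the derivatives extend continuously.
-/
theorem IsC1.comp {f : ℝ → Space d → X} (hf : D.IsC1 T f) {Φ : X → Y} {O : Set X} (hO : IsOpen O)
    (hΦ : ContDiffOn ℝ 1 Φ O) (hmaps : ∀ t ∈ Icc 0 T, ∀ x ∈ closure D.space, f t x ∈ O) :
    D.IsC1 T fun t x => Φ (f t x) := by
  obtain ⟨hp, hc, ft, fx, hft, hfx, hd⟩ := hf
  have hm : MapsTo (fun z : ℝ × Space d => f z.1 z.2) (Icc 0 T ×ˢ closure D.space) O :=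
    fun z hz => hmaps z.1 hz.1 z.2 hz.2
  have hΦ' := (hΦ.continuousOn_fderiv_of_isOpen hO le_rfl).comp hc hm
  refine ⟨fun t ht => periodicOn_comp (hp t ht) Φ, hΦ.continuousOn.comp hc hm,
    fun t x => fderiv ℝ Φ (f t x) (ft t x), fun t x => (fderiv ℝ Φ (f t x)).comp (fx t x),
    hΦ'.clm_apply hft, hΦ'.clm_comp hfx, fun t ht x hx => ?_⟩
  have h1 : HasFDerivAt Φ (fderiv ℝ Φ (f t x)) (f t x) :=
    ((hΦ.differentiableOn one_ne_zero).differentiableAt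
      (hO.mem_nhds (hmaps t ht x (subset_closure hx)))).hasFDerivAt
  exact ⟨h1.comp_hasDerivWithinAt t (hd t ht x hx).1, h1.comp x (hd t ht x hx).2⟩

theorem IsC1.comp_contDiff {f : ℝ → Space d → X} (hf : D.IsC1 T f) {Φ : X → Y}
    (hΦ : ContDiff ℝ 1 Φ) : D.IsC1 T fun t x => Φ (f t x) :=
  hf.comp isOpen_univ hΦ.contDiffOn fun _ _ _ _ => mem_univ _

theorem IsC1.prodMk {f : ℝ → Space d → X} {g : ℝ → Space d → Y} (hf : D.IsC1 T f)
    (hg : D.IsC1 T g) : D.IsC1 T fun t x => (f t x, g t x) := by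
  obtain ⟨hp, hc, ft, fx, hft, hfx, hd⟩ := hf
  obtain ⟨hp', hc', gt, gx, hgt, hgx, hd'⟩ := hg
  refine ⟨fun t ht => ?_, hc.prodMk hc', fun t x => (ft t x, gt t x),
    fun t x => (fx t x).prod (gx t x), hft.prodMk hgt, ?_, fun t ht x hx =>
      ⟨(hd t ht x hx).1.prodMk (hd' t ht x hx).1, (hd t ht x hx).2.prodMk (hd' t ht x hx).2⟩⟩
  · cases D with
    | torus => intro x i; exact Prod.ext (hp t ht x i) (hp' t ht x i)
    | dirichlet Ω => trivial
  · exact ((ContinuousLinearMap.prodₗᵢ (𝕜 := ℝ) (E := Space d) (F := X) (G := Y) ℝ).continuous.comp_continuousOn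
      (hfx.prodMk hgx))

theorem isC1_time {ψ : ℝ → ℝ} (h : ContDiff ℝ 1 ψ) : D.IsC1 T fun t _ => ψ t := by
  refine ⟨fun t _ => ?_, (h.continuous.comp continuous_fst).continuousOn, fun t _ => deriv ψ t,
    fun _ _ => 0, ((h.continuous_deriv le_rfl).comp continuous_fst).continuousOn,
    continuousOn_const, fun t _ x _ =>
      ⟨(h.differentiable one_ne_zero t).hasDerivAt.hasDerivWithinAt, hasFDerivAt_const _ _⟩⟩
  cases D with
  | torus => intro x i; rfl
  | dirichlet Ω => trivial

theorem isC1_space {η : Space d → ℝ} (h : ContDiff ℝ 1 η) (hp : D.PeriodicOn η) :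
    D.IsC1 T fun _ x => η x :=
  ⟨fun _ _ => hp, (h.continuous.comp continuous_snd).continuousOn, fun _ _ => 0,
    fun _ x => fderiv ℝ η x, continuousOn_const,
    ((h.continuous_fderiv one_ne_zero).comp continuous_snd).continuousOn, fun _ _ x _ =>
      ⟨hasDerivWithinAt_const _ _ _, (h.differentiable one_ne_zero x).hasFDerivAt⟩⟩

theorem IsC1.smul {f : ℝ → Space d → ℝ} {g : ℝ → Space d → X} (hf : D.IsC1 T f)
    (hg : D.IsC1 T g) : D.IsC1 T fun t x => f t x • g t x :=
  (hf.prodMk hg).comp_contDiff (Φ := fun y : ℝ × X => y.1 • y.2) (contDiff_fst.smul contDiff_snd)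

theorem IsC1.mul {f g : ℝ → Space d → ℝ} (hf : D.IsC1 T f)
    (hg : D.IsC1 T g) : D.IsC1 T fun t x => f t x * g t x := hf.smul hg

theorem IsC1.add {f g : ℝ → Space d → X} (hf : D.IsC1 T f)
    (hg : D.IsC1 T g) : D.IsC1 T fun t x => f t x + g t x :=
  (hf.prodMk hg).comp_contDiff (Φ := fun y : X × X => y.1 + y.2) (contDiff_fst.add contDiff_snd)

theorem IsC1.sub {f g : ℝ → Space d → X} (hf : D.IsC1 T f)
    (hg : D.IsC1 T g) : D.IsC1 T fun t x => f t x - g t x :=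
  (hf.prodMk hg).comp_contDiff (Φ := fun y : X × X => y.1 - y.2) (contDiff_fst.sub contDiff_snd)

theorem IsC1.const_mul {f : ℝ → Space d → ℝ} (hf : D.IsC1 T f) (r : ℝ) :
    D.IsC1 T fun t x => r * f t x :=
  hf.comp_contDiff (Φ := fun y => r * y) (contDiff_const.mul contDiff_id)

theorem IsC1.apply {f : ℝ → Space d → Space d} (hf : D.IsC1 T f) (i : Fin d) :
    D.IsC1 T fun t x => f t x i :=
  hf.comp_contDiff (Φ := fun y : Space d => y i) (EuclideanSpace.proj (𝕜 := ℝ) i).contDiff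

theorem IsC1.differentiableAt_space {f : ℝ → Space d → X} (hf : D.IsC1 T f) {t : ℝ}
    (ht : t ∈ Icc 0 T) {x : Space d} (hx : x ∈ D.space) : DifferentiableAt ℝ (f t) x := by
  obtain ⟨-, -, ft, fx, -, -, hd⟩ := hf
  exact (hd t ht x hx).2.differentiableAt

theorem IsC1.differentiableAt_time {f : ℝ → Space d → X} (hf : D.IsC1 T f) {t : ℝ}
    (ht : t ∈ Ioo 0 T) {x : Space d} (hx : x ∈ D.space) :
    DifferentiableAt ℝ (fun r => f r x) t := by
  obtain ⟨-, -, ft, fx, -, -, hd⟩ := hf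
  exact ((hd t (Ioo_subset_Icc_self ht) x hx).1.hasDerivAt
    (Icc_mem_nhds ht.1 ht.2)).differentiableAt

theorem IsC1.bddMeas (hD : D.IsAdmissible) [SecondCountableTopologyEither (ℝ × Space d) X]
    {f : ℝ → Space d → X} (hf : D.IsC1 T f) :
    D.BddMeas T f := BddMeas.of_continuousOn hD hf.2.1

theorem IsC1.bddMeas_deriv (hD : D.IsAdmissible) [SecondCountableTopologyEither (ℝ × Space d) X]
    {f : ℝ → Space d → X} (hf : D.IsC1 T f) :
    D.BddMeas T fun t x => deriv (fun r => f r x) t := by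
  obtain ⟨-, -, ft, fx, hft, -, hd⟩ := hf
  refine (BddMeas.of_continuousOn hD hft).congr hD fun t ht x hx => ?_
  exact (((hd t (Ioo_subset_Icc_self ht) x (cell_subset_space hx)).1.hasDerivAt
    (Icc_mem_nhds ht.1 ht.2)).deriv).symm

theorem IsC1.bddMeas_fderiv (hD : D.IsAdmissible)
    {f : ℝ → Space d → X} (hf : D.IsC1 T f) :
    D.BddMeas T fun t x => fderiv ℝ (f t) x := by
  obtain ⟨-, -, ft, fx, -, hfx, hd⟩ := hf
  refine (BddMeas.of_continuousOn hD hfx).congr hD fun t ht x hx => ?_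
  exact (hd t (Ioo_subset_Icc_self ht) x (cell_subset_space hx)).2.fderiv.symm

theorem IsC1.bddMeas_pd (hD : D.IsAdmissible) {f : ℝ → Space d → ℝ} (hf : D.IsC1 T f)
    (i : Fin d) : D.BddMeas T fun t x => pd i (f t) x :=
  (hf.bddMeas_fderiv hD).clm (ContinuousLinearMap.apply ℝ ℝ (EuclideanSpace.single i 1))

theorem IsC1.continuousOn_slice {f : ℝ → Space d → X} (hf : D.IsC1 T f) {t : ℝ}
    (ht : t ∈ Icc 0 T) : ContinuousOn (f t) (closure D.space) :=
  hf.2.1.comp (Continuous.prodMk_right t).continuousOn fun _ hx => ⟨ht, hx⟩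

theorem IsC1.bddC1 (hD : D.IsAdmissible) {f : ℝ → Space d → ℝ} (hf : D.IsC1 T f) {t : ℝ}
    (ht : t ∈ Icc 0 T) : D.BddC1 (f t) := by
  refine ⟨?_, hf.1 t ht, exists_bound_cell hD (hf.continuousOn_slice ht), ?_⟩ <;>
  obtain ⟨-, -, ft, fx, -, hfx, hd⟩ := hf <;>
  have hc : ContinuousOn (fx t) (closure D.space) :=
    hfx.comp (Continuous.prodMk_right t).continuousOn fun _ hx => ⟨ht, hx⟩
  · rw [← zero_add (1 : ℕ∞ω), contDiffOn_succ_iff_fderiv_of_isOpen (isOpen_space hD)]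
    refine ⟨fun x hx => (hd t ht x hx).2.differentiableAt.differentiableWithinAt,
      by simp, contDiffOn_zero.2 ?_⟩
    exact (hc.mono subset_closure).congr fun x hx => (hd t ht x hx).2.fderiv
  · obtain ⟨M, hM⟩ := exists_bound_cell hD hc
    exact ⟨M, fun x hx => (hd t ht x (cell_subset_space hx)).2.fderiv ▸ hM x hx⟩

theorem IsC1.vanishC1 (hD : D.IsAdmissible) {f : ℝ → Space d → ℝ} (hf : D.IsC1 T f)
    (h0 : ∀ t ∈ Icc 0 T, ∀ x ∈ D.bdry, f t x = 0) {t : ℝ}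
    (ht : t ∈ Icc 0 T) : D.VanishC1 (f t) :=
  ⟨hf.bddC1 hD ht, hf.continuousOn_slice ht, h0 t ht⟩

end IsC1

end FluidDomain

/-! ### Pressure laws -/

namespace IsPressureLaw

variable {p P : ℝ → ℝ}

theorem differentiableAt (h : IsPressureLaw p P) {r : ℝ} (hr : 0 < r) : DifferentiableAt ℝ p r :=
  (h.smooth.differentiableOn (by simp)).differentiableAt (Ioi_mem_nhds hr)

theorem monotoneOn (h : IsPressureLaw p P) : MonotoneOn p (Ici 0) := by
  refine monotoneOn_of_deriv_nonneg (convex_Ici 0) h.continuousOn ?_ ?_ <;> rw [interior_Ici]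
  · exact fun r hr => (h.differentiableAt hr).differentiableWithinAt
  · exact fun r hr => (h.deriv_pos r hr).le

/-- Beyond some `r₀` the slope of `p` exceeds a constant `δ > 0`, so `p` grows at least linearly and
controls `r`. In turn `p` is at most `a(1 + P)`, and at least `p(0)` by monotonicity. An integrable
potential thus makes density and pressure integrable. -/
theorem exists_bound (h : IsPressureLaw p P) :
    ∃ K, 0 < K ∧ ∀ r, 0 ≤ r → r ≤ K * (1 + ‖P r‖) ∧ ‖p r‖ ≤ K * (1 + ‖P r‖) := by
  obtain ⟨a, ha, hpa⟩ := h.le_potential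
  obtain ⟨δ, hδ0, hδ⟩ := EReal.lt_iff_exists_real_btwn.1 h.liminf_pos
  have hδ0' : 0 < δ := by exact_mod_cast hδ0
  obtain ⟨r₁, hr₁⟩ := eventually_atTop.1 (eventually_lt_of_lt_liminf hδ)
  set r₀ := max r₁ 1 with hr₀
  have hr0 : 0 < r₀ := lt_max_of_lt_right one_pos
  have h1 : ∀ r, r₀ ≤ r → δ * (r - r₀) ≤ p r - p r₀ := by
    intro r hr
    refine (convex_Ici r₀).mul_sub_le_image_sub_of_le_deriv
      (h.continuousOn.mono (Ici_subset_Ici.2 hr0.le)) ?_ ?_ r₀ self_mem_Ici r hr hr <;>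
      rw [interior_Ici]
    · exact fun r hr => (h.differentiableAt (hr0.trans hr)).differentiableWithinAt
    · intro r hr
      have := hr₁ r ((le_max_left _ _).trans (le_of_lt hr))
      exact_mod_cast this.le
  have h2 : ∀ r, 0 ≤ r → ‖p r‖ ≤ (a + ‖p 0‖) * (1 + ‖P r‖) := by
    intro r hr
    have e1 := h.monotoneOn self_mem_Ici hr hr
    have e2 := (hpa r hr).trans (mul_le_mul_of_nonneg_left
      (add_le_add_right (Real.le_norm_self (P r)) 1) ha.le)
    have e3 := neg_abs_le (p 0)
    have e4 : 0 ≤ ‖p 0‖ * ‖P r‖ := by positivity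
    have e5 : 0 ≤ a * (1 + ‖P r‖) := by positivity
    have e6 : 0 ≤ ‖p 0‖ := norm_nonneg _
    simp only [Real.norm_eq_abs] at *
    rw [abs_le]
    constructor <;> nlinarith
  set K₁ := a + ‖p 0‖ with hK₁
  have hK1 : 0 < K₁ := by positivity
  -- `K₁` bounds the pressure, `r₀` covers the densities up to `r₀`, and the quotient comes from
  -- inverting `δ (r - r₀) ≤ p r - p r₀`.
  refine ⟨K₁ + (r₀ + (‖p r₀‖ + K₁) / δ), by positivity, fun r hr => ⟨?_, ?_⟩⟩
  · have e0 : 0 ≤ (‖p r₀‖ + K₁) / δ := by positivity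
    have e1 : 0 ≤ ‖P r‖ := norm_nonneg _
    rcases le_total r r₀ with hrr | hrr
    · nlinarith [mul_nonneg hr0.le e1, mul_nonneg e0 e1, mul_nonneg hK1.le e1]
    · have e2 : r - r₀ ≤ (‖p r₀‖ + K₁ * (1 + ‖P r‖)) / δ := by
        rw [le_div_iff₀ hδ0']
        have := h1 r hrr
        have e3 := (Real.le_norm_self (p r)).trans (h2 r hr)
        have e4 := neg_abs_le (p r₀)
        rw [← Real.norm_eq_abs] at e4
        linarith
      have e3 : (‖p r₀‖ + K₁ * (1 + ‖P r‖)) / δ ≤ (‖p r₀‖ + K₁) / δ * (1 + ‖P r‖) := by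
        rw [div_mul_eq_mul_div]
        gcongr
        nlinarith [norm_nonneg (p r₀)]
      nlinarith [mul_nonneg hr0.le e1, mul_nonneg hK1.le e1]
  · refine (h2 r hr).trans ?_
    gcongr
    have : 0 ≤ r₀ + (‖p r₀‖ + K₁) / δ := by positivity
    linarith

theorem deriv_potential (h : IsPressureLaw p P) {r : ℝ} (hr : 0 < r) :
    deriv P r = (p r + P r) / r := by
  rw [eq_div_iff hr.ne', ← h.potential_eq r hr]; ring

/-- Only first order differentiability of `P` is assumed. The relation `P' = (p + P)/r` supplies the
second derivative, and the terms with `P` cancel in the quotient rule. -/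
theorem hasDerivAt_deriv_potential (h : IsPressureLaw p P) {r : ℝ} (hr : 0 < r) :
    HasDerivAt (deriv P) (deriv p r / r) r := by
  have h1 := ((h.differentiableAt hr).hasDerivAt.add
    (h.potential_differentiableAt r hr).hasDerivAt).div (hasDerivAt_id r) hr.ne'
  have h2 : HasDerivAt (fun r => (p r + P r) / r) (deriv p r / r) r := by
    refine h1.congr_deriv ?_
    simp only [Pi.add_apply, id, mul_one]
    rw [h.deriv_potential hr]
    field_simp
    ring
  refine h2.congr_of_eventuallyEq ?_
  filter_upwards [Ioi_mem_nhds hr] with s hs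
  exact h.deriv_potential hs

theorem contDiffOn_deriv_potential (h : IsPressureLaw p P) :
    ContDiffOn ℝ 1 (deriv P) (Ioi 0) := by
  rw [← zero_add (1 : ℕ∞ω), contDiffOn_succ_iff_deriv_of_isOpen isOpen_Ioi]
  refine ⟨fun r hr => (h.hasDerivAt_deriv_potential hr).differentiableAt.differentiableWithinAt,
    by simp, contDiffOn_zero.2 ?_⟩
  have h1 : ContinuousOn (fun r => deriv p r / r) (Ioi 0) :=
    (h.smooth.continuousOn_deriv_of_isOpen isOpen_Ioi (by simp)).div continuousOn_id
      fun r hr => (ne_of_gt hr)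
  exact h1.congr fun r hr => (h.hasDerivAt_deriv_potential hr).deriv

theorem contDiffOn_one (h : IsPressureLaw p P) : ContDiffOn ℝ 1 p (Ioi 0) :=
  h.smooth.of_le (by simp)

theorem aesm_comp (h : IsPressureLaw p P) {α : Type*} [MeasurableSpace α] {μ : Measure α}
    {f : α → ℝ} (hf : AEStronglyMeasurable f μ) (h0 : ∀ᵐ x ∂μ, 0 ≤ f x) :
    AEStronglyMeasurable (fun x => p (f x)) μ := by
  -- Continuity of `p` is known on `[0,∞)` only; the extension by `p(0)` is continuous everywhere
  -- and agrees with `p` along a nonnegative density.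
  have hc : Continuous fun r => p (max r 0) :=
    h.continuousOn.comp_continuous (continuous_id.max continuous_const) fun r => mem_Ici.2 (le_max_right _ _)
  refine (hc.comp_aestronglyMeasurable hf).congr ?_
  filter_upwards [h0] with x hx
  simp [max_eq_left hx]

theorem integrable_of_potential (h : IsPressureLaw p P) {α : Type*} [MeasurableSpace α]
    {μ : Measure α} [IsFiniteMeasure μ] {f : α → ℝ} (hf : AEStronglyMeasurable f μ)
    (h0 : ∀ᵐ x ∂μ, 0 ≤ f x) (hP : Integrable (fun x => P (f x)) μ) :
    Integrable f μ ∧ Integrable (fun x => p (f x)) μ := by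
  obtain ⟨K, hK, hb⟩ := h.exists_bound
  have hi : Integrable (fun x => K * (1 + ‖P (f x)‖)) μ :=
    ((integrable_const (1 : ℝ)).add hP.norm).const_mul K
  refine ⟨hi.mono' hf ?_, hi.mono' (h.aesm_comp hf h0) ?_⟩
  · filter_upwards [h0] with x hx
    rw [Real.norm_of_nonneg hx]
    exact (hb _ hx).1
  · filter_upwards [h0] with x hx using (hb _ hx).2

end IsPressureLaw

/-! ### The relative energy at a fixed time -/

/-- The state of the fluid at a fixed time has finite energy. -/
structure IsState (D : FluidDomain d) (P : ℝ → ℝ) (ρ : Space d → ℝ) (u : Space d → Space d)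
    (c : Space d → ℝ) (Dc : Space d → Space d) : Prop where
  ρ_int : IntegrableOn ρ D.cell
  mom_int : ∀ i, IntegrableOn (fun x => ρ x * u x i) D.cell
  kin_int : IntegrableOn (fun x => ρ x * ‖u x‖ ^ 2) D.cell
  pot_int : IntegrableOn (fun x => P (ρ x)) D.cell
  c_mem : MemLp c 2 (volume.restrict D.cell)
  Dc_mem : ∀ i, MemLp (fun x => Dc x i) 2 (volume.restrict D.cell)

theorem inner_eq_sum (a b : Space d) : inner ℝ a b = ∑ i, a i * b i := by
  simp [PiLp.inner_apply, mul_comm]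

theorem norm_sq_eq_sum (a : Space d) : ‖a‖ ^ 2 = ∑ i, a i ^ 2 := by
  rw [EuclideanSpace.norm_sq_eq]; simp

/-- Through `c² = F(c) - W(c)` and `P'(R)R - P(R) = p(R)` the density becomes the energy density,
minus `W(c)`, plus terms linear in `ρ`, `ρu`, `c` and `∇c`, plus a function of the comparison
fields. Each piece is governed by one balance law. -/
theorem relDensity_eq {p P : ℝ → ℝ} (hp : IsPressureLaw p P) (ρ : ℝ) (u : Space d) (c : ℝ)
    (Dc : Space d) {R : ℝ} (hR : 0 < R) (U : Space d) (C : ℝ) (DC : Space d) :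
    relDensity P ρ u c Dc R U C DC
      = (ρ * ‖u‖ ^ 2 / 2 + ‖Dc‖ ^ 2 / 2 + P ρ + glF c) - glW c - ∑ i, ρ * u i * U i
        + ρ * (‖U‖ ^ 2 / 2 - deriv P R) - c * (2 * C) - ∑ i, Dc i * DC i
        + (p R + C ^ 2 + (∑ i, DC i ^ 2) / 2) := by
  have h1 := hp.potential_eq R hR
  have h2 : ∑ i, ρ * u i * U i = ρ * inner ℝ u U := by
    rw [inner_eq_sum, Finset.mul_sum]; exact Finset.sum_congr rfl fun i _ => by ring
  rw [relDensity, norm_sub_sq_real, norm_sub_sq_real, h2, ← inner_eq_sum, ← norm_sq_eq_sum,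
    ← h1, glW]
  ring

variable {D : FluidDomain d}

theorem IsState.integrable_energy (hD : D.IsAdmissible) {P : ℝ → ℝ} {ρ : Space d → ℝ}
    {u : Space d → Space d} {c : Space d → ℝ} {Dc : Space d → Space d} (h : IsState D P ρ u c Dc) :
    IntegrableOn (fun x => ρ x * ‖u x‖ ^ 2 / 2 + ‖Dc x‖ ^ 2 / 2 + P (ρ x) + glF (c x)) D.cell ∧
    IntegrableOn (fun x => glW (c x)) D.cell := by
  have := FluidDomain.isFiniteMeasure_cell hD
  have i1 : IntegrableOn (fun x => glW (c x)) D.cell :=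
    (FluidDomain.memLp_glW hD h.c_mem).integrable (by norm_num)
  have i2 : IntegrableOn (fun x => c x ^ 2) D.cell := h.c_mem.integrable_sq
  refine ⟨?_, i1⟩
  have i3 : IntegrableOn (fun x => ‖Dc x‖ ^ 2 / 2) D.cell := by
    simp_rw [norm_sq_eq_sum]
    exact (integrable_finsetSum _ fun i _ => (h.Dc_mem i).integrable_sq).div_const 2
  simp_rw [glF_eq]
  exact (((h.kin_int.div_const 2).add i3).add h.pot_int).add (i1.add i2)

/-- The function `L` stands for `ΔC`. The hypotheses `e1` and `e2` trade the gradient terms for `c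
ΔC` and `C ΔC`, so that the cross terms in `c` collect to `c (2C - ΔC)`, to which the Allen–Cahn
equation applies. -/
theorem IsState.integral_relDensity (hD : D.IsAdmissible) {p P : ℝ → ℝ} (hp : IsPressureLaw p P)
    {ρ : Space d → ℝ} {u : Space d → Space d} {c : Space d → ℝ} {Dc : Space d → Space d}
    (h : IsState D P ρ u c Dc) {R : Space d → ℝ} {U : Space d → Space d} {C L : Space d → ℝ}
    {DC : Space d → Space d} (hR : ∀ x ∈ D.cell, 0 < R x)
    (hU : ∀ i, MemLp (fun x => U x i) ⊤ (volume.restrict D.cell))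
    (hN : MemLp (fun x => ‖U x‖ ^ 2 / 2 - deriv P (R x)) ⊤ (volume.restrict D.cell))
    (hpR : MemLp (fun x => p (R x)) ⊤ (volume.restrict D.cell))
    (hC : MemLp C ⊤ (volume.restrict D.cell)) (hL : MemLp L ⊤ (volume.restrict D.cell))
    (hDC : ∀ i, MemLp (fun x => DC x i) ⊤ (volume.restrict D.cell))
    (e1 : ∑ i, ∫ x in D.cell, Dc x i * DC x i = - ∫ x in D.cell, c x * L x)
    (e2 : ∑ i, ∫ x in D.cell, DC x i ^ 2 = - ∫ x in D.cell, C x * L x) :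
    IntegrableOn (fun x => relDensity P (ρ x) (u x) (c x) (Dc x) (R x) (U x) (C x) (DC x)) D.cell ∧
    ∫ x in D.cell, relDensity P (ρ x) (u x) (c x) (Dc x) (R x) (U x) (C x) (DC x)
      = (∫ x in D.cell, (ρ x * ‖u x‖ ^ 2 / 2 + ‖Dc x‖ ^ 2 / 2 + P (ρ x) + glF (c x)))
        - (∫ x in D.cell, glW (c x)) - (∑ i, ∫ x in D.cell, ρ x * u x i * U x i)
        + (∫ x in D.cell, ρ x * (‖U x‖ ^ 2 / 2 - deriv P (R x)))
        - (∫ x in D.cell, c x * (2 * C x - L x))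
        + ∫ x in D.cell, (p (R x) + (C x ^ 2 - C x * L x / 2)) := by
  have := FluidDomain.isFiniteMeasure_cell hD
  obtain ⟨i0, i1⟩ := h.integrable_energy hD
  have ci := h.c_mem.integrable (by norm_num : (1 : ℝ≥0∞) ≤ 2)
  have i2 : ∀ i, IntegrableOn (fun x => ρ x * u x i * U x i) D.cell := fun i =>
    (h.mom_int i).mul_of_top_left (hU i)
  have i3 : IntegrableOn (fun x => ρ x * (‖U x‖ ^ 2 / 2 - deriv P (R x))) D.cell :=
    h.ρ_int.mul_of_top_left hN
  have i4 : IntegrableOn (fun x => c x * C x) D.cell := ci.mul_of_top_left hC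
  have i5 : IntegrableOn (fun x => c x * L x) D.cell := ci.mul_of_top_left hL
  have i6 : ∀ i, IntegrableOn (fun x => Dc x i * DC x i) D.cell := fun i =>
    ((h.Dc_mem i).integrable (by norm_num)).mul_of_top_left (hDC i)
  have i7 : IntegrableOn (fun x => p (R x)) D.cell := hpR.integrable le_top
  have i8 : IntegrableOn (fun x => C x ^ 2) D.cell :=
    (hC.mono_exponent le_top).integrable_sq
  have i9 : IntegrableOn (fun x => C x * L x) D.cell := (hC.integrable le_top).mul_of_top_left hL
  have i10 : ∀ i, IntegrableOn (fun x => DC x i ^ 2) D.cell := fun i =>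
    ((hDC i).mono_exponent le_top).integrable_sq
  have i4' : IntegrableOn (fun x => c x * (2 * C x)) D.cell :=
    (i4.const_mul 2).congr (Eventually.of_forall fun x => by ring)
  have s2 : IntegrableOn (fun x => ∑ i, ρ x * u x i * U x i) D.cell :=
    integrable_finsetSum _ fun i _ => i2 i
  have s6 : IntegrableOn (fun x => ∑ i, Dc x i * DC x i) D.cell :=
    integrable_finsetSum _ fun i _ => i6 i
  have s10 : IntegrableOn (fun x => (∑ i, DC x i ^ 2) / 2) D.cell :=
    (integrable_finsetSum _ fun i _ => i10 i).div_const 2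
  have a1 : IntegrableOn (fun x => (ρ x * ‖u x‖ ^ 2 / 2 + ‖Dc x‖ ^ 2 / 2 + P (ρ x) + glF (c x))
      - glW (c x)) D.cell := i0.sub i1
  have a2 : IntegrableOn (fun x => (ρ x * ‖u x‖ ^ 2 / 2 + ‖Dc x‖ ^ 2 / 2 + P (ρ x) + glF (c x))
      - glW (c x) - ∑ i, ρ x * u x i * U x i) D.cell := a1.sub s2
  have a3 : IntegrableOn (fun x => (ρ x * ‖u x‖ ^ 2 / 2 + ‖Dc x‖ ^ 2 / 2 + P (ρ x) + glF (c x))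
      - glW (c x) - (∑ i, ρ x * u x i * U x i) + ρ x * (‖U x‖ ^ 2 / 2 - deriv P (R x))) D.cell :=
    a2.add i3
  have a4 : IntegrableOn (fun x => (ρ x * ‖u x‖ ^ 2 / 2 + ‖Dc x‖ ^ 2 / 2 + P (ρ x) + glF (c x))
      - glW (c x) - (∑ i, ρ x * u x i * U x i) + ρ x * (‖U x‖ ^ 2 / 2 - deriv P (R x))
      - c x * (2 * C x)) D.cell := a3.sub i4'
  have a5 : IntegrableOn (fun x => (ρ x * ‖u x‖ ^ 2 / 2 + ‖Dc x‖ ^ 2 / 2 + P (ρ x) + glF (c x))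
      - glW (c x) - (∑ i, ρ x * u x i * U x i) + ρ x * (‖U x‖ ^ 2 / 2 - deriv P (R x))
      - c x * (2 * C x) - ∑ i, Dc x i * DC x i) D.cell := a4.sub s6
  have b1 : IntegrableOn (fun x => p (R x) + C x ^ 2) D.cell := i7.add i8
  have b2 : IntegrableOn (fun x => p (R x) + C x ^ 2 + (∑ i, DC x i ^ 2) / 2) D.cell := b1.add s10
  have b3 : IntegrableOn (fun x => C x ^ 2 - C x * L x / 2) D.cell := i8.sub (i9.div_const 2)
  have hcongr : EqOn (fun x => relDensity P (ρ x) (u x) (c x) (Dc x) (R x) (U x) (C x) (DC x))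
      (fun x => (ρ x * ‖u x‖ ^ 2 / 2 + ‖Dc x‖ ^ 2 / 2 + P (ρ x) + glF (c x))
      - glW (c x) - (∑ i, ρ x * u x i * U x i) + ρ x * (‖U x‖ ^ 2 / 2 - deriv P (R x))
      - c x * (2 * C x) - (∑ i, Dc x i * DC x i)
      + (p (R x) + C x ^ 2 + (∑ i, DC x i ^ 2) / 2)) D.cell := fun x hx =>
    relDensity_eq hp _ _ _ _ (hR x hx) _ _ _
  have hm := FluidDomain.measurableSet_cell hD
  refine ⟨IntegrableOn.congr_fun (a5.add b2) (fun x hx => (hcongr hx).symm) hm, ?_⟩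
  have e4 : ∫ x in D.cell, c x * (2 * C x) = 2 * ∫ x in D.cell, c x * C x := by
    rw [← integral_const_mul]; congr 1; ext x; ring
  have e5 : ∫ x in D.cell, c x * (2 * C x - L x)
      = (∫ x in D.cell, c x * (2 * C x)) - ∫ x in D.cell, c x * L x := by
    rw [← integral_sub i4' i5]; congr 1; ext x; ring
  rw [setIntegral_congr_fun hm hcongr, integral_add a5 b2, integral_sub a4 s6, integral_sub a3 i4',
    integral_add a2 i3, integral_sub a1 s2, integral_sub i0 i1, integral_add b1 s10,
    integral_add i7 i8, integral_add i7 b3, integral_sub i8 (i9.div_const 2), e5,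
    integral_finsetSum _ fun i _ => i2 i, integral_finsetSum _ fun i _ => i6 i, integral_div,
    integral_finsetSum _ fun i _ => i10 i, e1, e2, integral_div]
  ring

open FluidDomain

theorem memLp_apply {α : Type*} [MeasurableSpace α] {μ : Measure α} {q : ℝ≥0∞} {f : α → Space d}
    (h : MemLp f q μ) (i : Fin d) : MemLp (fun x => f x i) q μ :=
  (EuclideanSpace.proj (𝕜 := ℝ) i).comp_memLp' h

theorem memLp_deriv_glF {α : Type*} [MeasurableSpace α] {μ : Measure α} [IsFiniteMeasure μ]
    {f : α → ℝ} (h : MemLp f 2 μ) : MemLp (fun x => deriv glF (f x)) 2 μ := by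
  simp_rw [deriv_glF]
  refine (h.const_mul 2).add (MemLp.of_bound
    (continuous_deriv_glW.comp_aestronglyMeasurable h.1) 2 ?_)
  exact Eventually.of_forall fun x => abs_deriv_glW_le _

section FiniteEnergy

variable {D : FluidDomain d} {p P : ℝ → ℝ} {I : InitialData d}

theorem InitialData.FiniteEnergy.isState (hD : D.IsAdmissible) (hp : IsPressureLaw p P)
    (hI : I.FiniteEnergy D P) : IsState D P I.ρ I.u I.c I.Dc := by
  have := isFiniteMeasure_cell hD
  have hρ : IntegrableOn I.ρ D.cell :=
    (hp.integrable_of_potential hI.ρ_meas hI.ρ_nonneg hI.internal).1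
  have hm : ∀ᵐ x ∂(volume.restrict D.cell), I.ρ x • I.u x = I.m x := by
    filter_upwards [hI.m_vacuum] with x hx
    by_cases h0 : I.ρ x = 0
    · simp [h0, hx h0]
    · rw [InitialData.u, smul_smul, mul_inv_cancel₀ h0, one_smul]
  refine ⟨hρ, fun i => ?_, ?_, hI.internal, hI.c_mem, fun i => memLp_apply hI.Dc_mem i⟩
  · refine (hρ.add hI.kinetic).mono' ?_ ?_
    · refine ((EuclideanSpace.proj (𝕜 := ℝ) i).continuous.comp_aestronglyMeasurable
        hI.m_meas).congr ?_
      filter_upwards [hm] with x hx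
      simp [← hx]
    · filter_upwards [hm, hI.ρ_nonneg, hI.m_vacuum] with x hx h0 hv
      have e : I.ρ x * I.u x i = I.m x i := by rw [← hx]; simp
      rw [e]
      refine (PiLp.norm_apply_le (I.m x) i).trans ?_
      rcases h0.eq_or_lt with h | h
      · simp [hv h.symm, ← h]
      · simp only [Pi.add_apply]
        rw [← sub_nonneg]
        -- Completing the square: `ρ + |m|²/ρ` dominates `|m|`, so the momentum is integrable.
        have : I.ρ x + ‖I.m x‖ ^ 2 / I.ρ x - ‖I.m x‖
            = ((I.ρ x - ‖I.m x‖) ^ 2 + I.ρ x * ‖I.m x‖) / I.ρ x := by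
          field_simp; ring
        rw [this]; positivity
  · refine hI.kinetic.congr (Eventually.of_forall fun x => ?_)
    simp only [InitialData.u, norm_smul, norm_inv, mul_pow, inv_pow, Real.norm_eq_abs, sq_abs]
    by_cases h0 : I.ρ x = 0
    · simp [h0]
    · field_simp

theorem InitialData.FiniteEnergy.mom_ae (hI : I.FiniteEnergy D P) :
    ∀ᵐ x ∂(volume.restrict D.cell), ∀ i, I.ρ x * I.u x i = I.m x i := by
  filter_upwards [hI.m_vacuum] with x hx i
  by_cases h0 : I.ρ x = 0
  · simp [h0, hx h0]
  · simp [InitialData.u, mul_inv_cancel_left₀ h0]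

theorem InitialData.kinetic_eq (I : InitialData d) (x : Space d) :
    I.ρ x * ‖I.u x‖ ^ 2 = ‖I.m x‖ ^ 2 / I.ρ x := by
  simp only [InitialData.u, norm_smul, norm_inv, mul_pow, inv_pow, Real.norm_eq_abs, sq_abs]
  by_cases h0 : I.ρ x = 0
  · simp [h0]
  · field_simp

theorem InitialData.FiniteEnergy.isSobolev (hI : I.FiniteEnergy D P) :
    D.IsSobolev I.c fun i x => I.Dc x i :=
  ⟨hI.c_mem, fun i => memLp_apply hI.Dc_mem i, hI.Dc_weak⟩

end FiniteEnergy

/-! ### Integrability and spatial regularity of the solution -/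

namespace IsDissipativeWeakSolution

variable {D : FluidDomain d} {T ν lam : ℝ} {p P : ℝ → ℝ} {I : InitialData d} {s : Flow d}

theorem memLp_u (hs : IsDissipativeWeakSolution D T ν lam p P I s) (i : Fin d) :
    MemLp (fun z : ℝ × Space d => s.u z.1 z.2 i) 2 (D.cyl T) :=
  memLp_apply (hs.u_mem.memLp_cyl (by norm_num) (by norm_num)) i

theorem memLp_Du (hs : IsDissipativeWeakSolution D T ν lam p P I s) (i j : Fin d) :
    MemLp (fun z : ℝ × Space d => s.Du z.1 z.2 i j) 2 (D.cyl T) :=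
  (hs.Du_mem i j).memLp_cyl (by norm_num) (by norm_num)

theorem memLp_c (hs : IsDissipativeWeakSolution D T ν lam p P I s) :
    MemLp (fun z : ℝ × Space d => s.c z.1 z.2) 2 (D.cyl T) :=
  (hs.c_mem.mono_exponent le_top).memLp_cyl (by norm_num) (by norm_num)

theorem memLp_Dc (hs : IsDissipativeWeakSolution D T ν lam p P I s) (i : Fin d) :
    MemLp (fun z : ℝ × Space d => s.Dc z.1 z.2 i) 2 (D.cyl T) :=
  memLp_apply ((hs.Dc_mem.mono_exponent le_top).memLp_cyl (by norm_num) (by norm_num)) i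

theorem memLp_D2c (hs : IsDissipativeWeakSolution D T ν lam p P I s) (i j : Fin d) :
    MemLp (fun z : ℝ × Space d => s.D2c z.1 z.2 i j) 2 (D.cyl T) :=
  (hs.D2c_mem i j).memLp_cyl (by norm_num) (by norm_num)

theorem memLp_lapc (hs : IsDissipativeWeakSolution D T ν lam p P I s) :
    MemLp (fun z : ℝ × Space d => s.lapc z.1 z.2) 2 (D.cyl T) :=
  memLp_finsetSum Finset.univ fun i _ => hs.memLp_D2c i i

theorem memLp_divu (hs : IsDissipativeWeakSolution D T ν lam p P I s) :
    MemLp (fun z : ℝ × Space d => s.divu z.1 z.2) 2 (D.cyl T) :=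
  memLp_finsetSum Finset.univ fun i _ => hs.memLp_Du i i

theorem memLp_μ (hs : IsDissipativeWeakSolution D T ν lam p P I s) (hD : D.IsAdmissible) :
    MemLp (fun z : ℝ × Space d => s.μ z.1 z.2) 2 (D.cyl T) := by
  have := isFiniteMeasure_cyl (T := T) hD
  exact hs.memLp_lapc.sub (memLp_deriv_glF hs.memLp_c)

theorem memLp_sqrt_mom (hs : IsDissipativeWeakSolution D T ν lam p P I s) (i : Fin d) :
    MemLp (fun z : ℝ × Space d => √(s.ρ z.1 z.2) * s.u z.1 z.2 i) 2 (D.cyl T) :=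
  memLp_apply ((hs.momentum_mem.mono_exponent le_top).memLp_cyl (by norm_num) (by norm_num)) i

theorem intCyl_potential (hs : IsDissipativeWeakSolution D T ν lam p P I s) :
    D.IntCyl T fun t x => P (s.ρ t x) :=
  memLp_one_iff_integrable.1
    ((hs.potential_mem.mono_exponent le_top).memLp_cyl (by norm_num) (by norm_num))

theorem intCyl_ρ (hs : IsDissipativeWeakSolution D T ν lam p P I s) (hD : D.IsAdmissible)
    (hp : IsPressureLaw p P) : D.IntCyl T s.ρ := by
  have := isFiniteMeasure_cyl (T := T) hD
  exact (hp.integrable_of_potential hs.ρ_meas hs.ρ_nonneg hs.intCyl_potential).1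

theorem intCyl_p (hs : IsDissipativeWeakSolution D T ν lam p P I s) (hD : D.IsAdmissible)
    (hp : IsPressureLaw p P) : D.IntCyl T fun t x => p (s.ρ t x) := by
  have := isFiniteMeasure_cyl (T := T) hD
  exact (hp.integrable_of_potential hs.ρ_meas hs.ρ_nonneg hs.intCyl_potential).2

theorem intCyl_ρuu (hs : IsDissipativeWeakSolution D T ν lam p P I s) (i j : Fin d) :
    D.IntCyl T fun t x => s.ρ t x * s.u t x i * s.u t x j := by
  refine (intCyl_mul_L2 (f := fun t x => √(s.ρ t x) * s.u t x i)
    (g := fun t x => √(s.ρ t x) * s.u t x j) (hs.memLp_sqrt_mom i) (hs.memLp_sqrt_mom j)).congr ?_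
  filter_upwards [hs.ρ_nonneg] with z hz
  have := Real.mul_self_sqrt hz
  linear_combination s.u z.1 z.2 i * s.u z.1 z.2 j * this

/-- `ρu` is the product of `√ρ`, which is square integrable because `ρ` is integrable, and `√ρ u`.
-/
theorem intCyl_ρu (hs : IsDissipativeWeakSolution D T ν lam p P I s) (hD : D.IsAdmissible)
    (hp : IsPressureLaw p P) (i : Fin d) : D.IntCyl T fun t x => s.ρ t x * s.u t x i := by
  have h1 : MemLp (fun z : ℝ × Space d => √(s.ρ z.1 z.2)) 2 (D.cyl T) := by
    rw [memLp_two_iff_integrable_sq (Real.continuous_sqrt.comp_aestronglyMeasurable hs.ρ_meas)]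
    refine Integrable.congr (hs.intCyl_ρ hD hp) ?_
    filter_upwards [hs.ρ_nonneg] with z hz
    rw [Real.sq_sqrt hz]
  refine (intCyl_mul_L2 (f := fun t x => √(s.ρ t x))
    (g := fun t x => √(s.ρ t x) * s.u t x i) h1 (hs.memLp_sqrt_mom i)).congr ?_
  filter_upwards [hs.ρ_nonneg] with z hz
  rw [← mul_assoc, Real.mul_self_sqrt hz]

theorem ae_isState (hs : IsDissipativeWeakSolution D T ν lam p P I s) (hD : D.IsAdmissible)
    (hp : IsPressureLaw p P) :
    ∀ᵐ t ∂(volume.restrict (Ioo 0 T)), IsState D P (s.ρ t) (s.u t) (s.c t) (s.Dc t) := by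
  have h1 := (IntCyl.sum Finset.univ fun i _ => hs.intCyl_ρuu i i).ae_integrable
  have h2 : ∀ᵐ t ∂(volume.restrict (Ioo 0 T)), ∀ i,
      IntegrableOn (fun x => s.ρ t x * s.u t x i) D.cell :=
    ae_all_iff.2 fun i => (hs.intCyl_ρu hD hp i).ae_integrable
  filter_upwards [(hs.intCyl_ρ hD hp).ae_integrable, h2, h1, hs.intCyl_potential.ae_integrable,
    hs.c_mem.2.1, hs.Dc_mem.2.1] with t a1 a2 a3 a4 a5 a6
  refine ⟨a1, a2, a3.congr (Eventually.of_forall fun x => ?_), a4, a5, fun i => memLp_apply a6 i⟩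
  simp only [norm_sq_eq_sum, Finset.mul_sum]
  exact Finset.sum_congr rfl fun i _ => by ring

theorem ae_isSobolev0_c (hs : IsDissipativeWeakSolution D T ν lam p P I s) (hd : 0 < d)
    (hD : D.IsAdmissible) :
    ∀ᵐ t ∂(volume.restrict (Ioo 0 T)), D.IsSobolev0 (s.c t) fun i x => s.Dc t x i := by
  have h0 : ∀ᵐ t ∂(volume.restrict (Ioo 0 T)), ∀ Ω, D = .dirichlet Ω →
      D.IsW012 (s.c t) (fun i x => s.Dc t x i) := by
    cases D with
    | torus => simp
    | dirichlet Ω =>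
      filter_upwards [hs.c_dirichlet Ω rfl] with t ht Ω' _
      exact ht
  filter_upwards [hs.c_mem.2.1, hs.Dc_mem.2.1, hs.Dc_weak, h0] with t h1 h2 h3 h4
  exact IsSobolev.isSobolev0 hd hD ⟨h1, fun i => memLp_apply h2 i, h3⟩ h4

theorem ae_isSobolev0_u (hs : IsDissipativeWeakSolution D T ν lam p P I s) (hd : 0 < d)
    (hD : D.IsAdmissible) :
    ∀ᵐ t ∂(volume.restrict (Ioo 0 T)), ∀ i,
      D.IsSobolev0 (fun x => s.u t x i) fun j x => s.Du t x i j := by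
  have h0 : ∀ᵐ t ∂(volume.restrict (Ioo 0 T)), ∀ Ω, D = .dirichlet Ω → ∀ i,
      D.IsW012 (fun x => s.u t x i) (fun j x => s.Du t x i j) := by
    cases D with
    | torus => simp
    | dirichlet Ω =>
      filter_upwards [hs.u_dirichlet Ω rfl] with t ht Ω' _
      exact ht
  have h2 : ∀ᵐ t ∂(volume.restrict (Ioo 0 T)), ∀ i j,
      MemLp (fun x => s.Du t x i j) 2 (volume.restrict D.cell) :=
    ae_all_iff.2 fun i => ae_all_iff.2 fun j => (hs.Du_mem i j).2.1
  filter_upwards [hs.u_mem.2.1, h2, hs.Du_weak, h0] with t h1 h2 h3 h4 i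
  exact IsSobolev.isSobolev0 hd hD ⟨memLp_apply h1 i, h2 i, h3 i⟩ fun Ω hΩ => h4 Ω hΩ i

theorem ae_isSobolev_Dc (hs : IsDissipativeWeakSolution D T ν lam p P I s) :
    ∀ᵐ t ∂(volume.restrict (Ioo 0 T)), ∀ i,
      D.IsSobolev (fun x => s.Dc t x i) fun j x => s.D2c t x i j := by
  have h2 : ∀ᵐ t ∂(volume.restrict (Ioo 0 T)), ∀ i j,
      MemLp (fun x => s.D2c t x i j) 2 (volume.restrict D.cell) :=
    ae_all_iff.2 fun i => ae_all_iff.2 fun j => (hs.D2c_mem i j).2.1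
  filter_upwards [hs.Dc_mem.2.1, h2, hs.D2c_weak] with t h1 h2 h3 i
  exact ⟨memLp_apply h1 i, h2 i, h3 i⟩

/-! ### Spatial identities -/

/-- `∫ (W(c) div u + W'(c) u·∇c) = 0`. -/
theorem ae_integral_glW (hs : IsDissipativeWeakSolution D T ν lam p P I s) (hd : 0 < d)
    (hD : D.IsAdmissible) :
    ∀ᵐ t ∂(volume.restrict (Ioo 0 T)),
      ∫ x in D.cell, (glW (s.c t x) * s.divu t x
        + deriv glW (s.c t x) * inner ℝ (s.u t x) (s.Dc t x)) = 0 := by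
  filter_upwards [hs.ae_isSobolev0_c hd hD, hs.ae_isSobolev0_u hd hD] with t h1 h2
  have e : ∀ x, glW (s.c t x) * s.divu t x + deriv glW (s.c t x) * inner ℝ (s.u t x) (s.Dc t x)
      = ∑ i, (glW (s.c t x) * s.Du t x i i + deriv glW (s.c t x) * s.Dc t x i * s.u t x i) := by
    intro x
    rw [inner_eq_sum, Flow.divu, Matrix.trace, Finset.sum_add_distrib, Finset.mul_sum,
      Finset.mul_sum]
    congr 1
    exact Finset.sum_congr rfl fun i _ => by ring
  have j : ∀ i, IntegrableOn (fun x => glW (s.c t x) * s.Du t x i i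
      + deriv glW (s.c t x) * s.Dc t x i * s.u t x i) D.cell := fun i =>
    (integrable_mul_L2 (memLp_glW hD h1.mem) ((h2 i).grad_mem i)).add
      (integrable_mul_L2 (memLp_deriv_glW_mul h1.mem (h1.grad_mem i)) (h2 i).mem)
  simp_rw [e]
  rw [integral_finsetSum _ fun i _ => j i]
  exact Finset.sum_eq_zero fun i _ => h1.integral_glW hD (h2 i) i

theorem jac_apply {V : Space d → Space d} {x : Space d} (h : DifferentiableAt ℝ V x)
    (i j : Fin d) : jac V x i j = pd j (fun y => V y i) x := by
  have h1 := ((EuclideanSpace.proj (ι := Fin d) (𝕜 := ℝ) i).hasFDerivAt.comp x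
    h.hasFDerivAt).fderiv
  simp only [jac, Matrix.of_apply, pd]
  have h2 : (fun y => V y i) = (EuclideanSpace.proj (ι := Fin d) (𝕜 := ℝ) i) ∘ V := rfl
  rw [h2, h1]
  rfl

theorem korteweg_apply (a : Space d) (i k : Fin d) :
    korteweg a k i = a i * a k - if i = k then (∑ j, a j ^ 2) / 2 else 0 := by
  simp only [korteweg, otimes, Matrix.sub_apply, Matrix.of_apply, Matrix.smul_apply,
    Matrix.one_apply, norm_sq_eq_sum, smul_eq_mul, mul_ite, mul_one, mul_zero, eq_comm (a := k)]
  ring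

theorem integrable_ddot_korteweg (hD : D.IsAdmissible) {a : Space d → Space d}
    (ha : ∀ i, MemLp (fun x => a x i) 2 (volume.restrict D.cell)) {V : Space d → Space d}
    (hV : ∀ i, D.BddC1 fun x => V x i) (i k : Fin d) :
    IntegrableOn (fun x => korteweg (a x) k i * pd i (fun y => V y k) x) D.cell := by
  obtain ⟨M, hM⟩ := (hV k).pd_bound
  refine integrable_mul_bdd hD ?_ ((hV k).memLp_pd hD i).1 (hM i)
  simp_rw [korteweg_apply]
  refine Integrable.sub (integrable_mul_L2 (ha i) (ha k)) ?_
  by_cases h : i = k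
  · simp only [h, if_true]
    exact (integrable_finsetSum _ fun j _ => (ha j).integrable_sq).div_const 2
  · simp [h]

/-- `∫ (∇c ⊗ ∇c - |∇c|²/2 𝕀) : ∇U + Δc ∇c·U = 0`. -/
theorem ae_integral_korteweg (hs : IsDissipativeWeakSolution D T ν lam p P I s) (hd : 0 < d)
    (hD : D.IsAdmissible) :
    ∀ᵐ t ∂(volume.restrict (Ioo 0 T)), ∀ V : Space d → Space d,
      (∀ x ∈ D.cell, DifferentiableAt ℝ V x) → (∀ i, D.VanishC1 fun x => V x i) →
      ∫ x in D.cell, (ddot (korteweg (s.Dc t x)) (jac V x)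
        + s.lapc t x * inner ℝ (s.Dc t x) (V x)) = 0 := by
  -- The exceptional set of times is fixed before `V` is chosen, so `V` may be the value at time `t`
  -- of a time-dependent field.
  filter_upwards [hs.Dc_weak, hs.ae_isSobolev_Dc] with t h1 h2 V hVd hV
  have e : ∀ x ∈ D.cell, ddot (korteweg (s.Dc t x)) (jac V x)
      + s.lapc t x * inner ℝ (s.Dc t x) (V x)
      = ∑ k, (∑ i, (s.Dc t x i * s.Dc t x k - if i = k then (∑ j, s.Dc t x j ^ 2) / 2 else 0)
        * pd i (fun y => V y k) x + (∑ i, s.D2c t x i i) * s.Dc t x k * V x k) := by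
    intro x hx
    rw [inner_eq_sum, Flow.lapc, Matrix.trace, Finset.sum_add_distrib, Finset.mul_sum, ddot]
    simp only [Matrix.diag, jac_apply (hVd x hx), korteweg_apply, mul_assoc]
  have hm := measurableSet_cell hD
  rw [setIntegral_congr_fun hm e, integral_finsetSum _ fun k _ => ?_]
  · exact Finset.sum_eq_zero fun k _ => integral_korteweg hd hD h1 h2 k (hV k)
  · refine Integrable.add (integrable_finsetSum _ fun i _ => ?_) ?_
    · have := integrable_ddot_korteweg hD (fun i => (h2 i).mem) (fun i => (hV i).toBddC1) i k
      simp only [korteweg_apply] at this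
      exact this
    · simp_rw [Finset.sum_mul]
      refine integrable_finsetSum _ fun i _ => ?_
      obtain ⟨M, hM⟩ := (hV k).bound
      exact integrable_mul_bdd hD (integrable_mul_L2 ((h2 i).grad_mem i) (h2 k).mem)
        ((hV k).memLp hD).1 hM

/-- `∫ (F(c) div U + F'(c) ∇c·U) = 0`. -/
theorem ae_integral_glF (hs : IsDissipativeWeakSolution D T ν lam p P I s) (hd : 0 < d)
    (hD : D.IsAdmissible) :
    ∀ᵐ t ∂(volume.restrict (Ioo 0 T)), ∀ V : Space d → Space d,
      (∀ x ∈ D.cell, DifferentiableAt ℝ V x) → (∀ i, D.VanishC1 fun x => V x i) →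
      ∫ x in D.cell, (glF (s.c t x) * (jac V x).trace
        + deriv glF (s.c t x) * inner ℝ (s.Dc t x) (V x)) = 0 := by
  have := isFiniteMeasure_cell hD
  filter_upwards [hs.ae_isSobolev0_c hd hD] with t h1 V hVd hV
  have e : ∀ x ∈ D.cell, glF (s.c t x) * (jac V x).trace
      + deriv glF (s.c t x) * inner ℝ (s.Dc t x) (V x)
      = ∑ k, (glF (s.c t x) * pd k (fun y => V y k) x
        + deriv glF (s.c t x) * s.Dc t x k * V x k) := by
    intro x hx
    rw [inner_eq_sum, Matrix.trace, Finset.sum_add_distrib, Finset.mul_sum, Finset.mul_sum]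
    simp only [Matrix.diag, jac_apply (hVd x hx), mul_assoc]
  rw [setIntegral_congr_fun (measurableSet_cell hD) e, integral_finsetSum _ fun k _ => ?_]
  · exact Finset.sum_eq_zero fun k _ => h1.integral_glF hd hD k (hV k)
  · obtain ⟨M, hM⟩ := (hV k).bound
    obtain ⟨M', hM'⟩ := (hV k).pd_bound
    refine Integrable.add (integrable_mul_bdd hD ?_ ((hV k).memLp_pd hD k).1 (hM' k))
      (integrable_mul_bdd hD (integrable_mul_L2 (memLp_deriv_glF h1.mem) (h1.grad_mem k))
        ((hV k).memLp hD).1 hM)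
    simp_rw [glF_eq]
    exact Integrable.add ((memLp_glW hD h1.mem).integrable (by norm_num)) h1.mem.integrable_sq

end IsDissipativeWeakSolution

theorem gradient_apply (f : Space d → ℝ) (x : Space d) (i : Fin d) :
    gradient f x i = pd i f x := by
  have h := InnerProductSpace.toDual_symm_apply (𝕜 := ℝ) (x := EuclideanSpace.single i (1 : ℝ))
    (y := fderiv ℝ f x)
  have h2 := EuclideanSpace.inner_single_right (𝕜 := ℝ) i (1 : ℝ) (gradient f x)
  rw [pd, ← h]
  simpa using h2.symm

/-- The second derivative of `f` at `x` is determined by the gradient near `x`, so any field `g`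
agreeing with it there may be differentiated instead. The Laplacian is the trace in the standard
basis. -/
theorem laplacian_eq_sum {f : Space d → ℝ} {g : Space d → Space d} {x : Space d}
    (h : ∀ᶠ y in 𝓝 x, g y = gradient f y) (hg : DifferentiableAt ℝ g x) :
    Laplacian.laplacian f x = ∑ i, pd i (fun y => g y i) x := by
  rw [InnerProductSpace.laplacian_eq_iteratedFDeriv_orthonormalBasis f
    (EuclideanSpace.basisFun (Fin d) ℝ)]
  refine Finset.sum_congr rfl fun i _ => ?_
  rw [iteratedFDeriv_two_apply]
  have h1 : fderiv ℝ f =ᶠ[𝓝 x] fun y => InnerProductSpace.toDual ℝ (Space d) (g y) := by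
    filter_upwards [h] with y hy
    rw [hy, gradient]; simp
  have h2 := ((InnerProductSpace.toDual ℝ (Space d)).toContinuousLinearEquiv.toContinuousLinearMap
    |>.hasFDerivAt.comp x hg.hasFDerivAt).fderiv
  have h3 := ((EuclideanSpace.proj (ι := Fin d) (𝕜 := ℝ) i).hasFDerivAt.comp x
    hg.hasFDerivAt).fderiv
  have h4 : pd i (fun y => g y i) x = (fderiv ℝ g x (EuclideanSpace.single i 1)) i := by
    have : (fun y => g y i) = (EuclideanSpace.proj (ι := Fin d) (𝕜 := ℝ) i) ∘ g := rfl
    rw [pd, this, h3]; rfl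
  rw [h4, h1.fderiv_eq]
  simp only [Matrix.cons_val_zero, Matrix.cons_val_one, EuclideanSpace.basisFun_apply]
  have h5 : (fun y => InnerProductSpace.toDual ℝ (Space d) (g y))
    = (InnerProductSpace.toDual ℝ (Space d)).toContinuousLinearEquiv.toContinuousLinearMap ∘ g := rfl
  rw [h5, h2]
  simp [EuclideanSpace.inner_single_right]

/-! ### Time derivatives of integrals of classical functions -/

namespace FluidDomain

variable {D : FluidDomain d} {T : ℝ}

theorem BddMeas.memLp_top_of_continuousOn (hD : D.IsAdmissible) {f : Space d → ℝ}
    (h : ContinuousOn f (closure D.space)) : MemLp f ⊤ (volume.restrict D.cell) := by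
  obtain ⟨M, hM⟩ := exists_bound_cell hD h
  exact memLp_top_of_bound (aesm_of_continuousOn hD (h.mono subset_closure)) M (ae_cell hD hM)

theorem IsC1.memLp_top (hD : D.IsAdmissible) {f : ℝ → Space d → ℝ} (hf : D.IsC1 T f) {t : ℝ}
    (ht : t ∈ Icc 0 T) : MemLp (f t) ⊤ (volume.restrict D.cell) :=
  BddMeas.memLp_top_of_continuousOn hD (hf.continuousOn_slice ht)

theorem IsC1.exists_deriv_bound (hD : D.IsAdmissible) {f : ℝ → Space d → ℝ} (hf : D.IsC1 T f) :
    ∃ M, ∀ t ∈ Ioo 0 T, ∀ x ∈ D.cell, ‖deriv (fun r => f r x) t‖ ≤ M :=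
  (hf.bddMeas_deriv hD).bound

theorem IsC1.continuousOn_deriv {f : ℝ → Space d → ℝ} (hf : D.IsC1 T f) {t : ℝ}
    (ht : t ∈ Ioo 0 T) : ContinuousOn (fun x => deriv (fun r => f r x) t) D.space := by
  obtain ⟨-, -, ft, fx, hft, -, hd⟩ := hf
  have h1 : ContinuousOn (ft t) D.space :=
    hft.comp (Continuous.prodMk_right t).continuousOn fun _ hx =>
      ⟨Ioo_subset_Icc_self ht, subset_closure hx⟩
  exact h1.congr fun x hx => ((hd t (Ioo_subset_Icc_self ht) x hx).1.hasDerivAt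
    (Icc_mem_nhds ht.1 ht.2)).deriv

/-- Integrals of continuously differentiable functions in time. -/
theorem IsC1.integral_sub_eq_iter (hD : D.IsAdmissible) {f : ℝ → Space d → ℝ} (hf : D.IsC1 T f) {τ : ℝ}
    (hτ : τ ∈ Ioo 0 T) :
    (∫ x in D.cell, f τ x) - ∫ x in D.cell, f 0 x
      = D.iter τ fun t x => deriv (fun r => f r x) t := by
  have := isFiniteMeasure_cell hD
  have hsub : Ioo 0 τ ⊆ Ioo 0 T := Ioo_subset_Ioo_right hτ.2.le
  have h0 : (0 : ℝ) ∈ Icc 0 T := ⟨le_rfl, (hτ.1.trans hτ.2).le⟩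
  have hint : Integrable (fun z : ℝ × Space d => deriv (fun r => f r z.2) z.1)
      ((volume.restrict (Ioo 0 τ)).prod (volume.restrict D.cell)) := by
    rw [← cyl_eq_prod]
    exact ((hf.bddMeas_deriv hD).intCyl hD).mono_measure
      (Measure.restrict_mono (prod_mono_left hsub) le_rfl)
  rw [iter, intervalIntegral.integral_of_le hτ.1.le, integral_Ioc_eq_integral_Ioo,
    integral_integral_swap hint,
    ← MeasureTheory.integral_sub ((hf.memLp_top hD (Ioo_subset_Icc_self hτ)).integrable le_top)
      ((hf.memLp_top hD h0).integrable le_top)]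
  refine setIntegral_congr_fun (measurableSet_cell hD) fun x hx => ?_
  have hxs := cell_subset_space hx
  have hc : ContinuousOn (fun r => f r x) (Icc 0 τ) :=
    hf.2.1.comp (Continuous.prodMk_left x).continuousOn fun t ht =>
      ⟨⟨ht.1, ht.2.trans hτ.2.le⟩, subset_closure hxs⟩
  obtain ⟨M, hM⟩ := hf.exists_deriv_bound hD
  have hm : AEStronglyMeasurable (fun t => deriv (fun r => f r x) t)
      (volume.restrict (Ioo 0 τ)) := (measurable_deriv _).aestronglyMeasurable
  have hi : IntegrableOn (fun t => deriv (fun r => f r x) t) (Ioo 0 τ) :=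
    IntegrableOn.of_bound measure_Ioo_lt_top hm M ((ae_restrict_iff' measurableSet_Ioo).2
      (Eventually.of_forall fun t ht => hM t (hsub ht) x hx))
  have := intervalIntegral.integral_eq_sub_of_hasDerivAt_of_le hτ.1.le hc
    (fun t ht => (hf.differentiableAt_time (hsub ht) hxs).hasDerivAt)
    ((intervalIntegrable_iff_integrableOn_Ioo_of_le hτ.1.le).2 hi)
  rw [intervalIntegral.integral_of_le hτ.1.le, integral_Ioc_eq_integral_Ioo] at this
  exact this.symm

theorem IsC1.hasDerivAt_integral_mul (hD : D.IsAdmissible) {f : ℝ → Space d → ℝ}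
    (hf : D.IsC1 T f) {w : Space d → ℝ} (hw : MemLp w ⊤ (volume.restrict D.cell)) {t : ℝ}
    (ht : t ∈ Ioo 0 T) :
    HasDerivAt (fun r => ∫ x in D.cell, f r x * w x)
      (∫ x in D.cell, deriv (fun r => f r x) t * w x) t := by
  have := isFiniteMeasure_cell hD
  obtain ⟨M, hM⟩ := hf.exists_deriv_bound hD
  have hwi : IntegrableOn w D.cell := hw.integrable le_top
  refine (hasDerivAt_integral_of_dominated_loc_of_deriv_le (bound := fun x => M * ‖w x‖)
    (F := fun r x => f r x * w x) (F' := fun r x => deriv (fun r => f r x) r * w x)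
    (Ioo_mem_nhds ht.1 ht.2) ?_ ?_ ?_ ?_ (hwi.norm.const_mul M) ?_).2
  · filter_upwards [Ioo_mem_nhds ht.1 ht.2] with r hr
    exact (hf.memLp_top hD (Ioo_subset_Icc_self hr)).1.mul hw.1
  · exact ((hf.memLp_top hD (Ioo_subset_Icc_self ht)).integrable le_top).mul_of_top_left hw
  · exact (aesm_of_continuousOn hD (hf.continuousOn_deriv ht)).mul hw.1
  · refine ae_cell hD fun x hx r hr => ?_
    rw [norm_mul]
    exact mul_le_mul_of_nonneg_right (hM r hr x hx) (norm_nonneg _)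
  · refine ae_cell hD fun x hx r hr => ?_
    exact (hf.differentiableAt_time hr (cell_subset_space hx)).hasDerivAt.mul_const _

/-! ### Concentrations with regular gradient and Laplacian -/

/-- `C ∈ C¹([0,T] × closure Ω)` vanishes on the boundary, and `g`, `L` are the `C¹` extensions of
its gradient and Laplacian. -/
structure IsRegular (D : FluidDomain d) (T : ℝ) (C : ℝ → Space d → ℝ) (g : ℝ → Space d → Space d)
    (L : ℝ → Space d → ℝ) : Prop where
  C1 : D.IsC1 T C
  grad_C1 : D.IsC1 T g
  lap_C1 : D.IsC1 T L
  grad_eq : ∀ t ∈ Icc 0 T, ∀ x ∈ D.space, g t x = gradient (C t) x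
  lap_eq : ∀ t ∈ Icc 0 T, ∀ x ∈ D.space, L t x = Laplacian.laplacian (C t) x
  bdry : ∀ t ∈ Icc 0 T, ∀ x ∈ D.bdry, C t x = 0

namespace IsRegular

variable {C : ℝ → Space d → ℝ} {g : ℝ → Space d → Space d} {L : ℝ → Space d → ℝ}

theorem pd_eq (h : D.IsRegular T C g L) {t : ℝ} (ht : t ∈ Icc 0 T) {x : Space d}
    (hx : x ∈ D.cell) (i : Fin d) : pd i (C t) x = g t x i := by
  rw [h.grad_eq t ht x (cell_subset_space hx), gradient_apply]

theorem sum_pd_eq (hD : D.IsAdmissible) (h : D.IsRegular T C g L) {t : ℝ} (ht : t ∈ Icc 0 T)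
    {x : Space d} (hx : x ∈ D.cell) : ∑ i, pd i (fun y => g t y i) x = L t x := by
  have hxs := cell_subset_space hx
  rw [h.lap_eq t ht x hxs]
  refine (laplacian_eq_sum ?_ (h.grad_C1.differentiableAt_space ht hxs)).symm
  filter_upwards [(isOpen_space hD).mem_nhds hxs] with y hy
  exact h.grad_eq t ht y hy

theorem green (hd : 0 < d) (hD : D.IsAdmissible) (h : D.IsRegular T C g L) {r t : ℝ}
    (hr : r ∈ Icc 0 T) (ht : t ∈ Icc 0 T) :
    ∑ i, ∫ x in D.cell, g r x i * g t x i = - ∫ x in D.cell, L r x * C t x := by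
  have := isFiniteMeasure_cell hD
  have h1 := VanishC1.green hd hD (fun i => (h.grad_C1.apply i).bddC1 hD hr)
    (h.C1.vanishC1 hD h.bdry ht)
  have e : EqOn (fun x => ∑ i, g r x i * pd i (C t) x + (∑ i, pd i (fun y => g r y i) x) * C t x)
      (fun x => ∑ i, g r x i * g t x i + L r x * C t x) D.cell := fun x hx => by
    simp only [h.sum_pd_eq hD hr hx, h.pd_eq ht hx]
  have i1 : ∀ i, IntegrableOn (fun x => g r x i * g t x i) D.cell := fun i =>
    (((h.grad_C1.apply i).memLp_top hD hr).integrable le_top).mul_of_top_left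
      ((h.grad_C1.apply i).memLp_top hD ht)
  have i2 : IntegrableOn (fun x => L r x * C t x) D.cell :=
    ((h.lap_C1.memLp_top hD hr).integrable le_top).mul_of_top_left (h.C1.memLp_top hD ht)
  rw [setIntegral_congr_fun (measurableSet_cell hD) e,
    integral_add (integrable_finsetSum _ fun i _ => i1 i) i2,
    integral_finsetSum _ fun i _ => i1 i] at h1
  linarith

/-- Green's formula twice. The two time arguments are independent so that one of them can be
differentiated while the other stays frozen. -/
theorem integral_symm (hd : 0 < d) (hD : D.IsAdmissible) (h : D.IsRegular T C g L) {r t : ℝ}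
    (hr : r ∈ Icc 0 T) (ht : t ∈ Icc 0 T) :
    ∫ x in D.cell, L r x * C t x = ∫ x in D.cell, C r x * L t x := by
  have h1 := h.green hd hD hr ht
  have h2 := h.green hd hD ht hr
  simp_rw [fun i x => mul_comm (g t x i) (g r x i), mul_comm (L t _)] at h2
  linarith

/-- `∫ ∂_t C ΔC = ∫ C ∂_t ΔC`. -/
theorem integral_deriv_symm (hd : 0 < d) (hD : D.IsAdmissible) (h : D.IsRegular T C g L) {t : ℝ}
    (ht : t ∈ Ioo 0 T) :
    ∫ x in D.cell, deriv (fun r => L r x) t * C t x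
      = ∫ x in D.cell, deriv (fun r => C r x) t * L t x := by
  have ht' := Ioo_subset_Icc_self ht
  -- `∂ₜC` is not known to have second spatial derivatives, so Green's formula cannot be applied to
  -- it. Instead the identity `∫ ΔC(r) C(t) = ∫ C(r) ΔC(t)` is differentiated in `r` at `r = t`.
  have h1 := h.lap_C1.hasDerivAt_integral_mul hD (h.C1.memLp_top hD ht') ht
  have h2 := h.C1.hasDerivAt_integral_mul hD (h.lap_C1.memLp_top hD ht') ht
  refine h1.unique (h2.congr_of_eventuallyEq ?_)
  filter_upwards [Ioo_mem_nhds ht.1 ht.2] with r hr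
  exact h.integral_symm hd hD (Ioo_subset_Icc_self hr) ht'

/-- Integration by parts with the components of `∇C`, which need not vanish on the boundary: by `H`,
the zero boundary values are carried by `f`. -/
theorem sum_integral_mul (hD : D.IsAdmissible) (h : D.IsRegular T C g L) {t : ℝ}
    (ht : t ∈ Icc 0 T) {f : Space d → ℝ} {a : Fin d → Space d → ℝ}
    (hf : MemLp f 2 (volume.restrict D.cell))
    (H : ∀ V, D.BddC1 V → ∀ i, ∫ x in D.cell, f x * pd i V x = - ∫ x in D.cell, a i x * V x) :
    ∑ i, ∫ x in D.cell, a i x * g t x i = - ∫ x in D.cell, f x * L t x := by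
  have hg := fun i => (h.grad_C1.apply i).bddC1 hD ht
  have e : EqOn (fun x => f x * L t x) (fun x => ∑ i, f x * pd i (fun y => g t y i) x) D.cell :=
    fun x hx => by simp only [← h.sum_pd_eq hD ht hx, Finset.mul_sum]
  rw [setIntegral_congr_fun (measurableSet_cell hD) e,
    integral_finsetSum _ fun i _ => integrable_mul_L2 hf ((hg i).memLp_pd hD i),
    ← Finset.sum_neg_distrib]
  exact Finset.sum_congr rfl fun i _ => by rw [H _ (hg i) i, neg_neg]

end IsRegular

end FluidDomain

/-! ### Defect measures: bounds, convergence and measurability in time -/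

/-- A family of signed measures in `L^∞(0,T; 𝓜(Ω))`. -/
structure IsDefect (D : FluidDomain d) (T : ℝ) (𝓡 : ℝ → SignedMeasure (Space d)) : Prop where
  bdd : ∃ M : ℝ, ∀ᵐ t ∂(volume.restrict (Ioo 0 T)), (𝓡 t).variation univ ≤ ENNReal.ofReal M
  supp : ∀ᵐ t ∂(volume.restrict (Ioo 0 T)), (𝓡 t).variation D.cellᶜ = 0
  meas : ∀ φ : Space d → ℝ, D.ContTest φ →
    AEMeasurable (fun t => ∫ᵛ x, φ x ∂•(𝓡 t)) (volume.restrict (Ioo 0 T))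

/-- A finite signed measure on the physical domain. -/
structure IsCellMeasure (D : FluidDomain d) (κ : SignedMeasure (Space d)) : Prop where
  fin : IsFiniteMeasure κ.variation
  supp : κ.variation D.cellᶜ = 0

namespace IsCellMeasure

variable {D : FluidDomain d} {κ : SignedMeasure (Space d)}

theorem ae_of_cell (h : IsCellMeasure D κ) {A : Space d → Prop} (hA : ∀ x ∈ D.cell, A x) :
    ∀ᵐ x ∂κ.variation, A x := by
  have : ∀ᵐ x ∂κ.variation, x ∈ D.cell := mem_ae_iff.2 h.supp
  filter_upwards [this] with x hx using hA x hx

theorem aesm (h : IsCellMeasure D κ) (hD : D.IsAdmissible) {f : Space d → ℝ}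
    (hf : ContinuousOn f D.space) : AEStronglyMeasurable f κ.variation := by
  have := (hf.mono cell_subset_space).aestronglyMeasurable (μ := κ.variation)
    (measurableSet_cell hD)
  rwa [Measure.restrict_eq_self_of_ae_mem (h.ae_of_cell fun x hx => hx)] at this

theorem integrable (h : IsCellMeasure D κ) (hD : D.IsAdmissible) {f : Space d → ℝ}
    (hf : ContinuousOn f D.space) {L : ℝ} (hL : ∀ x ∈ D.cell, ‖f x‖ ≤ L) : κ.Integrable f := by
  have := h.fin
  exact Integrable.of_bound (h.aesm hD hf) L (h.ae_of_cell hL)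

theorem tendsto (h : IsCellMeasure D κ) (hD : D.IsAdmissible) {F : ℕ → Space d → ℝ}
    {f : Space d → ℝ} (hF : ∀ n, ContinuousOn (F n) D.space) {L : ℝ}
    (hL : ∀ n, ∀ x ∈ D.cell, ‖F n x‖ ≤ L)
    (hlim : ∀ x ∈ D.cell, Tendsto (fun n => F n x) atTop (𝓝 (f x))) :
    Tendsto (fun n => ∫ᵛ x, F n x ∂•κ) atTop (𝓝 (∫ᵛ x, f x ∂•κ)) := by
  have := h.fin
  exact VectorMeasure.tendsto_integral_of_dominated_convergence (fun _ => L) (fun n => h.aesm hD (hF n))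
    (integrable_const L) (fun n => h.ae_of_cell (hL n)) (h.ae_of_cell hlim)

end IsCellMeasure

namespace FluidDomain

variable {D : FluidDomain d} {T : ℝ}

theorem SmoothTest.contTest_mul (hD : D.IsAdmissible) {η f : Space d → ℝ} (h : D.SmoothTest η)
    (hf : ContinuousOn f D.space) (hp : D.PeriodicOn f) : D.ContTest fun x => η x * f x := by
  refine ⟨?_, periodicOn_mul h.2.1 hp, compactSupp_mul_left h.2.2⟩
  have hη := h.1.continuous
  have h3 := h.2.2
  cases D with
  | torus => exact hη.mul (continuousOn_univ.1 hf)
  | dirichlet Ω =>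
    rw [continuous_iff_continuousAt]
    intro x
    by_cases hx : x ∈ Ω
    · exact hη.continuousAt.mul (hf.continuousAt (hD.1.mem_nhds hx))
    · have : (fun x => η x * f x) =ᶠ[𝓝 x] fun _ => 0 := by
        filter_upwards [notMem_tsupport_iff_eventuallyEq.1 fun hh => hx (h3.2 hh)] with y hy
        simp [hy]
      exact continuousAt_const.congr this.symm

theorem IsC1.continuousOn_pd_time {V : ℝ → Space d → ℝ} (hV : D.IsC1 T V) (j : Fin d)
    {x : Space d} (hx : x ∈ D.space) : ContinuousOn (fun t => pd j (V t) x) (Icc 0 T) := by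
  obtain ⟨-, -, ft, fx, -, hfx, hd⟩ := hV
  have h1 : ContinuousOn (fun t => fx t x) (Icc 0 T) :=
    hfx.comp (Continuous.prodMk_left x).continuousOn fun t ht => ⟨ht, subset_closure hx⟩
  exact (h1.clm_apply (continuousOn_const (c := EuclideanSpace.single j (1 : ℝ)))).congr fun t ht => by
    simp only [pd, (hd t ht x hx).2.fderiv]

theorem IsC1.exists_pd_bound (hD : D.IsAdmissible) {V : ℝ → Space d → ℝ} (hV : D.IsC1 T V) :
    ∃ M, ∀ t ∈ Icc 0 T, ∀ x ∈ D.cell, ‖fderiv ℝ (V t) x‖ ≤ M := by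
  obtain ⟨-, -, ft, fx, -, hfx, hd⟩ := hV
  obtain ⟨K, hK, hK1, hK2⟩ := exists_compact_cell hD
  obtain ⟨M, hM⟩ := (isCompact_Icc.prod hK).exists_bound_of_continuousOn
    (hfx.mono (prod_mono_right hK2))
  exact ⟨M, fun t ht x hx => by
    rw [(hd t ht x (cell_subset_space hx)).2.fderiv]; exact hM (t, x) ⟨ht, hK1 hx⟩⟩

/-- Rational approximation of the time variable. -/
def timeStep (k : ℕ) (t : ℝ) : ℝ := ⌊t * (k + 1)⌋ / (k + 1)

theorem timeStep_mem {k : ℕ} {t : ℝ} (ht : t ∈ Ioo 0 T) : timeStep k t ∈ Icc 0 T := by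
  have hk : (0 : ℝ) < k + 1 := by positivity
  refine ⟨div_nonneg ?_ hk.le, ?_⟩
  · exact_mod_cast Int.floor_nonneg.2 (mul_nonneg ht.1.le hk.le)
  · refine le_trans ?_ ht.2.le
    rw [timeStep, div_le_iff₀ hk]
    exact Int.floor_le _

theorem tendsto_timeStep (t : ℝ) : Tendsto (fun k => timeStep k t) atTop (𝓝 t) := by
  have h : ∀ k : ℕ, t - 1 / (k + 1) ≤ timeStep k t ∧ timeStep k t ≤ t := by
    intro k
    have hk : (0 : ℝ) < k + 1 := by positivity
    constructor
    · rw [timeStep, le_div_iff₀ hk, sub_mul, one_div, inv_mul_cancel₀ hk.ne']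
      exact (Int.sub_one_lt_floor _).le
    · rw [timeStep, div_le_iff₀ hk]
      exact Int.floor_le _
  refine tendsto_of_tendsto_of_tendsto_of_le_of_le ?_ tendsto_const_nhds (fun k => (h k).1)
    fun k => (h k).2
  simpa using tendsto_one_div_add_atTop_nhds_zero_nat.const_sub t

end FluidDomain

namespace IsDefect

variable {D : FluidDomain d} {T : ℝ} {𝓡 : ℝ → SignedMeasure (Space d)}

theorem ae_isCellMeasure (h : IsDefect D T 𝓡) :
    ∀ᵐ t ∂(volume.restrict (Ioo 0 T)), IsCellMeasure D (𝓡 t) := by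
  obtain ⟨M, hM⟩ := h.bdd
  filter_upwards [hM, h.supp] with t h1 h2
  exact ⟨⟨h1.trans_lt ENNReal.ofReal_lt_top⟩, h2⟩

/-- The quantifier over `f` stands inside the almost everywhere statement, so that the integrand may
depend on `t`. -/
theorem exists_bound (h : IsDefect D T 𝓡) :
    ∃ K, 0 ≤ K ∧ ∀ᵐ t ∂(volume.restrict (Ioo 0 T)), ∀ (f : Space d → ℝ) (L : ℝ), 0 ≤ L →
      (∀ x ∈ D.cell, ‖f x‖ ≤ L) → ‖∫ᵛ x, f x ∂•(𝓡 t)‖ ≤ K * L := by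
  obtain ⟨M, hM⟩ := h.bdd
  refine ⟨‖ContinuousLinearMap.lsmul ℝ ℝ (E := ℝ)‖ * max M 0, by positivity, ?_⟩
  filter_upwards [hM, h.ae_isCellMeasure] with t h1 h2 f L hL hf
  have := h2.fin
  refine (VectorMeasure.norm_integral_le_of_norm_le_const (h2.ae_of_cell hf)).trans ?_
  have h3 : (𝓡 t).variation.real univ ≤ max M 0 := by
    refine ENNReal.toReal_le_of_le_ofReal (le_max_right _ _) (h1.trans ?_)
    exact ENNReal.ofReal_le_ofReal (le_max_left _ _)
  calc _ ≤ L * ‖ContinuousLinearMap.lsmul ℝ ℝ (E := ℝ)‖ * max M 0 := by gcongr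
    _ = _ := by ring

/-- On each of the countably many level sets of the floor function the integrand is frozen at a
single time, where measurability for fixed test functions applies. -/
theorem aemeasurable_timeStep (h : IsDefect D T 𝓡) {f : ℝ → Space d → ℝ}
    (hf : ∀ t ∈ Icc 0 T, D.ContTest (f t)) (k : ℕ) :
    AEMeasurable (fun t => ∫ᵛ x, f (timeStep k t) x ∂•(𝓡 t)) (volume.restrict (Ioo 0 T)) := by
  have hmeas : Measurable fun t : ℝ => ⌊t * ((k : ℝ) + 1)⌋ :=
    Int.measurable_floor.comp (measurable_id.mul_const _)
  have hU : volume.restrict (Ioo 0 T) = (volume.restrict (Ioo 0 T)).restrict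
      (⋃ n : ℤ, (fun t : ℝ => ⌊t * ((k : ℝ) + 1)⌋) ⁻¹' {n}) := by
    rw [← preimage_iUnion, iUnion_of_singleton, preimage_univ, Measure.restrict_univ]
  rw [hU, aemeasurable_iUnion_iff]
  intro n
  have hms : MeasurableSet ((fun t : ℝ => ⌊t * ((k : ℝ) + 1)⌋) ⁻¹' {n}) :=
    hmeas (measurableSet_singleton n)
  by_cases hn : (n : ℝ) / (k + 1) ∈ Icc 0 T
  · refine ((h.meas _ (hf _ hn)).restrict).congr ?_
    rw [EventuallyEq, ae_restrict_iff' hms]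
    refine Eventually.of_forall fun t ht => ?_
    have e : timeStep k t = (n : ℝ) / (k + 1) := by
      rw [timeStep, mem_singleton_iff.1 (mem_preimage.1 ht)]
    simp only [e]
  -- If the frozen time falls outside `[0,T]`, the level set does not meet `(0,T)`.
  · have hz : (volume.restrict (Ioo 0 T)).restrict
        ((fun t : ℝ => ⌊t * ((k : ℝ) + 1)⌋) ⁻¹' {n}) = 0 := by
      rw [Measure.restrict_restrict hms, Measure.restrict_eq_zero]
      convert measure_empty (μ := volume)
      ext t
      simp only [mem_inter_iff, mem_preimage, mem_singleton_iff, mem_empty_iff_false, iff_false,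
        not_and]
      intro ht ht'
      apply hn
      have := timeStep_mem (k := k) ht'
      rwa [timeStep, ht] at this
    rw [hz]
    exact aemeasurable_zero_measure

/-- Measurability is only given for fixed test functions, which in a domain have compact support.
Two limits lead to `∂_j V(t)`: the time steps are refined, which handles the time dependence, and
the spatial cutoff is removed. -/
theorem aemeasurable_pd (h : IsDefect D T 𝓡) (hd : 0 < d) (hD : D.IsAdmissible)
    {V : ℝ → Space d → ℝ} (hV : D.IsC1 T V) (j : Fin d) :
    AEMeasurable (fun t => ∫ᵛ x, pd j (V t) x ∂•(𝓡 t)) (volume.restrict (Ioo 0 T)) := by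
  obtain ⟨η, hη⟩ := exists_isCutoff hd D hD
  obtain ⟨M, hM⟩ := hV.exists_pd_bound hD
  have hb : ∀ m, ∀ t ∈ Icc 0 T, ∀ x ∈ D.cell, ‖η m x * pd j (V t) x‖ ≤ M := fun m t ht x hx => by
    rw [norm_mul]
    exact (mul_le_of_le_one_left (norm_nonneg _) (hη.norm_le m x)).trans
      ((norm_pd_le j (V t) x).trans (hM t ht x hx))
  have hc : ∀ t ∈ Icc 0 T, ContinuousOn (pd j (V t)) D.space := fun t ht =>
    (hV.bddC1 hD ht).continuousOn_pd hD j
  have hcη : ∀ m, ∀ t ∈ Icc 0 T, ContinuousOn (fun x => η m x * pd j (V t) x) D.space :=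
    fun m t ht => (hη.test m).1.continuous.continuousOn.mul (hc t ht)
  have hIoo : ∀ᵐ t ∂(volume.restrict (Ioo 0 T)), t ∈ Ioo 0 T := ae_restrict_mem measurableSet_Ioo
  have h1 : ∀ m, AEMeasurable (fun t => ∫ᵛ x, η m x * pd j (V t) x ∂•(𝓡 t))
      (volume.restrict (Ioo 0 T)) := by
    intro m
    refine aemeasurable_of_tendsto_metrizable_ae' (fun k => h.aemeasurable_timeStep
      (f := fun t x => η m x * pd j (V t) x) (fun t ht =>
        (hη.test m).contTest_mul hD (hc t ht) (periodicOn_pd (hV.1 t ht) j)) k) ?_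
    filter_upwards [h.ae_isCellMeasure, hIoo] with t ht ht'
    refine ht.tendsto hD (fun k => hcη m _ (timeStep_mem ht'))
      (fun k => hb m _ (timeStep_mem ht')) fun x hx => ?_
    refine Tendsto.const_mul _ ?_
    have h2 := (hV.continuousOn_pd_time j (cell_subset_space hx)).continuousAt
      (Icc_mem_nhds ht'.1 ht'.2)
    exact h2.tendsto.comp (tendsto_timeStep t)
  refine aemeasurable_of_tendsto_metrizable_ae' h1 ?_
  filter_upwards [h.ae_isCellMeasure, hIoo] with t ht ht'
  have ht'' := Ioo_subset_Icc_self ht'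
  refine ht.tendsto hD (fun m => hcη m t ht'') (fun m => hb m t ht'') fun x hx => ?_
  refine tendsto_const_nhds.congr' ?_
  filter_upwards [hη.tendsto_one (cell_subset_space hx)] with m hm
  rw [hm.eq_of_nhds, one_mul]

theorem integrable_pd (h : IsDefect D T 𝓡) (hd : 0 < d) (hD : D.IsAdmissible)
    {V : ℝ → Space d → ℝ} (hV : D.IsC1 T V) (j : Fin d) :
    IntegrableOn (fun t => ∫ᵛ x, pd j (V t) x ∂•(𝓡 t)) (Ioo 0 T) := by
  obtain ⟨M, hM⟩ := hV.exists_pd_bound hD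
  obtain ⟨K, hK, hb⟩ := h.exists_bound
  refine IntegrableOn.of_bound measure_Ioo_lt_top
    (h.aemeasurable_pd hd hD hV j).aestronglyMeasurable (K * |M|) ?_
  filter_upwards [hb, ae_restrict_mem measurableSet_Ioo] with t ht ht'
  exact ht _ _ (abs_nonneg M) fun x hx => ((norm_pd_le j (V t) x).trans
    (hM t (Ioo_subset_Icc_self ht') x hx)).trans (le_abs_self M)

end IsDefect

/-! ### From weak formulations to balance laws at almost every time -/

namespace FluidDomain

variable {D : FluidDomain d} {T : ℝ}

theorem iter_eq_integral (hT : 0 < T) {F : ℝ → Space d → ℝ} (hF : D.IntCyl T F) :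
    D.iter T F = ∫ z, F z.1 z.2 ∂(D.cyl T) := by
  rw [IntCyl, cyl_eq_prod] at hF
  rw [iter, intervalIntegral.integral_of_le hT.le, integral_Ioc_eq_integral_Ioo, cyl_eq_prod,
    integral_prod _ hF]

theorem tendsto_iter_mul (hT : 0 < T) (hD : D.IsAdmissible) {f : ℝ → Space d → ℝ}
    {g : ℕ → ℝ → Space d → ℝ} {g' : ℝ → Space d → ℝ} (hf : D.IntCyl T f)
    (hg : ∀ n, D.BddMeas T (g n)) (hg' : D.BddMeas T g') {L : ℝ}
    (hL : ∀ n, ∀ t ∈ Ioo 0 T, ∀ x ∈ D.cell, ‖g n t x‖ ≤ L)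
    (hlim : ∀ t ∈ Ioo 0 T, ∀ x ∈ D.cell, Tendsto (fun n => g n t x) atTop (𝓝 (g' t x))) :
    Tendsto (fun n => D.iter T fun t x => f t x * g n t x) atTop
      (𝓝 (D.iter T fun t x => f t x * g' t x)) := by
  rw [iter_eq_integral hT (hf.mul_bdd hD hg')]
  simp_rw [fun n => iter_eq_integral hT (hf.mul_bdd hD (hg n))]
  refine tendsto_integral_of_dominated_convergence (fun z => ‖f z.1 z.2‖ * L)
    (fun n => hf.1.mul (hg n).aesm) (Integrable.mul_const (Integrable.norm hf) L) (fun n => ?_) ?_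
  · refine ae_cyl hD fun t ht x hx => ?_
    rw [norm_mul]
    exact mul_le_mul_of_nonneg_left (hL n t ht x hx) (norm_nonneg _)
  · exact ae_cyl hD fun t ht x hx => (hlim t ht x hx).const_mul _

theorem iter_weak (hT : 0 < T) {a F : ℝ → Space d → ℝ} (ha : D.IntCyl T a) (hF : D.IntCyl T F)
    (ψ : ℝ → ℝ) :
    D.iter T (fun t x => deriv ψ t * a t x + ψ t * F t x)
      = ∫ t in (0)..T, (deriv ψ t * (∫ x in D.cell, a t x) + ψ t * ∫ x in D.cell, F t x) := by
  refine intervalIntegral.integral_congr_ae_restrict ?_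
  rw [uIoc_of_le hT.le, ← restrict_Ioo_eq_restrict_Ioc]
  filter_upwards [ha.ae_integrable, hF.ae_integrable] with t h1 h2
  rw [integral_add (h1.const_mul _) (h2.const_mul _), integral_const_mul, integral_const_mul]

/-- The integrated form of a balance law. -/
theorem ae_balance (hT : 0 < T) {a F : ℝ → Space d → ℝ} (ha : D.IntCyl T a) (hF : D.IntCyl T F)
    {a₀ : ℝ} {S : ℝ → ℝ} (hS : IntegrableOn S (Ioo 0 T))
    (h : ∀ ψ, TimeTest T ψ → D.iter T (fun t x => deriv ψ t * a t x + ψ t * F t x)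
      = - (ψ 0 * a₀) + ∫ t in (0)..T, ψ t * S t) :
    ∀ᵐ τ ∂(volume.restrict (Ioo 0 T)),
      ∫ x in D.cell, a τ x = a₀ + D.iter τ F - ∫ t in (0)..τ, S t := by
  have hTm : T ∈ Icc 0 T := ⟨hT.le, le_rfl⟩
  -- `S` is kept apart from `F` because it is not an integral over the cell: in the momentum
  -- equation it is the contribution of the defect measure.
  have key := ae_eq_primitive_of_weak hT ha.integrable_integral (hF.integrable_integral.sub hS)
    (a₀ := a₀) fun ψ hψ => ?_
  · filter_upwards [key, ae_restrict_mem measurableSet_Ioo] with τ hτ hτ'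
    have hτ'' := Ioo_subset_Icc_self hτ'
    have e : ∫ t in (0)..τ, ((fun t => ∫ x in D.cell, F t x) - S) t
        = D.iter τ F - ∫ t in (0)..τ, S t :=
      intervalIntegral.integral_sub (hF.intervalIntegrable hτ'')
        (intervalIntegrable_of_integrable hS hτ'')
    rw [hτ, e]; ring
  · have h1 := h ψ hψ
    rw [iter_weak hT ha hF] at h1
    have i1 : IntervalIntegrable (fun t => deriv ψ t * (∫ x in D.cell, a t x)
        + ψ t * ∫ x in D.cell, F t x) volume 0 T :=
      ((ha.intervalIntegrable hTm).continuousOn_mul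
        (hψ.1.continuous_deriv (by simp)).continuousOn).add
        ((hF.intervalIntegrable hTm).continuousOn_mul hψ.1.continuous.continuousOn)
    have i2 : IntervalIntegrable (fun t => ψ t * S t) volume 0 T :=
      (intervalIntegrable_of_integrable hS hTm).continuousOn_mul hψ.1.continuous.continuousOn
    have e : ∀ t, deriv ψ t * (∫ x in D.cell, a t x)
        + ψ t * ((fun t => ∫ x in D.cell, F t x) - S) t
        = (deriv ψ t * (∫ x in D.cell, a t x) + ψ t * ∫ x in D.cell, F t x) - ψ t * S t := by
      intro t; simp only [Pi.sub_apply]; ring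
    simp_rw [e]
    rw [intervalIntegral.integral_sub i1 i2, h1]
    ring

section Tests

variable {X : Type*} [NormedAddCommGroup X] [NormedSpace ℝ X]

theorem IsC1.isTestClosed_smul {ψ : ℝ → ℝ} (hψ : TimeTest T ψ) {V : ℝ → Space d → X}
    (hV : D.IsC1 T V) : D.IsTestClosed T fun t x => ψ t • V t x := by
  refine ⟨(isC1_time (hψ.1.of_le (by simp))).smul hV, ?_⟩
  obtain ⟨t₀, h1, h2⟩ := hψ.2
  exact ⟨t₀, h1, fun t _ ht x _ => by simp [h2 t ht]⟩

theorem SmoothTest.isC1 {η : Space d → ℝ} (hη : D.SmoothTest η) : D.IsC1 T fun _ x => η x :=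
  isC1_space (hη.1.of_le (by simp)) hη.2.1

theorem IsTestClosed.isTest_smul {η : Space d → ℝ} (hη : D.SmoothTest η) {φ : ℝ → Space d → X}
    (hφ : D.IsTestClosed T φ) : D.IsTest T fun t x => η x • φ t x := by
  obtain ⟨hC, t₀, h1, h2⟩ := hφ
  refine ⟨⟨hη.isC1.smul hC, t₀, h1, fun t ht ht' x hx => by simp [h2 t ht ht' x hx]⟩, ?_⟩
  rintro Ω rfl
  exact ⟨tsupport η, hη.2.2.2, hη.2.2.1, fun t ht x hx => by
    simp [image_eq_zero_of_notMem_tsupport hx.2]⟩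

theorem IsC1.apply_deriv {φ : ℝ → Space d → Space d} (hφ : D.IsC1 T φ) {t : ℝ} (ht : t ∈ Ioo 0 T)
    {x : Space d} (hx : x ∈ D.space) (i : Fin d) :
    deriv (fun r => φ r x) t i = deriv (fun r => φ r x i) t := by
  have := ((EuclideanSpace.proj (ι := Fin d) (𝕜 := ℝ) i).hasFDerivAt.comp_hasDerivAt t
    (hφ.differentiableAt_time ht hx).hasDerivAt).deriv
  exact this.symm

theorem IsC1.deriv_time_mul {ψ : ℝ → ℝ} (hψ : TimeTest T ψ) {V : ℝ → Space d → ℝ}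
    (hV : D.IsC1 T V) {t : ℝ} (ht : t ∈ Ioo 0 T) {x : Space d} (hx : x ∈ D.cell) :
    deriv (fun r => ψ r * V r x) t = deriv ψ t * V t x + ψ t * deriv (fun r => V r x) t :=
  deriv_fun_mul (hψ.1.differentiable (by simp) t)
    (hV.differentiableAt_time ht (cell_subset_space hx))

theorem IsC1.pd_time_mul (ψ : ℝ → ℝ) {V : ℝ → Space d → ℝ} (hV : D.IsC1 T V) {t : ℝ}
    (ht : t ∈ Icc 0 T) {x : Space d} (hx : x ∈ D.cell) (i : Fin d) :
    pd i (fun y => ψ t * V t y) x = ψ t * pd i (V t) x := by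
  rw [pd, fderiv_const_mul (hV.differentiableAt_space ht (cell_subset_space hx))]
  rfl

end Tests

end FluidDomain

/-! ### The continuity and Allen–Cahn equations, integrated in time -/

namespace IsDissipativeWeakSolution

variable {D : FluidDomain d} {T ν lam : ℝ} {p P : ℝ → ℝ} {I : InitialData d} {s : Flow d}

theorem intCyl_continuity_flux (hs : IsDissipativeWeakSolution D T ν lam p P I s)
    (hD : D.IsAdmissible) (hp : IsPressureLaw p P) {V : ℝ → Space d → ℝ} (hV : D.IsC1 T V) :
    D.IntCyl T fun t x => s.ρ t x * deriv (fun r => V r x) t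
      + ∑ i, s.ρ t x * s.u t x i * pd i (V t) x :=
  ((hs.intCyl_ρ hD hp).mul_bdd hD (hV.bddMeas_deriv hD)).add
    (IntCyl.sum _ fun i _ => (hs.intCyl_ρu hD hp i).mul_bdd hD (hV.bddMeas_pd hD i))

/-- The equation of continuity, integrated in time. -/
theorem ae_continuity (hs : IsDissipativeWeakSolution D T ν lam p P I s) (hT : 0 < T)
    (hD : D.IsAdmissible) (hp : IsPressureLaw p P) {V : ℝ → Space d → ℝ} (hV : D.IsC1 T V) :
    ∀ᵐ τ ∂(volume.restrict (Ioo 0 T)),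
      ∫ x in D.cell, s.ρ τ x * V τ x = (∫ x in D.cell, I.ρ x * V 0 x)
        + D.iter τ fun t x => s.ρ t x * deriv (fun r => V r x) t
          + ∑ i, s.ρ t x * s.u t x i * pd i (V t) x := by
  have ha : D.IntCyl T fun t x => s.ρ t x * V t x :=
    (hs.intCyl_ρ hD hp).mul_bdd hD (hV.bddMeas hD)
  have key := ae_balance hT ha (hs.intCyl_continuity_flux hD hp hV)
    (a₀ := ∫ x in D.cell, I.ρ x * V 0 x) (S := fun _ => 0) integrableOn_zero fun ψ hψ => ?_
  · simpa using key
  · have h1 := hs.continuity _ (hV.isTestClosed_smul hψ)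
    simp only [mul_zero, intervalIntegral.integral_zero, add_zero]
    have e2 : - (ψ 0 * ∫ x in D.cell, I.ρ x * V 0 x)
        = - ∫ x in D.cell, I.ρ x * (ψ 0 • V 0 x) := by
      rw [← integral_const_mul]; congr 2; ext x; simp only [smul_eq_mul]; ring
    rw [e2, ← h1]
    refine iter_congr_ae (T := T) ⟨hT.le, le_rfl⟩ (ae_cyl hD fun t ht x hx => ?_)
    simp only [smul_eq_mul]
    rw [hV.deriv_time_mul hψ ht hx, inner_eq_sum]
    simp only [gradient_apply, hV.pd_time_mul ψ (Ioo_subset_Icc_self ht) hx, Finset.mul_sum,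
      mul_add]
    rw [← add_assoc]
    congr 1
    · ring
    · exact Finset.sum_congr rfl fun i _ => by ring

theorem intCyl_inner_uDc (hs : IsDissipativeWeakSolution D T ν lam p P I s) :
    D.IntCyl T fun t x => inner ℝ (s.u t x) (s.Dc t x) := by
  simp_rw [inner_eq_sum]
  exact IntCyl.sum _ fun i _ => intCyl_mul_L2 (hs.memLp_u i) (hs.memLp_Dc i)

/-- The material derivative of the concentration. -/
theorem intCyl_source (hs : IsDissipativeWeakSolution D T ν lam p P I s) (hD : D.IsAdmissible) :
    D.IntCyl T fun t x => s.μ t x - inner ℝ (s.u t x) (s.Dc t x) := by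
  have := isFiniteMeasure_cyl (T := T) hD
  exact IntCyl.sub ((hs.memLp_μ hD).integrable (by norm_num)) hs.intCyl_inner_uDc

theorem intCyl_c (hs : IsDissipativeWeakSolution D T ν lam p P I s) (hD : D.IsAdmissible) :
    D.IntCyl T s.c := by
  have := isFiniteMeasure_cyl (T := T) hD
  exact hs.memLp_c.integrable (by norm_num)

/-- The Allen--Cahn equation for test functions which need not vanish on the boundary. -/
theorem allenCahn_closed (hs : IsDissipativeWeakSolution D T ν lam p P I s) (hd : 0 < d)
    (hT : 0 < T) (hD : D.IsAdmissible) (hI : I.FiniteEnergy D P) {φ : ℝ → Space d → ℝ}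
    (hφ : D.IsTestClosed T φ) :
    D.iter T (fun t x => s.c t x * deriv (fun r => φ r x) t
      + (s.μ t x - inner ℝ (s.u t x) (s.Dc t x)) * φ t x) = - ∫ x in D.cell, I.c x * φ 0 x := by
  have hfin := isFiniteMeasure_cell hD
  have hTm : T ∈ Icc 0 T := ⟨hT.le, le_rfl⟩
  have h0m : (0 : ℝ) ∈ Icc 0 T := ⟨le_rfl, hT.le⟩
  obtain ⟨η, hη⟩ := exists_isCutoff hd D hD
  have hK : D.IntCyl T fun t x => s.c t x * deriv (fun r => φ r x) t
      + (s.μ t x - inner ℝ (s.u t x) (s.Dc t x)) * φ t x :=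
    ((hs.intCyl_c hD).mul_bdd hD (hφ.1.bddMeas_deriv hD)).add
      ((hs.intCyl_source hD).mul_bdd hD (hφ.1.bddMeas hD))
  have hηC : ∀ n, D.IsC1 T fun _ x => η n x := fun n => (hη.test n).isC1
  -- No spatial derivative falls on the test function, so a cutoff enters merely as a factor bounded
  -- by `1` and disappears by dominated convergence. No boundary values are required; this matters
  -- because `ΔC` need not vanish on the boundary.
  have e1 : ∀ n, D.iter T (fun t x => (s.c t x * deriv (fun r => φ r x) t
      + (s.μ t x - inner ℝ (s.u t x) (s.Dc t x)) * φ t x) * η n x)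
      = - ∫ x in D.cell, I.c x * φ 0 x * η n x := by
    intro n
    have h1 := hs.allenCahn _ (hφ.isTest_smul (hη.test n))
    have hφn : D.IsC1 T fun t x => η n x * φ t x := (hηC n).mul hφ.1
    have i1 : D.IntCyl T fun t x => s.c t x * deriv (fun r => η n x • φ r x) t
        - inner ℝ (s.u t x) (s.Dc t x) * η n x • φ t x :=
      ((hs.intCyl_c hD).mul_bdd hD (hφn.bddMeas_deriv hD)).sub
        (hs.intCyl_inner_uDc.mul_bdd hD (hφn.bddMeas hD))
    have i2 : D.IntCyl T fun t x => s.μ t x * η n x • φ t x := by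
      have := isFiniteMeasure_cyl (T := T) hD
      exact IntCyl.mul_bdd hD ((hs.memLp_μ hD).integrable (by norm_num)) (hφn.bddMeas hD)
    have h2 := iter_add hTm i1 i2
    have e3 : ∫ x in D.cell, I.c x * φ 0 x * η n x = ∫ x in D.cell, I.c x * η n x • φ 0 x := by
      congr 1; ext x; simp only [smul_eq_mul]; ring
    rw [e3]
    have h3 : D.iter T (fun t x => s.c t x * deriv (fun r => η n x • φ r x) t
        - inner ℝ (s.u t x) (s.Dc t x) * η n x • φ t x)
        + D.iter T (fun t x => s.μ t x * η n x • φ t x)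
        = - ∫ x in D.cell, I.c x * η n x • φ 0 x := by
      rw [iter, h1, iter]; ring
    rw [← h3, ← h2]
    refine iter_congr_ae hTm (ae_cyl hD fun t ht x hx => ?_)
    simp only [smul_eq_mul]
    rw [deriv_const_mul _ (hφ.1.differentiableAt_time ht (cell_subset_space hx))]
    ring
  have l1 : Tendsto (fun n => D.iter T (fun t x => (s.c t x * deriv (fun r => φ r x) t
      + (s.μ t x - inner ℝ (s.u t x) (s.Dc t x)) * φ t x) * η n x)) atTop
      (𝓝 (D.iter T (fun t x => (s.c t x * deriv (fun r => φ r x) t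
        + (s.μ t x - inner ℝ (s.u t x) (s.Dc t x)) * φ t x) * 1))) := by
    refine tendsto_iter_mul hT hD (g := fun n _ x => η n x) (g' := fun _ _ => 1) (L := 1) hK
      (fun n => (hηC n).bddMeas hD) (BddMeas.const 1) (fun n t _ x _ => hη.norm_le n x)
      fun t _ x hx => tendsto_const_nhds.congr' ?_
    filter_upwards [hη.tendsto_one (cell_subset_space hx)] with n hn
    exact hn.eq_of_nhds.symm
  have hc0 : IntegrableOn (fun x => I.c x * φ 0 x) D.cell :=
    (hI.c_mem.integrable (by norm_num)).mul_of_top_left (hφ.1.memLp_top hD h0m)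
  have l2 : Tendsto (fun n => - ∫ x in D.cell, I.c x * φ 0 x * η n x) atTop
      (𝓝 (- ∫ x in D.cell, I.c x * φ 0 x)) := by
    refine Tendsto.neg (tendsto_integral_of_dominated_convergence (fun x => ‖I.c x * φ 0 x‖)
      (fun n => hc0.1.mul (hη.test n).1.continuous.aestronglyMeasurable) hc0.norm
      (fun n => Eventually.of_forall fun x => ?_) (ae_cell hD fun x hx => ?_))
    · rw [norm_mul]
      exact mul_le_of_le_one_right (norm_nonneg _) (hη.norm_le n x)
    · refine tendsto_const_nhds.congr' ?_
      filter_upwards [hη.tendsto_one (cell_subset_space hx)] with n hn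
      rw [hn.eq_of_nhds, mul_one]
  have := tendsto_nhds_unique l1 (l2.congr fun n => (e1 n).symm)
  simpa only [mul_one] using this

/-- The Allen--Cahn equation, integrated in time. -/
theorem ae_allenCahn (hs : IsDissipativeWeakSolution D T ν lam p P I s) (hd : 0 < d)
    (hT : 0 < T) (hD : D.IsAdmissible) (hI : I.FiniteEnergy D P) {V : ℝ → Space d → ℝ}
    (hV : D.IsC1 T V) :
    ∀ᵐ τ ∂(volume.restrict (Ioo 0 T)),
      ∫ x in D.cell, s.c τ x * V τ x = (∫ x in D.cell, I.c x * V 0 x)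
        + D.iter τ fun t x => s.c t x * deriv (fun r => V r x) t
          + (s.μ t x - inner ℝ (s.u t x) (s.Dc t x)) * V t x := by
  have ha : D.IntCyl T fun t x => s.c t x * V t x := (hs.intCyl_c hD).mul_bdd hD (hV.bddMeas hD)
  have hF : D.IntCyl T fun t x => s.c t x * deriv (fun r => V r x) t
      + (s.μ t x - inner ℝ (s.u t x) (s.Dc t x)) * V t x :=
    ((hs.intCyl_c hD).mul_bdd hD (hV.bddMeas_deriv hD)).add
      ((hs.intCyl_source hD).mul_bdd hD (hV.bddMeas hD))
  have key := ae_balance hT ha hF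
    (a₀ := ∫ x in D.cell, I.c x * V 0 x) (S := fun _ => 0) integrableOn_zero fun ψ hψ => ?_
  · simpa using key
  · have h1 := hs.allenCahn_closed hd hT hD hI (hV.isTestClosed_smul hψ)
    simp only [mul_zero, intervalIntegral.integral_zero, add_zero]
    have e2 : - (ψ 0 * ∫ x in D.cell, I.c x * V 0 x)
        = - ∫ x in D.cell, I.c x * (ψ 0 • V 0 x) := by
      rw [← integral_const_mul]; congr 2; ext x; simp only [smul_eq_mul]; ring
    rw [e2, ← h1]
    refine iter_congr_ae (T := T) ⟨hT.le, le_rfl⟩ (ae_cyl hD fun t ht x hx => ?_)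
    simp only [smul_eq_mul]
    rw [hV.deriv_time_mul hψ ht hx]
    ring

end IsDissipativeWeakSolution

/-! ### The momentum equation, integrated in time -/

theorem stress_apply (ν lam : ℝ) (A : Mat d) (i j : Fin d) :
    stress ν lam A i j = ν * (A i j + A j i - if i = j then 2 / (d : ℝ) * A.trace else 0)
      + if i = j then lam * A.trace else 0 := by
  simp only [stress, Matrix.add_apply, Matrix.sub_apply, Matrix.smul_apply, Matrix.transpose_apply,
    Matrix.one_apply, smul_eq_mul, mul_ite, mul_one, mul_zero]

theorem memLp_stress {α : Type*} [MeasurableSpace α] {μ : Measure α} {A : α → Mat d}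
    (hA : ∀ i j, MemLp (fun x => A x i j) 2 μ) (ν lam : ℝ) (i j : Fin d) :
    MemLp (fun x => stress ν lam (A x) i j) 2 μ := by
  have ht : MemLp (fun x => (A x).trace) 2 μ := memLp_finsetSum Finset.univ fun k _ => hA k k
  simp_rw [stress_apply]
  by_cases h : i = j
  · simp only [h, if_true]
    exact ((((hA j j).add (hA j j)).sub (ht.const_mul _)).const_mul ν).add (ht.const_mul lam)
  · simp only [h, if_false, sub_zero, add_zero]
    exact ((hA i j).add (hA j i)).const_mul ν

namespace IsDissipativeWeakSolution

variable {D : FluidDomain d} {T ν lam : ℝ} {p P : ℝ → ℝ} {I : InitialData d} {s : Flow d}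

theorem isDefect (hs : IsDissipativeWeakSolution D T ν lam p P I s) (i j : Fin d) :
    IsDefect D T fun t => s.𝓡 t i j := by
  obtain ⟨M, hM⟩ := hs.𝓡_bdd
  refine ⟨⟨M, ?_⟩, ?_, fun φ hφ => hs.𝓡_meas φ hφ i j⟩
  · filter_upwards [hM] with t ht using ht i j
  · filter_upwards [hs.𝓡_supp] with t ht using ht i j

theorem ae_matIntegral (hs : IsDissipativeWeakSolution D T ν lam p P I s)
    {V : ℝ → Space d → Space d} (hV : D.IsC1 T V) :
    ∀ᵐ t ∂(volume.restrict (Ioo 0 T)), matIntegral (jac (V t)) (s.𝓡 t)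
      = ∑ i, ∑ j, ∫ᵛ x, pd j (fun y => V t y i) x ∂•(s.𝓡 t i j) := by
  have h1 : ∀ᵐ t ∂(volume.restrict (Ioo 0 T)), ∀ i j, IsCellMeasure D (s.𝓡 t i j) :=
    ae_all_iff.2 fun i => ae_all_iff.2 fun j => (hs.isDefect i j).ae_isCellMeasure
  filter_upwards [h1, ae_restrict_mem measurableSet_Ioo] with t ht ht'
  refine Finset.sum_congr rfl fun i _ => Finset.sum_congr rfl fun j _ => ?_
  refine VectorMeasure.integral_congr_ae ((ht i j).ae_of_cell fun x hx => ?_)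
  exact jac_apply (hV.differentiableAt_space (Ioo_subset_Icc_self ht') (cell_subset_space hx)) i j

theorem integrableOn_sum_defect (hs : IsDissipativeWeakSolution D T ν lam p P I s) (hd : 0 < d)
    (hD : D.IsAdmissible) {V : ℝ → Space d → Space d} (hV : D.IsC1 T V) :
    IntegrableOn (fun t => ∑ i, ∑ j, ∫ᵛ x, pd j (fun y => V t y i) x ∂•(s.𝓡 t i j)) (Ioo 0 T) :=
  integrable_finsetSum _ fun i _ => integrable_finsetSum _ fun j _ =>
    (hs.isDefect i j).integrable_pd hd hD (hV.apply i) j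

theorem integrableOn_matIntegral (hs : IsDissipativeWeakSolution D T ν lam p P I s) (hd : 0 < d)
    (hD : D.IsAdmissible) {V : ℝ → Space d → Space d} (hV : D.IsC1 T V) :
    IntegrableOn (fun t => matIntegral (jac (V t)) (s.𝓡 t)) (Ioo 0 T) :=
  (hs.integrableOn_sum_defect hd hD hV).congr ((hs.ae_matIntegral hV).mono fun _ h => h.symm)

theorem ae_integrable_jac (hs : IsDissipativeWeakSolution D T ν lam p P I s)
    (hD : D.IsAdmissible) {V : ℝ → Space d → Space d} (hV : D.IsC1 T V) :
    ∀ᵐ t ∂(volume.restrict (Ioo 0 T)), ∀ i j,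
      (s.𝓡 t i j).Integrable (fun x => jac (V t) x i j) := by
  have h1 : ∀ᵐ t ∂(volume.restrict (Ioo 0 T)), ∀ i j, IsCellMeasure D (s.𝓡 t i j) :=
    ae_all_iff.2 fun i => ae_all_iff.2 fun j => (hs.isDefect i j).ae_isCellMeasure
  filter_upwards [h1, ae_restrict_mem measurableSet_Ioo] with t ht ht' i j
  have ht'' := Ioo_subset_Icc_self ht'
  have hb := (hV.apply i).bddC1 hD ht''
  obtain ⟨M, hM⟩ := hb.pd_bound
  refine Integrable.congr ((ht i j).integrable hD (hb.continuousOn_pd hD j) (hM j))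
    ((ht i j).ae_of_cell fun x hx => ?_)
  exact (jac_apply (hV.differentiableAt_space ht'' (cell_subset_space hx)) i j).symm

/-- The coefficient of `∂_j φ_i` in the momentum equation. -/
def momentumFlux (s : Flow d) (ν lam : ℝ) (p : ℝ → ℝ) (i j : Fin d) (t : ℝ) (x : Space d) : ℝ :=
  s.ρ t x * s.u t x i * s.u t x j + (if i = j then p (s.ρ t x) else 0)
    - stress ν lam (s.Du t x) i j

theorem intCyl_momentumFlux (hs : IsDissipativeWeakSolution D T ν lam p P I s)
    (hD : D.IsAdmissible) (hp : IsPressureLaw p P) (i j : Fin d) :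
    D.IntCyl T (momentumFlux s ν lam p i j) := by
  have := isFiniteMeasure_cyl (T := T) hD
  refine ((hs.intCyl_ρuu i j).add ?_).sub
    ((memLp_stress (fun i j => hs.memLp_Du i j) ν lam i j).integrable (by norm_num))
  by_cases h : i = j
  · simpa only [h, if_true] using hs.intCyl_p hD hp
  · simpa only [h, if_false] using (BddMeas.const (0 : ℝ)).intCyl hD

theorem intCyl_μDc (hs : IsDissipativeWeakSolution D T ν lam p P I s)
    (hD : D.IsAdmissible) (i : Fin d) : D.IntCyl T fun t x => s.μ t x * s.Dc t x i :=
  intCyl_mul_L2 (hs.memLp_μ hD) (hs.memLp_Dc i)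

/-- The integrand of the momentum equation. -/
def momentumForm (s : Flow d) (ν lam : ℝ) (p : ℝ → ℝ) (φ : ℝ → Space d → Space d) (t : ℝ)
    (x : Space d) : ℝ :=
  ∑ i, (s.ρ t x * s.u t x i * deriv (fun r => φ r x i) t
    + ∑ j, momentumFlux s ν lam p i j t x * pd j (fun y => φ t y i) x
    - s.μ t x * s.Dc t x i * φ t x i)

/-- Every component is an integrable function times a bounded one, so that dominated convergence can
be applied term by term when the cutoff is removed. -/
theorem iter_momentumForm (hs : IsDissipativeWeakSolution D T ν lam p P I s)
    (hD : D.IsAdmissible) (hp : IsPressureLaw p P) {φ : ℝ → Space d → Space d}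
    (hφ : D.IsC1 T φ) {τ : ℝ} (hτ : τ ∈ Icc 0 T) :
    D.IntCyl T (momentumForm s ν lam p φ) ∧
    D.iter τ (momentumForm s ν lam p φ)
      = ∑ i, (D.iter τ (fun t x => s.ρ t x * s.u t x i * deriv (fun r => φ r x i) t)
        + ∑ j, D.iter τ (fun t x => momentumFlux s ν lam p i j t x * pd j (fun y => φ t y i) x)
        - D.iter τ (fun t x => s.μ t x * s.Dc t x i * φ t x i)) := by
  have i1 : ∀ i, D.IntCyl T fun t x => s.ρ t x * s.u t x i * deriv (fun r => φ r x i) t :=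
    fun i => (hs.intCyl_ρu hD hp i).mul_bdd hD ((hφ.apply i).bddMeas_deriv hD)
  have i2 : ∀ i j, D.IntCyl T fun t x => momentumFlux s ν lam p i j t x
      * pd j (fun y => φ t y i) x :=
    fun i j => (hs.intCyl_momentumFlux hD hp i j).mul_bdd hD ((hφ.apply i).bddMeas_pd hD j)
  have i3 : ∀ i, D.IntCyl T fun t x => s.μ t x * s.Dc t x i * φ t x i :=
    fun i => (hs.intCyl_μDc hD i).mul_bdd hD ((hφ.apply i).bddMeas hD)
  have i4 : ∀ i, D.IntCyl T fun t x => ∑ j, momentumFlux s ν lam p i j t x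
      * pd j (fun y => φ t y i) x := fun i => IntCyl.sum _ fun j _ => i2 i j
  have i5 := fun i => ((i1 i).add (i4 i)).sub (i3 i)
  refine ⟨IntCyl.sum _ fun i _ => i5 i, ?_⟩
  unfold momentumForm
  rw [iter_sum Finset.univ hτ fun i _ => i5 i]
  refine Finset.sum_congr rfl fun i _ => ?_
  rw [iter_sub hτ ((i1 i).add (i4 i)) (i3 i), iter_add hτ (i1 i) (i4 i),
    iter_sum Finset.univ hτ fun j _ => i2 i j]

theorem momentum_form_eq (s : Flow d) (ν lam : ℝ) (p : ℝ → ℝ) {φ : ℝ → Space d → Space d}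
    (hφ : D.IsC1 T φ) {t : ℝ} (ht : t ∈ Ioo 0 T) {x : Space d} (hx : x ∈ D.space) :
    momentumForm s ν lam p φ t x
      = (s.ρ t x * inner ℝ (s.u t x) (deriv (fun r => φ r x) t)
          + ddot (s.ρ t x • otimes (s.u t x) (s.u t x)) (jac (φ t) x)
          + p (s.ρ t x) * (jac (φ t) x).trace)
        - (ddot (stress ν lam (s.Du t x)) (jac (φ t) x)
            + s.μ t x * inner ℝ (s.Dc t x) (φ t x)) := by
  have hj := jac_apply (hφ.differentiableAt_space (Ioo_subset_Icc_self ht) hx)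
  simp only [momentumForm, momentumFlux, inner_eq_sum, hφ.apply_deriv ht hx, ddot, otimes,
    Matrix.smul_apply, Matrix.of_apply, smul_eq_mul, Matrix.trace, Matrix.diag, hj,
    Finset.sum_add_distrib, Finset.sum_sub_distrib, Finset.mul_sum, add_mul, sub_mul, ite_mul,
    zero_mul, Finset.sum_ite_eq, Finset.mem_univ, if_true]
  have e1 : ∑ i, s.ρ t x * s.u t x i * deriv (fun r => φ r x i) t
      = ∑ i, s.ρ t x * (s.u t x i * deriv (fun r => φ r x i) t) :=
    Finset.sum_congr rfl fun i _ => by ring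
  have e2 : ∑ i, s.μ t x * s.Dc t x i * φ t x i = ∑ i, s.μ t x * (s.Dc t x i * φ t x i) :=
    Finset.sum_congr rfl fun i _ => by ring
  have e3 : ∑ i, ∑ j, s.ρ t x * s.u t x i * s.u t x j * pd j (fun y => φ t y i) x
      = ∑ i, ∑ j, s.ρ t x * (s.u t x i * s.u t x j) * pd j (fun y => φ t y i) x :=
    Finset.sum_congr rfl fun i _ => Finset.sum_congr rfl fun j _ => by ring
  rw [e1, e2, e3]
  ring

theorem momentum_test (hs : IsDissipativeWeakSolution D T ν lam p P I s) (hT : 0 < T)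
    (hD : D.IsAdmissible) (hp : IsPressureLaw p P) (hI : I.FiniteEnergy D P)
    {φ : ℝ → Space d → Space d} (hφ : D.IsTest T φ) :
    D.iter T (momentumForm s ν lam p φ)
      = - (∑ i, ∫ x in D.cell, I.ρ x * I.u x i * φ 0 x i)
        + ∫ t in (0)..T, ∑ i, ∑ j, ∫ᵛ x, pd j (fun y => φ t y i) x ∂•(s.𝓡 t i j) := by
  have hTm : T ∈ Icc 0 T := ⟨hT.le, le_rfl⟩
  have h0m : (0 : ℝ) ∈ Icc 0 T := ⟨le_rfl, hT.le⟩
  have hfin := isFiniteMeasure_cell hD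
  have hfin' := isFiniteMeasure_cyl (T := T) hD
  have hC := hφ.1.1
  have hst := hI.isState hD hp
  have h1 := hs.momentum φ hφ
  have e1 : ∫ t in (0)..T, matIntegral (jac (φ t)) (s.𝓡 t)
      = ∫ t in (0)..T, ∑ i, ∑ j, ∫ᵛ x, pd j (fun y => φ t y i) x ∂•(s.𝓡 t i j) := by
    refine intervalIntegral.integral_congr_ae_restrict ?_
    rw [uIoc_of_le hT.le, ← restrict_Ioo_eq_restrict_Ioc]
    exact hs.ae_matIntegral hC
  have e2 : ∫ x in D.cell, inner ℝ (I.m x) (φ 0 x)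
      = ∑ i, ∫ x in D.cell, I.ρ x * I.u x i * φ 0 x i := by
    have hi : ∀ i, IntegrableOn (fun x => I.ρ x * I.u x i * φ 0 x i) D.cell := fun i =>
      (hst.mom_int i).mul_of_top_left ((hC.apply i).memLp_top hD h0m)
    rw [← integral_finsetSum _ fun i _ => hi i]
    refine integral_congr_ae ?_
    filter_upwards [hI.mom_ae] with x hx
    simp only [inner_eq_sum, hx]
  have i2 : D.IntCyl T fun t x => ddot (stress ν lam (s.Du t x)) (jac (φ t) x)
      + s.μ t x * inner ℝ (s.Dc t x) (φ t x) := by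
    refine IntCyl.congr (F := fun t x => (∑ i, ∑ j, stress ν lam (s.Du t x) i j
      * pd j (fun y => φ t y i) x) + ∑ i, s.μ t x * s.Dc t x i * φ t x i) (IntCyl.add
      (IntCyl.sum _ fun i _ => IntCyl.sum _ fun j _ => IntCyl.mul_bdd hD
        ((memLp_stress (fun i j => hs.memLp_Du i j) ν lam i j).integrable (by norm_num))
        ((hC.apply i).bddMeas_pd hD j))
      (IntCyl.sum _ fun i _ => (hs.intCyl_μDc hD i).mul_bdd hD ((hC.apply i).bddMeas hD)))
      (ae_cyl hD fun t ht x hx => ?_)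
    have hj := jac_apply (hC.differentiableAt_space (Ioo_subset_Icc_self ht) (cell_subset_space hx))
    simp only [ddot, hj, inner_eq_sum, Finset.mul_sum]
    congr 1
    exact Finset.sum_congr rfl fun i _ => by ring
  have hM := (hs.iter_momentumForm hD hp hC hTm).1
  have hform := ae_cyl (A := fun z => momentumForm s ν lam p φ z.1 z.2
      + (ddot (stress ν lam (s.Du z.1 z.2)) (jac (φ z.1) z.2)
        + s.μ z.1 z.2 * inner ℝ (s.Dc z.1 z.2) (φ z.1 z.2))
      = s.ρ z.1 z.2 * inner ℝ (s.u z.1 z.2) (deriv (fun r => φ r z.2) z.1)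
          + ddot (s.ρ z.1 z.2 • otimes (s.u z.1 z.2) (s.u z.1 z.2)) (jac (φ z.1) z.2)
          + p (s.ρ z.1 z.2) * (jac (φ z.1) z.2).trace) hD fun t ht x hx => by
    rw [momentum_form_eq s ν lam p hC ht (cell_subset_space hx)]
    ring
  have h3 := iter_congr_ae (D := D) (F := fun t x => momentumForm s ν lam p φ t x
      + (ddot (stress ν lam (s.Du t x)) (jac (φ t) x) + s.μ t x * inner ℝ (s.Dc t x) (φ t x)))
    (G := fun t x => s.ρ t x * inner ℝ (s.u t x) (deriv (fun r => φ r x) t)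
          + ddot (s.ρ t x • otimes (s.u t x) (s.u t x)) (jac (φ t) x)
          + p (s.ρ t x) * (jac (φ t) x).trace) hTm hform
  rw [iter_add hTm hM i2] at h3
  rw [e1, e2] at h1
  simp only [iter] at h3 ⊢
  linarith

/-- The momentum equation for test functions that vanish on the boundary. -/
theorem momentum_vanish (hs : IsDissipativeWeakSolution D T ν lam p P I s) (hd : 0 < d)
    (hT : 0 < T) (hD : D.IsAdmissible) (hp : IsPressureLaw p P) (hI : I.FiniteEnergy D P)
    {φ : ℝ → Space d → Space d} (hφ : D.IsTestClosed T φ)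
    (h0 : ∀ t ∈ Icc 0 T, ∀ x ∈ D.bdry, φ t x = 0) :
    D.iter T (momentumForm s ν lam p φ)
      = - (∑ i, ∫ x in D.cell, I.ρ x * I.u x i * φ 0 x i)
        + ∫ t in (0)..T, ∑ i, ∑ j, ∫ᵛ x, pd j (fun y => φ t y i) x ∂•(s.𝓡 t i j) := by
  have hTm : T ∈ Icc 0 T := ⟨hT.le, le_rfl⟩
  have h0m : (0 : ℝ) ∈ Icc 0 T := ⟨le_rfl, hT.le⟩
  have hst := hI.isState hD hp
  obtain ⟨η, hη⟩ := exists_isCutoff hd D hD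
  have hφn : ∀ n, D.IsTest T fun t x => η n x • φ t x := fun n => hφ.isTest_smul (hη.test n)
  have hC := hφ.1
  have hCn : ∀ n, D.IsC1 T fun t x => η n x • φ t x := fun n => (hφn n).1.1
  have e1 := fun n => hs.momentum_test hT hD hp hI (hφn n)
  have hpdb : ∀ i, ∃ M, ∀ t ∈ Icc 0 T, ∀ x ∈ D.cell, ‖fderiv ℝ (fun y => φ t y i) x‖ ≤ M :=
    fun i => (hC.apply i).exists_pd_bound hD
  choose M hM using hpdb
  -- The vanishing of `φ` on the boundary enters here: the derivatives of the cut-off fields stay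
  -- bounded as `n → ∞`.
  have hpd : ∀ i j n, ∀ t ∈ Icc 0 T, ∀ x ∈ D.cell,
      ‖pd j (fun y => (η n y • φ t y) i) x‖ ≤ 4 * M i := fun i j n t ht x hx =>
    hη.norm_pd_mul_le hD ((hC.apply i).vanishC1 hD (fun t ht x hx => by simp [h0 t ht x hx]) ht)
      (hM i t ht) j n hx
  have hev : ∀ i, ∀ t, ∀ x ∈ D.cell, ∀ᶠ n in atTop, η n x * φ t x i = φ t x i ∧
      ∀ j, pd j (fun y => (η n y • φ t y) i) x = pd j (fun y => φ t y i) x :=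
    fun i t x hx => hη.eventually_mul_eq (fun y => φ t y i) hx
  have l1 : Tendsto (fun n => D.iter T (momentumForm s ν lam p fun t x => η n x • φ t x)) atTop
      (𝓝 (D.iter T (momentumForm s ν lam p φ))) := by
    simp_rw [fun n => (hs.iter_momentumForm hD hp (hCn n) hTm).2,
      (hs.iter_momentumForm hD hp hC hTm).2]
    refine tendsto_finsetSum _ fun i _ => ((?_ : Tendsto _ _ _).add
      (tendsto_finsetSum _ fun j _ => ?_)).sub ?_
    · obtain ⟨L, hL⟩ := ((hC.apply i).bddMeas_deriv hD).bound
      have hder : ∀ n, ∀ t ∈ Ioo 0 T, ∀ x ∈ D.cell, deriv (fun r => (η n x • φ r x) i) t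
          = η n x * deriv (fun r => φ r x i) t := fun n t ht x hx =>
        deriv_const_mul _ ((hC.apply i).differentiableAt_time ht (cell_subset_space hx))
      refine tendsto_iter_mul hT hD (hs.intCyl_ρu hD hp i)
        (fun n => ((hCn n).apply i).bddMeas_deriv hD) ((hC.apply i).bddMeas_deriv hD) (L := L)
        (fun n t ht x hx => ?_) fun t ht x hx => ?_
      · rw [hder n t ht x hx, norm_mul]
        exact (mul_le_of_le_one_left (norm_nonneg _) (hη.norm_le n x)).trans (hL t ht x hx)
      · refine tendsto_const_nhds.congr' ?_
        filter_upwards [hη.tendsto_one (cell_subset_space hx)] with n hn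
        rw [hder n t ht x hx, hn.eq_of_nhds, one_mul]
    · refine tendsto_iter_mul hT hD (hs.intCyl_momentumFlux hD hp i j)
        (fun n => ((hCn n).apply i).bddMeas_pd hD j) ((hC.apply i).bddMeas_pd hD j) (L := 4 * M i)
        (fun n t ht x hx => hpd i j n t (Ioo_subset_Icc_self ht) x hx) fun t ht x hx => ?_
      refine tendsto_const_nhds.congr' ?_
      filter_upwards [hev i t x hx] with n hn using (hn.2 j).symm
    · obtain ⟨L, hL⟩ := ((hC.apply i).bddMeas hD).bound
      refine tendsto_iter_mul hT hD (hs.intCyl_μDc hD i)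
        (fun n => ((hCn n).apply i).bddMeas hD) ((hC.apply i).bddMeas hD) (L := L)
        (fun n t ht x hx => ?_) fun t ht x hx => ?_
      · simp only [PiLp.smul_apply, smul_eq_mul]
        rw [norm_mul]
        exact (mul_le_of_le_one_left (norm_nonneg _) (hη.norm_le n x)).trans (hL t ht x hx)
      · refine tendsto_const_nhds.congr' ?_
        filter_upwards [hev i t x hx] with n hn using hn.1.symm
  have l2 : Tendsto (fun n => - ∑ i, ∫ x in D.cell, I.ρ x * I.u x i * (η n x • φ 0 x) i) atTop
      (𝓝 (- ∑ i, ∫ x in D.cell, I.ρ x * I.u x i * φ 0 x i)) := by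
    refine Tendsto.neg (tendsto_finsetSum _ fun i _ => ?_)
    have hi : IntegrableOn (fun x => I.ρ x * I.u x i * φ 0 x i) D.cell :=
      (hst.mom_int i).mul_of_top_left ((hC.apply i).memLp_top hD h0m)
    refine tendsto_integral_of_dominated_convergence (fun x => ‖I.ρ x * I.u x i * φ 0 x i‖)
      (fun n => (hst.mom_int i).1.mul (((hCn n).apply i).memLp_top hD h0m).1) hi.norm
      (fun n => Eventually.of_forall fun x => ?_) (ae_cell hD fun x hx => ?_)
    · simp only [PiLp.smul_apply, smul_eq_mul]
      rw [mul_left_comm, norm_mul]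
      exact mul_le_of_le_one_left (norm_nonneg _) (hη.norm_le n x)
    · refine tendsto_const_nhds.congr' ?_
      filter_upwards [hev i 0 x hx] with n hn
      simp only [PiLp.smul_apply, smul_eq_mul, hn.1]
  -- The defect measures charge only the cell, at every point of which the derivatives are
  -- eventually those of `φ`. Pointwise convergence with a uniform bound is what makes the limit
  -- legitimate for measures that may be singular.
  have l3 : Tendsto (fun n => ∫ t in (0)..T, ∑ i, ∑ j,
        ∫ᵛ x, pd j (fun y => (η n y • φ t y) i) x ∂•(s.𝓡 t i j)) atTop
      (𝓝 (∫ t in (0)..T, ∑ i, ∑ j, ∫ᵛ x, pd j (fun y => φ t y i) x ∂•(s.𝓡 t i j))) := by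
    choose K hK hb using fun i j => (hs.isDefect i j).exists_bound
    have hIoc : volume.restrict (uIoc 0 T) = volume.restrict (Ioo 0 T) := by
      rw [uIoc_of_le hT.le, restrict_Ioo_eq_restrict_Ioc]
    have hb' : ∀ᵐ t ∂(volume.restrict (Ioo 0 T)), ∀ i j, ∀ (f : Space d → ℝ) (L : ℝ), 0 ≤ L →
        (∀ x ∈ D.cell, ‖f x‖ ≤ L) → ‖∫ᵛ x, f x ∂•(s.𝓡 t i j)‖ ≤ K i j * L :=
      ae_all_iff.2 fun i => ae_all_iff.2 fun j => hb i j
    have hcm : ∀ᵐ t ∂(volume.restrict (Ioo 0 T)), ∀ i j, IsCellMeasure D (s.𝓡 t i j) :=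
      ae_all_iff.2 fun i => ae_all_iff.2 fun j => (hs.isDefect i j).ae_isCellMeasure
    have hIoo : ∀ᵐ t ∂(volume.restrict (Ioo 0 T)), t ∈ Ioo 0 T :=
      ae_restrict_mem measurableSet_Ioo
    simp_rw [intervalIntegral.integral_of_le hT.le, integral_Ioc_eq_integral_Ioo]
    refine tendsto_integral_of_dominated_convergence
      (fun _ => ∑ i, ∑ j, K i j * |4 * M i|)
      (fun n => (hs.integrableOn_sum_defect hd hD (hCn n)).1) (integrable_const _) (fun n => ?_) ?_
    · filter_upwards [hb', hIoo] with t ht ht'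
      refine (norm_sum_le _ _).trans (Finset.sum_le_sum fun i _ =>
        (norm_sum_le _ _).trans (Finset.sum_le_sum fun j _ => ?_))
      exact ht i j _ _ (abs_nonneg _) fun x hx =>
        (hpd i j n t (Ioo_subset_Icc_self ht') x hx).trans (le_abs_self _)
    · filter_upwards [hcm, hIoo] with t ht ht'
      have ht'' := Ioo_subset_Icc_self ht'
      refine tendsto_finsetSum _ fun i _ => tendsto_finsetSum _ fun j _ => ?_
      refine (ht i j).tendsto hD (fun n => (((hCn n).apply i).bddC1 hD ht'').continuousOn_pd hD j)
        (fun n x hx => hpd i j n t ht'' x hx) fun x hx => ?_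
      refine tendsto_const_nhds.congr' ?_
      filter_upwards [hev i t x hx] with n hn using (hn.2 j).symm
  exact tendsto_nhds_unique l1 ((l2.add l3).congr fun n => (e1 n).symm)

/-- The momentum equation, integrated in time. -/
theorem ae_momentum (hs : IsDissipativeWeakSolution D T ν lam p P I s) (hd : 0 < d)
    (hT : 0 < T) (hD : D.IsAdmissible) (hp : IsPressureLaw p P) (hI : I.FiniteEnergy D P)
    {U : ℝ → Space d → Space d} (hU : D.IsC1 T U)
    (h0 : ∀ t ∈ Icc 0 T, ∀ x ∈ D.bdry, U t x = 0) :
    ∀ᵐ τ ∂(volume.restrict (Ioo 0 T)),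
      ∑ i, ∫ x in D.cell, s.ρ τ x * s.u τ x i * U τ x i
        = (∑ i, ∫ x in D.cell, I.ρ x * I.u x i * U 0 x i)
          + D.iter τ (momentumForm s ν lam p U)
          - ∫ t in (0)..τ, matIntegral (jac (U t)) (s.𝓡 t) := by
  have hTm : T ∈ Icc 0 T := ⟨hT.le, le_rfl⟩
  have hai : ∀ i, D.IntCyl T fun t x => s.ρ t x * s.u t x i * U t x i := fun i =>
    (hs.intCyl_ρu hD hp i).mul_bdd hD ((hU.apply i).bddMeas hD)
  have ha : D.IntCyl T fun t x => ∑ i, s.ρ t x * s.u t x i * U t x i :=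
    IntCyl.sum _ fun i _ => hai i
  have hai' : ∀ᵐ τ ∂(volume.restrict (Ioo 0 T)), ∀ i,
      IntegrableOn (fun x => s.ρ τ x * s.u τ x i * U τ x i) D.cell :=
    ae_all_iff.2 fun i => (hai i).ae_integrable
  have key := ae_balance hT ha (hs.iter_momentumForm hD hp hU hTm).1
    (a₀ := ∑ i, ∫ x in D.cell, I.ρ x * I.u x i * U 0 x i)
    (hs.integrableOn_matIntegral hd hD hU) fun ψ hψ => ?_
  · filter_upwards [key, hai'] with τ h1 h2
    rw [← h1, integral_finsetSum _ fun i _ => h2 i]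
  · have h1 := hs.momentum_vanish hd hT hD hp hI (hU.isTestClosed_smul hψ)
      (fun t ht x hx => by simp [h0 t ht x hx])
    have e1 : ∑ i, ∫ x in D.cell, I.ρ x * I.u x i * (ψ 0 • U 0 x) i
        = ψ 0 * ∑ i, ∫ x in D.cell, I.ρ x * I.u x i * U 0 x i := by
      rw [Finset.mul_sum]
      refine Finset.sum_congr rfl fun i _ => ?_
      rw [← integral_const_mul]; congr 1; ext x; simp only [PiLp.smul_apply, smul_eq_mul]; ring
    have e2 : ∫ t in (0)..T, ∑ i, ∑ j, ∫ᵛ x, pd j (fun y => (ψ t • U t y) i) x ∂•(s.𝓡 t i j)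
        = ∫ t in (0)..T, ψ t * matIntegral (jac (U t)) (s.𝓡 t) := by
      refine intervalIntegral.integral_congr_ae_restrict ?_
      rw [uIoc_of_le hT.le, ← restrict_Ioo_eq_restrict_Ioc]
      have hcm : ∀ᵐ t ∂(volume.restrict (Ioo 0 T)), ∀ i j, IsCellMeasure D (s.𝓡 t i j) :=
        ae_all_iff.2 fun i => ae_all_iff.2 fun j => (hs.isDefect i j).ae_isCellMeasure
      filter_upwards [hs.ae_matIntegral hU, hcm, ae_restrict_mem measurableSet_Ioo] with t ht hc ht'
      rw [ht, Finset.mul_sum]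
      refine Finset.sum_congr rfl fun i _ => ?_
      rw [Finset.mul_sum]
      refine Finset.sum_congr rfl fun j _ => ?_
      rw [← smul_eq_mul, ← VectorMeasure.integral_fun_smul]
      refine VectorMeasure.integral_congr_ae ((hc i j).ae_of_cell fun x hx => ?_)
      exact (hU.apply i).pd_time_mul ψ (Ioo_subset_Icc_self ht') hx j
    rw [e1, e2] at h1
    rw [← h1]
    refine iter_congr_ae hTm (ae_cyl hD fun t ht x hx => ?_)
    simp only [momentumForm, Finset.mul_sum]
    rw [← Finset.sum_add_distrib]
    refine Finset.sum_congr rfl fun i _ => ?_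
    have f1 : deriv (fun r => ψ r * U r x i) t = _ := (hU.apply i).deriv_time_mul hψ ht hx
    have f2 : ∀ j, pd j (fun y => ψ t * U t y i) x = _ := fun j =>
      (hU.apply i).pd_time_mul ψ (Ioo_subset_Icc_self ht) hx j
    simp only [PiLp.smul_apply, smul_eq_mul, f1, f2]
    have f3 : ∑ j, momentumFlux s ν lam p i j t x * (ψ t * pd j (fun y => U t y i) x)
        = ψ t * ∑ j, momentumFlux s ν lam p i j t x * pd j (fun y => U t y i) x := by
      rw [Finset.mul_sum]
      exact Finset.sum_congr rfl fun j _ => by ring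
    rw [f3]
    ring

end IsDissipativeWeakSolution

/-! ### Exchanging almost every time with almost every point -/

/-- Integration by parts against `q - t`, which vanishes at `q` and has derivative `-1`. -/
theorem integral_primitive {B : ℝ → ℝ} {q : ℝ} (hB : IntervalIntegrable B volume 0 q) (a : ℝ) :
    ∫ t in (0)..q, (a + ∫ r in (0)..t, B r) = q * a + ∫ t in (0)..q, (q - t) * B t := by
  set H : ℝ → ℝ := fun τ => a + ∫ t in (0)..τ, B t with hHdef
  have hH : AbsolutelyContinuousOnInterval H 0 q :=
    ((LipschitzWith.const a).lipschitzOnWith (s := uIcc 0 q)).absolutelyContinuousOnInterval.add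
      (hB.absolutelyContinuousOnInterval_intervalIntegral (c := 0) (by simp))
  have hf : AbsolutelyContinuousOnInterval (fun t => q - t) 0 q :=
    ((contDiff_const.sub contDiff_id : ContDiff ℝ 1 fun t : ℝ => q - t).contDiffOn
        (s := uIcc 0 q)).absolutelyContinuousOnInterval
  have h1 := hf.integral_mul_deriv_eq_deriv_mul hH
  have h2 : ∫ t in (0)..q, (q - t) * deriv H t = ∫ t in (0)..q, (q - t) * B t := by
    refine intervalIntegral.integral_congr_ae ?_
    filter_upwards [hB.ae_hasDerivAt_integral] with t ht ht'
    rw [((ht (uIoc_subset_uIcc ht') 0 (by simp)).const_add a).deriv]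
  have h3 : ∀ t, deriv (fun t => q - t) t = -1 := fun t => by simp
  have h4 : H 0 = a := by simp [hHdef]
  simp only [h2, h3, h4, sub_self, zero_mul, sub_zero, neg_one_mul,
    intervalIntegral.integral_neg] at h1
  linarith

/-- An identity at almost every time becomes countably many identities between integrals. In that
form it can be integrated over `x`, or tested in `x` and localized, although the exceptional sets of
times for different `x` are unrelated. -/
theorem ae_eq_primitive_iff {T : ℝ} (hT : 0 < T) {A B : ℝ → ℝ} {a : ℝ}
    (hA : IntegrableOn A (Ioo 0 T)) (hB : IntegrableOn B (Ioo 0 T)) :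
    (∀ᵐ t ∂(volume.restrict (Ioo 0 T)), A t = a + ∫ r in (0)..t, B r) ↔
      ∀ q : ℚ, (q : ℝ) ∈ Ioo 0 T → ∫ t in (0)..(q : ℝ), A t
        = q * a + ∫ t in (0)..(q : ℝ), (q - t) * B t := by
  have hTm : T ∈ Icc 0 T := ⟨hT.le, le_rfl⟩
  have hB' := intervalIntegrable_of_integrable hB hTm
  have hH : ContinuousOn (fun τ => a + ∫ t in (0)..τ, B t) (uIcc 0 T) := continuousOn_const.add
      (hB'.absolutelyContinuousOnInterval_intervalIntegral (c := 0) (by simp)).continuousOn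
  constructor
  · intro h q hq
    rw [← integral_primitive (intervalIntegrable_of_integrable hB (Ioo_subset_Icc_self hq))]
    refine intervalIntegral.integral_congr_ae_restrict ?_
    rw [uIoc_of_le hq.1.le, ← restrict_Ioo_eq_restrict_Ioc]
    exact ae_restrict_of_ae_restrict_of_subset (Ioo_subset_Ioo_right hq.2.le) h
  · intro h
    have key := ae_eq_zero_of_primitive_eq_zero hT (f := fun t => A t - (a + ∫ r in (0)..t, B r))
      ((intervalIntegrable_of_integrable hA hTm).sub hH.intervalIntegrable) fun q hq => ?_
    · filter_upwards [key] with t ht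
      linarith
    · have hqm := Ioo_subset_Icc_self hq
      have hsub : uIcc 0 (q : ℝ) ⊆ uIcc 0 T := by
        rw [uIcc_of_le hq.1.le, uIcc_of_le hT.le]; exact Icc_subset_Icc_right hq.2.le
      rw [intervalIntegral.integral_sub (intervalIntegrable_of_integrable hA hqm)
        (hH.mono hsub).intervalIntegrable, h q hq,
        integral_primitive (intervalIntegrable_of_integrable hB hqm), sub_self]

namespace FluidDomain

variable {D : FluidDomain d} {T : ℝ}

theorem IntCyl.ae_integrable_time {F : ℝ → Space d → ℝ} (h : D.IntCyl T F) :
    ∀ᵐ x ∂(volume.restrict D.cell), IntegrableOn (fun t => F t x) (Ioo 0 T) := by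
  rw [IntCyl, cyl_eq_prod] at h
  exact h.prod_left_ae

theorem IntCyl.time_mul (hD : D.IsAdmissible) {F : ℝ → Space d → ℝ} (h : D.IntCyl T F)
    {w : ℝ → ℝ} (hw : Continuous w) : D.IntCyl T fun t x => w t * F t x := by
  have hb : D.BddMeas T fun t _ => w t :=
    BddMeas.of_continuousOn hD (hw.comp continuous_fst).continuousOn
  simpa only [mul_comm] using h.mul_bdd hD hb

/-- Fubini's theorem on `(0,q) × Ω`. -/
theorem IntCyl.iter_swap {F : ℝ → Space d → ℝ} (h : D.IntCyl T F) {q : ℝ} (hq : q ∈ Icc 0 T) :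
    IntegrableOn (fun x => ∫ t in (0)..q, F t x) D.cell ∧
    D.iter q F = ∫ x in D.cell, ∫ t in (0)..q, F t x := by
  have hint : Integrable (fun z : ℝ × Space d => F z.1 z.2)
      ((volume.restrict (Ioo 0 q)).prod (volume.restrict D.cell)) := by
    rw [← cyl_eq_prod]
    exact Integrable.mono_measure h
      (Measure.restrict_mono (prod_mono_left (Ioo_subset_Ioo_right hq.2)) le_rfl)
  simp only [iter, intervalIntegral.integral_of_le hq.1, integral_Ioc_eq_integral_Ioo]
  exact ⟨hint.integral_prod_right, integral_integral_swap hint⟩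

/-- In the integrated form of `ae_eq_primitive_iff` the time integrals commute with the integral
over `x` by Fubini. -/
theorem ae_integral_of_ae_primitive (hT : 0 < T) (hD : D.IsAdmissible) {a g : ℝ → Space d → ℝ}
    {a₀ : Space d → ℝ} (ha : D.IntCyl T a) (hg : D.IntCyl T g) (ha₀ : IntegrableOn a₀ D.cell)
    (h : ∀ᵐ x ∂(volume.restrict D.cell), ∀ᵐ t ∂(volume.restrict (Ioo 0 T)),
      a t x = a₀ x + ∫ r in (0)..t, g r x) :
    ∀ᵐ t ∂(volume.restrict (Ioo 0 T)), ∫ x in D.cell, a t x = (∫ x in D.cell, a₀ x)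
      + D.iter t g := by
  refine (ae_eq_primitive_iff hT ha.integrable_integral hg.integrable_integral).2 fun q hq => ?_
  have hqm := Ioo_subset_Icc_self hq
  have hgq : D.IntCyl T fun t x => (q - t) * g t x :=
    hg.time_mul hD (continuous_const.sub continuous_id)
  have e1 : ∫ t in (0)..(q : ℝ), ((q : ℝ) - t) * ∫ x in D.cell, g t x
      = D.iter q fun t x => (q - t) * g t x := by
    simp only [iter, integral_const_mul]
  have e2 : ∫ t in (0)..(q : ℝ), ∫ x in D.cell, a t x = D.iter q a := rfl
  rw [e1, e2, (ha.iter_swap hqm).2, (hgq.iter_swap hqm).2, ← integral_const_mul,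
    ← integral_add (ha₀.const_mul _) (hgq.iter_swap hqm).1]
  refine integral_congr_ae ?_
  filter_upwards [h, ha.ae_integrable_time, hg.ae_integrable_time] with x h1 h2 h3
  exact (ae_eq_primitive_iff hT h2 h3).1 h1 q hq

/-- For every rational `q` the defect of the integrated identity is an integrable function of `x`
orthogonal to all test functions, hence zero almost everywhere. Countably many `q` leave one common
null set of points. -/
theorem ae_primitive_of_weak (hT : 0 < T) (hD : D.IsAdmissible) {a g : ℝ → Space d → ℝ}
    {a₀ : Space d → ℝ} (ha : D.IntCyl T a) (hg : D.IntCyl T g) (ha₀ : IntegrableOn a₀ D.cell)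
    (h : ∀ χ, D.SmoothTest χ → ∀ᵐ t ∂(volume.restrict (Ioo 0 T)),
      ∫ x in D.cell, a t x * χ x = (∫ x in D.cell, a₀ x * χ x) + D.iter t fun r x => g r x * χ x) :
    ∀ᵐ x ∂(volume.restrict D.cell), ∀ᵐ t ∂(volume.restrict (Ioo 0 T)),
      a t x = a₀ x + ∫ r in (0)..t, g r x := by
  have key : ∀ᵐ x ∂(volume.restrict D.cell), ∀ q : ℚ, (q : ℝ) ∈ Ioo 0 T →
      ∫ t in (0)..(q : ℝ), a t x = q * a₀ x + ∫ t in (0)..(q : ℝ), (q - t) * g t x := by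
    refine ae_all_iff.2 fun q => ?_
    by_cases hq : (q : ℝ) ∈ Ioo 0 T
    swap
    · exact Eventually.of_forall fun x h => absurd h hq
    have hqm := Ioo_subset_Icc_self hq
    have hgq : D.IntCyl T fun t x => (q - t) * g t x :=
      hg.time_mul hD (continuous_const.sub continuous_id)
    have i1 := (ha.iter_swap hqm).1
    have i2 : IntegrableOn (fun x => (q : ℝ) * a₀ x + ∫ t in (0)..(q : ℝ), (q - t) * g t x) D.cell :=
      (ha₀.const_mul _).add (hgq.iter_swap hqm).1
    have hz := ae_eq_zero_of_integral_smoothTest hD (h := fun x => (∫ t in (0)..(q : ℝ), a t x)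
      - (q * a₀ x + ∫ t in (0)..(q : ℝ), (q - t) * g t x)) (i1.sub i2) fun χ hχ => ?_
    · filter_upwards [hz] with x hx _
      linarith
    · have hχb := hχ.isC1 (T := T)
      have aχ : D.IntCyl T fun t x => a t x * χ x := ha.mul_bdd hD (hχb.bddMeas hD)
      have gχ : D.IntCyl T fun t x => g t x * χ x := hg.mul_bdd hD (hχb.bddMeas hD)
      have gχq : D.IntCyl T fun t x => (q - t) * (g t x * χ x) :=
        gχ.time_mul hD (continuous_const.sub continuous_id)
      have h0 : (0 : ℝ) ∈ Icc 0 T := ⟨le_rfl, hT.le⟩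
      have a0χ : IntegrableOn (fun x => a₀ x * χ x) D.cell :=
        ha₀.mul_of_top_left (hχb.memLp_top hD h0)
      have h1 := (ae_eq_primitive_iff hT aχ.integrable_integral gχ.integrable_integral).1
        (h χ hχ) q hq
      have e1 : ∫ t in (0)..(q : ℝ), ((q : ℝ) - t) * ∫ x in D.cell, g t x * χ x
          = D.iter q fun t x => (q - t) * (g t x * χ x) := by
        simp only [iter, integral_const_mul]
      have e2 : ∫ t in (0)..(q : ℝ), ∫ x in D.cell, a t x * χ x
        = D.iter q fun t x => a t x * χ x := rfl
      rw [e1, e2, (aχ.iter_swap hqm).2, (gχq.iter_swap hqm).2, ← integral_const_mul,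
        ← integral_add (a0χ.const_mul _) (gχq.iter_swap hqm).1] at h1
      have j2 : IntegrableOn (fun x => (q : ℝ) * (a₀ x * χ x)
          + ∫ t in (0)..(q : ℝ), (q - t) * (g t x * χ x)) D.cell :=
        (a0χ.const_mul _).add (gχq.iter_swap hqm).1
      rw [← sub_eq_zero, ← integral_sub (aχ.iter_swap hqm).1 j2] at h1
      refine Eq.trans ?_ h1
      congr 1; ext x
      have f1 : ∫ t in (0)..(q : ℝ), a t x * χ x = (∫ t in (0)..(q : ℝ), a t x) * χ x :=
        intervalIntegral.integral_mul_const _ _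
      have f2 : ∫ t in (0)..(q : ℝ), ((q : ℝ) - t) * (g t x * χ x)
          = (∫ t in (0)..(q : ℝ), (q - t) * g t x) * χ x := by
        rw [← intervalIntegral.integral_mul_const]
        congr 1; ext t; ring
      rw [f1, f2]
      ring
  filter_upwards [key, ha.ae_integrable_time, hg.ae_integrable_time] with x h1 h2 h3
  exact (ae_eq_primitive_iff hT h2 h3).2 h1

theorem tendsto_iter_zero (hT : 0 < T) {g : ℝ → Space d → ℝ} (hg : D.IntCyl T g) {τ : ℕ → ℝ}
    (hτ : ∀ k, τ k ∈ Icc 0 T) (h0 : Tendsto τ atTop (𝓝 0)) :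
    Tendsto (fun k => D.iter (τ k) g) atTop (𝓝 0) := by
  have hTm : T ∈ Icc 0 T := ⟨hT.le, le_rfl⟩
  have hc := ((hg.intervalIntegrable hTm).absolutelyContinuousOnInterval_intervalIntegral
    (c := 0) (by simp)).continuousOn 0 (by simp)
  have h1 : Tendsto τ atTop (𝓝[uIcc 0 T] 0) :=
    tendsto_nhdsWithin_iff.2 ⟨h0, Eventually.of_forall fun k => by
      rw [uIcc_of_le hT.le]; exact hτ k⟩
  have h2 := hc.tendsto.comp h1
  simpa only [intervalIntegral.integral_same, Function.comp_def, iter] using h2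

/-- A function of the form `a₀ + ∫ g` attains its initial value in `L¹` along a sequence of good
times. -/
theorem exists_seq_of_ae_primitive (hT : 0 < T) (hD : D.IsAdmissible) {a g : ℝ → Space d → ℝ}
    {a₀ : Space d → ℝ} (ha : D.IntCyl T a) (hg : D.IntCyl T g) (ha₀ : IntegrableOn a₀ D.cell)
    (h : ∀ᵐ x ∂(volume.restrict D.cell), ∀ᵐ t ∂(volume.restrict (Ioo 0 T)),
      a t x = a₀ x + ∫ r in (0)..t, g r x) {A : ℝ → Prop}
    (hA : ∀ᵐ t ∂(volume.restrict (Ioo 0 T)), A t) :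
    ∃ t : ℕ → ℝ, (∀ k, A (t k)) ∧ (∀ k, IntegrableOn (a (t k)) D.cell) ∧
      Tendsto (fun k => ∫ x in D.cell, ‖a (t k) x - a₀ x‖) atTop (𝓝 0) := by
  have hfin := isFiniteMeasure_cell hD
  have hg' : D.IntCyl T fun t x => ‖g t x‖ := Integrable.norm hg
  have ha₀' : D.IntCyl T fun _ x => a₀ x := by
    rw [IntCyl, cyl_eq_prod]
    exact ha₀.comp_snd _
  have hN : D.IntCyl T fun t x => ‖a t x - a₀ x‖ := Integrable.norm (ha.sub ha₀')
  have step : ∀ τ, τ ∈ Ioo 0 T → ∃ t, A t ∧ IntegrableOn (a t) D.cell ∧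
      ∫ x in D.cell, ‖a t x - a₀ x‖ ≤ D.iter τ fun t x => ‖g t x‖ := by
    intro τ hτ
    have hτm := Ioo_subset_Icc_self hτ
    have hsub : Ioo 0 τ ⊆ Ioo 0 T := Ioo_subset_Ioo_right hτ.2.le
    have hA' : ∀ᵐ t ∂(volume.restrict (Ioo 0 τ)), A t ∧ IntegrableOn (a t) D.cell :=
      ae_restrict_of_ae_restrict_of_subset hsub (hA.and ha.ae_integrable)
    have hNτ : IntegrableOn (fun t => ∫ x in D.cell, ‖a t x - a₀ x‖) (Ioo 0 τ) :=
      IntegrableOn.mono_set hN.integrable_integral hsub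
    -- Some time outside the exceptional null set has an `L¹` distance no larger than the average
    -- over `(0,τ)`.
    obtain ⟨t, ht, ht'⟩ := exists_notMem_null_le_average (μ := volume.restrict (Ioo 0 τ))
      (by simp [Measure.restrict_eq_zero, hτ.1]) hNτ (ae_iff.1 hA')
    simp only [mem_ofPred_eq, not_not] at ht
    refine ⟨t, ht.1, ht.2, ht'.trans ?_⟩
    have hav : ⨍ t in Ioo 0 τ, (∫ x in D.cell, ‖a t x - a₀ x‖)
        = τ⁻¹ * D.iter τ fun t x => ‖a t x - a₀ x‖ := by
      rw [setAverage_eq, iter, intervalIntegral.integral_of_le hτ.1.le,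
        integral_Ioc_eq_integral_Ioo]
      simp [hτ.1.le]
    rw [hav, inv_mul_le_iff₀ hτ.1, (hN.iter_swap hτm).2, (hg'.iter_swap hτm).2,
      ← integral_const_mul]
    refine integral_mono_ae (hN.iter_swap hτm).1 ((hg'.iter_swap hτm).1.const_mul τ) ?_
    filter_upwards [h, hN.ae_integrable_time, hg.ae_integrable_time] with x h1 h2 h3
    have hgi := intervalIntegrable_of_integrable h3 hτm
    -- For `t < τ` the deviation from the initial value is at most `∫₀^τ |g|`, so the average over
    -- `(0,τ)` obeys the same bound, which tends to zero with `τ` after integration in `x`.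
    have e : ∫ t in (0)..τ, ‖a t x - a₀ x‖ ≤ ∫ _ in (0)..τ, ∫ t in (0)..τ, ‖g t x‖ := by
      refine intervalIntegral.integral_mono_ae_restrict hτ.1.le
        (intervalIntegrable_of_integrable h2 hτm) intervalIntegrable_const ?_
      rw [← restrict_Ioo_eq_restrict_Icc]
      filter_upwards [ae_restrict_of_ae_restrict_of_subset hsub h1,
        ae_restrict_mem measurableSet_Ioo] with t ht ht'
      rw [ht, add_sub_cancel_left]
      refine (intervalIntegral.norm_integral_le_integral_norm ht'.1.le).trans ?_
      exact intervalIntegral.integral_mono_interval le_rfl ht'.1.le ht'.2.le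
        (Eventually.of_forall fun _ => norm_nonneg _) hgi.norm
    simpa using e
  -- The shift by `2` keeps the value strictly below `T` also for `k = 0`.
  have hτ : ∀ k : ℕ, T / (k + 2) ∈ Ioo 0 T := fun k =>
    ⟨by positivity, div_lt_self hT (by have : (0 : ℝ) ≤ k := Nat.cast_nonneg k; linarith)⟩
  choose t h1 h2 h3 using fun k : ℕ => step _ (hτ k)
  refine ⟨t, h1, h2, ?_⟩
  have hlim : Tendsto (fun k : ℕ => T / ((k : ℝ) + 2)) atTop (𝓝 0) :=
    tendsto_const_nhds.div_atTop (tendsto_natCast_atTop_atTop.atTop_add tendsto_const_nhds)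
  exact squeeze_zero (fun k => integral_nonneg fun x => norm_nonneg _) h3
    (tendsto_iter_zero hT hg' (fun k => Ioo_subset_Icc_self (hτ k)) hlim)

end FluidDomain

/-! ### Renormalization and the initial concentration -/

namespace IsDissipativeWeakSolution

variable {D : FluidDomain d} {T ν lam : ℝ} {p P : ℝ → ℝ} {I : InitialData d} {s : Flow d}

/-- Test functions independent of time remove the term with `∂ₜφ`, and the weak equation becomes an
ordinary differential equation in `t` at almost every point `x`. -/
theorem ae_primitive_c (hs : IsDissipativeWeakSolution D T ν lam p P I s) (hd : 0 < d)
    (hT : 0 < T) (hD : D.IsAdmissible) (hI : I.FiniteEnergy D P) :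
    ∀ᵐ x ∂(volume.restrict D.cell), ∀ᵐ t ∂(volume.restrict (Ioo 0 T)),
      s.c t x = I.c x + ∫ r in (0)..t, (s.μ r x - inner ℝ (s.u r x) (s.Dc r x)) := by
  have := isFiniteMeasure_cell hD
  refine ae_primitive_of_weak hT hD (hs.intCyl_c hD) (hs.intCyl_source hD)
    (hI.c_mem.integrable (by norm_num)) fun χ hχ => ?_
  have := hs.ae_allenCahn hd hT hD hI hχ.isC1
  simpa only [deriv_const, mul_zero, zero_add] using this

theorem intCyl_deriv_glW (hs : IsDissipativeWeakSolution D T ν lam p P I s)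
    {F : ℝ → Space d → ℝ} (hF : D.IntCyl T F) :
    D.IntCyl T fun t x => deriv glW (s.c t x) * F t x := by
  refine Integrable.bdd_mul (c := 2) hF
    (continuous_deriv_glW.comp_aestronglyMeasurable hs.memLp_c.1) ?_
  exact Eventually.of_forall fun z => abs_deriv_glW_le _

/-- Renormalization of the Allen--Cahn equation. -/
theorem ae_integral_glW_eq (hs : IsDissipativeWeakSolution D T ν lam p P I s) (hd : 0 < d)
    (hT : 0 < T) (hD : D.IsAdmissible) (hI : I.FiniteEnergy D P) :
    ∀ᵐ τ ∂(volume.restrict (Ioo 0 T)),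
      ∫ x in D.cell, glW (s.c τ x) = (∫ x in D.cell, glW (I.c x))
        + D.iter τ fun t x => deriv glW (s.c t x)
          * (s.μ t x - inner ℝ (s.u t x) (s.Dc t x)) := by
  have hfin := isFiniteMeasure_cell hD
  have hfin' := isFiniteMeasure_cyl (T := T) hD
  have hW : D.IntCyl T fun t x => glW (s.c t x) := by
    refine Integrable.mono' ((integrable_const (1 : ℝ)).add
      ((Integrable.norm (hs.intCyl_c hD)).const_mul 2))
      (contDiff_glW.continuous.comp_aestronglyMeasurable hs.memLp_c.1) ?_
    exact Eventually.of_forall fun z => abs_glW_le _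
  have hsrc := hs.intCyl_source hD
  refine ae_integral_of_ae_primitive hT hD hW (hs.intCyl_deriv_glW hsrc)
    ((memLp_glW hD hI.c_mem).integrable (by norm_num)) ?_
  -- At almost every `x` the concentration agrees at almost all times with an absolutely continuous
  -- function, so the chain rule is the one-dimensional one. The source need only be integrable;
  -- `W'(c)` is never used as a test function.
  filter_upwards [hs.ae_primitive_c hd hT hD hI, hsrc.ae_integrable_time] with x h1 h2
  filter_upwards [h1, ae_restrict_mem measurableSet_Ioo] with t ht ht'
  have htm := Ioo_subset_Icc_self ht'
  rw [ht, comp_primitive_eq lipschitz_glW (contDiff_glW.differentiable one_ne_zero) _ _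
    (intervalIntegrable_of_integrable h2 htm)]
  congr 1
  refine intervalIntegral.integral_congr_ae_restrict ?_
  rw [uIoc_of_le ht'.1.le, ← restrict_Ioo_eq_restrict_Ioc]
  filter_upwards [ae_restrict_of_ae_restrict_of_subset (Ioo_subset_Ioo_right ht'.2.le) h1]
    with r hr
  rw [hr]

/-- The essential supremum of the norm of `∇c` bounds it at almost every single time; times chosen
off a null set then have uniformly bounded gradients. -/
theorem exists_bound_Dc (hs : IsDissipativeWeakSolution D T ν lam p P I s) :
    ∃ M, ∀ᵐ t ∂(volume.restrict (Ioo 0 T)), ∀ i,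
      (eLpNorm (fun x => s.Dc t x i) 2 (volume.restrict D.cell)).toReal ≤ M := by
  have h1 := hs.Dc_mem.2.2
  refine ⟨(eLpNormEssSup (fun t => (eLpNorm (s.Dc t) 2 (volume.restrict D.cell)).toReal)
    (volume.restrict (Ioo 0 T))).toReal, ?_⟩
  have h2 := h1.2
  rw [eLpNorm_exponent_top] at h2
  filter_upwards [ae_le_eLpNormEssSup (f := fun t =>
    (eLpNorm (s.Dc t) 2 (volume.restrict D.cell)).toReal) (μ := volume.restrict (Ioo 0 T)),
    hs.Dc_mem.2.1] with t ht ht' i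
  have h3 : (eLpNorm (fun x => s.Dc t x i) 2 (volume.restrict D.cell)).toReal
      ≤ (eLpNorm (s.Dc t) 2 (volume.restrict D.cell)).toReal :=
    ENNReal.toReal_mono ht'.2.ne (eLpNorm_mono fun x => PiLp.norm_apply_le (s.Dc t x) i)
  refine h3.trans ?_
  have h4 := ENNReal.toReal_mono h2.ne ht
  rwa [Real.enorm_of_nonneg ENNReal.toReal_nonneg, ENNReal.toReal_ofReal
    ENNReal.toReal_nonneg] at h4

/-- The initial concentration vanishes on the boundary, in the weak sense. -/
theorem integral_mul_pd_init (hs : IsDissipativeWeakSolution D T ν lam p P I s) (hd : 0 < d)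
    (hT : 0 < T) (hD : D.IsAdmissible) (hI : I.FiniteEnergy D P) {V : Space d → ℝ}
    (hV : D.BddC1 V) (i : Fin d) :
    ∫ x in D.cell, I.c x * pd i V x = - ∫ x in D.cell, I.Dc x i * V x := by
  have := isFiniteMeasure_cell hD
  have hc0 : IntegrableOn I.c D.cell := hI.c_mem.integrable (by norm_num)
  obtain ⟨M, hM⟩ := hs.exists_bound_Dc
  -- Along these times `c` lies in `W₀^{1,2}` with bounded gradient and converges to `c₀` in `L¹`.
  -- The integration by parts up to the boundary passes to the limit, although nothing is assumed
  -- about `c₀` on the boundary.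
  obtain ⟨t, h1, h2, h3⟩ := exists_seq_of_ae_primitive hT hD (hs.intCyl_c hD)
    (hs.intCyl_source hD) hc0 (hs.ae_primitive_c hd hT hD hI)
    ((hs.ae_isSobolev0_c hd hD).and hM)
  refine hI.isSobolev.integral_mul_pd_of_tendsto hd hD (fun k => (h1 k).1) (M := M)
    (fun k i => (h1 k).2 i) (fun v hv hb => ?_) hV i
  obtain ⟨B, hB⟩ := hb
  rw [tendsto_iff_norm_sub_tendsto_zero]
  refine squeeze_zero (fun k => norm_nonneg _) (fun k => ?_)
    (by simpa using h3.mul_const |B|)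
  have hd1 : IntegrableOn (fun x => s.c (t k) x - I.c x) D.cell := (h2 k).sub hc0
  rw [← MeasureTheory.integral_sub (integrable_mul_bdd hD (h2 k) hv hB) (integrable_mul_bdd hD hc0 hv hB),
    ← integral_mul_const]
  refine norm_integral_le_of_norm_le (hd1.norm.mul_const _) (ae_cell hD fun x hx => ?_)
  rw [← sub_mul, norm_mul]
  exact mul_le_mul_of_nonneg_left ((hB x hx).trans (le_abs_self B)) (norm_nonneg _)

end IsDissipativeWeakSolution

/-! ### Algebra of stresses -/

theorem ddot_sub_left (A B M : Mat d) : ddot (A - B) M = ddot A M - ddot B M := by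
  simp only [ddot, Matrix.sub_apply, sub_mul, Finset.sum_sub_distrib]

theorem ddot_sub_right (M A B : Mat d) : ddot M (A - B) = ddot M A - ddot M B := by
  simp only [ddot, Matrix.sub_apply, mul_sub, Finset.sum_sub_distrib]

theorem stress_sub (ν lam : ℝ) (A B : Mat d) :
    stress ν lam (A - B) = stress ν lam A - stress ν lam B := by
  ext i j
  simp only [stress_apply, Matrix.sub_apply, Matrix.trace_sub]
  split_ifs <;> ring

/-- Linearity of the stress alone. On the right, the first term is dissipated in the energy balance,
the second occurs in the momentum equation tested with `U`, and the third is an entry of the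
remainder. -/
theorem ddot_stress_sub (ν lam : ℝ) (A B : Mat d) :
    ddot (stress ν lam (A - B)) (A - B)
      = ddot (stress ν lam A) A - ddot (stress ν lam A) B - ddot (stress ν lam B) (A - B) := by
  rw [stress_sub, ddot_sub_left, ddot_sub_right]

theorem otimes_sub (a b e : Space d) : otimes (a - b) e = otimes a e - otimes b e := by
  ext i j
  simp only [otimes, Matrix.sub_apply, Matrix.of_apply, PiLp.sub_apply, sub_mul]

theorem ddot_smul_left (r : ℝ) (A M : Mat d) : ddot (r • A) M = r * ddot A M := by
  simp only [ddot, Matrix.smul_apply, smul_eq_mul, Finset.mul_sum, mul_assoc]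

theorem ddot_otimes (a b : Space d) (M : Mat d) :
    ddot (otimes a b) M = ∑ j, b j * ∑ i, a i * M i j := by
  simp only [ddot, otimes, Matrix.of_apply, Finset.mul_sum]
  rw [Finset.sum_comm]
  exact Finset.sum_congr rfl fun j _ => Finset.sum_congr rfl fun i _ => by ring

theorem FluidDomain.IsC1.bddMeas_jac {D : FluidDomain d} {T : ℝ} (hD : D.IsAdmissible)
    {V : ℝ → Space d → Space d} (hV : D.IsC1 T V) (i j : Fin d) :
    D.BddMeas T fun t x => jac (V t) x i j :=
  ((hV.bddMeas_fderiv hD).clm (ContinuousLinearMap.apply ℝ (Space d)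
    (EuclideanSpace.single j 1))).clm (EuclideanSpace.proj (𝕜 := ℝ) i)

theorem FluidDomain.IsC1.bddMeas_trace_jac {D : FluidDomain d} {T : ℝ} (hD : D.IsAdmissible)
    {V : ℝ → Space d → Space d} (hV : D.IsC1 T V) :
    D.BddMeas T fun t x => (jac (V t) x).trace :=
  BddMeas.sum Finset.univ fun i => hV.bddMeas_jac hD i i

/-! ### Comparison fields -/

/-- The smooth fields with which a dissipative weak solution is compared; `g` and `L` extend the
gradient and the Laplacian of `C`. -/
structure IsComparison (D : FluidDomain d) (T : ℝ) (R : ℝ → Space d → ℝ)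
    (U : ℝ → Space d → Space d) (C : ℝ → Space d → ℝ) (g : ℝ → Space d → Space d)
    (L : ℝ → Space d → ℝ) : Prop where
  density : D.IsC1 T R
  density_pos : ∀ t ∈ Icc 0 T, ∀ x ∈ closure D.space, 0 < R t x
  velocity : D.IsC1 T U
  velocity_bdry : ∀ t ∈ Icc 0 T, ∀ x ∈ D.bdry, U t x = 0
  concentration : D.IsRegular T C g L

namespace IsComparison

variable {D : FluidDomain d} {T : ℝ} {p P : ℝ → ℝ} {R : ℝ → Space d → ℝ}
  {U : ℝ → Space d → Space d} {C : ℝ → Space d → ℝ} {g : ℝ → Space d → Space d}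
  {L : ℝ → Space d → ℝ}

theorem potential (h : IsComparison D T R U C g L) (hp : IsPressureLaw p P) :
    D.IsC1 T fun t x => deriv P (R t x) :=
  h.density.comp isOpen_Ioi hp.contDiffOn_deriv_potential h.density_pos

theorem kinetic (h : IsComparison D T R U C g L) : D.IsC1 T fun t x => ‖U t x‖ ^ 2 / 2 :=
  h.velocity.comp_contDiff (Φ := fun y => ‖y‖ ^ 2 / 2) ((contDiff_norm_sq ℝ).div_const 2)

/-- The multiplier in the equation of continuity. -/
theorem continuityTest (h : IsComparison D T R U C g L) (hp : IsPressureLaw p P) :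
    D.IsC1 T fun t x => ‖U t x‖ ^ 2 / 2 - deriv P (R t x) := h.kinetic.sub (h.potential hp)

theorem pressure (h : IsComparison D T R U C g L) (hp : IsPressureLaw p P) :
    D.IsC1 T fun t x => p (R t x) :=
  h.density.comp isOpen_Ioi hp.contDiffOn_one h.density_pos

/-- The multiplier in the Allen--Cahn equation. -/
theorem allenCahnTest (h : IsComparison D T R U C g L) : D.IsC1 T fun t x => 2 * C t x - L t x :=
  (h.concentration.C1.const_mul 2).sub h.concentration.lap_C1

theorem source (h : IsComparison D T R U C g L) (hp : IsPressureLaw p P) :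
    D.IsC1 T fun t x => p (R t x) + (C t x ^ 2 - C t x * L t x / 2) := by
  have h1 := h.concentration.C1.mul (h.concentration.C1.sub (h.concentration.lap_C1.const_mul (1 / 2)))
  refine (h.pressure hp).add ?_
  have e : (fun t x => C t x ^ 2 - C t x * L t x / 2)
      = fun t x => C t x * (C t x - 1 / 2 * L t x) := by ext t x; ring
  rw [e]
  exact h1

theorem deriv_continuityTest (h : IsComparison D T R U C g L) (hp : IsPressureLaw p P) {t : ℝ}
    (ht : t ∈ Ioo 0 T) {x : Space d} (hx : x ∈ D.space) :
    deriv (fun r => ‖U r x‖ ^ 2 / 2 - deriv P (R r x)) t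
      = inner ℝ (U t x) (deriv (fun r => U r x) t) - deriv (fun r => deriv P (R r x)) t := by
  have h1 := ((h.velocity.differentiableAt_time ht hx).hasDerivAt.norm_sq.div_const 2).sub
    ((h.potential hp).differentiableAt_time ht hx).hasDerivAt
  exact h1.deriv.trans (by ring)

theorem pd_continuityTest (h : IsComparison D T R U C g L) (hp : IsPressureLaw p P) {t : ℝ}
    (ht : t ∈ Ioo 0 T) {x : Space d} (hx : x ∈ D.space) (i : Fin d) :
    pd i (fun y => ‖U t y‖ ^ 2 / 2 - deriv P (R t y)) x
      = (∑ j, U t x j * jac (U t) x j i) - pd i (fun y => deriv P (R t y)) x := by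
  have ht' := Ioo_subset_Icc_self ht
  have h1 := ((h.velocity.differentiableAt_space ht' hx).hasFDerivAt.norm_sq.mul_const
    (1 / 2 : ℝ)).sub ((h.potential hp).differentiableAt_space ht' hx).hasFDerivAt
  have e : (fun y => ‖U t y‖ ^ 2 / 2 - deriv P (R t y))
      = fun y => ‖U t y‖ ^ 2 * (1 / 2) - deriv P (R t y) := by ext y; ring
  rw [pd, e]
  refine (congrArg (fun A : Space d →L[ℝ] ℝ => A (EuclideanSpace.single i 1)) h1.fderiv).trans ?_
  simp [inner_eq_sum, jac, pd]

/-- `P'' = p'/r` yields `∂ₜ p(R) = R ∂ₜ P'(R)`, which produces the part of the term `(R - ρ)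
∂ₜP'(R)` that does not contain `ρ`. -/
theorem deriv_source (h : IsComparison D T R U C g L) (hp : IsPressureLaw p P) {t : ℝ}
    (ht : t ∈ Ioo 0 T) {x : Space d} (hx : x ∈ D.space) :
    deriv (fun r => p (R r x) + (C r x ^ 2 - C r x * L r x / 2)) t
      = R t x * deriv (fun r => deriv P (R r x)) t + (2 * C t x * deriv (fun r => C r x) t
        - (deriv (fun r => C r x) t * L t x + C t x * deriv (fun r => L r x) t) / 2) := by
  have hR := (h.density.differentiableAt_time ht hx).hasDerivAt
  have hpos := h.density_pos t (Ioo_subset_Icc_self ht) x (subset_closure hx)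
  have hC := (h.concentration.C1.differentiableAt_time ht hx).hasDerivAt
  have hL := (h.concentration.lap_C1.differentiableAt_time ht hx).hasDerivAt
  have h1 := (hp.hasDerivAt_deriv_potential hpos).comp t hR
  have h2 := (hp.differentiableAt hpos).hasDerivAt.comp t hR
  have h3 := h2.add ((hC.pow 2).sub ((hC.mul hL).div_const 2))
  have e1 : deriv (fun r => deriv P (R r x)) t = deriv p (R t x) / R t x * deriv (fun r => R r x) t :=
    h1.deriv
  have e3 : deriv (fun r => p (R r x) + (C r x ^ 2 - C r x * L r x / 2)) t = _ := h3.deriv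
  rw [e3, e1]
  push_cast
  field_simp

theorem deriv_allenCahnTest (h : IsComparison D T R U C g L) {t : ℝ}
    (ht : t ∈ Ioo 0 T) {x : Space d} (hx : x ∈ D.space) :
    deriv (fun r => 2 * C r x - L r x) t
      = 2 * deriv (fun r => C r x) t - deriv (fun r => L r x) t :=
  (((h.concentration.C1.differentiableAt_time ht hx).hasDerivAt.const_mul 2).sub
    (h.concentration.lap_C1.differentiableAt_time ht hx).hasDerivAt).deriv

theorem deriv_laplacian (h : IsComparison D T R U C g L) {t : ℝ}
    (ht : t ∈ Ioo 0 T) {x : Space d} (hx : x ∈ D.space) :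
    deriv (fun r => Laplacian.laplacian (C r) x) t = deriv (fun r => L r x) t := by
  refine Filter.EventuallyEq.deriv_eq ?_
  filter_upwards [Ioo_mem_nhds ht.1 ht.2] with r hr
  exact (h.concentration.lap_eq r (Ioo_subset_Icc_self hr) x hx).symm

end IsComparison

theorem FluidDomain.IntCyl.div_const {D : FluidDomain d} {T : ℝ} {F : ℝ → Space d → ℝ}
    (hF : D.IntCyl T F) (r : ℝ) : D.IntCyl T fun t x => F t x / r := Integrable.div_const hF r

namespace IsDissipativeWeakSolution

variable {D : FluidDomain d} {T ν lam : ℝ} {p P : ℝ → ℝ} {I : InitialData d} {s : Flow d}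
  {R : ℝ → Space d → ℝ} {U : ℝ → Space d → Space d} {C : ℝ → Space d → ℝ}
  {g : ℝ → Space d → Space d} {L : ℝ → Space d → ℝ}

/-! ### Integrability -/

theorem intCyl_ddot_L2 {A B : ℝ → Space d → Mat d}
    (hA : ∀ i j, MemLp (fun z : ℝ × Space d => A z.1 z.2 i j) 2 (D.cyl T))
    (hB : ∀ i j, MemLp (fun z : ℝ × Space d => B z.1 z.2 i j) 2 (D.cyl T)) :
    D.IntCyl T fun t x => ddot (A t x) (B t x) :=
  IntCyl.sum _ fun i _ => IntCyl.sum _ fun j _ => intCyl_mul_L2 (hA i j) (hB i j)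

theorem intCyl_sq {f : ℝ → Space d → ℝ}
    (hf : MemLp (fun z : ℝ × Space d => f z.1 z.2) 2 (D.cyl T)) :
    D.IntCyl T fun t x => f t x ^ 2 := hf.integrable_sq

theorem intCyl_μ_sq (hs : IsDissipativeWeakSolution D T ν lam p P I s) (hD : D.IsAdmissible) :
    D.IntCyl T fun t x => s.μ t x ^ 2 := (hs.memLp_μ hD).integrable_sq

theorem memLp_glW (hs : IsDissipativeWeakSolution D T ν lam p P I s) (hD : D.IsAdmissible) :
    MemLp (fun z : ℝ × Space d => glW (s.c z.1 z.2)) 2 (D.cyl T) := by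
  have := isFiniteMeasure_cyl (T := T) hD
  refine MemLp.mono' ((memLp_const (1 : ℝ)).add (hs.memLp_c.norm.const_mul 2))
    (contDiff_glW.continuous.comp_aestronglyMeasurable hs.memLp_c.1) ?_
  exact Eventually.of_forall fun z => abs_glW_le _

theorem intCyl_glF (hs : IsDissipativeWeakSolution D T ν lam p P I s) (hD : D.IsAdmissible) :
    D.IntCyl T fun t x => glF (s.c t x) := by
  have := isFiniteMeasure_cyl (T := T) hD
  simp_rw [glF_eq]
  exact IntCyl.add ((hs.memLp_glW hD).integrable (by norm_num)) hs.memLp_c.integrable_sq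

theorem memLp_Du_sub_jac (hs : IsDissipativeWeakSolution D T ν lam p P I s) (hD : D.IsAdmissible)
    (hU : D.IsC1 T U) (i j : Fin d) :
    MemLp (fun z : ℝ × Space d => (s.Du z.1 z.2 - jac (U z.1) z.2) i j) 2 (D.cyl T) :=
  (hs.memLp_Du i j).sub ((hU.bddMeas_jac hD i j).memLp hD)

theorem intCyl_dissipation (hs : IsDissipativeWeakSolution D T ν lam p P I s)
    (hD : D.IsAdmissible) (hU : D.IsC1 T U) : D.IntCyl T (dissipation ν lam s U) :=
  IntCyl.add (intCyl_ddot_L2 (memLp_stress (fun i j => hs.memLp_Du_sub_jac hD hU i j) ν lam)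
    (fun i j => hs.memLp_Du_sub_jac hD hU i j)) (hs.intCyl_μ_sq hD)

theorem intCyl_energy_dissipation (hs : IsDissipativeWeakSolution D T ν lam p P I s)
    (hD : D.IsAdmissible) :
    D.IntCyl T fun t x => ddot (stress ν lam (s.Du t x)) (s.Du t x) + s.μ t x ^ 2 :=
  IntCyl.add (intCyl_ddot_L2 (memLp_stress hs.memLp_Du ν lam) hs.memLp_Du) (hs.intCyl_μ_sq hD)

theorem intCyl_korteweg (hs : IsDissipativeWeakSolution D T ν lam p P I s) (hD : D.IsAdmissible)
    (i j : Fin d) : D.IntCyl T fun t x => korteweg (s.Dc t x) i j := by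
  simp_rw [korteweg_apply]
  refine (intCyl_mul_L2 (hs.memLp_Dc j) (hs.memLp_Dc i)).sub ?_
  by_cases h : j = i
  · simp only [h, if_true]
    have h2 : D.IntCyl T fun t x => ∑ k, s.Dc t x k ^ 2 :=
      IntCyl.sum Finset.univ fun k _ => intCyl_sq (f := fun t x => s.Dc t x k) (hs.memLp_Dc k)
    exact h2.div_const 2
  · simpa only [h, if_false] using (BddMeas.const (0 : ℝ)).intCyl hD

theorem intCyl_ddot_bdd (hD : D.IsAdmissible) {A B : ℝ → Space d → Mat d}
    (hA : ∀ i j, D.IntCyl T fun t x => A t x i j) (hB : ∀ i j, D.BddMeas T fun t x => B t x i j) :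
    D.IntCyl T fun t x => ddot (A t x) (B t x) :=
  IntCyl.sum _ fun i _ => IntCyl.sum _ fun j _ => (hA i j).mul_bdd hD (hB i j)

theorem intCyl_ρ_sub (hs : IsDissipativeWeakSolution D T ν lam p P I s) (hD : D.IsAdmissible)
    (hp : IsPressureLaw p P) (hU : D.IsC1 T U) (i : Fin d) :
    D.IntCyl T fun t x => s.ρ t x * (U t x - s.u t x) i := by
  have h : D.IntCyl T fun t x => s.ρ t x * U t x i - s.ρ t x * s.u t x i :=
    ((hs.intCyl_ρ hD hp).mul_bdd hD ((hU.apply i).bddMeas hD)).sub (hs.intCyl_ρu hD hp i)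
  simpa only [PiLp.sub_apply, mul_sub] using h

theorem intCyl_remainder (hs : IsDissipativeWeakSolution D T ν lam p P I s) (hD : D.IsAdmissible)
    (hp : IsPressureLaw p P) (h : IsComparison D T R U C g L) (k : Fin 11) :
    D.IntCyl T fun t x => remainder ν lam p P s R U C t x k := by
  have hfin := isFiniteMeasure_cyl (T := T) hD
  have htr := h.velocity.bddMeas_trace_jac hD
  have hUt := fun i => (h.velocity.bddMeas_deriv hD).clm (EuclideanSpace.proj (𝕜 := ℝ) i)
  have hLap : D.BddMeas T fun t x => Laplacian.laplacian (C t) x - 2 * C t x :=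
    ((h.concentration.lap_C1.bddMeas hD).congr hD fun t ht x hx =>
      h.concentration.lap_eq t (Ioo_subset_Icc_self ht) x (cell_subset_space hx)).sub
      ((h.concentration.C1.const_mul 2).bddMeas hD)
  have hLapt : D.BddMeas T fun t x =>
      deriv (fun r => Laplacian.laplacian (C r) x) t - 2 * deriv (fun r => C r x) t :=
    ((h.concentration.lap_C1.bddMeas_deriv hD).congr hD fun t ht x hx =>
      (h.deriv_laplacian ht (cell_subset_space hx)).symm).sub
      ((BddMeas.const 2).mul (h.concentration.C1.bddMeas_deriv hD))
  fin_cases k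
  · exact (intCyl_mul_L2 (hs.memLp_μ hD)
      ((hs.memLp_lapc.sub (hs.memLp_μ hD)).sub (hs.memLp_c.const_mul 2))).neg
  · exact (intCyl_mul_L2 (hs.memLp_divu.sub (htr.memLp hD)) (hs.memLp_glW hD)).neg
  · refine (IntCyl.sum Finset.univ fun i _ =>
      (hs.intCyl_ρ_sub hD hp h.velocity i).mul_bdd hD (hUt i)).congr (.of_forall fun z => ?_)
    change _ = s.ρ z.1 z.2 * inner ℝ (U z.1 z.2 - s.u z.1 z.2) (deriv (fun r => U r z.2) z.1)
    rw [inner_eq_sum, Finset.mul_sum]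
    exact Finset.sum_congr rfl fun i _ => mul_assoc _ _ _
  · exact (((h.density.bddMeas hD).intCyl hD).sub (hs.intCyl_ρ hD hp)).mul_bdd hD
      ((h.potential hp).bddMeas_deriv hD)
  · refine (IntCyl.sum Finset.univ fun i _ => (hs.intCyl_ρu hD hp i).mul_bdd hD
      ((h.potential hp).bddMeas_pd hD i)).neg.congr (.of_forall fun z => ?_)
    change _ = - (s.ρ z.1 z.2 * inner ℝ (s.u z.1 z.2) (gradient (fun y => deriv P (R z.1 y)) z.2))
    rw [inner_eq_sum, Finset.mul_sum]
    refine congrArg Neg.neg (Finset.sum_congr rfl fun i _ => ?_)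
    rw [gradient_apply, mul_assoc]
  · have i1 : ∀ i j, D.IntCyl T fun t x =>
        (s.ρ t x • otimes (U t x - s.u t x) (s.u t x)) i j := fun i j => by
      have := ((hs.intCyl_ρu hD hp j).mul_bdd hD ((h.velocity.apply i).bddMeas hD)).sub
        (hs.intCyl_ρuu i j)
      refine this.congr (.of_forall fun z => ?_)
      simp only [otimes, Matrix.smul_apply, Matrix.of_apply, PiLp.sub_apply, smul_eq_mul]
      ring
    have := intCyl_ddot_bdd hD i1 (h.velocity.bddMeas_jac hD)
    simp_rw [ddot_smul_left] at this
    exact this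
  · exact (((hs.intCyl_p hD hp).sub (intCyl_sq (f := s.c) hs.memLp_c)).mul_bdd hD htr).neg
  · exact (intCyl_ddot_bdd hD (hs.intCyl_korteweg hD) (h.velocity.bddMeas_jac hD)).neg
  · exact (hs.intCyl_source hD).mul_bdd hD hLap
  · exact ((hs.intCyl_c hD).sub ((h.concentration.C1.bddMeas hD).intCyl hD)).mul_bdd hD hLapt
  · exact (intCyl_ddot_L2 (memLp_stress (fun i j => (h.velocity.bddMeas_jac hD i j).memLp hD)
      ν lam) (fun i j => hs.memLp_Du_sub_jac hD h.velocity i j)).neg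

/-! ### The pointwise identity -/

/-- The first six groups on the right are the rates in the balance laws; the last four have zero
integral over the cell. Adding `W(c) div u + W'(c) u·∇c` trades `W'(c) u·∇c` for `W(c) div u`. The
Korteweg and `F` identities together replace `μ ∇c·U`, through `μ = Δc - F'(c)`, by terms with `∇U`.
The last group turns the symmetric expression `∂ₜ(CΔC)/2` into `C ∂ₜΔC`. -/
theorem sum_remainder_sub_dissipation (hp : IsPressureLaw p P) (h : IsComparison D T R U C g L)
    {t : ℝ} (ht : t ∈ Ioo 0 T) {x : Space d} (hx : x ∈ D.cell) :
    (∑ k, remainder ν lam p P s R U C t x k) - dissipation ν lam s U t x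
      = - (ddot (stress ν lam (s.Du t x)) (s.Du t x) + s.μ t x ^ 2)
        - deriv glW (s.c t x) * (s.μ t x - inner ℝ (s.u t x) (s.Dc t x))
        - momentumForm s ν lam p U t x
        + (s.ρ t x * deriv (fun r => ‖U r x‖ ^ 2 / 2 - deriv P (R r x)) t
          + ∑ i, s.ρ t x * s.u t x i * pd i (fun y => ‖U t y‖ ^ 2 / 2 - deriv P (R t y)) x)
        - (s.c t x * deriv (fun r => 2 * C r x - L r x) t
          + (s.μ t x - inner ℝ (s.u t x) (s.Dc t x)) * (2 * C t x - L t x))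
        + deriv (fun r => p (R r x) + (C r x ^ 2 - C r x * L r x / 2)) t
        - (glW (s.c t x) * s.divu t x
          + deriv glW (s.c t x) * inner ℝ (s.u t x) (s.Dc t x))
        - (ddot (korteweg (s.Dc t x)) (jac (U t) x)
          + s.lapc t x * inner ℝ (s.Dc t x) (U t x))
        + (glF (s.c t x) * (jac (U t) x).trace
          + deriv glF (s.c t x) * inner ℝ (s.Dc t x) (U t x))
        + (deriv (fun r => C r x) t * L t x - deriv (fun r => L r x) t * C t x) / 2 := by
  have hx' := cell_subset_space hx
  have e1 : ∑ i, s.ρ t x * s.u t x i * pd i (fun y => ‖U t y‖ ^ 2 / 2 - deriv P (R t y)) x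
      = s.ρ t x * ddot (otimes (U t x) (s.u t x)) (jac (U t) x)
        - s.ρ t x * inner ℝ (s.u t x) (gradient (fun y => deriv P (R t y)) x) := by
    rw [ddot_otimes, inner_eq_sum, ← mul_sub, ← Finset.sum_sub_distrib, Finset.mul_sum]
    refine Finset.sum_congr rfl fun i _ => ?_
    rw [h.pd_continuityTest hp ht hx', gradient_apply]
    ring
  rw [e1, momentum_form_eq s ν lam p h.velocity ht hx', h.deriv_continuityTest hp ht hx',
    h.deriv_allenCahnTest ht hx', h.deriv_source hp ht hx', dissipation, ddot_stress_sub,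
    ddot_smul_left]
  simp only [remainder, Fin.sum_univ_succ, Fin.sum_univ_zero, Matrix.cons_val_zero,
    Matrix.cons_val_succ]
  rw [h.deriv_laplacian ht hx', ← h.concentration.lap_eq t (Ioo_subset_Icc_self ht) x hx',
    otimes_sub, ddot_sub_left, inner_sub_left, deriv_glF, glF_eq]
  -- With `W'(c) = Δc - μ - 2c` the product `-μ W'(c)` becomes the first entry of the remainder.
  -- After this substitution the identity is polynomial.
  have hμ : s.lapc t x = s.μ t x + (2 * s.c t x + deriv glW (s.c t x)) := by
    rw [Flow.μ, deriv_glF]; ring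
  rw [hμ]
  ring

end IsDissipativeWeakSolution

/-! ### Assembly of the relative energy inequality -/

theorem FluidDomain.iter_eq_zero {D : FluidDomain d} {T τ : ℝ} {F : ℝ → Space d → ℝ}
    (hτ : τ ∈ Icc 0 T) (h : ∀ᵐ t ∂(volume.restrict (Ioo 0 T)), ∫ x in D.cell, F t x = 0) :
    D.iter τ F = 0 := by
  rw [iter_congr (G := fun _ _ => 0) hτ (by simpa using h)]
  simp [iter]

theorem FluidDomain.iter_congr_cell {D : FluidDomain d} {T τ : ℝ} (hD : D.IsAdmissible)
    {F G : ℝ → Space d → ℝ} (hτ : τ ∈ Icc 0 T)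
    (h : ∀ t ∈ Ioo 0 T, ∀ x ∈ D.cell, F t x = G t x) : D.iter τ F = D.iter τ G :=
  iter_congr_ae hτ (ae_cyl hD h)

namespace IsDissipativeWeakSolution

variable {D : FluidDomain d} {T ν lam : ℝ} {p P : ℝ → ℝ} {I : InitialData d} {s : Flow d}
  {R : ℝ → Space d → ℝ} {U : ℝ → Space d → Space d} {C : ℝ → Space d → ℝ}
  {g : ℝ → Space d → Space d} {L : ℝ → Space d → ℝ}

/-- The pointwise identity integrated over `(0,τ) × Ω`. The right-hand side keeps exactly the
increments that the balance laws provide. -/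
theorem sum_iter_remainder (hs : IsDissipativeWeakSolution D T ν lam p P I s) (hd : 0 < d)
    (hD : D.IsAdmissible) (hp : IsPressureLaw p P) (h : IsComparison D T R U C g L) {τ : ℝ}
    (hτ : τ ∈ Icc 0 T) :
    (∑ k, D.iter τ fun t x => remainder ν lam p P s R U C t x k)
        - D.iter τ (dissipation ν lam s U)
      = - (D.iter τ fun t x => ddot (stress ν lam (s.Du t x)) (s.Du t x) + s.μ t x ^ 2)
        - (D.iter τ fun t x => deriv glW (s.c t x) * (s.μ t x - inner ℝ (s.u t x) (s.Dc t x)))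
        - D.iter τ (momentumForm s ν lam p U)
        + (D.iter τ fun t x => s.ρ t x * deriv (fun r => ‖U r x‖ ^ 2 / 2 - deriv P (R r x)) t
          + ∑ i, s.ρ t x * s.u t x i * pd i (fun y => ‖U t y‖ ^ 2 / 2 - deriv P (R t y)) x)
        - (D.iter τ fun t x => s.c t x * deriv (fun r => 2 * C r x - L r x) t
          + (s.μ t x - inner ℝ (s.u t x) (s.Dc t x)) * (2 * C t x - L t x))
        + D.iter τ fun t x =>
          deriv (fun r => p (R r x) + (C r x ^ 2 - C r x * L r x / 2)) t := by
  have hUJ := h.velocity.bddMeas_jac hD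
  have htr := h.velocity.bddMeas_trace_jac hD
  have hC := h.concentration.C1
  have hL := h.concentration.lap_C1
  have hr := hs.intCyl_remainder hD hp h (ν := ν) (lam := lam)
  have q1 := hs.intCyl_energy_dissipation hD
  have q2 := hs.intCyl_deriv_glW (hs.intCyl_source hD)
  have q3 := (hs.iter_momentumForm hD hp h.velocity hτ).1
  have q4 := hs.intCyl_continuity_flux hD hp (h.continuityTest hp)
  have q5 : D.IntCyl T fun t x => s.c t x * deriv (fun r => 2 * C r x - L r x) t
      + (s.μ t x - inner ℝ (s.u t x) (s.Dc t x)) * (2 * C t x - L t x) :=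
    ((hs.intCyl_c hD).mul_bdd hD (h.allenCahnTest.bddMeas_deriv hD)).add
      ((hs.intCyl_source hD).mul_bdd hD (h.allenCahnTest.bddMeas hD))
  have q6 := ((h.source hp).bddMeas_deriv hD).intCyl hD
  have z1 : D.IntCyl T fun t x => glW (s.c t x) * s.divu t x
      + deriv glW (s.c t x) * inner ℝ (s.u t x) (s.Dc t x) :=
    (intCyl_mul_L2 (hs.memLp_glW hD) hs.memLp_divu).add (hs.intCyl_deriv_glW hs.intCyl_inner_uDc)
  have hDcU : MemLp (fun z : ℝ × Space d => inner ℝ (s.Dc z.1 z.2) (U z.1 z.2)) 2 (D.cyl T) := by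
    simp_rw [inner_eq_sum]
    refine memLp_finsetSum Finset.univ fun i _ => ?_
    obtain ⟨M, hM⟩ := ((h.velocity.apply i).bddMeas hD).bound
    exact MemLp.mul' (p := 2) (q := ⊤)
      (memLp_top_of_bound ((h.velocity.apply i).bddMeas hD).aesm M (ae_cyl hD hM))
      (hs.memLp_Dc i)
  have z2 : D.IntCyl T fun t x => ddot (korteweg (s.Dc t x)) (jac (U t) x)
      + s.lapc t x * inner ℝ (s.Dc t x) (U t x) :=
    (intCyl_ddot_bdd hD (hs.intCyl_korteweg hD) hUJ).add (intCyl_mul_L2 hs.memLp_lapc hDcU)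
  have z3 : D.IntCyl T fun t x => glF (s.c t x) * (jac (U t) x).trace
      + deriv glF (s.c t x) * inner ℝ (s.Dc t x) (U t x) := by
    have := isFiniteMeasure_cyl (T := T) hD
    exact ((hs.intCyl_glF hD).mul_bdd hD htr).add
      (intCyl_mul_L2 (f := fun t x => deriv glF (s.c t x)) (memLp_deriv_glF hs.memLp_c) hDcU)
  have w1 : D.IntCyl T fun t x => deriv (fun r => C r x) t * L t x :=
    ((hC.bddMeas_deriv hD).intCyl hD).mul_bdd hD (hL.bddMeas hD)
  have w2 : D.IntCyl T fun t x => deriv (fun r => L r x) t * C t x :=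
    ((hL.bddMeas_deriv hD).intCyl hD).mul_bdd hD (hC.bddMeas hD)
  have z4 : D.IntCyl T fun t x =>
      (deriv (fun r => C r x) t * L t x - deriv (fun r => L r x) t * C t x) / 2 :=
    (w1.sub w2).div_const 2
  -- The four null terms: the chain rule for `W(c)` paired with `u`, the Korteweg identity and the
  -- chain rule for `F(c)` paired with `U`, and the symmetry of the Laplacian.
  have v1 := iter_eq_zero hτ (hs.ae_integral_glW hd hD)
  have v2 : D.iter τ (fun t x => ddot (korteweg (s.Dc t x)) (jac (U t) x)
      + s.lapc t x * inner ℝ (s.Dc t x) (U t x)) = 0 := by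
    refine iter_eq_zero hτ ?_
    filter_upwards [hs.ae_integral_korteweg hd hD, ae_restrict_mem measurableSet_Ioo] with t h1 ht
    have ht' := Ioo_subset_Icc_self ht
    exact h1 _ (fun x hx => h.velocity.differentiableAt_space ht' (cell_subset_space hx))
      fun i => (h.velocity.apply i).vanishC1 hD (fun t ht x hx => by
        simp [h.velocity_bdry t ht x hx]) ht'
  have v3 : D.iter τ (fun t x => glF (s.c t x) * (jac (U t) x).trace
      + deriv glF (s.c t x) * inner ℝ (s.Dc t x) (U t x)) = 0 := by
    refine iter_eq_zero hτ ?_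
    filter_upwards [hs.ae_integral_glF hd hD, ae_restrict_mem measurableSet_Ioo] with t h1 ht
    have ht' := Ioo_subset_Icc_self ht
    exact h1 _ (fun x hx => h.velocity.differentiableAt_space ht' (cell_subset_space hx))
      fun i => (h.velocity.apply i).vanishC1 hD (fun t ht x hx => by
        simp [h.velocity_bdry t ht x hx]) ht'
  have v4 : D.iter τ (fun t x =>
      (deriv (fun r => C r x) t * L t x - deriv (fun r => L r x) t * C t x) / 2) = 0 := by
    refine iter_eq_zero hτ ?_
    filter_upwards [w1.ae_integrable, w2.ae_integrable, ae_restrict_mem measurableSet_Ioo]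
      with t h1 h2 ht
    rw [integral_div, integral_sub h1 h2, h.concentration.integral_deriv_symm hd hD ht]
    simp
  rw [← iter_sum Finset.univ hτ fun k _ => hr k,
    ← iter_sub hτ (IntCyl.sum Finset.univ fun k _ => hr k) (hs.intCyl_dissipation hD h.velocity),
    iter_congr_cell hD hτ fun t ht x hx => sum_remainder_sub_dissipation hp h ht hx,
    iter_add hτ ((((((((q1.neg.sub q2).sub q3).add q4).sub q5).add q6).sub z1).sub z2).add z3) z4,
    iter_add hτ (((((((q1.neg.sub q2).sub q3).add q4).sub q5).add q6).sub z1).sub z2) z3,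
    iter_sub hτ ((((((q1.neg.sub q2).sub q3).add q4).sub q5).add q6).sub z1) z2,
    iter_sub hτ (((((q1.neg.sub q2).sub q3).add q4).sub q5).add q6) z1,
    iter_add hτ ((((q1.neg.sub q2).sub q3).add q4).sub q5) q6,
    iter_sub hτ (((q1.neg.sub q2).sub q3).add q4) q5,
    iter_add hτ ((q1.neg.sub q2).sub q3) q4, iter_sub hτ (q1.neg.sub q2) q3,
    iter_sub hτ q1.neg q2, v1, v2, v3, v4]
  have e := iter_const_mul (D := D) τ (-1)
    fun t x => ddot (stress ν lam (s.Du t x)) (s.Du t x) + s.μ t x ^ 2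
  simp only [neg_one_mul] at e
  rw [e]
  ring

/-- The relative energy, expanded. -/
theorem _root_.NSAC.IsState.integral_relDensity_gradient (hd : 0 < d) (hD : D.IsAdmissible)
    (hp : IsPressureLaw p P) (h : IsComparison D T R U C g L) {t : ℝ} (ht : t ∈ Icc 0 T)
    {ρ : Space d → ℝ} {u : Space d → Space d} {c : Space d → ℝ} {Dc : Space d → Space d}
    (hst : IsState D P ρ u c Dc)
    (hc : ∀ V, D.BddC1 V → ∀ i, ∫ x in D.cell, c x * pd i V x = - ∫ x in D.cell, Dc x i * V x) :
    IntegrableOn (fun x => relDensity P (ρ x) (u x) (c x) (Dc x) (R t x) (U t x) (C t x)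
      (gradient (C t) x)) D.cell ∧
    ∫ x in D.cell, relDensity P (ρ x) (u x) (c x) (Dc x) (R t x) (U t x) (C t x)
      (gradient (C t) x)
      = (∫ x in D.cell, (ρ x * ‖u x‖ ^ 2 / 2 + ‖Dc x‖ ^ 2 / 2 + P (ρ x) + glF (c x)))
        - (∫ x in D.cell, glW (c x)) - (∑ i, ∫ x in D.cell, ρ x * u x i * U t x i)
        + (∫ x in D.cell, ρ x * (‖U t x‖ ^ 2 / 2 - deriv P (R t x)))
        - (∫ x in D.cell, c x * (2 * C t x - L t x))
        + ∫ x in D.cell, (p (R t x) + (C t x ^ 2 - C t x * L t x / 2)) := by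
  have hm := measurableSet_cell hD
  have hcon := h.concentration
  have key := hst.integral_relDensity hD hp (R := R t) (U := U t) (C := C t) (L := L t) (DC := g t)
    (fun x hx => h.density_pos t ht x (subset_closure (cell_subset_space hx)))
    (fun i => (h.velocity.apply i).memLp_top hD ht) ((h.continuityTest hp).memLp_top hD ht)
    ((h.pressure hp).memLp_top hD ht) (hcon.C1.memLp_top hD ht) (hcon.lap_C1.memLp_top hD ht)
    (fun i => (hcon.grad_C1.apply i).memLp_top hD ht)
    (hcon.sum_integral_mul hD ht hst.c_mem hc) (by
      have := hcon.green hd hD ht ht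
      simp_rw [← sq, mul_comm (L t _)] at this
      exact this)
  have e : EqOn (fun x => relDensity P (ρ x) (u x) (c x) (Dc x) (R t x) (U t x) (C t x) (g t x))
      (fun x => relDensity P (ρ x) (u x) (c x) (Dc x) (R t x) (U t x) (C t x)
        (gradient (C t) x)) D.cell := fun x hx => by
    simp only [hcon.grad_eq t ht x (cell_subset_space hx)]
  exact ⟨key.1.congr_fun e hm, by rw [← setIntegral_congr_fun hm e, key.2]⟩

/-- The expansion at time `0` needs `∫ ∇c₀·∇C = -∫ c₀ ΔC`, for which `c₀` must vanish on the
boundary in the weak sense; `integral_mul_pd_init` provides this. The kinetic term agrees with that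
of the energy balance, also on the vacuum set, since division by zero gives zero. -/
theorem relDensityInit_spec (hs : IsDissipativeWeakSolution D T ν lam p P I s) (hd : 0 < d)
    (hT : 0 < T) (hD : D.IsAdmissible) (hp : IsPressureLaw p P) (hI : I.FiniteEnergy D P)
    (h : IsComparison D T R U C g L) :
    IntegrableOn (relDensityInit P I R U C) D.cell ∧
    ∫ x in D.cell, relDensityInit P I R U C x
      = (∫ x in D.cell, (‖I.m x‖ ^ 2 / I.ρ x / 2 + ‖I.Dc x‖ ^ 2 / 2 + P (I.ρ x) + glF (I.c x)))
        - (∫ x in D.cell, glW (I.c x)) - (∑ i, ∫ x in D.cell, I.ρ x * I.u x i * U 0 x i)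
        + (∫ x in D.cell, I.ρ x * (‖U 0 x‖ ^ 2 / 2 - deriv P (R 0 x)))
        - (∫ x in D.cell, I.c x * (2 * C 0 x - L 0 x))
        + ∫ x in D.cell, (p (R 0 x) + (C 0 x ^ 2 - C 0 x * L 0 x / 2)) := by
  have key := (hI.isState hD hp).integral_relDensity_gradient hd hD hp h ⟨le_rfl, hT.le⟩
    fun V hV i => hs.integral_mul_pd_init hd hT hD hI hV i
  simp_rw [I.kinetic_eq] at key
  exact key

theorem ae_relDensityAt_spec (hs : IsDissipativeWeakSolution D T ν lam p P I s) (hd : 0 < d)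
    (hD : D.IsAdmissible) (hp : IsPressureLaw p P) (h : IsComparison D T R U C g L) :
    ∀ᵐ τ ∂(volume.restrict (Ioo 0 T)),
      IntegrableOn (relDensityAt P s R U C τ) D.cell ∧
      ∫ x in D.cell, relDensityAt P s R U C τ x
        = (∫ x in D.cell, (s.ρ τ x * ‖s.u τ x‖ ^ 2 / 2 + ‖s.Dc τ x‖ ^ 2 / 2 + P (s.ρ τ x)
            + glF (s.c τ x)))
          - (∫ x in D.cell, glW (s.c τ x)) - (∑ i, ∫ x in D.cell, s.ρ τ x * s.u τ x i * U τ x i)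
          + (∫ x in D.cell, s.ρ τ x * (‖U τ x‖ ^ 2 / 2 - deriv P (R τ x)))
          - (∫ x in D.cell, s.c τ x * (2 * C τ x - L τ x))
          + ∫ x in D.cell, (p (R τ x) + (C τ x ^ 2 - C τ x * L τ x / 2)) := by
  filter_upwards [hs.ae_isState hD hp, hs.ae_isSobolev0_c hd hD,
    ae_restrict_mem measurableSet_Ioo] with τ h1 h2 hτ
  exact h1.integral_relDensity_gradient hd hD hp h (Ioo_subset_Icc_self hτ)
    fun V hV i => h2.integral_mul_pd hD hV i

/-- The relative energy inequality. -/
theorem ae_relative_energy (hs : IsDissipativeWeakSolution D T ν lam p P I s) (hd : 0 < d)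
    (hT : 0 < T) (hD : D.IsAdmissible) (hp : IsPressureLaw p P) (hI : I.FiniteEnergy D P)
    (h : IsComparison D T R U C g L) :
    ∀ᵐ τ ∂(volume.restrict (Ioo 0 T)),
      (∫ x in D.cell, relDensityAt P s R U C τ x) - (∫ x in D.cell, relDensityInit P I R U C x)
          + D.iter τ (dissipation ν lam s U) + (s.𝓔 τ).real D.closedCell
        ≤ (∑ k, D.iter τ fun t x => remainder ν lam p P s R U C t x k)
          + ∫ t in (0)..τ, matIntegral (jac (U t)) (s.𝓡 t) := by
  filter_upwards [hs.ae_relDensityAt_spec hd hD hp h, hs.energy,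
    hs.ae_integral_glW_eq hd hT hD hI, hs.ae_momentum hd hT hD hp hI h.velocity h.velocity_bdry,
    hs.ae_continuity hT hD hp (h.continuityTest hp), hs.ae_allenCahn hd hT hD hI h.allenCahnTest,
    ae_restrict_mem measurableSet_Ioo] with τ h1 h2 h3 h4 h5 h6 hτ
  have h7 := (h.source hp).integral_sub_eq_iter hD hτ
  have h8 := (hs.relDensityInit_spec hd hT hD hp hI h).2
  have h9 := hs.sum_iter_remainder hd hD hp h (Ioo_subset_Icc_self hτ)
  change _ + D.iter τ (fun t x => ddot (stress ν lam (s.Du t x)) (s.Du t x) + s.μ t x ^ 2) + _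
    ≤ _ at h2
  -- Both relative energies are expanded. What remains is a linear combination of five equalities
  -- for the increments, the integrated pointwise identity, and the energy balance, which is the
  -- sole source of the inequality and of the term with the energy defect.
  rw [h1.2, h8]
  linarith

end IsDissipativeWeakSolution

end NSAC

end

theorem mainTheorem3 {d : ℕ} (hd : d = 2 ∨ d = 3) (D : NSAC.FluidDomain d) (hD : D.IsAdmissible)
    (T : ℝ) (hT : 0 < T) (ν lam : ℝ) (hν : 0 < ν) (hlam : 0 ≤ lam)
    (p P : ℝ → ℝ) (hp : NSAC.IsPressureLaw p P)
    (I : NSAC.InitialData d) (hI : I.FiniteEnergy D P)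
    (s : NSAC.Flow d) (hs : NSAC.IsDissipativeWeakSolution D T ν lam p P I s)
    (R : ℝ → NSAC.Space d → ℝ) (U : ℝ → NSAC.Space d → NSAC.Space d) (C : ℝ → NSAC.Space d → ℝ)
    (hR : D.IsC1 T R) (hRpos : ∀ t ∈ Icc 0 T, ∀ x ∈ closure D.space, 0 < R t x)
    (hU : D.IsC1 T U) (hC : D.IsC1 T C)
    (hDC : D.ExtendsToC1 T (fun t x => gradient (C t) x))
    (hLC : D.ExtendsToC1 T (fun t x => Laplacian.laplacian (C t) x))
    (hUbdry : ∀ t ∈ Icc 0 T, ∀ x ∈ D.bdry, U t x = 0)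
    (hCbdry : ∀ t ∈ Icc 0 T, ∀ x ∈ D.bdry, C t x = 0) :
    -- all the integrals in the inequality converge
    (IntegrableOn (NSAC.relDensityInit P I R U C) D.cell ∧
      (∀ᵐ τ ∂(volume.restrict (Ioo 0 T)),
        IntegrableOn (NSAC.relDensityAt P s R U C τ) D.cell) ∧
      IntegrableOn (fun z : ℝ × NSAC.Space d => NSAC.dissipation ν lam s U z.1 z.2)
        (Ioo 0 T ×ˢ D.cell) ∧
      (∀ k, IntegrableOn (fun z : ℝ × NSAC.Space d => NSAC.remainder ν lam p P s R U C z.1 z.2 k)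
        (Ioo 0 T ×ˢ D.cell)) ∧
      (∀ᵐ t ∂(volume.restrict (Ioo 0 T)), ∀ i j,
        (s.𝓡 t i j).Integrable (fun x => NSAC.jac (U t) x i j)) ∧
      IntegrableOn (fun t => NSAC.matIntegral (NSAC.jac (U t)) (s.𝓡 t)) (Ioo 0 T)) ∧
    -- the relative energy inequality
    ∀ᵐ τ ∂(volume.restrict (Ioo 0 T)),
      (∫ x in D.cell, NSAC.relDensityAt P s R U C τ x)
          - (∫ x in D.cell, NSAC.relDensityInit P I R U C x)
          + (∫ t in (0)..τ, ∫ x in D.cell, NSAC.dissipation ν lam s U t x)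
          + (s.𝓔 τ).real D.closedCell
        ≤ (∑ k, ∫ t in (0)..τ, ∫ x in D.cell, NSAC.remainder ν lam p P s R U C t x k)
          + ∫ t in (0)..τ, NSAC.matIntegral (NSAC.jac (U t)) (s.𝓡 t) := by
  have hd' : 0 < d := by omega
  obtain ⟨g, hg, hg'⟩ := hDC
  obtain ⟨L, hL, hL'⟩ := hLC
  have h : NSAC.IsComparison D T R U C g L := ⟨hR, hRpos, hU, hUbdry, hC, hg, hL, hg', hL', hCbdry⟩
  exact ⟨⟨(hs.relDensityInit_spec hd' hT hD hp hI h).1,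
    (hs.ae_relDensityAt_spec hd' hD hp h).mono fun _ h1 => h1.1, hs.intCyl_dissipation hD hU,
    hs.intCyl_remainder hD hp h, hs.ae_integrable_jac hD hU,
    hs.integrableOn_matIntegral hd' hD hU⟩, hs.ae_relative_energy hd' hT hD hp hI h⟩
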